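/- Let $\mathcal V=(\mathcal V,\otimes,I,c)$ be a braided monoidal category with equalizers of coreflexive pairs such that each functor $Z\otimes-$ preserves them. For comonoids $C,D$ in $\mathcal V$, a comodule $C\nrightarrow D$ is an object with commuting left $C$- and right $D$-coactions; $\mathrm{Comod}\mathcal V(C,D)$ is the category of these (the coalgebras for the comonad $C\otimes-\otimes D$). Comodules $M:C\nrightarrow D$ and $N:D\nrightarrow E$ compose to the coreflexive equalizer $M\otimes_DN$ of $M\otimes N\rightrightarrows M\otimes D\otimes N$. Let $C^o=(C,c\delta,\epsilon)$, and let $e:C\otimes C^o\nrightarrow I$ and $n:I\nrightarrow C^o\otimes C$ be the comodules with underlying object $C$ which exhibit $C^o$ as a right bidual of $C$. A comodule with a right $C^o\otimes C'$-coaction is regarded as a comodule $C\nrightarrow C'$ by this biduality whenever tensor products $\otimes_C$, $\otimes_{C'}$ are formed; for $X:P\nrightarrow A^o\otimes C$ and $Y:Q\nrightarrow C^o\otimes B$ the composite $(A^o\otimes e\otimes B)\circ(X\otimes Y)$ is $X\otimes_CY$ with the induced coactions. For $n\ge1$ and comodules $X_i:C_{i-1}^o\otimes C_i\nrightarrow C_{i-1}^o\otimes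 C_i$ $(1\le i\le n)$ put $p_n=C_0^o\otimes e\otimes\dots\otimes e\otimes C_n$ and let $T_n(X_1,\dots,X_n):C_0^o\otimes C_n\nrightarrow C_0^o\otimes C_n$ be the left Kan extension of $p_n\circ(X_1\otimes\dots\otimes X_n)$ along $p_n$ in $\mathrm{Comod}\mathcal V$, when it exists. For a partition $\xi:m=m_1+\dots+m_n$ with all $m_i>0$ the universal properties give a map $\beta_\xi:T_m(X_{11},\dots,X_{nm_n})\to T_n(T_{m_1}(X_{11},\dots,X_{1m_1}),\dots,T_{m_n}(X_{n1},\dots,X_{nm_n}))$. An algebroid $(A,C)$ is a comonoid $C$ with a monoidal endomorphism $A$ on $C^o\otimes C$: a comodule $A:C^o\otimes C\nrightarrow C^o\otimes C$ with 2-cells $\mu:p_2\circ(A\otimes A)\Rightarrow A\circ p_2$ and $\eta:n\Rightarrow A\circ n$ satisfying associativity and the two unit laws. A module from $(A,C)$ to $(A',C')$ is a comodule $M:C^o\otimes C'\nrightarrow C^o\otimes C'$ with a 2-cell $\gamma:p_3\circ(A\otimes M\otimes A')\Rightarrow M\circ p_3$ which is an associative and unital action; a map of modules is a comodule map which respects the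 actions. Composing $\gamma$ with the unit of $A'$ (of $A$) gives the left action $\alpha_l:T_2(A,M)\to M$ (the right action $\alpha_r:T_2(M,A')\to M$). Let $\mathcal X$ be a class of comodules of the form $X:C^o\otimes C'\nrightarrow C^o\otimes C'$ such that (1) $T_n(X_1,\dots,X_n)$ exists for all composable $X_1,\dots,X_n$ in $\mathcal X$, $n\ge 1$; (2) $\beta_\xi$ is invertible for every partition $\xi$ with positive parts and all comodules $X_{ij}$ in $\mathcal X$ for which the left Kan extensions involved exist; (3) if $X:C^o\otimes C'\nrightarrow C^o\otimes C'$ is in $\mathcal X$, then $X\otimes_{C'}-:\mathrm{Comod}\mathcal V(C',I)\to\mathcal V$ and $-\otimes_CX:\mathrm{Comod}\mathcal V(I,C)\to\mathcal V$ preserve reflexive coequalizers; (4) if $X:C_0^o\otimes C_1\nrightarrow C_0^o\otimes C_1$ and $Y:C_1^o\otimes C_2\nrightarrow C_1^o\otimes C_2$ are in $\mathcal X$, then so is $X\otimes_{C_1}Y:C_0^o\otimes C_2\nrightarrow C_0^o\otimes C_2$; (5) if $X$ is in $\mathcal X$ and $X\to Y$ is an epimorphism of comodules, then $Y$ is in $\mathcal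 X$. For modules $M:(A_1,C_1)\to(A_2,C_2)$ and $N:(A_2,C_2)\to(A_3,C_3)$ with $A_1,A_2,A_3,M,N$ in $\mathcal X$ let $M\bullet N$ be the coequalizer in $\mathrm{Comod}\mathcal V(C_1^o\otimes C_3,C_1^o\otimes C_3)$ of $$T_2(M,\alpha_l)\beta_{1+2},\ T_2(\alpha_r,N)\beta_{2+1}:\ T_3(M,A_2,N)\rightrightarrows T_2(M,N);$$ these coequalizers are assumed to exist. Then the algebroids $(A,C)$ with $A$ in $\mathcal X$, the modules $M$ between them with $M$ in $\mathcal X$, and the maps of modules form a bicategory under the composition $\bullet$: $M\bullet N$ carries the action induced by the left action on $M$ and the right action on $N$, it lies in $\mathcal X$, horizontal composition of 2-cells and the associativity isomorphisms are the ones induced on coequalizers, the unit 1-cell of $(A,C)$ is $A$ with the action given by $\mu$, and the unit isomorphisms $A\bullet M\cong M$, $M\bullet A'\cong M$ are induced by $\alpha_l$ and $\alpha_r$. -/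

import Mathlib

open CategoryTheory MonoidalCategory Limits
open scoped ComonObj

universe v u

namespace QuantumModules

section Comonoids

variable {V : Type u} [Category.{v} V] [MonoidalCategory V] [BraidedCategory V]

lemma tensorμ_whiskerRight {X₁ X₂ Y₁ Y₂ Z₁ Z₂ : V} (f : X₁ ⟶ Z₁) (g : Y₁ ⟶ Z₂) :
    tensorμ X₁ X₂ Y₁ Y₂ ≫ (f ⊗ₘ g) ▷ (X₂ ⊗ Y₂) = (f ▷ X₂ ⊗ₘ g ▷ Y₂) ≫ tensorμ Z₁ X₂ Z₂ Y₂ := by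
  have h := tensorμ_natural f (𝟙 X₂) g (𝟙 Y₂)
  simpa using h.symm

lemma tensorμ_whiskerLeft {X₁ X₂ Y₁ Y₂ Z₁ Z₂ : V} (f : X₂ ⟶ Z₁) (g : Y₂ ⟶ Z₂) :
    tensorμ X₁ X₂ Y₁ Y₂ ≫ (X₁ ⊗ Y₁) ◁ (f ⊗ₘ g) = (X₁ ◁ f ⊗ₘ Y₁ ◁ g) ≫ tensorμ X₁ Z₁ Y₁ Z₂ := by
  have h := tensorμ_natural (𝟙 X₁) f (𝟙 Y₁) g
  simpa using h.symm

/-- The opposite comonoid `Cᵒ = (C, c δ, ε)`. -/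
abbrev opComon (C : Comon V) : Comon V where
  X := C.X
  comon :=
    { counit := ε[C.X]
      comul := Δ[C.X] ≫ (β_ C.X C.X).hom
      counit_comul := by
        rw [Category.assoc, ← BraidedCategory.braiding_naturality_right, ← Category.assoc,
          ComonObj.comul_counit]
        simp
      comul_counit := by
        rw [Category.assoc, ← BraidedCategory.braiding_naturality_left, ← Category.assoc,
          ComonObj.counit_comul]
        simp
      comul_assoc := by
        simp only [Category.assoc, MonoidalCategory.whiskerLeft_comp, comp_whiskerRight]
        rw [← BraidedCategory.braiding_naturality_left_assoc,
          ← BraidedCategory.braiding_naturality_right_assoc, ComonObj.comul_assoc_assoc]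
        simp only [BraidedCategory.braiding_tensor_left_hom,
          BraidedCategory.braiding_tensor_right_hom, Category.assoc]
        simp [BraidedCategory.yang_baxter] }

/-- The tensor product of two comonoids. -/
abbrev tensorComon (C D : Comon V) : Comon V := ⟨C.X ⊗ D.X⟩

/-- The unit comonoid `I`. -/
abbrev unitComon : Comon V := @Comon.mk V _ _ (𝟙_ V) (ComonObj.instTensorUnit V)

/-- The comonoid map `C ⊗ D ⟶ C` given by the counit of `D`. -/
def projL (C D : Comon V) : tensorComon C D ⟶ C :=
  Comon.Hom.mk' (C.X ◁ ε[D.X] ≫ (ρ_ C.X).hom)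
    (by simp [MonoidalCategory.tensorHom_def', unitors_equal])
    (by
      have h := tensorμ_natural (𝟙 C.X) (𝟙 C.X) ε[D.X] ε[D.X]
      have h2 : tensorμ C.X C.X (𝟙_ V) (𝟙_ V) ≫ ((ρ_ C.X).hom ⊗ₘ (ρ_ C.X).hom) =
          (C.X ⊗ C.X) ◁ (λ_ (𝟙_ V)).hom ≫ (ρ_ (C.X ⊗ C.X)).hom := by
        rw [tensor_right_unitality]; simp
      simp only [id_tensorHom, tensorHom_id, id_whiskerRight] at h
      rw [Comon.tensorObj_comul, ← tensorHom_comp_tensorHom, Category.assoc, Category.assoc,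
        ← reassoc_of% h, h2, ← id_tensorHom, ← id_tensorHom,
        ← id_tensorHom, tensorHom_comp_tensorHom_assoc, tensorHom_comp_tensorHom_assoc]
      simp [MonoidalCategory.tensorHom_def'])

/-- The comonoid map `C ⊗ D ⟶ D` given by the counit of `C`. -/
def projR (C D : Comon V) : tensorComon C D ⟶ D :=
  Comon.Hom.mk' (ε[C.X] ▷ D.X ≫ (λ_ D.X).hom)
    (by simp [MonoidalCategory.tensorHom_def])
    (by
      have h := tensorμ_natural ε[C.X] ε[C.X] (𝟙 D.X) (𝟙 D.X)
      have h2 : tensorμ (𝟙_ V) (𝟙_ V) D.X D.X ≫ ((λ_ D.X).hom ⊗ₘ (λ_ D.X).hom) =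
          (λ_ (𝟙_ V)).hom ▷ (D.X ⊗ D.X) ≫ (λ_ (D.X ⊗ D.X)).hom := by
        rw [tensor_left_unitality]; simp
      simp only [tensorHom_id, id_whiskerRight] at h
      rw [Comon.tensorObj_comul, ← tensorHom_comp_tensorHom, Category.assoc, Category.assoc,
        ← reassoc_of% h, h2, ← tensorHom_id, ← tensorHom_id,
        ← tensorHom_id, tensorHom_comp_tensorHom_assoc, tensorHom_comp_tensorHom_assoc]
      simp [MonoidalCategory.tensorHom_def, unitors_equal])

/-- The tensor product of two comonoid maps. -/
def tensorComonHom {C D C' D' : Comon V} (f : C ⟶ C') (g : D ⟶ D') :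
    tensorComon C D ⟶ tensorComon C' D' := (f ⊗ₘ g : C ⊗ D ⟶ C' ⊗ D')

/-- Reassociation of tensor products of comonoids. -/
def assocComon (C D E : Comon V) :
    tensorComon (tensorComon C D) E ⟶ tensorComon C (tensorComon D E) :=
  (α_ C D E).hom

/-- The unit law for tensor products of comonoids. -/
def lunitComon (C : Comon V) : tensorComon (unitComon (V := V)) C ⟶ C := projR _ _

end Comonoids

section Bicomodules

variable {V : Type u} [Category.{v} V] [MonoidalCategory V]

/-- A comodule `C ⇸ D`: an object with commuting left `C`- and right `D`-coactions
(equivalently, a coalgebra for the comonad `C ⊗ - ⊗ D`). -/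
structure Bicomod (C D : Comon V) where
  X : V
  lact : X ⟶ C.X ⊗ X
  ract : X ⟶ X ⊗ D.X
  lact_counit : lact ≫ ε[C.X] ▷ X = (λ_ X).inv
  lact_coassoc : lact ≫ C.X ◁ lact = lact ≫ Δ[C.X] ▷ X ≫ (α_ C.X C.X X).hom
  ract_counit : ract ≫ X ◁ ε[D.X] = (ρ_ X).inv
  ract_coassoc : ract ≫ ract ▷ D.X = ract ≫ X ◁ Δ[D.X] ≫ (α_ X D.X D.X).inv
  comm : lact ≫ C.X ◁ ract = ract ≫ lact ▷ D.X ≫ (α_ C.X X D.X).hom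

namespace Bicomod

variable {A B C D : Comon V}

/-- Maps of comodules: the 2-cells of `Comod V`. -/
@[ext]
structure Hom (M N : Bicomod C D) where
  hom : M.X ⟶ N.X
  left : M.lact ≫ C.X ◁ hom = hom ≫ N.lact
  right : M.ract ≫ hom ▷ D.X = hom ≫ N.ract

instance : Category (Bicomod C D) where
  Hom := Hom
  id M := ⟨𝟙 M.X, by simp, by simp⟩
  comp f g := ⟨f.hom ≫ g.hom,
    by rw [MonoidalCategory.whiskerLeft_comp, reassoc_of% f.left, g.left, Category.assoc],
    by rw [comp_whiskerRight, reassoc_of% f.right, g.right, Category.assoc]⟩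
  id_comp f := Hom.ext (Category.id_comp _)
  comp_id f := Hom.ext (Category.comp_id _)
  assoc f g h := Hom.ext (Category.assoc _ _ _)

@[simp] lemma id_hom (M : Bicomod C D) : Hom.hom (𝟙 M) = 𝟙 M.X := rfl
@[simp] lemma comp_hom {M N K : Bicomod C D} (f : M ⟶ N) (g : N ⟶ K) :
    Hom.hom (f ≫ g) = f.hom ≫ g.hom := rfl

@[ext] lemma hom_ext {M N : Bicomod C D} {f g : M ⟶ N} (h : f.hom = g.hom) : f = g := Hom.ext h

/-- The identity comodule `C : C ⇸ C`. -/
abbrev regular (C : Comon V) : Bicomod C C where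
  X := C.X
  lact := Δ[C.X]
  ract := Δ[C.X]
  lact_counit := by simp
  lact_coassoc := by simp
  ract_counit := by simp
  ract_coassoc := by simp
  comm := by simp

/-- Corestriction of the left coaction along a comonoid map. -/
def mapL (u : A ⟶ B) (M : Bicomod A D) : Bicomod B D where
  X := M.X
  lact := M.lact ≫ u.hom ▷ M.X
  ract := M.ract
  lact_counit := by
    rw [Category.assoc, ← comp_whiskerRight, IsComonHom.hom_counit, M.lact_counit]
  lact_coassoc := by
    simp only [MonoidalCategory.whiskerLeft_comp, Category.assoc]
    rw [← whisker_exchange_assoc, reassoc_of% M.lact_coassoc, ← comp_whiskerRight_assoc,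
      IsComonHom.hom_comul]
    simp [MonoidalCategory.tensorHom_def]
  ract_counit := M.ract_counit
  ract_coassoc := M.ract_coassoc
  comm := by
    rw [Category.assoc, ← whisker_exchange, reassoc_of% M.comm]
    simp

/-- Corestriction of the right coaction along a comonoid map. -/
def mapR (v : B ⟶ D) (M : Bicomod A B) : Bicomod A D where
  X := M.X
  lact := M.lact
  ract := M.ract ≫ M.X ◁ v.hom
  lact_counit := M.lact_counit
  lact_coassoc := M.lact_coassoc
  ract_counit := by
    rw [Category.assoc, ← MonoidalCategory.whiskerLeft_comp, IsComonHom.hom_counit, M.ract_counit]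
  ract_coassoc := by
    simp only [comp_whiskerRight, Category.assoc]
    rw [whisker_exchange_assoc, reassoc_of% M.ract_coassoc, ← MonoidalCategory.whiskerLeft_comp_assoc,
      IsComonHom.hom_comul]
    simp [MonoidalCategory.tensorHom_def']
  comm := by
    simp only [MonoidalCategory.whiskerLeft_comp, Category.assoc]
    rw [reassoc_of% M.comm]
    rw [whisker_exchange_assoc]
    simp

section Braided

variable [BraidedCategory V] {C' D' : Comon V}

/-- The tensor product of comodules, `M ⊗ N : C ⊗ C' ⇸ D ⊗ D'`. -/
def tensor (M : Bicomod C D) (N : Bicomod C' D') : Bicomod (tensorComon C C') (tensorComon D D') where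
  X := M.X ⊗ N.X
  lact := (M.lact ⊗ₘ N.lact) ≫ tensorμ C.X M.X C'.X N.X
  ract := (M.ract ⊗ₘ N.ract) ≫ tensorμ M.X D.X N.X D'.X
  lact_counit := by
    rw [Category.assoc, Comon.tensorObj_counit, comp_whiskerRight,
      reassoc_of% tensorμ_whiskerRight, tensorHom_comp_tensorHom_assoc, M.lact_counit, N.lact_counit,
      ← cancel_mono (λ_ (M.X ⊗ N.X)).hom]
    simp only [Category.assoc, ← leftUnitor_monoidal]
    simp
  lact_coassoc := by
    simp only [Comon.tensorObj_comul, Category.assoc, MonoidalCategory.whiskerLeft_comp,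
      comp_whiskerRight]
    rw [reassoc_of% tensorμ_whiskerLeft, tensorHom_comp_tensorHom_assoc, M.lact_coassoc,
      N.lact_coassoc, reassoc_of% tensorμ_whiskerRight, associator_monoidal,
      tensorHom_comp_tensorHom_assoc, tensorHom_comp_tensorHom_assoc]
    simp only [Category.assoc]
  ract_counit := by
    rw [Category.assoc, Comon.tensorObj_counit, MonoidalCategory.whiskerLeft_comp,
      reassoc_of% tensorμ_whiskerLeft, tensorHom_comp_tensorHom_assoc, M.ract_counit, N.ract_counit,
      ← cancel_mono (ρ_ (M.X ⊗ N.X)).hom]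
    simp only [Category.assoc, ← rightUnitor_monoidal]
    simp
  ract_coassoc := by
    simp only [Comon.tensorObj_comul, Category.assoc, MonoidalCategory.whiskerLeft_comp,
      comp_whiskerRight]
    rw [← cancel_mono (α_ (M.X ⊗ N.X) (D.X ⊗ D'.X) (D.X ⊗ D'.X)).hom]
    simp only [Category.assoc]
    rw [reassoc_of% tensorμ_whiskerRight, tensorHom_comp_tensorHom_assoc, M.ract_coassoc,
      N.ract_coassoc, associator_monoidal, reassoc_of% tensorμ_whiskerLeft,
      tensorHom_comp_tensorHom_assoc, tensorHom_comp_tensorHom_assoc]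
    simp
  comm := by
    simp only [Category.assoc, MonoidalCategory.whiskerLeft_comp, comp_whiskerRight]
    rw [reassoc_of% tensorμ_whiskerLeft, tensorHom_comp_tensorHom_assoc, M.comm, N.comm,
      reassoc_of% tensorμ_whiskerRight, associator_monoidal, tensorHom_comp_tensorHom_assoc,
      tensorHom_comp_tensorHom_assoc]
    simp only [Category.assoc]

end Braided

end Bicomod
end Bicomodules

section Equalizers

/-- Preservation of equalizers of coreflexive pairs. -/
class PreservesCoreflexiveEqualizers {C : Type*} [Category C] {D : Type*} [Category D]
    (F : C ⥤ D) : Prop where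
  preserves : ∀ {A B : C} (f g : A ⟶ B) [IsCoreflexivePair f g],
    PreservesLimit (parallelPair f g) F

/-- Preservation of coequalizers of reflexive pairs. -/
class PreservesReflexiveCoequalizers {C : Type*} [Category C] {D : Type*} [Category D]
    (F : C ⥤ D) : Prop where
  preserves : ∀ {A B : C} (f g : A ⟶ B) [IsReflexivePair f g],
    PreservesColimit (parallelPair f g) F

variable {V : Type u} [Category.{v} V] [MonoidalCategory V]
  [HasCoreflexiveEqualizers V] [∀ Z : V, PreservesCoreflexiveEqualizers (tensorLeft Z)]
  {A B : V} (f g : A ⟶ B) [IsCoreflexivePair f g]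

lemma exists_whiskerLeft_lift {T : V} (Z : V) (k : T ⟶ Z ⊗ A) (hk : k ≫ Z ◁ f = k ≫ Z ◁ g) :
    ∃ l : T ⟶ Z ⊗ equalizer f g, l ≫ Z ◁ equalizer.ι f g = k := by
  have := PreservesCoreflexiveEqualizers.preserves (F := tensorLeft Z) f g
  have hl := isLimitForkMapOfIsLimit (tensorLeft Z) (equalizer.condition f g)
    (equalizerIsEqualizer f g)
  exact ⟨Fork.IsLimit.lift hl k hk, Fork.IsLimit.lift_ι hl⟩

instance mono_whiskerLeft_ι (Z : V) : Mono (Z ◁ equalizer.ι f g) := by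
  have := PreservesCoreflexiveEqualizers.preserves (F := tensorLeft Z) f g
  have hl := isLimitForkMapOfIsLimit (tensorLeft Z) (equalizer.condition f g)
    (equalizerIsEqualizer f g)
  exact ⟨fun a b h => Fork.IsLimit.hom_ext hl h⟩

variable [BraidedCategory V]

lemma exists_whiskerRight_lift {T : V} (Z : V) (k : T ⟶ A ⊗ Z) (hk : k ≫ f ▷ Z = k ≫ g ▷ Z) :
    ∃ l : T ⟶ equalizer f g ⊗ Z, l ≫ equalizer.ι f g ▷ Z = k := by
  obtain ⟨l, hl⟩ := exists_whiskerLeft_lift f g Z (k ≫ (β_ A Z).hom) (by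
    rw [Category.assoc, Category.assoc, ← BraidedCategory.braiding_naturality_left,
      ← BraidedCategory.braiding_naturality_left, reassoc_of% hk])
  refine ⟨l ≫ (β_ _ Z).inv, ?_⟩
  rw [Category.assoc, ← BraidedCategory.braiding_inv_naturality_right, reassoc_of% hl]
  simp

instance mono_whiskerRight_ι (Z : V) : Mono (equalizer.ι f g ▷ Z) := by
  have h : equalizer.ι f g ▷ Z =
      (β_ _ Z).hom ≫ Z ◁ equalizer.ι f g ≫ (β_ _ Z).inv := by
    rw [← BraidedCategory.braiding_naturality_left_assoc]; simp
  rw [h]; infer_instance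

instance mono_whiskerLeft_whiskerLeft_ι (Z W : V) : Mono (W ◁ Z ◁ equalizer.ι f g) := by
  have h : W ◁ Z ◁ equalizer.ι f g =
      (α_ W Z _).inv ≫ (W ⊗ Z) ◁ equalizer.ι f g ≫ (α_ W Z _).hom := by simp
  rw [h]; infer_instance

instance mono_whiskerRight_whiskerRight_ι (Z W : V) : Mono (equalizer.ι f g ▷ Z ▷ W) := by
  have h : equalizer.ι f g ▷ Z ▷ W =
      (α_ _ Z W).hom ≫ equalizer.ι f g ▷ (Z ⊗ W) ≫ (α_ _ Z W).inv := by simp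
  rw [h]; infer_instance

instance mono_whiskerLeft_whiskerRight_ι (Z W : V) : Mono (Z ◁ equalizer.ι f g ▷ W) := by
  have h : Z ◁ equalizer.ι f g ▷ W =
      (α_ Z _ W).inv ≫ (Z ◁ equalizer.ι f g) ▷ W ≫ (α_ Z _ W).hom := by simp
  have h2 : (Z ◁ equalizer.ι f g) ▷ W =
      (β_ _ W).hom ≫ W ◁ Z ◁ equalizer.ι f g ≫ (β_ _ W).inv := by
    rw [← BraidedCategory.braiding_naturality_left_assoc]; simp
  rw [h, h2]; infer_instance

end Equalizers

section Composition

variable {V : Type u} [Category.{v} V] [MonoidalCategory V] [BraidedCategory V]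
  [HasCoreflexiveEqualizers V] [∀ Z : V, PreservesCoreflexiveEqualizers (tensorLeft Z)]

namespace Bicomod

variable {A B C D E : Comon V}

section Sub

variable (M : Bicomod C D) {N : V} (f g : M.X ⟶ N) [IsCoreflexivePair f g]

/-- The coreflexive equalizer of two maps out of a comodule is a subcomodule as soon as the
coactions restrict to it. -/
noncomputable def subMk (l : equalizer f g ⟶ C.X ⊗ equalizer f g)
    (r : equalizer f g ⟶ equalizer f g ⊗ D.X)
    (hl : l ≫ C.X ◁ equalizer.ι f g = equalizer.ι f g ≫ M.lact)
    (hr : r ≫ equalizer.ι f g ▷ D.X = equalizer.ι f g ≫ M.ract) : Bicomod C D where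
  X := equalizer f g
  lact := l
  ract := r
  lact_counit := by
    rw [← cancel_mono (𝟙_ V ◁ equalizer.ι f g), Category.assoc, ← whisker_exchange,
      reassoc_of% hl, M.lact_counit]
    simp
  lact_coassoc := by
    rw [← cancel_mono (C.X ◁ C.X ◁ equalizer.ι f g), Category.assoc,
      ← MonoidalCategory.whiskerLeft_comp, hl, MonoidalCategory.whiskerLeft_comp,
      reassoc_of% hl, M.lact_coassoc, ← reassoc_of% hl, whisker_exchange_assoc]
    simp
  ract_counit := by
    rw [← cancel_mono (equalizer.ι f g ▷ 𝟙_ V), Category.assoc, whisker_exchange,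
      reassoc_of% hr, M.ract_counit]
    simp
  ract_coassoc := by
    rw [← cancel_mono (equalizer.ι f g ▷ D.X ▷ D.X), Category.assoc,
      ← comp_whiskerRight, hr, comp_whiskerRight,
      reassoc_of% hr, M.ract_coassoc, ← reassoc_of% hr, ← whisker_exchange_assoc]
    simp
  comm := by
    rw [← cancel_mono (C.X ◁ equalizer.ι f g ▷ D.X), Category.assoc,
      ← MonoidalCategory.whiskerLeft_comp, hr, MonoidalCategory.whiskerLeft_comp,
      reassoc_of% hl, M.comm, ← reassoc_of% hr, ← comp_whiskerRight_assoc, ← hl]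
    simp

lemma sub_exists_l
    (hl : equalizer.ι f g ≫ M.lact ≫ C.X ◁ f = equalizer.ι f g ≫ M.lact ≫ C.X ◁ g) :
    ∃ l, l ≫ C.X ◁ equalizer.ι f g = equalizer.ι f g ≫ M.lact :=
  exists_whiskerLeft_lift f g C.X (equalizer.ι f g ≫ M.lact) (by simpa using hl)

lemma sub_exists_r
    (hr : equalizer.ι f g ≫ M.ract ≫ f ▷ D.X = equalizer.ι f g ≫ M.ract ≫ g ▷ D.X) :
    ∃ r, r ≫ equalizer.ι f g ▷ D.X = equalizer.ι f g ≫ M.ract :=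
  exists_whiskerRight_lift f g D.X (equalizer.ι f g ≫ M.ract) (by simpa using hr)

variable (hl : equalizer.ι f g ≫ M.lact ≫ C.X ◁ f = equalizer.ι f g ≫ M.lact ≫ C.X ◁ g)
  (hr : equalizer.ι f g ≫ M.ract ≫ f ▷ D.X = equalizer.ι f g ≫ M.ract ≫ g ▷ D.X)

/-- The subcomodule on the coreflexive equalizer of two maps. -/
noncomputable def sub : Bicomod C D :=
  M.subMk f g (M.sub_exists_l f g hl).choose (M.sub_exists_r f g hr).choose
    (M.sub_exists_l f g hl).choose_spec (M.sub_exists_r f g hr).choose_spec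

lemma sub_lact : (M.sub f g hl hr).lact ≫ C.X ◁ equalizer.ι f g = equalizer.ι f g ≫ M.lact :=
  (M.sub_exists_l f g hl).choose_spec

lemma sub_ract : (M.sub f g hl hr).ract ≫ equalizer.ι f g ▷ D.X = equalizer.ι f g ≫ M.ract :=
  (M.sub_exists_r f g hr).choose_spec

end Sub

/-- `M ⊗ N` with the left coaction of `M` and the right coaction of `N`. -/
abbrev outer (M : Bicomod A B) (N : Bicomod C D) : Bicomod A D where
  X := M.X ⊗ N.X
  lact := M.lact ▷ N.X ≫ (α_ A.X M.X N.X).hom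
  ract := M.X ◁ N.ract ≫ (α_ M.X N.X D.X).inv
  lact_counit := by
    have := congrArg (· ▷ N.X) M.lact_counit
    simp only [comp_whiskerRight] at this
    simp [reassoc_of% this]
  lact_coassoc := by
    have := congrArg (· ▷ N.X) M.lact_coassoc
    simp only [comp_whiskerRight] at this
    simp only [MonoidalCategory.whiskerLeft_comp, Category.assoc]
    rw [← associator_naturality_middle_assoc, reassoc_of% this]
    simp
  ract_counit := by
    have := congrArg (M.X ◁ ·) N.ract_counit
    simp only [MonoidalCategory.whiskerLeft_comp] at this
    simp [reassoc_of% this]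
  ract_coassoc := by
    have := congrArg (M.X ◁ ·) N.ract_coassoc
    simp only [MonoidalCategory.whiskerLeft_comp] at this
    simp only [comp_whiskerRight, Category.assoc]
    rw [← associator_inv_naturality_middle_assoc, reassoc_of% this]
    simp
  comm := by
    simp only [MonoidalCategory.whiskerLeft_comp, comp_whiskerRight, Category.assoc]
    rw [← associator_naturality_right_assoc, ← whisker_exchange_assoc]
    simp

/-- The first of the two maps whose equalizer is `M ⊗_B N`. -/
abbrev compL (M : Bicomod A B) (N : Bicomod B D) : M.X ⊗ N.X ⟶ (M.X ⊗ B.X) ⊗ N.X :=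
  M.ract ▷ N.X

/-- The second of the two maps whose equalizer is `M ⊗_B N`. -/
abbrev compR (M : Bicomod A B) (N : Bicomod B D) : M.X ⊗ N.X ⟶ (M.X ⊗ B.X) ⊗ N.X :=
  M.X ◁ N.lact ≫ (α_ M.X B.X N.X).inv

instance (M : Bicomod A B) (N : Bicomod B D) : IsCoreflexivePair (compL M N) (compR M N) :=
  IsCoreflexivePair.mk' ((M.X ◁ ε[B.X] ≫ (ρ_ M.X).hom) ▷ N.X)
    (by rw [← comp_whiskerRight, reassoc_of% M.ract_counit]; simp)
    (by
      have := congrArg (M.X ◁ ·) N.lact_counit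
      simp only [MonoidalCategory.whiskerLeft_comp] at this
      simp [reassoc_of% this])

lemma outer_lact_compL (M : Bicomod A B) (N : Bicomod B D) :
    (outer M N).lact ≫ A.X ◁ compL M N =
      compL M N ≫ (M.lact ▷ B.X ≫ (α_ _ _ _).hom) ▷ N.X ≫ (α_ _ _ _).hom := by
  have := congrArg (· ▷ N.X) M.comm
  simp only [comp_whiskerRight] at this
  simp only [Category.assoc, comp_whiskerRight]
  rw [← associator_naturality_middle, reassoc_of% this]

lemma outer_lact_compR (M : Bicomod A B) (N : Bicomod B D) :
    (outer M N).lact ≫ A.X ◁ compR M N =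
      compR M N ≫ (M.lact ▷ B.X ≫ (α_ _ _ _).hom) ▷ N.X ≫ (α_ _ _ _).hom := by
  simp only [Category.assoc, comp_whiskerRight, MonoidalCategory.whiskerLeft_comp]
  rw [← associator_naturality_right_assoc, ← whisker_exchange_assoc]
  simp

lemma outer_ract_compL (M : Bicomod A B) (N : Bicomod B D) :
    (outer M N).ract ≫ compL M N ▷ D.X =
      compL M N ≫ (M.X ⊗ B.X) ◁ N.ract ≫ (α_ _ _ _).inv := by
  simp only [Category.assoc]
  rw [← associator_inv_naturality_left, whisker_exchange_assoc]

lemma outer_ract_compR (M : Bicomod A B) (N : Bicomod B D) :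
    (outer M N).ract ≫ compR M N ▷ D.X =
      compR M N ≫ (M.X ⊗ B.X) ◁ N.ract ≫ (α_ _ _ _).inv := by
  have := congrArg (M.X ◁ ·) N.comm
  simp only [MonoidalCategory.whiskerLeft_comp] at this
  simp only [Category.assoc, comp_whiskerRight]
  rw [← associator_inv_naturality_middle_assoc, ← associator_inv_naturality_right_assoc,
    reassoc_of% this]
  simp

/-- The composite `M ⊗_B N : A ⇸ D` of comodules `M : A ⇸ B` and `N : B ⇸ D`, the coreflexive
equalizer of `M ⊗ N ⇉ M ⊗ B ⊗ N`. -/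
noncomputable def comp (M : Bicomod A B) (N : Bicomod B D) : Bicomod A D :=
  (outer M N).sub (compL M N) (compR M N)
    (by rw [outer_lact_compL, outer_lact_compR, equalizer.condition_assoc])
    (by rw [outer_ract_compL, outer_ract_compR, equalizer.condition_assoc])

/-- The inclusion `M ⊗_B N ⟶ M ⊗ N`. -/
noncomputable def compι (M : Bicomod A B) (N : Bicomod B D) : comp M N ⟶ outer M N where
  hom := equalizer.ι (compL M N) (compR M N)
  left := sub_lact _ _ _ _ _
  right := sub_ract _ _ _ _ _

instance mono_compι_hom (M : Bicomod A B) (N : Bicomod B D) : Mono (compι M N).hom :=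
  inferInstanceAs (Mono (equalizer.ι (compL M N) (compR M N)))

instance mono_compι_wl (M : Bicomod A B) (N : Bicomod B D) (Z : V) :
    Mono (Z ◁ (compι M N).hom) :=
  mono_whiskerLeft_ι (compL M N) (compR M N) Z

instance mono_compι_wr (M : Bicomod A B) (N : Bicomod B D) (Z : V) :
    Mono ((compι M N).hom ▷ Z) :=
  mono_whiskerRight_ι (compL M N) (compR M N) Z

instance mono_compι_wrr (M : Bicomod A B) (N : Bicomod B D) (Z W : V) :
    Mono ((compι M N).hom ▷ Z ▷ W) :=
  mono_whiskerRight_whiskerRight_ι (compL M N) (compR M N) Z W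

instance mono_compι_wlr (M : Bicomod A B) (N : Bicomod B D) (Z W : V) :
    Mono (Z ◁ (compι M N).hom ▷ W) :=
  mono_whiskerLeft_whiskerRight_ι (compL M N) (compR M N) Z W

lemma comp_condition (M : Bicomod A B) (N : Bicomod B D) :
    (compι M N).hom ≫ M.ract ▷ N.X =
      (compι M N).hom ≫ M.X ◁ N.lact ≫ (α_ M.X B.X N.X).inv :=
  equalizer.condition (compL M N) (compR M N)

lemma exists_compLift {T : V} (M : Bicomod A B) (N : Bicomod B D) (k : T ⟶ M.X ⊗ N.X)
    (hk : k ≫ M.ract ▷ N.X = k ≫ M.X ◁ N.lact ≫ (α_ M.X B.X N.X).inv) :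
    ∃ l : T ⟶ (comp M N).X, l ≫ (compι M N).hom = k :=
  ⟨equalizer.lift (f := compL M N) (g := compR M N) k hk, equalizer.lift_ι _ _⟩

/-- A map of comodules into `M ⊗ N` which equalizes the two coactions of `B` lifts to
`M ⊗_B N`. -/
noncomputable def compLift {K : Bicomod A D} {M : Bicomod A B} {N : Bicomod B D}
    (k : K ⟶ outer M N)
    (hk : k.hom ≫ M.ract ▷ N.X = k.hom ≫ M.X ◁ N.lact ≫ (α_ M.X B.X N.X).inv) :
    K ⟶ comp M N where
  hom := (exists_compLift M N k.hom hk).choose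
  left := by
    have h := (exists_compLift M N k.hom hk).choose_spec
    rw [← cancel_mono (A.X ◁ (compι M N).hom), Category.assoc, Category.assoc, (compι M N).left,
      ← MonoidalCategory.whiskerLeft_comp, h, reassoc_of% h]
    exact k.left
  right := by
    have h := (exists_compLift M N k.hom hk).choose_spec
    rw [← cancel_mono ((compι M N).hom ▷ D.X), Category.assoc, Category.assoc, (compι M N).right,
      ← comp_whiskerRight, h, reassoc_of% h]
    exact k.right

@[simp]
lemma compLift_ι {K : Bicomod A D} {M : Bicomod A B} {N : Bicomod B D} (k : K ⟶ outer M N)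
    (hk : k.hom ≫ M.ract ▷ N.X = k.hom ≫ M.X ◁ N.lact ≫ (α_ M.X B.X N.X).inv) :
    compLift k hk ≫ compι M N = k :=
  Hom.ext (exists_compLift M N k.hom hk).choose_spec

/-- The tensor product of two maps of comodules, as a map of outer comodules. -/
abbrev outerMap {M M' : Bicomod A B} {N N' : Bicomod C D} (f : M ⟶ M') (g : N ⟶ N') :
    outer M N ⟶ outer M' N' where
  hom := f.hom ⊗ₘ g.hom
  left := by
    have := congrArg (· ▷ N.X) f.left
    simp only [comp_whiskerRight] at this
    rw [MonoidalCategory.tensorHom_def, Category.assoc, MonoidalCategory.whiskerLeft_comp,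
      ← associator_naturality_middle_assoc, reassoc_of% this, ← associator_naturality_right,
      ← whisker_exchange_assoc, Category.assoc]
  right := by
    have := congrArg (M.X ◁ ·) g.right
    simp only [MonoidalCategory.whiskerLeft_comp] at this
    rw [MonoidalCategory.tensorHom_def', Category.assoc, comp_whiskerRight,
      ← associator_inv_naturality_middle_assoc, reassoc_of% this, ← associator_inv_naturality_left,
      whisker_exchange_assoc, Category.assoc]

/-- Horizontal composition of maps of comodules. -/
noncomputable def compMap {M M' : Bicomod A B} {N N' : Bicomod B D} (f : M ⟶ M') (g : N ⟶ N') :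
    comp M N ⟶ comp M' N' :=
  compLift (compι M N ≫ outerMap f g) (by
    have hf := congrArg (· ▷ N.X) f.right
    have hg := congrArg (M.X ◁ ·) g.left
    simp only [comp_whiskerRight, MonoidalCategory.whiskerLeft_comp] at hf hg
    have h1 : (f.hom ⊗ₘ g.hom) ≫ M'.ract ▷ N'.X =
        M.ract ▷ N.X ≫ (f.hom ▷ B.X ⊗ₘ g.hom) := by
      rw [MonoidalCategory.tensorHom_def, MonoidalCategory.tensorHom_def, Category.assoc,
        whisker_exchange, reassoc_of% hf]
    have h2 : (f.hom ⊗ₘ g.hom) ≫ M'.X ◁ N'.lact ≫ (α_ M'.X B.X N'.X).inv =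
        M.X ◁ N.lact ≫ (α_ M.X B.X N.X).inv ≫ (f.hom ▷ B.X ⊗ₘ g.hom) := by
      have e := associator_inv_naturality f.hom (𝟙 B.X) g.hom
      rw [tensorHom_id, id_tensorHom] at e
      rw [← e, MonoidalCategory.tensorHom_def', MonoidalCategory.tensorHom_def',
        Category.assoc, Category.assoc, ← whisker_exchange_assoc, reassoc_of% hg]
    simp only [comp_hom, Category.assoc]
    rw [h1, h2, reassoc_of% comp_condition])

/-- `N ⟶ C ⊗_C N`. -/
noncomputable def lunitInv (N : Bicomod C D) : N ⟶ comp (regular C) N :=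
  compLift (M := regular C) (N := N)
    { hom := N.lact
      left := N.lact_coassoc
      right := by
        have := N.comm
        simp only [← Category.assoc] at this ⊢
        rw [this]
        simp }
    (by
      have := N.lact_coassoc
      simp only [← Category.assoc] at this ⊢
      rw [this]
      simp)

/-- `M ⟶ M ⊗_D D`. -/
noncomputable def runitInv (M : Bicomod C D) : M ⟶ comp M (regular D) :=
  compLift (M := M) (N := regular D)
    { hom := M.ract
      left := M.comm
      right := M.ract_coassoc }
    M.ract_coassoc

lemma exists_assoc (M : Bicomod A B) (N : Bicomod B C) (K : Bicomod C D) :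
    ∃ s : (comp M (comp N K)).X ⟶ (comp M N).X ⊗ K.X, s ≫ (compι M N).hom ▷ K.X =
      (compι M (comp N K)).hom ≫ M.X ◁ (compι N K).hom ≫ (α_ M.X N.X K.X).inv :=
  exists_whiskerRight_lift _ _ _ _ (by
    have h := congrArg (M.X ◁ ·) (compι N K).left
    simp only [MonoidalCategory.whiskerLeft_comp] at h
    simp only [Category.assoc, comp_whiskerRight]
    rw [← associator_inv_naturality_left, whisker_exchange_assoc, reassoc_of% comp_condition,
      ← associator_inv_naturality_right_assoc, reassoc_of% h,
      ← associator_inv_naturality_middle_assoc]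
    simp)

/-- `M ⊗_B (N ⊗_C K) ⟶ (M ⊗_B N) ⊗_C K`. -/
noncomputable def assocInv (M : Bicomod A B) (N : Bicomod B C) (K : Bicomod C D) :
    comp M (comp N K) ⟶ comp (comp M N) K :=
  have h := (exists_assoc M N K).choose_spec
  compLift (M := comp M N) (N := K)
    { hom := (exists_assoc M N K).choose
      left := by
        have h1 := congrArg (· ▷ K.X) (compι M N).left
        simp only [comp_whiskerRight] at h1
        rw [← cancel_mono (A.X ◁ (compι M N).hom ▷ K.X)]
        simp only [Category.assoc]
        rw [← MonoidalCategory.whiskerLeft_comp, h, ← associator_naturality_middle,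
          reassoc_of% h1, reassoc_of% h, MonoidalCategory.whiskerLeft_comp,
          reassoc_of% (compι M (comp N K)).left]
        simp only [MonoidalCategory.whiskerLeft_comp, Category.assoc]
        rw [← associator_naturality_right_assoc, ← whisker_exchange_assoc]
        simp
      right := by
        have h1 := congrArg (M.X ◁ ·) (compι N K).right
        simp only [MonoidalCategory.whiskerLeft_comp] at h1
        rw [← cancel_mono ((compι M N).hom ▷ K.X ▷ D.X)]
        simp only [Category.assoc]
        rw [← comp_whiskerRight, h, ← associator_inv_naturality_left,
          whisker_exchange_assoc, reassoc_of% h, comp_whiskerRight,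
          reassoc_of% (compι M (comp N K)).right]
        simp [reassoc_of% h1] }
    (by
      have h1 := congrArg (· ▷ K.X) (compι M N).right
      have h2 := congrArg (M.X ◁ ·) (comp_condition N K)
      simp only [comp_whiskerRight, MonoidalCategory.whiskerLeft_comp] at h1 h2
      rw [← cancel_mono ((compι M N).hom ▷ C.X ▷ K.X)]
      simp only [Category.assoc]
      rw [h1, reassoc_of% h, ← associator_inv_naturality_left, whisker_exchange_assoc,
        reassoc_of% h, ← associator_inv_naturality_middle_assoc]
      simp [reassoc_of% h2])

end Bicomod
end Composition

section Biduality

variable {V : Type u} [Category.{v} V] [MonoidalCategory V] [BraidedCategory V]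

lemma comul_projL_projR (C D : Comon V) :
    Δ[C.X ⊗ D.X] ≫ ((projL C D).hom ⊗ₘ (projR C D).hom) = 𝟙 (C.X ⊗ D.X) := by
  have h := tensorμ_natural (𝟙 C.X) ε[C.X] ε[D.X] (𝟙 D.X)
  change Δ[C.X ⊗ D.X] ≫ ((C.X ◁ ε[D.X] ≫ (ρ_ C.X).hom) ⊗ₘ (ε[C.X] ▷ D.X ≫ (λ_ D.X).hom)) = _
  simp only [id_tensorHom, tensorHom_id] at h
  rw [Comon.tensorObj_comul, ← tensorHom_comp_tensorHom, Category.assoc, ← reassoc_of% h,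
    tensorHom_comp_tensorHom_assoc, ComonObj.comul_counit, ComonObj.counit_comul, tensorμ,
    braiding_tensorUnit_left]
  monoidal

lemma comul_projR_projL (C D : Comon V) :
    Δ[C.X ⊗ D.X] ≫ ((projR C D).hom ⊗ₘ (projL C D).hom) = (β_ C.X D.X).hom := by
  have h := tensorμ_natural ε[C.X] (𝟙 C.X) (𝟙 D.X) ε[D.X]
  change Δ[C.X ⊗ D.X] ≫ ((ε[C.X] ▷ D.X ≫ (λ_ D.X).hom) ⊗ₘ (C.X ◁ ε[D.X] ≫ (ρ_ C.X).hom)) = _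
  simp only [id_tensorHom, tensorHom_id] at h
  rw [Comon.tensorObj_comul, ← tensorHom_comp_tensorHom, Category.assoc, ← reassoc_of% h,
    tensorHom_comp_tensorHom_assoc, ComonObj.comul_counit, ComonObj.counit_comul, tensorμ]
  monoidal

namespace Bicomod

variable {P a c : Comon V}

/-- The right `a`-coaction underlying a right `a ⊗ c`-coaction. -/
def ractL (M : Bicomod P (tensorComon a c)) : M.X ⟶ M.X ⊗ a.X := M.ract ≫ M.X ◁ (projL a c).hom

/-- The right `c`-coaction underlying a right `a ⊗ c`-coaction. -/
def ractR (M : Bicomod P (tensorComon a c)) : M.X ⟶ M.X ⊗ c.X := M.ract ≫ M.X ◁ (projR a c).hom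

lemma ractL_counit (M : Bicomod P (tensorComon a c)) : M.ractL ≫ M.X ◁ ε[a.X] = (ρ_ M.X).inv :=
  (M.mapR (projL a c)).ract_counit

lemma ractR_counit (M : Bicomod P (tensorComon a c)) : M.ractR ≫ M.X ◁ ε[c.X] = (ρ_ M.X).inv :=
  (M.mapR (projR a c)).ract_counit

lemma ractL_coassoc (M : Bicomod P (tensorComon a c)) :
    M.ractL ≫ M.ractL ▷ a.X = M.ractL ≫ M.X ◁ Δ[a.X] ≫ (α_ M.X a.X a.X).inv :=
  (M.mapR (projL a c)).ract_coassoc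

lemma ractR_coassoc (M : Bicomod P (tensorComon a c)) :
    M.ractR ≫ M.ractR ▷ c.X = M.ractR ≫ M.X ◁ Δ[c.X] ≫ (α_ M.X c.X c.X).inv :=
  (M.mapR (projR a c)).ract_coassoc

lemma ractL_comm (M : Bicomod P (tensorComon a c)) :
    M.lact ≫ P.X ◁ M.ractL = M.ractL ≫ M.lact ▷ a.X ≫ (α_ P.X M.X a.X).hom :=
  (M.mapR (projL a c)).comm

lemma ractR_comm (M : Bicomod P (tensorComon a c)) :
    M.lact ≫ P.X ◁ M.ractR = M.ractR ≫ M.lact ▷ c.X ≫ (α_ P.X M.X c.X).hom :=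
  (M.mapR (projR a c)).comm

lemma ract_swap (M : Bicomod P (tensorComon a c)) :
    M.ractL ≫ M.ractR ▷ a.X = M.ractR ≫ M.ractL ▷ c.X ≫ (α_ M.X a.X c.X).hom ≫
        M.X ◁ (β_ a.X c.X).hom ≫ (α_ M.X c.X a.X).inv := by
  have h1 : M.ractL ≫ M.ractR ▷ a.X =
      M.ract ≫ M.X ◁ (Δ[a.X ⊗ c.X] ≫ ((projR a c).hom ⊗ₘ (projL a c).hom)) ≫
        (α_ _ _ _).inv := by
    simp only [ractL, ractR, Category.assoc, comp_whiskerRight, MonoidalCategory.whiskerLeft_comp]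
    rw [whisker_exchange_assoc, reassoc_of% M.ract_coassoc]
    simp [MonoidalCategory.tensorHom_def']
  have h2 : M.ractR ≫ M.ractL ▷ c.X =
      M.ract ≫ M.X ◁ (Δ[a.X ⊗ c.X] ≫ ((projL a c).hom ⊗ₘ (projR a c).hom)) ≫
        (α_ _ _ _).inv := by
    simp only [ractL, ractR, Category.assoc, comp_whiskerRight, MonoidalCategory.whiskerLeft_comp]
    rw [whisker_exchange_assoc, reassoc_of% M.ract_coassoc]
    simp [MonoidalCategory.tensorHom_def']
  rw [reassoc_of% h2, h1, comul_projR_projL, comul_projL_projR]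
  simp

/-- A comodule with right `Cᵒ ⊗ C'`-coaction, regarded as a comodule `C ⇸ C'` by means of the
biduality between `C` and `Cᵒ`. -/
def bd (M : Bicomod P (tensorComon (opComon a) c)) : Bicomod a c where
  X := M.X
  lact := M.ractL ≫ (β_ a.X M.X).inv
  ract := M.ractR
  lact_counit := by
    have h : M.ractL ≫ M.X ◁ ε[a.X] = (ρ_ M.X).inv := M.ractL_counit
    rw [Category.assoc, ← BraidedCategory.braiding_inv_naturality_right, reassoc_of% h]
    simp
  lact_coassoc := by
    have h : M.ractL ≫ M.ractL ▷ a.X =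
      M.ractL ≫ M.X ◁ (Δ[a.X] ≫ (β_ a.X a.X).hom) ≫ (α_ M.X a.X a.X).inv := M.ractL_coassoc
    simp only [Category.assoc, MonoidalCategory.whiskerLeft_comp]
    rw [← BraidedCategory.braiding_inv_naturality_left_assoc, reassoc_of% h,
      ← BraidedCategory.braiding_inv_naturality_right_assoc,
      BraidedCategory.braiding_tensor_left_inv, BraidedCategory.braiding_tensor_right_inv]
    simp
  ract_counit := M.ractR_counit
  ract_coassoc := M.ractR_coassoc
  comm := by
    have h : M.ractL ≫ M.ractR ▷ a.X = M.ractR ≫ M.ractL ▷ c.X ≫ (α_ M.X a.X c.X).hom ≫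
        M.X ◁ (β_ a.X c.X).hom ≫ (α_ M.X c.X a.X).inv := M.ract_swap
    rw [Category.assoc, ← BraidedCategory.braiding_inv_naturality_left, reassoc_of% h,
      BraidedCategory.braiding_tensor_right_inv]
    simp

/-- A map which respects the right coactions induces a map of the comodules regarded as
comodules `C ⇸ C'`. -/
def bdMap {Q : Comon V} {M : Bicomod P (tensorComon (opComon a) c)}
    {N : Bicomod Q (tensorComon (opComon a) c)} (f : M.X ⟶ N.X)
    (hf : M.ract ≫ f ▷ (a.X ⊗ c.X) = f ≫ N.ract) : bd M ⟶ bd N where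
  hom := f
  left := by
    change (M.ractL ≫ (β_ a.X M.X).inv) ≫ a.X ◁ f = f ≫ N.ractL ≫ (β_ a.X N.X).inv
    rw [Category.assoc, ← BraidedCategory.braiding_inv_naturality_left]
    simp only [ractL, Category.assoc]
    rw [whisker_exchange_assoc, reassoc_of% hf]
  right := by
    change M.ractR ≫ f ▷ c.X = f ≫ N.ractR
    simp only [ractR, Category.assoc]
    rw [whisker_exchange, reassoc_of% hf]

/-- Two commuting right coactions make up a right coaction of the tensor product. -/
lemma ofRight_coassoc {X : V} (A B : Comon V) (r : X ⟶ X ⊗ A.X) (s : X ⟶ X ⊗ B.X)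
    (hr : r ≫ r ▷ A.X = r ≫ X ◁ Δ[A.X] ≫ (α_ X A.X A.X).inv)
    (hs : s ≫ s ▷ B.X = s ≫ X ◁ Δ[B.X] ≫ (α_ X B.X B.X).inv)
    (h : r ≫ s ▷ A.X = s ≫ r ▷ B.X ≫ (α_ X A.X B.X).hom ≫ X ◁ (β_ A.X B.X).hom ≫
      (α_ X B.X A.X).inv) :
    (s ≫ r ▷ B.X ≫ (α_ X A.X B.X).hom) ≫ (s ≫ r ▷ B.X ≫ (α_ X A.X B.X).hom) ▷ (A.X ⊗ B.X) =
      (s ≫ r ▷ B.X ≫ (α_ X A.X B.X).hom) ≫ X ◁ Δ[A.X ⊗ B.X] ≫ (α_ X _ _).inv := by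
  have h' := congrArg (· ▷ B.X) h
  have hr' := congrArg (· ▷ B.X ▷ B.X) hr
  simp only [comp_whiskerRight] at h' hr'
  calc _ = s ≫ (r ▷ B.X ≫ s ▷ A.X ▷ B.X) ⊗≫ r ▷ B.X ▷ A.X ▷ B.X ⊗≫ 𝟙 _ := by
        monoidal
    _ = (s ≫ s ▷ B.X) ≫ r ▷ B.X ▷ B.X ⊗≫ (X ◁ ((β_ A.X B.X).hom ▷ B.X) ≫
          r ▷ ((B.X ⊗ A.X) ⊗ B.X)) ⊗≫ 𝟙 _ := by
        rw [h']
        monoidal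
    _ = s ≫ X ◁ Δ[B.X] ⊗≫ (r ≫ r ▷ A.X) ▷ B.X ▷ B.X ⊗≫
          X ◁ A.X ◁ (β_ A.X B.X).hom ▷ B.X ⊗≫ 𝟙 _ := by
        rw [hs, whisker_exchange]
        monoidal
    _ = s ≫ (X ◁ Δ[B.X] ≫ r ▷ (B.X ⊗ B.X)) ⊗≫ X ◁ Δ[A.X] ▷ B.X ▷ B.X ⊗≫
          X ◁ A.X ◁ (β_ A.X B.X).hom ▷ B.X ⊗≫ 𝟙 _ := by
        rw [hr]
        monoidal
    _ = _ := by
        rw [Comon.tensorObj_comul, tensorμ, whisker_exchange, MonoidalCategory.tensorHom_def']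
        monoidal

end Bicomod

end Biduality

section Duality

variable {V : Type u} [Category.{v} V] [MonoidalCategory V] [BraidedCategory V]

namespace Bicomod

/-- Two commuting left coactions make up a left coaction of the tensor product. -/
lemma ofLeft_coassoc {X : V} (A B : Comon V) (l : X ⟶ A.X ⊗ X) (m : X ⟶ B.X ⊗ X)
    (hl : l ≫ A.X ◁ l = l ≫ Δ[A.X] ▷ X ≫ (α_ A.X A.X X).hom)
    (hm : m ≫ B.X ◁ m = m ≫ Δ[B.X] ▷ X ≫ (α_ B.X B.X X).hom)
    (h : m ≫ B.X ◁ l = l ≫ A.X ◁ m ≫ (α_ A.X B.X X).inv ≫ (β_ A.X B.X).hom ▷ X ≫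
      (α_ B.X A.X X).hom) :
    (l ≫ A.X ◁ m ≫ (α_ A.X B.X X).inv) ≫ (A.X ⊗ B.X) ◁ (l ≫ A.X ◁ m ≫ (α_ A.X B.X X).inv) =
      (l ≫ A.X ◁ m ≫ (α_ A.X B.X X).inv) ≫ Δ[A.X ⊗ B.X] ▷ X ≫ (α_ _ _ X).hom := by
  have h' := congrArg (A.X ◁ ·) h
  simp only [MonoidalCategory.whiskerLeft_comp] at h'
  calc _ = l ≫ (A.X ◁ m ≫ A.X ◁ B.X ◁ l) ⊗≫ A.X ◁ B.X ◁ A.X ◁ m ⊗≫ 𝟙 _ := by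
        monoidal
    _ = (l ≫ A.X ◁ l) ≫ A.X ◁ A.X ◁ m ⊗≫ ((A.X ◁ (β_ A.X B.X).hom) ▷ X ≫
          (A.X ⊗ (B.X ⊗ A.X)) ◁ m) ⊗≫ 𝟙 _ := by
        rw [h']
        monoidal
    _ = l ≫ Δ[A.X] ▷ X ⊗≫ A.X ◁ A.X ◁ (m ≫ B.X ◁ m) ⊗≫
          (A.X ◁ (β_ A.X B.X).hom ▷ B.X) ▷ X ⊗≫ 𝟙 _ := by
        rw [hl, ← whisker_exchange]
        monoidal
    _ = l ≫ (Δ[A.X] ▷ X ≫ (A.X ⊗ A.X) ◁ m) ⊗≫ (A.X ⊗ A.X) ◁ Δ[B.X] ▷ X ⊗≫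
          (A.X ◁ (β_ A.X B.X).hom ▷ B.X) ▷ X ⊗≫ 𝟙 _ := by
        rw [hm]
        monoidal
    _ = _ := by
        rw [Comon.tensorObj_comul, tensorμ, ← whisker_exchange, MonoidalCategory.tensorHom_def]
        monoidal

/-- The unit `n : I ⇸ Cᵒ ⊗ C` of the biduality, with underlying object `C`. -/
def n (c : Comon V) : Bicomod (unitComon (V := V)) (tensorComon (opComon c) c) where
  X := c.X
  lact := (λ_ c.X).inv
  ract := Δ[c.X] ≫ (Δ[c.X] ≫ (β_ c.X c.X).hom) ▷ c.X ≫ (α_ c.X c.X c.X).hom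
  lact_counit := by
    change (λ_ c.X).inv ≫ (𝟙 (𝟙_ V)) ▷ c.X = _
    simp
  lact_coassoc := by
    change (λ_ c.X).inv ≫ 𝟙_ V ◁ (λ_ c.X).inv =
      (λ_ c.X).inv ≫ (λ_ (𝟙_ V)).inv ▷ c.X ≫ (α_ _ _ _).hom
    monoidal
  ract_counit := by
    have h : (Δ[c.X] ≫ (β_ c.X c.X).hom) ≫ c.X ◁ ε[c.X] = (ρ_ c.X).inv :=
      (opComon c).comon.comul_counit
    have h' := congrArg (· ▷ c.X) h
    simp only [comp_whiskerRight] at h'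
    rw [Comon.tensorObj_counit]
    calc _ = Δ[c.X] ≫ (((Δ[c.X] ≫ (β_ c.X c.X).hom) ≫ c.X ◁ ε[c.X]) ▷ c.X) ≫
          ((c.X ⊗ 𝟙_ V) ◁ ε[c.X]) ⊗≫ 𝟙 _ := by
          rw [MonoidalCategory.tensorHom_def]
          simp only [Category.assoc]
          change _ ≫ _ ≫ _ ≫ c.X ◁ (ε[c.X] ▷ c.X ≫ 𝟙_ V ◁ ε[c.X] ≫ (λ_ (𝟙_ V)).hom) = _
          monoidal
      _ = (Δ[c.X] ≫ c.X ◁ ε[c.X]) ⊗≫ 𝟙 _ := by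
          rw [h]
          monoidal
      _ = _ := by
          rw [ComonObj.comul_counit]
          monoidal
  ract_coassoc := by
    refine ofRight_coassoc (opComon c) c (Δ[c.X] ≫ (β_ c.X c.X).hom) Δ[c.X] ?_ ?_ ?_
    · have h := (opComon c).comon.comul_assoc
      change (Δ[c.X] ≫ (β_ c.X c.X).hom) ≫ c.X ◁ (Δ[c.X] ≫ (β_ c.X c.X).hom) =
        (Δ[c.X] ≫ (β_ c.X c.X).hom) ≫ (Δ[c.X] ≫ (β_ c.X c.X).hom) ▷ c.X ≫
          (α_ c.X c.X c.X).hom at h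
      change (Δ[c.X] ≫ (β_ c.X c.X).hom) ≫ (Δ[c.X] ≫ (β_ c.X c.X).hom) ▷ c.X =
        (Δ[c.X] ≫ (β_ c.X c.X).hom) ≫ c.X ◁ (Δ[c.X] ≫ (β_ c.X c.X).hom) ≫ (α_ _ _ _).inv
      rw [← Category.assoc _ (c.X ◁ _) _, h]
      simp
    · simp
    · change (Δ[c.X] ≫ (β_ c.X c.X).hom) ≫ Δ[c.X] ▷ c.X =
        Δ[c.X] ≫ (Δ[c.X] ≫ (β_ c.X c.X).hom) ▷ c.X ≫ (α_ c.X c.X c.X).hom ≫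
          c.X ◁ (β_ c.X c.X).hom ≫ (α_ c.X c.X c.X).inv
      rw [Category.assoc, ← BraidedCategory.braiding_naturality_right,
        BraidedCategory.braiding_tensor_right_hom, comp_whiskerRight]
      simp
  comm := by
    change (λ_ c.X).inv ≫ 𝟙_ V ◁ (Δ[c.X] ≫ (Δ[c.X] ≫ (β_ c.X c.X).hom) ▷ c.X ≫
      (α_ c.X c.X c.X).hom) = (Δ[c.X] ≫ (Δ[c.X] ≫ (β_ c.X c.X).hom) ▷ c.X ≫
      (α_ c.X c.X c.X).hom) ≫ (λ_ c.X).inv ▷ (c.X ⊗ c.X) ≫ (α_ _ _ _).hom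
    monoidal

/-- The counit `e : C ⊗ Cᵒ ⇸ I` of the biduality, with underlying object `C`. -/
def e (c : Comon V) : Bicomod (tensorComon c (opComon c)) (unitComon (V := V)) where
  X := c.X
  lact := Δ[c.X] ≫ c.X ◁ (Δ[c.X] ≫ (β_ c.X c.X).hom) ≫ (α_ c.X c.X c.X).inv
  ract := (ρ_ c.X).inv
  ract_counit := by
    change (ρ_ c.X).inv ≫ c.X ◁ (𝟙 (𝟙_ V)) = _
    simp
  ract_coassoc := by
    change (ρ_ c.X).inv ≫ (ρ_ c.X).inv ▷ 𝟙_ V =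
      (ρ_ c.X).inv ≫ c.X ◁ (λ_ (𝟙_ V)).inv ≫ (α_ _ _ _).inv
    monoidal
  lact_counit := by
    have h : (Δ[c.X] ≫ (β_ c.X c.X).hom) ≫ ε[c.X] ▷ c.X = (λ_ c.X).inv :=
      (opComon c).comon.counit_comul
    rw [Comon.tensorObj_counit]
    calc _ = Δ[c.X] ≫ (c.X ◁ ((Δ[c.X] ≫ (β_ c.X c.X).hom) ≫ ε[c.X] ▷ c.X)) ≫
          (ε[c.X] ▷ (𝟙_ V ⊗ c.X)) ⊗≫ 𝟙 _ := by
          rw [MonoidalCategory.tensorHom_def']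
          simp only [Category.assoc]
          change _ ≫ _ ≫ _ ≫ (c.X ◁ ε[c.X] ≫ ε[c.X] ▷ 𝟙_ V ≫ (λ_ (𝟙_ V)).hom) ▷ c.X = _
          monoidal
      _ = (Δ[c.X] ≫ ε[c.X] ▷ c.X) ⊗≫ 𝟙 _ := by
          rw [h]
          monoidal
      _ = _ := by
          rw [ComonObj.counit_comul]
          monoidal
  lact_coassoc := by
    refine ofLeft_coassoc c (opComon c) Δ[c.X] (Δ[c.X] ≫ (β_ c.X c.X).hom) ?_ ?_ ?_
    · simp
    · have h := (opComon c).comon.comul_assoc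
      exact h
    · change (Δ[c.X] ≫ (β_ c.X c.X).hom) ≫ c.X ◁ Δ[c.X] =
        Δ[c.X] ≫ c.X ◁ (Δ[c.X] ≫ (β_ c.X c.X).hom) ≫ (α_ c.X c.X c.X).inv ≫
          (β_ c.X c.X).hom ▷ c.X ≫ (α_ c.X c.X c.X).hom
      rw [Category.assoc, ← BraidedCategory.braiding_naturality_left,
        BraidedCategory.braiding_tensor_left_hom, MonoidalCategory.whiskerLeft_comp]
      simp
  comm := by
    change (Δ[c.X] ≫ c.X ◁ (Δ[c.X] ≫ (β_ c.X c.X).hom) ≫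
      (α_ c.X c.X c.X).inv) ≫ (c.X ⊗ c.X) ◁ (ρ_ c.X).inv = (ρ_ c.X).inv ≫ (Δ[c.X] ≫
        c.X ◁ (Δ[c.X] ≫ (β_ c.X c.X).hom) ≫ (α_ c.X c.X c.X).inv) ▷ 𝟙_ V ≫ (α_ _ _ _).hom
    monoidal

end Bicomod
end Duality

section Cotensor

variable {V : Type u} [Category.{v} V] [MonoidalCategory V] [BraidedCategory V]

namespace Bicomod

variable {P Q a b c : Comon V}

lemma cot_l1 (X : Bicomod P (tensorComon (opComon a) c)) (Y : Bicomod Q (tensorComon (opComon c) b)) :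
    ((X.lact ⊗ₘ Y.lact) ≫ tensorμ P.X X.X Q.X Y.X) ≫ (P.X ⊗ Q.X) ◁ (X.ractR ▷ Y.X) =
      X.ractR ▷ Y.X ≫ ((X.lact ▷ c.X ≫ (α_ _ _ _).hom) ⊗ₘ Y.lact) ≫
        tensorμ P.X (X.X ⊗ c.X) Q.X Y.X := by
  rw [← tensorHom_id, Category.assoc, tensorμ_whiskerLeft, tensorHom_comp_tensorHom_assoc,
    X.ractR_comm, tensorHom_comp_tensorHom_assoc]
  simp

lemma bd_lact_lact (Y : Bicomod Q (tensorComon (opComon c) b)) :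
    Y.lact ≫ Q.X ◁ (Y.ractL ≫ (β_ c.X Y.X).inv) = (Y.ractL ≫ (β_ c.X Y.X).inv) ≫ c.X ◁ Y.lact ≫
      (α_ _ _ _).inv ≫ (β_ c.X Q.X).hom ▷ Y.X ≫ (α_ _ _ _).hom := by
  have h : Y.lact ≫ Q.X ◁ Y.ractL = Y.ractL ≫ Y.lact ▷ c.X ≫ (α_ Q.X Y.X c.X).hom := Y.ractL_comm
  rw [MonoidalCategory.whiskerLeft_comp, reassoc_of% h, Category.assoc,
    ← BraidedCategory.braiding_inv_naturality_left_assoc,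
    BraidedCategory.braiding_tensor_right_inv]
  simp [← comp_whiskerRight_assoc]

lemma cot_l2 (X : Bicomod P (tensorComon (opComon a) c)) (Y : Bicomod Q (tensorComon (opComon c) b))
    (l : Y.X ⟶ c.X ⊗ Y.X)
    (e : Y.lact ≫ Q.X ◁ l = l ≫ c.X ◁ Y.lact ≫ (α_ _ _ _).inv ≫
      (β_ c.X Q.X).hom ▷ Y.X ≫ (α_ _ _ _).hom) :
    ((X.lact ⊗ₘ Y.lact) ≫ tensorμ P.X X.X Q.X Y.X) ≫
        (P.X ⊗ Q.X) ◁ (X.X ◁ l ≫ (α_ _ _ _).inv) =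
      (X.X ◁ l ≫ (α_ _ _ _).inv) ≫ ((X.lact ▷ c.X ≫ (α_ _ _ _).hom) ⊗ₘ Y.lact) ≫
        tensorμ P.X (X.X ⊗ c.X) Q.X Y.X := by
  have h := tensorμ_whiskerLeft (X₁ := P.X) (Y₁ := Q.X) (𝟙 X.X) l
  rw [id_tensorHom] at h
  rw [MonoidalCategory.whiskerLeft_comp, Category.assoc, reassoc_of% h,
    tensorHom_comp_tensorHom_assoc, e, tensorμ, tensorμ,
    BraidedCategory.braiding_tensor_left_hom]
  calc _ = (X.X ◁ l ≫ X.lact ▷ (c.X ⊗ Y.X)) ≫ (P.X ⊗ X.X) ◁ c.X ◁ Y.lact ⊗≫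
          P.X ◁ X.X ◁ (β_ c.X Q.X).hom ▷ Y.X ⊗≫ P.X ◁ (β_ X.X Q.X).hom ▷ (c.X ⊗ Y.X) ⊗≫ 𝟙 _ := by
        rw [whisker_exchange, MonoidalCategory.tensorHom_def]
        monoidal
    _ = _ := by
        rw [MonoidalCategory.tensorHom_def]
        monoidal

lemma cot_r1 (X : Bicomod P (tensorComon (opComon a) c)) (Y : Bicomod Q (tensorComon (opComon c) b)) :
    ((X.ractL ⊗ₘ Y.ractR) ≫ tensorμ X.X a.X Y.X b.X) ≫ (X.ractR ▷ Y.X) ▷ (a.X ⊗ b.X) =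
      X.ractR ▷ Y.X ≫ ((X.ractL ▷ c.X ≫ (α_ _ _ _).hom ≫ X.X ◁ (β_ a.X c.X).hom ≫
        (α_ _ _ _).inv) ⊗ₘ Y.ractR) ≫ tensorμ (X.X ⊗ c.X) a.X Y.X b.X := by
  have h : X.ractL ≫ X.ractR ▷ a.X = X.ractR ≫ X.ractL ▷ c.X ≫ (α_ X.X a.X c.X).hom ≫
        X.X ◁ (β_ a.X c.X).hom ≫ (α_ X.X c.X a.X).inv := X.ract_swap
  have h2 := tensorμ_whiskerRight (X₂ := a.X) (Y₂ := b.X) X.ractR (𝟙 Y.X)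
  rw [tensorHom_id] at h2
  rw [Category.assoc, h2, tensorHom_comp_tensorHom_assoc]
  change (X.ractL ≫ X.ractR ▷ a.X ⊗ₘ _) ≫ _ = _
  rw [h, ← tensorHom_id X.ractR Y.X, tensorHom_comp_tensorHom_assoc]
  simp

lemma bd_ract_lact (Y : Bicomod Q (tensorComon (opComon c) b)) :
    Y.ractR ≫ (Y.ractL ≫ (β_ c.X Y.X).inv) ▷ b.X =
      (Y.ractL ≫ (β_ c.X Y.X).inv) ≫ c.X ◁ Y.ractR ≫ (α_ c.X Y.X b.X).inv := by
  have h := (bd Y).comm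
  change (Y.ractL ≫ (β_ c.X Y.X).inv) ≫ c.X ◁ Y.ractR =
    Y.ractR ≫ (Y.ractL ≫ (β_ c.X Y.X).inv) ▷ b.X ≫ (α_ c.X Y.X b.X).hom at h
  rw [← Category.assoc, h]
  simp

lemma cot_r2 (X : Bicomod P (tensorComon (opComon a) c)) (Y : Bicomod Q (tensorComon (opComon c) b))
    (l : Y.X ⟶ c.X ⊗ Y.X)
    (e : Y.ractR ≫ l ▷ b.X = l ≫ c.X ◁ Y.ractR ≫ (α_ c.X Y.X b.X).inv) :
    ((X.ractL ⊗ₘ Y.ractR) ≫ tensorμ X.X a.X Y.X b.X) ≫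
        (X.X ◁ l ≫ (α_ _ _ _).inv) ▷ (a.X ⊗ b.X) =
      (X.X ◁ l ≫ (α_ _ _ _).inv) ≫ ((X.ractL ▷ c.X ≫ (α_ _ _ _).hom ≫
        X.X ◁ (β_ a.X c.X).hom ≫ (α_ _ _ _).inv) ⊗ₘ Y.ractR) ≫
          tensorμ (X.X ⊗ c.X) a.X Y.X b.X := by
  have h := tensorμ_whiskerRight (X₂ := a.X) (Y₂ := b.X) (𝟙 X.X) l
  rw [id_tensorHom] at h
  rw [comp_whiskerRight, Category.assoc, reassoc_of% h, tensorHom_comp_tensorHom_assoc]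
  change (X.ractL ≫ 𝟙 X.X ▷ a.X ⊗ₘ _) ≫ _ = _
  rw [e, tensorμ, tensorμ, BraidedCategory.braiding_tensor_right_hom]
  calc _ = (X.X ◁ l ≫ X.ractL ▷ (c.X ⊗ Y.X)) ≫ (X.X ⊗ a.X) ◁ c.X ◁ Y.ractR ⊗≫
          X.X ◁ (β_ a.X c.X).hom ▷ Y.X ▷ b.X ⊗≫ X.X ◁ c.X ◁ (β_ a.X Y.X).hom ▷ b.X ⊗≫ 𝟙 _ := by
        rw [whisker_exchange, MonoidalCategory.tensorHom_def]
        monoidal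
    _ = X.X ◁ l ⊗≫ X.ractL ▷ c.X ▷ Y.X ⊗≫ ((X.X ⊗ (a.X ⊗ c.X)) ◁ Y.ractR ≫
          (X.X ◁ (β_ a.X c.X).hom) ▷ (Y.X ⊗ b.X)) ⊗≫
            X.X ◁ c.X ◁ (β_ a.X Y.X).hom ▷ b.X ⊗≫ 𝟙 _ := by
        monoidal
    _ = _ := by
        rw [whisker_exchange, MonoidalCategory.tensorHom_def]
        monoidal

/-- The first of the two maps whose equalizer is `X ⊗_C Y`. -/
abbrev cotL (X : Bicomod P (tensorComon (opComon a) c))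
    (Y : Bicomod Q (tensorComon (opComon c) b)) : X.X ⊗ Y.X ⟶ (X.X ⊗ c.X) ⊗ Y.X :=
  X.ractR ▷ Y.X

/-- The second of the two maps whose equalizer is `X ⊗_C Y`. -/
abbrev cotR (X : Bicomod P (tensorComon (opComon a) c))
    (Y : Bicomod Q (tensorComon (opComon c) b)) : X.X ⊗ Y.X ⟶ (X.X ⊗ c.X) ⊗ Y.X :=
  X.X ◁ (Y.ractL ≫ (β_ c.X Y.X).inv) ≫ (α_ X.X c.X Y.X).inv

instance isCoreflexivePair_cot (X : Bicomod P (tensorComon (opComon a) c))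
    (Y : Bicomod Q (tensorComon (opComon c) b)) : IsCoreflexivePair (cotL X Y) (cotR X Y) :=
  inferInstanceAs (IsCoreflexivePair (compL (bd X) (bd Y)) (compR (bd X) (bd Y)))

variable [HasCoreflexiveEqualizers V] [∀ Z : V, PreservesCoreflexiveEqualizers (tensorLeft Z)]

/-- For comodules `X : P ⇸ Aᵒ ⊗ C` and `Y : Q ⇸ Cᵒ ⊗ B`, the composite
`P ⊗ Q ⇸ Aᵒ ⊗ C ⊗ Cᵒ ⊗ B ⇸ Aᵒ ⊗ B` of `X ⊗ Y` and `Aᵒ ⊗ e ⊗ B`: this is `X ⊗_C Y` with the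
coactions induced from `X` and `Y`. -/
noncomputable def cot (X : Bicomod P (tensorComon (opComon a) c))
    (Y : Bicomod Q (tensorComon (opComon c) b)) :
    Bicomod (tensorComon P Q) (tensorComon (opComon a) b) :=
  @sub V _ _ _ _ _ _ _ (tensor (X.mapR (projL (opComon a) c)) (Y.mapR (projR (opComon c) b)))
    _ (cotL X Y) (cotR X Y) (isCoreflexivePair_cot X Y)
    ((congrArg (equalizer.ι (cotL X Y) (cotR X Y) ≫ ·) (cot_l1 X Y)).trans
      ((equalizer.condition_assoc (cotL X Y) (cotR X Y) _).trans
        (congrArg (equalizer.ι (cotL X Y) (cotR X Y) ≫ ·)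
          (cot_l2 X Y _ Y.bd_lact_lact)).symm))
    ((congrArg (equalizer.ι (cotL X Y) (cotR X Y) ≫ ·) (cot_r1 X Y)).trans
      ((equalizer.condition_assoc (cotL X Y) (cotR X Y) _).trans
        (congrArg (equalizer.ι (cotL X Y) (cotR X Y) ≫ ·)
          (cot_r2 X Y _ Y.bd_ract_lact)).symm))

lemma cot_ract (X : Bicomod P (tensorComon (opComon a) c))
    (Y : Bicomod Q (tensorComon (opComon c) b)) :
    (cot X Y).ract ≫ (show (cot X Y).X ⟶ X.X ⊗ Y.X from (compι (bd X) (bd Y)).hom) ▷ (a.X ⊗ b.X) =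
      (show (cot X Y).X ⟶ X.X ⊗ Y.X from (compι (bd X) (bd Y)).hom) ≫ (X.ractL ⊗ₘ Y.ractR) ≫ tensorμ X.X a.X Y.X b.X :=
  @sub_ract V _ _ _ _ _ _ _ (tensor (X.mapR (projL (opComon a) c)) (Y.mapR (projR (opComon c) b)))
    _ (cotL X Y) (cotR X Y) (isCoreflexivePair_cot X Y) _ _

end Bicomod
end Cotensor

section CotensorComparison

variable {V : Type u} [Category.{v} V] [MonoidalCategory V] [BraidedCategory V]

namespace Bicomod

variable {P Q a b c : Comon V}

lemma tensorμ_projL {X Y : V} (A B : Comon V) (r : X ⟶ X ⊗ A.X) (s : Y ⟶ Y ⊗ B.X)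
    (hs : s ≫ Y ◁ ε[B.X] = (ρ_ Y).inv) :
    (r ⊗ₘ s) ≫ tensorμ X A.X Y B.X ≫ (X ⊗ Y) ◁ (projL A B).hom =
      r ▷ Y ≫ (α_ _ _ _).hom ≫ X ◁ (β_ A.X Y).hom ≫ (α_ _ _ _).inv := by
  change _ ≫ _ ≫ _ ◁ (A.X ◁ ε[B.X] ≫ (ρ_ A.X).hom) = _
  have h := tensorμ_whiskerLeft (X₁ := X) (Y₁ := Y) (𝟙 A.X) ε[B.X]
  rw [id_tensorHom] at h
  rw [MonoidalCategory.whiskerLeft_comp, reassoc_of% h, tensorHom_comp_tensorHom_assoc, hs,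
    tensorμ, MonoidalCategory.tensorHom_def]
  monoidal

lemma tensorμ_projR {X Y : V} (A B : Comon V) (r : X ⟶ X ⊗ A.X) (s : Y ⟶ Y ⊗ B.X)
    (hr : r ≫ X ◁ ε[A.X] = (ρ_ X).inv) :
    (r ⊗ₘ s) ≫ tensorμ X A.X Y B.X ≫ (X ⊗ Y) ◁ (projR A B).hom =
      X ◁ s ≫ (α_ _ _ _).inv := by
  change _ ≫ _ ≫ _ ◁ (ε[A.X] ▷ B.X ≫ (λ_ B.X).hom) = _
  have h := tensorμ_whiskerLeft (X₁ := X) (Y₁ := Y) ε[A.X] (𝟙 B.X)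
  rw [tensorHom_id] at h
  rw [MonoidalCategory.whiskerLeft_comp, reassoc_of% h, tensorHom_comp_tensorHom_assoc, hr,
    tensorμ, MonoidalCategory.tensorHom_def, braiding_tensorUnit_left]
  monoidal

variable [HasCoreflexiveEqualizers V] [∀ Z : V, PreservesCoreflexiveEqualizers (tensorLeft Z)]

/-- The inclusion of the underlying object of `X ⊗_C Y` into `X ⊗ Y`. -/
noncomputable abbrev cotι (X : Bicomod P (tensorComon (opComon a) c))
    (Y : Bicomod Q (tensorComon (opComon c) b)) : (cot X Y).X ⟶ X.X ⊗ Y.X :=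
  (compι (bd X) (bd Y)).hom

lemma cot_ractL (X : Bicomod P (tensorComon (opComon a) c))
    (Y : Bicomod Q (tensorComon (opComon c) b)) :
    (cot X Y).ractL ≫ cotι X Y ▷ a.X = cotι X Y ≫ X.ractL ▷ Y.X ≫ (α_ _ _ _).hom ≫
      X.X ◁ (β_ a.X Y.X).hom ≫ (α_ _ _ _).inv := by
  have h := cot_ract X Y
  change (cot X Y).ract ≫ cotι X Y ▷ (a.X ⊗ b.X) = cotι X Y ≫ _ at h
  rw [ractL, Category.assoc]
  change _ ≫ _ ≫ cotι X Y ▷ (opComon a).X = _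
  rw [whisker_exchange]
  have h3 := tensorμ_projL (opComon a) b X.ractL Y.ractR Y.ractR_counit
  change _ = cotι X Y ≫ X.ractL ▷ Y.X ≫ (α_ X.X (opComon a).X Y.X).hom ≫
      X.X ◁ (β_ (opComon a).X Y.X).hom ≫ (α_ X.X Y.X (opComon a).X).inv
  rw [← h3]
  have h4 := congrArg (· ≫ (X.X ⊗ Y.X) ◁ (projL (opComon a) b).hom) h
  simp only [Category.assoc] at h4
  exact h4

lemma cot_ractR (X : Bicomod P (tensorComon (opComon a) c))
    (Y : Bicomod Q (tensorComon (opComon c) b)) :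
    (cot X Y).ractR ≫ cotι X Y ▷ b.X = cotι X Y ≫ X.X ◁ Y.ractR ≫ (α_ _ _ _).inv := by
  have h := cot_ract X Y
  change (cot X Y).ract ≫ cotι X Y ▷ (a.X ⊗ b.X) = cotι X Y ≫ _ at h
  rw [ractR, Category.assoc, whisker_exchange,
    ← tensorμ_projR (opComon a) b X.ractL Y.ractR X.ractL_counit]
  have h4 := congrArg (· ≫ (X.X ⊗ Y.X) ◁ (projR (opComon a) b).hom) h
  simp only [Category.assoc] at h4
  exact h4

lemma bd_cot_left (X : Bicomod P (tensorComon (opComon a) c))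
    (Y : Bicomod Q (tensorComon (opComon c) b)) :
    (bd (cot X Y)).lact = (comp (bd X) (bd Y)).lact := by
  refine (cancel_mono (a.X ◁ (compι (bd X) (bd Y)).hom)).1 (Eq.trans ?_ (compι (bd X) (bd Y)).left.symm)
  change ((cot X Y).ractL ≫ (β_ a.X (cot X Y).X).inv) ≫ a.X ◁ cotι X Y =
    cotι X Y ≫ (X.ractL ≫ (β_ a.X X.X).inv) ▷ Y.X ≫ (α_ a.X X.X Y.X).hom
  rw [Category.assoc, ← BraidedCategory.braiding_inv_naturality_left]
  have h := cot_ractL X Y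
  change (cot X Y).ractL ≫ cotι X Y ▷ a.X = cotι X Y ≫ X.ractL ▷ Y.X ≫ (α_ X.X a.X Y.X).hom ≫
      X.X ◁ (β_ a.X Y.X).hom ≫ (α_ X.X Y.X a.X).inv at h
  rw [reassoc_of% h, BraidedCategory.braiding_tensor_right_inv]
  simp [← MonoidalCategory.whiskerLeft_comp_assoc]

lemma bd_cot_right (X : Bicomod P (tensorComon (opComon a) c))
    (Y : Bicomod Q (tensorComon (opComon c) b)) :
    (bd (cot X Y)).ract = (comp (bd X) (bd Y)).ract := by
  refine (cancel_mono ((compι (bd X) (bd Y)).hom ▷ b.X)).1 (Eq.trans ?_ (compι (bd X) (bd Y)).right.symm)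
  exact cot_ractR X Y

/-- The comodule `A ⇸ B` which corresponds to `X ⊗_C Y : P ⊗ Q ⇸ Aᵒ ⊗ B` is the composite of the
comodules which correspond to `X` and `Y`; this is the identity of `X ⊗_C Y`. -/
noncomputable def cotIso (X : Bicomod P (tensorComon (opComon a) c))
    (Y : Bicomod Q (tensorComon (opComon c) b)) :
    bd (cot X Y) ≅ comp (bd X) (bd Y) where
  hom :=
    { hom := 𝟙 (cot X Y).X
      left := by
        erw [MonoidalCategory.whiskerLeft_id, Category.comp_id, Category.id_comp]
        exact bd_cot_left X Y
      right := by
        erw [MonoidalCategory.id_whiskerRight, Category.comp_id, Category.id_comp]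
        exact bd_cot_right X Y }
  inv :=
    { hom := 𝟙 (cot X Y).X
      left := by
        erw [MonoidalCategory.whiskerLeft_id, Category.comp_id, Category.id_comp]
        exact (bd_cot_left X Y).symm
      right := by
        erw [MonoidalCategory.id_whiskerRight, Category.comp_id, Category.id_comp]
        exact (bd_cot_right X Y).symm }
  hom_inv_id := Hom.ext (Category.id_comp _)
  inv_hom_id := Hom.ext (Category.id_comp _)

end Bicomod
end CotensorComparison

section Cells

variable {V : Type u} [Category.{v} V] [MonoidalCategory V] [BraidedCategory V]

namespace Bicomod

variable {P Q a b c : Comon V}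

/-- A map of comodules `P ⇸ Aᵒ ⊗ C`, regarded as a map of comodules `A ⇸ C`. -/
abbrev bdHom {M N : Bicomod P (tensorComon (opComon a) c)} (f : M ⟶ N) : bd M ⟶ bd N :=
  bdMap f.hom f.right

lemma n_ractL (c : Comon V) : (n c).ractL = Δ[c.X] ≫ (β_ c.X c.X).hom := by
  change (Δ[c.X] ≫ (Δ[c.X] ≫ (β_ c.X c.X).hom) ▷ c.X ≫ (α_ c.X c.X c.X).hom) ≫
    c.X ◁ (c.X ◁ ε[c.X] ≫ (ρ_ c.X).hom) = _
  calc _ = Δ[c.X] ≫ ((Δ[c.X] ≫ (β_ c.X c.X).hom) ▷ c.X ≫ (c.X ⊗ c.X) ◁ ε[c.X]) ⊗≫ 𝟙 _ := by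
        monoidal
    _ = (Δ[c.X] ≫ c.X ◁ ε[c.X]) ⊗≫ (Δ[c.X] ≫ (β_ c.X c.X).hom) ⊗≫ 𝟙 _ := by
        rw [← whisker_exchange]
        monoidal
    _ = _ := by
        rw [ComonObj.comul_counit]
        monoidal

lemma n_ractR (c : Comon V) : (n c).ractR = Δ[c.X] := by
  have h : (Δ[c.X] ≫ (β_ c.X c.X).hom) ≫ c.X ◁ ε[c.X] = (ρ_ c.X).inv :=
    (opComon c).comon.comul_counit
  change (Δ[c.X] ≫ (Δ[c.X] ≫ (β_ c.X c.X).hom) ▷ c.X ≫ (α_ c.X c.X c.X).hom) ≫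
    c.X ◁ (ε[c.X] ▷ c.X ≫ (λ_ c.X).hom) = _
  calc _ = Δ[c.X] ≫ ((Δ[c.X] ≫ (β_ c.X c.X).hom) ≫ c.X ◁ ε[c.X]) ▷ c.X ⊗≫ 𝟙 _ := by
        monoidal
    _ = _ := by
        rw [h]
        monoidal

/-- The comodule `C ⇸ C` which corresponds to `n : I ⇸ Cᵒ ⊗ C` is the identity comodule. -/
def toBdN (c : Comon V) : regular c ⟶ bd (n c) where
  hom := 𝟙 c.X
  left := by
    change Δ[c.X] ≫ c.X ◁ 𝟙 c.X = 𝟙 c.X ≫ (n c).ractL ≫ (β_ c.X c.X).inv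
    rw [n_ractL, MonoidalCategory.whiskerLeft_id, Category.comp_id, Category.id_comp]
    exact (Iso.comp_inv_eq (β_ c.X c.X)).2 rfl |>.symm
  right := by
    change Δ[c.X] ≫ 𝟙 c.X ▷ c.X = 𝟙 c.X ≫ (n c).ractR
    rw [n_ractR, id_whiskerRight, Category.comp_id]
    exact (Category.id_comp _).symm

end Bicomod

lemma ract_augment {P Z D : V} (r : Z ⟶ Z ⊗ D) (g : P ⟶ 𝟙_ V) :
    P ◁ r ≫ (α_ P Z D).inv ≫ (g ▷ Z ≫ (λ_ Z).hom) ▷ D = g ▷ Z ≫ (λ_ Z).hom ≫ r := by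
  calc _ = (P ◁ r ≫ g ▷ (Z ⊗ D)) ≫ (λ_ (Z ⊗ D)).hom := by
        monoidal
    _ = _ := by
        rw [whisker_exchange]
        monoidal

/-- The map underlying a 2-cell `W ⇒ Z ∘ p`, where `p` has an augmentation. -/
noncomputable def Bicomod.underlying [HasCoreflexiveEqualizers V]
    [∀ Z : V, PreservesCoreflexiveEqualizers (tensorLeft Z)] {P R a c : Comon V}
    {W : Bicomod P (tensorComon (opComon a) c)} {p : Bicomod P R}
    {Z : Bicomod R (tensorComon (opComon a) c)} (s : W ⟶ Bicomod.comp p Z) (g : p.X ⟶ 𝟙_ V) :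
    Bicomod.bd W ⟶ Bicomod.bd Z :=
  Bicomod.bdMap (s.hom ≫ (Bicomod.compι p Z).hom ≫ g ▷ Z.X ≫ (λ_ Z.X).hom) (by
    have h := (s ≫ Bicomod.compι p Z).right
    change W.ract ≫ (s.hom ≫ (Bicomod.compι p Z).hom) ▷ ((opComon a).X ⊗ c.X) =
      (s.hom ≫ (Bicomod.compι p Z).hom) ≫ p.X ◁ Z.ract ≫ (α_ _ _ _).inv at h
    have h2 := ract_augment Z.ract g
    rw [← Category.assoc s.hom, comp_whiskerRight]
    change _ ≫ _ ▷ ((opComon a).X ⊗ c.X) ≫ _ = _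
    rw [reassoc_of% h]
    simp only [Category.assoc]
    exact congrArg (s.hom ≫ (Bicomod.compι p Z).hom ≫ ·) h2)

/-- Comodules of the form `Cᵒ ⊗ C' ⇸ Cᵒ ⊗ C'`. -/
abbrev EndoComod (c d : Comon V) := Bicomod (tensorComon (opComon c) d) (tensorComon (opComon c) d)

/-- Lists `X₁, …, Xₙ`, `n ≥ 1`, of comodules `Xᵢ : Cᵢ₋₁ᵒ ⊗ Cᵢ ⇸ Cᵢ₋₁ᵒ ⊗ Cᵢ`, where `C₀ = c` and
`Cₙ = d`. -/
inductive Chain : Comon V → Comon V → Type (max u v)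
  | single {c d : Comon V} (X : EndoComod c d) : Chain c d
  | cons {c e d : Comon V} (X : EndoComod c e) (l : Chain e d) : Chain c d

namespace Chain

/-- Concatenation of lists. -/
def append : {c e d : Comon V} → Chain c e → Chain e d → Chain c d
  | _, _, _, single X, m => cons X m
  | _, _, _, cons X l, m => cons X (append l m)

/-- All comodules of a list belong to a class. -/
def All (𝒳 : ∀ c d : Comon V, EndoComod c d → Prop) : {c d : Comon V} → Chain c d → Prop
  | _, _, single X => 𝒳 _ _ X
  | _, _, cons X l => 𝒳 _ _ X ∧ All 𝒳 l

/-- The comonoid `C₁ ⊗ C₁ᵒ ⊗ C₂ ⊗ … ⊗ Cₙ₋₁ᵒ ⊗ Cₙ`. -/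
def tail : {c d : Comon V} → Chain c d → Comon V
  | _, d, single _ => d
  | _, _, @cons _ _ _ _ _ e _ _ l => tensorComon e (tensorComon (opComon e) (tail l))

/-- The comodule `e ⊗ … ⊗ e ⊗ Cₙ`. -/
def evTail : {c d : Comon V} → (l : Chain c d) → Bicomod (tail l) d
  | _, d, single _ => Bicomod.regular d
  | _, d, @cons _ _ _ _ _ e _ _ l =>
      ((Bicomod.tensor (Bicomod.e e) (evTail l)).mapL
        (assocComon e (opComon e) (tail l))).mapR (lunitComon d)

/-- The comodule `p = C₀ᵒ ⊗ e ⊗ … ⊗ e ⊗ Cₙ` from `C₀ᵒ ⊗ C₁ ⊗ C₁ᵒ ⊗ … ⊗ Cₙ` to `C₀ᵒ ⊗ Cₙ`. -/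
def ev {c d : Comon V} (l : Chain c d) :
    Bicomod (tensorComon (opComon c) (tail l)) (tensorComon (opComon c) d) :=
  Bicomod.tensor (Bicomod.regular (opComon c)) (evTail l)

/-- The counit on the underlying object `C₁ ⊗ … ⊗ Cₙ` of `e ⊗ … ⊗ e ⊗ Cₙ`. -/
def augTail : {c d : Comon V} → (l : Chain c d) → ((evTail l).X ⟶ 𝟙_ V)
  | _, d, single _ => (ε[d.X] : d.X ⟶ 𝟙_ V)
  | _, _, @cons _ _ _ _ _ e _ _ l =>
      ((ε[e.X] ⊗ₘ augTail l) ≫ (λ_ (𝟙_ V)).hom : e.X ⊗ (evTail l).X ⟶ 𝟙_ V)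

/-- The counit on the underlying object `C₀ ⊗ C₁ ⊗ … ⊗ Cₙ` of `p`. -/
def aug {c d : Comon V} (l : Chain c d) : (ev l).X ⟶ 𝟙_ V :=
  ((ε[c.X] ⊗ₘ augTail l) ≫ (λ_ (𝟙_ V)).hom : c.X ⊗ (evTail l).X ⟶ 𝟙_ V)

variable [HasCoreflexiveEqualizers V] [∀ Z : V, PreservesCoreflexiveEqualizers (tensorLeft Z)]

/-- The composite `p ∘ (X₁ ⊗ … ⊗ Xₙ)`, which is `X₁ ⊗_{C₁} … ⊗_{Cₙ₋₁} Xₙ` with the left coactions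
of all `Xᵢ`, the right `C₀ᵒ`-coaction of `X₁` and the right `Cₙ`-coaction of `Xₙ`. -/
noncomputable def tot : {c d : Comon V} → (l : Chain c d) →
    Bicomod (tensorComon (opComon c) (tail l)) (tensorComon (opComon c) d)
  | _, _, single X => X
  | c, _, @cons _ _ _ _ _ e _ X l =>
      (Bicomod.cot X (tot l)).mapL
        (assocComon (opComon c) e (tensorComon (opComon e) (tail l)))

/-- As a comodule `C₀ ⇸ Cₙ`, `X₁ ⊗_{C₁} … ⊗ Xₙ` is the composite of the comodules `Xᵢ`. -/
noncomputable def consIso {c e d : Comon V} (X : EndoComod c e) (l : Chain e d) :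
    Bicomod.bd (tot (cons X l)) ≅ Bicomod.comp (Bicomod.bd X) (Bicomod.bd (tot l)) :=
  Bicomod.cotIso X (tot l)

/-- Bracketing of `X₁ ⊗ … ⊗ Xₘ ⊗ Y₁ ⊗ … ⊗ Yₙ`. -/
noncomputable def split : {c e d : Comon V} → (l : Chain c e) → (m : Chain e d) →
    (Bicomod.bd (tot (append l m)) ⟶ Bicomod.comp (Bicomod.bd (tot l)) (Bicomod.bd (tot m)))
  | _, _, _, single X, m => (consIso X m).hom
  | _, _, _, cons X l, m =>
      (consIso X (append l m)).hom ≫ Bicomod.compMap (𝟙 _) (split l m) ≫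
        Bicomod.assocInv _ _ _ ≫ Bicomod.compMap (consIso X l).inv (𝟙 _)

/-- A 2-cell `p ∘ (X₁ ⊗ … ⊗ Xₙ) ⇒ Z ∘ p`. -/
abbrev Cell {c d : Comon V} (l : Chain c d) (Z : EndoComod c d) := tot l ⟶ Bicomod.comp (ev l) Z

/-- The 2-cell exhibits `T` as the left Kan extension of `p ∘ (X₁ ⊗ … ⊗ Xₙ)` along `p`, that is,
as `Tₙ(X₁, …, Xₙ)`. -/
def IsKan {c d : Comon V} {l : Chain c d} {T : EndoComod c d} (t : Cell l T) : Prop :=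
  ∀ (Z : EndoComod c d) (s : Cell l Z),
    ∃! f : T ⟶ Z, t ≫ Bicomod.compMap (𝟙 (ev l)) f = s

/-- The map `X₁ ⊗_{C₁} … ⊗ Xₙ ⟶ Z` underlying a 2-cell. It respects the outer right coactions and
determines the 2-cell. -/
noncomputable def Cell.map {c d : Comon V} {l : Chain c d} {Z : EndoComod c d} (s : Cell l Z) :
    Bicomod.bd (tot l) ⟶ Bicomod.bd Z :=
  Bicomod.underlying s (aug l)

/-- A list obtained from `X₁, …, Xₘ` by a partition into nonempty blocks and a 2-cell
`p ∘ (Xᵢ ⊗ … ⊗ Xⱼ) ⇒ T ∘ p` for each block. -/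
inductive Blocks : {c d : Comon V} → Chain c d → Chain c d → Type (max u v)
  | single {c d : Comon V} {l : Chain c d} {T : EndoComod c d} (t : Cell l T) :
      Blocks l (single T)
  | cons {c e d : Comon V} {l : Chain c e} {T : EndoComod c e} (t : Cell l T)
      {m n : Chain e d} (b : Blocks m n) : Blocks (append l m) (cons T n)

/-- All 2-cells of a partition exhibit left Kan extensions. -/
def Blocks.AllKan : {c d : Comon V} → {l m : Chain c d} → Blocks l m → Prop
  | _, _, _, _, .single t => IsKan t
  | _, _, _, _, .cons t b => IsKan t ∧ AllKan b

/-- The tensor product of the maps underlying the 2-cells of a partition. -/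
noncomputable def Blocks.map : {c d : Comon V} → {l m : Chain c d} → Blocks l m →
    (Bicomod.bd (tot l) ⟶ Bicomod.bd (tot m))
  | _, _, _, _, .single t => t.map
  | _, _, _, _, @Blocks.cons _ _ _ _ _ _ _ _ _ l T t m n b =>
      split l m ≫ Bicomod.compMap t.map (Blocks.map b) ≫ (consIso T n).inv

/-- The associativity map
`β : Tₘ(X₁₁, …, Xₙₘₙ) ⟶ Tₙ(Tₘ₁(X₁₁, …, X₁ₘ₁), …, Tₘₙ(Xₙ₁, …, Xₙₘₙ))` of a partition is the unique
map which is compatible with the universal 2-cells. -/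
def IsAssociativityMap {c d : Comon V} {l m : Chain c d} (b : Blocks l m) {T T' : EndoComod c d}
    (t : Cell l T) (t' : Cell m T') (β : T ⟶ T') : Prop :=
  t.map ≫ Bicomod.bdHom β = b.map ≫ t'.map

end Chain
end Cells

section Algebroids

variable {V : Type u} [Category.{v} V] [MonoidalCategory V] [BraidedCategory V]
  [HasCoreflexiveEqualizers V] [∀ Z : V, PreservesCoreflexiveEqualizers (tensorLeft Z)]

namespace Chain

/-- The list `X, Y`. -/
abbrev two {a b c : Comon V} (X : EndoComod a b) (Y : EndoComod b c) : Chain a c :=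
  cons X (single Y)

/-- The list `X, Y, Z`. -/
abbrev three {a b c d : Comon V} (X : EndoComod a b) (Y : EndoComod b c) (Z : EndoComod c d) :
    Chain a d :=
  cons X (cons Y (single Z))

/-- The underlying map of a 2-cell `p ∘ (X ⊗ Y) ⇒ Z ∘ p`. -/
noncomputable def Cell.map₂ {a b c : Comon V} {X : EndoComod a b} {Y : EndoComod b c}
    {Z : EndoComod a c} (s : Cell (two X Y) Z) :
    Bicomod.comp (Bicomod.bd X) (Bicomod.bd Y) ⟶ Bicomod.bd Z :=
  (consIso X (single Y)).inv ≫ s.map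

/-- The underlying map of a 2-cell `p ∘ (X ⊗ Y ⊗ W) ⇒ Z ∘ p`. -/
noncomputable def Cell.map₃ {a b c d : Comon V} {X : EndoComod a b} {Y : EndoComod b c}
    {W : EndoComod c d} {Z : EndoComod a d} (s : Cell (three X Y W) Z) :
    Bicomod.comp (Bicomod.bd X) (Bicomod.comp (Bicomod.bd Y) (Bicomod.bd W)) ⟶ Bicomod.bd Z :=
  Bicomod.compMap (𝟙 _) (consIso Y (single W)).inv ≫ (consIso X (two Y W)).inv ≫ s.map

/-- A 2-cell `n ⇒ Z ∘ n`. -/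
abbrev UnitCell {c : Comon V} (Z : EndoComod c c) := Bicomod.n c ⟶ Bicomod.comp (Bicomod.n c) Z

/-- The underlying map `C ⟶ Z` of a 2-cell `n ⇒ Z ∘ n`. -/
noncomputable def UnitCell.map {c : Comon V} {Z : EndoComod c c} (s : UnitCell Z) :
    Bicomod.regular c ⟶ Bicomod.bd Z :=
  Bicomod.toBdN c ≫ Bicomod.underlying s (ε[c.X] : c.X ⟶ 𝟙_ V)

end Chain

namespace Bicomod

variable {A B C D : Comon V}

lemma comp_hom_ext {K : Bicomod A D} {M : Bicomod A B} {N : Bicomod B D} {f g : K ⟶ comp M N}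
    (h : f ≫ compι M N = g ≫ compι M N) : f = g :=
  Hom.ext ((cancel_mono (compι M N).hom).1 (congrArg Hom.hom h))

@[simp]
lemma compMap_id (M : Bicomod A B) (N : Bicomod B D) : compMap (𝟙 M) (𝟙 N) = 𝟙 (comp M N) := by
  apply comp_hom_ext
  rw [compMap, compLift_ι, Category.id_comp]
  ext
  simp

lemma compMap_comp {M M' M'' : Bicomod A B} {N N' N'' : Bicomod B D} (f : M ⟶ M') (f' : M' ⟶ M'')
    (g : N ⟶ N') (g' : N' ⟶ N'') : compMap (f ≫ f') (g ≫ g') = compMap f g ≫ compMap f' g' := by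
  apply comp_hom_ext
  have h : compMap f g ≫ compι M' N' = compι M N ≫ outerMap f g := compLift_ι _ _
  have h' : compMap f' g' ≫ compι M'' N'' = compι M' N' ≫ outerMap f' g' := compLift_ι _ _
  rw [Category.assoc, h', ← Category.assoc, h, Category.assoc, compMap, compLift_ι]
  ext
  simp

end Bicomod

open Bicomod Chain

/-- An algebroid `(A, C)`: a monoidal endomorphism `A` on `Cᵒ ⊗ C`. Its structure consists of
2-cells `μ : p ∘ (A ⊗ A) ⇒ A ∘ p` and `η : n ⇒ A ∘ n`, and the axioms are equalities of pasted
2-cells, expressed through the underlying maps. -/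
structure Algebroid (c : Comon V) where
  A : EndoComod c c
  μ : Cell (two A A) A
  η : UnitCell A
  assoc : assocInv (bd A) (bd A) (bd A) ≫ compMap μ.map₂ (𝟙 _) ≫ μ.map₂ =
    compMap (𝟙 _) μ.map₂ ≫ μ.map₂
  one_mul : lunitInv (bd A) ≫ compMap η.map (𝟙 _) ≫ μ.map₂ = 𝟙 _
  mul_one : runitInv (bd A) ≫ compMap (𝟙 _) η.map ≫ μ.map₂ = 𝟙 _

/-- A module from an algebroid `(A, C)` to an algebroid `(A', C')`: a comodule
`M : Cᵒ ⊗ C' ⇸ Cᵒ ⊗ C'` with an action 2-cell `γ`, where `p = Cᵒ ⊗ e ⊗ e ⊗ C'`. -/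
structure AlgModule {c d : Comon V} (A : Algebroid c) (B : Algebroid d) where
  M : EndoComod c d
  γ : Cell (three A.A M B.A) M
  assoc :
    compMap (𝟙 (bd A.A)) (compMap (𝟙 (bd A.A)) (assocInv (bd M) (bd B.A) (bd B.A)) ≫
        assocInv (bd A.A) (comp (bd M) (bd B.A)) (bd B.A) ≫ compMap γ.map₃ (𝟙 (bd B.A))) ≫
      γ.map₃ =
    assocInv (bd A.A) (bd A.A) (comp (bd M) (comp (bd B.A) (bd B.A))) ≫
      compMap A.μ.map₂ (compMap (𝟙 (bd M)) B.μ.map₂) ≫ γ.map₃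
  unit : lunitInv (bd M) ≫ compMap A.η.map (runitInv (bd M) ≫ compMap (𝟙 _) B.η.map) ≫
    γ.map₃ = 𝟙 _

namespace AlgModule

variable {c d : Comon V} {A : Algebroid c} {B : Algebroid d}

/-- A map of modules: a comodule map which respects the actions. -/
@[ext]
structure Hom (M N : AlgModule A B) where
  hom : M.M ⟶ N.M
  comm : compMap (𝟙 (bd A.A)) (compMap (bdHom hom) (𝟙 (bd B.A))) ≫ N.γ.map₃ =
    M.γ.map₃ ≫ bdHom hom

instance : Category (AlgModule A B) where
  Hom := Hom
  id M := ⟨𝟙 M.M, by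
    have h : bdHom (𝟙 M.M) = 𝟙 (bd M.M) := rfl
    simp [h]⟩
  comp f g := ⟨f.hom ≫ g.hom, by
    have h : bdHom (f.hom ≫ g.hom) = bdHom f.hom ≫ bdHom g.hom := rfl
    have h2 := compMap_comp (bdHom f.hom) (bdHom g.hom) (𝟙 (bd B.A)) (𝟙 (bd B.A))
    have h3 := compMap_comp (𝟙 (bd A.A)) (𝟙 (bd A.A))
      (compMap (bdHom f.hom) (𝟙 (bd B.A))) (compMap (bdHom g.hom) (𝟙 (bd B.A)))
    rw [Category.id_comp] at h2 h3
    rw [h, h2, h3, Category.assoc, g.comm, ← Category.assoc, f.comm, Category.assoc]⟩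
  id_comp f := Hom.ext (Category.id_comp _)
  comp_id f := Hom.ext (Category.comp_id _)
  assoc f g h := Hom.ext (Category.assoc _ _ _)

/-- The left action `A ⊗_C M ⟶ M`, obtained from the action and the unit of `B`. -/
noncomputable def actL (M : AlgModule A B) : comp (bd A.A) (bd M.M) ⟶ bd M.M :=
  compMap (𝟙 _) (runitInv (bd M.M) ≫ compMap (𝟙 _) B.η.map) ≫ M.γ.map₃

/-- The right action `M ⊗_D B ⟶ M`, obtained from the action and the unit of `A`. -/
noncomputable def actR (M : AlgModule A B) : comp (bd M.M) (bd B.A) ⟶ bd M.M :=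
  lunitInv (comp (bd M.M) (bd B.A)) ≫ compMap A.η.map (𝟙 _) ≫ M.γ.map₃

end AlgModule

end Algebroids

section Bullet

variable {V : Type u} [Category.{v} V] [MonoidalCategory V] [BraidedCategory V]
  [HasCoreflexiveEqualizers V] [∀ Z : V, PreservesCoreflexiveEqualizers (tensorLeft Z)]

open Bicomod Chain

/-- The functor `X ⊗_D - : Comod V (D, I) ⥤ V`. -/
@[simps]
noncomputable def cotensorLeft {c d : Comon V} (X : Bicomod c d) :
    Bicomod d (unitComon (V := V)) ⥤ V where
  obj N := (comp X N).X
  map f := (compMap (𝟙 X) f).hom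
  map_id N := by rw [compMap_id]; rfl
  map_comp f g := by
    have h := compMap_comp (𝟙 X) (𝟙 X) f g
    rw [Category.id_comp] at h
    rw [h]; rfl

/-- The functor `- ⊗_C X : Comod V (I, C) ⥤ V`. -/
@[simps]
noncomputable def cotensorRight {c d : Comon V} (X : Bicomod c d) :
    Bicomod (unitComon (V := V)) c ⥤ V where
  obj N := (comp N X).X
  map f := (compMap f (𝟙 X)).hom
  map_id N := by rw [compMap_id]; rfl
  map_comp f g := by
    have h := compMap_comp f g (𝟙 X) (𝟙 X)
    rw [Category.id_comp] at h
    rw [h]; rfl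

/-- `X ⊗_E Y` as a comodule `Cᵒ ⊗ D ⇸ Cᵒ ⊗ D`, with the left `Cᵒ`-coaction of `X` and the left
`D`-coaction of `Y`. -/
noncomputable def cotensor {c e d : Comon V} (X : EndoComod c e) (Y : EndoComod e d) :
    EndoComod c d :=
  (cot X Y).mapL (tensorComonHom (projL (opComon c) e) (projR (opComon e) d))

/-- The conditions on a class `𝒳` of comodules of the form `Cᵒ ⊗ C' ⇸ Cᵒ ⊗ C'`. -/
structure IsAdmissible (𝒳 : ∀ c d : Comon V, EndoComod c d → Prop) : Prop where
  /-- The left Kan extensions `Tₙ(X₁, …, Xₙ)` exist. -/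
  exists_kan : ∀ {c d : Comon V} (l : Chain c d), l.All 𝒳 →
    ∃ (T : EndoComod c d) (t : Cell l T), IsKan t
  /-- The associativity maps of partitions with positive parts are invertible. -/
  isIso_assoc : ∀ {c d : Comon V} {l m : Chain c d} (b : Blocks l m), l.All 𝒳 → b.AllKan →
    ∀ {T T' : EndoComod c d} (t : Cell l T) (t' : Cell m T'), IsKan t → IsKan t' →
      ∀ β : T ⟶ T', IsAssociativityMap b t t' β → IsIso β
  preserves_left : ∀ {c d : Comon V} (X : EndoComod c d), 𝒳 c d X →
    PreservesReflexiveCoequalizers (cotensorLeft (bd X))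
  preserves_right : ∀ {c d : Comon V} (X : EndoComod c d), 𝒳 c d X →
    PreservesReflexiveCoequalizers (cotensorRight (bd X))
  cotensor_mem : ∀ {c e d : Comon V} (X : EndoComod c e) (Y : EndoComod e d), 𝒳 c e X →
    𝒳 e d Y → 𝒳 c d (cotensor X Y)
  of_epi : ∀ {c d : Comon V} {X Y : EndoComod c d} (f : X ⟶ Y) [Epi f], 𝒳 c d X → 𝒳 c d Y

section

variable {c₁ c₂ c₃ : Comon V} {A₁ : Algebroid c₁} {A₂ : Algebroid c₂} {A₃ : Algebroid c₃}

/-- The parallel pair `T₃(M, A₂, N) ⇉ T₂(M, N)`, given by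
`T₂(M, α_l) β₁₊₂` and `T₂(α_r, N) β₂₊₁`. -/
structure BulletDiagram (M : AlgModule A₁ A₂) (N : AlgModule A₂ A₃) where
  T₂ : EndoComod c₁ c₃
  t₂ : Cell (two M.M N.M) T₂
  isKan₂ : IsKan t₂
  T₃ : EndoComod c₁ c₃
  t₃ : Cell (three M.M A₂.A N.M) T₃
  isKan₃ : IsKan t₃
  f : T₃ ⟶ T₂
  g : T₃ ⟶ T₂
  hf : t₃.map₃ ≫ bdHom f = compMap (𝟙 (bd M.M)) N.actL ≫ t₂.map₂
  hg : t₃.map₃ ≫ bdHom g =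
    assocInv (bd M.M) (bd A₂.A) (bd N.M) ≫ compMap M.actR (𝟙 (bd N.M)) ≫ t₂.map₂

/-- The map `q : M ⊗ N ⟶ K` exhibits the module `K` as `M • N`: it is the composite of the
universal map `M ⊗ N ⟶ T₂(M, N)` with a coequalizer `T₂(M, N) ⟶ K` of
`T₃(M, A₂, N) ⇉ T₂(M, N)`, and the action on `K` is induced by the left action on `M` and the
right action on `N`. -/
structure IsBullet (M : AlgModule A₁ A₂) (N : AlgModule A₂ A₃) (K : AlgModule A₁ A₃)
    (q : comp (bd M.M) (bd N.M) ⟶ bd K.M) : Prop where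
  isCoequalizer : ∃ (D : BulletDiagram M N) (π : D.T₂ ⟶ K.M) (w : D.f ≫ π = D.g ≫ π),
    Nonempty (IsColimit (Cofork.ofπ π w)) ∧ q = D.t₂.map₂ ≫ bdHom π
  action : compMap (𝟙 (bd A₁.A)) (assocInv (bd M.M) (bd N.M) (bd A₃.A) ≫
      compMap q (𝟙 (bd A₃.A))) ≫ K.γ.map₃ =
    assocInv (bd A₁.A) (bd M.M) (comp (bd N.M) (bd A₃.A)) ≫ compMap M.actL N.actR ≫ q

/-- The module `K` is the algebroid `A`, acting on itself by multiplication. -/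
def IsUnitModule {c : Comon V} (A : Algebroid c) (K : AlgModule A A) (h : A.A = K.M) : Prop :=
  compMap (𝟙 (bd A.A)) (compMap (bdHom (eqToHom h)) (𝟙 (bd A.A))) ≫ K.γ.map₃ =
    compMap (𝟙 (bd A.A)) A.μ.map₂ ≫ A.μ.map₂ ≫ bdHom (eqToHom h)

end

/-- The algebroids whose underlying comodule belongs to the class `𝒳`. -/
structure AlgebroidIn (𝒳 : ∀ c d : Comon V, EndoComod c d → Prop) where
  base : Comon V
  alg : Algebroid base
  mem : 𝒳 base base alg.A

/-- The bicategory structure on the algebroids in `𝒳` is the one given by modules with underlying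
comodule in `𝒳`, module maps and the composition `•`. The functors `U` identify the
hom-categories, and `q` is the universal map `M ⊗ N ⟶ M • N`. -/
structure IsBulletBicategory (𝒳 : ∀ c d : Comon V, EndoComod c d → Prop)
    [Bicategory.{v, max u v} (AlgebroidIn 𝒳)]
    (U : ∀ a b : AlgebroidIn 𝒳, (a ⟶ b) ⥤ AlgModule a.alg b.alg)
    (q : ∀ {a b c : AlgebroidIn 𝒳} (M : a ⟶ b) (N : b ⟶ c),
      comp (bd ((U a b).obj M).M) (bd ((U b c).obj N).M) ⟶ bd ((U a c).obj (M ≫ N)).M) :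
    Prop where
  full : ∀ a b, (U a b).Full
  faithful : ∀ a b, (U a b).Faithful
  injective : ∀ a b, Function.Injective (U a b).obj
  range : ∀ a b, Set.range (U a b).obj = {M | 𝒳 a.base b.base M.M}
  isBullet : ∀ {a b c : AlgebroidIn 𝒳} (M : a ⟶ b) (N : b ⟶ c),
    IsBullet ((U a b).obj M) ((U b c).obj N) ((U a c).obj (M ≫ N)) (q M N)
  whiskerLeft : ∀ {a b c : AlgebroidIn 𝒳} (M : a ⟶ b) {N N' : b ⟶ c} (f : N ⟶ N'),
    q M N ≫ bdHom ((U a c).map (Bicategory.whiskerLeft M f)).hom =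
      compMap (𝟙 _) (bdHom ((U b c).map f).hom) ≫ q M N'
  whiskerRight : ∀ {a b c : AlgebroidIn 𝒳} {M M' : a ⟶ b} (f : M ⟶ M') (N : b ⟶ c),
    q M N ≫ bdHom ((U a c).map (Bicategory.whiskerRight f N)).hom =
      compMap (bdHom ((U a b).map f).hom) (𝟙 _) ≫ q M' N
  associator : ∀ {a b c d : AlgebroidIn 𝒳} (M : a ⟶ b) (N : b ⟶ c) (K : c ⟶ d),
    assocInv _ _ _ ≫ compMap (q M N) (𝟙 _) ≫ q (M ≫ N) K ≫
        bdHom ((U a d).map (Bicategory.associator M N K).hom).hom =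
      compMap (𝟙 _) (q N K) ≫ q M (N ≫ K)
  unit : ∀ a : AlgebroidIn 𝒳, ∃ h : a.alg.A = ((U a a).obj (𝟙 a)).M,
    IsUnitModule a.alg ((U a a).obj (𝟙 a)) h ∧
    (∀ {b : AlgebroidIn 𝒳} (M : a ⟶ b), compMap (bdHom (eqToHom h)) (𝟙 _) ≫ q (𝟙 a) M ≫
      bdHom ((U a b).map (Bicategory.leftUnitor M).hom).hom = ((U a b).obj M).actL) ∧
    ∀ {b : AlgebroidIn 𝒳} (M : b ⟶ a), compMap (𝟙 _) (bdHom (eqToHom h)) ≫ q M (𝟙 a) ≫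
      bdHom ((U b a).map (Bicategory.rightUnitor M).hom).hom = ((U b a).obj M).actR

end Bullet

end QuantumModules

/-! The 2-cells in the statement are multimaps in disguise. The comodule `e` is the image of the
idempotent x ⊗ y ↦ x₁ ⊗ x₂ ε(y) on C ⊗ Cᵒ. Contracting with counits therefore turns a 2-cell p ∘ (X₁
⊗ … ⊗ Xₙ) ⇒ Z ∘ p into a map X₁ ⊗_{C₁} … ⊗ Xₙ ⟶ Z of comodules from C₀ to Cₙ subject to two
conditions: it respects the outer left coactions, of C₀ᵒ on X₁ and of Cₙ on Xₙ, and for 0 < i < n it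
does not distinguish the left Cᵢ-coaction of Xᵢ from the left Cᵢᵒ-coaction of Xᵢ₊₁. Nothing is lost
in this passage (`isCell_iff`, `exists_cell`, `Cell.map_injective`). The inner pairs of coactions
are called walls, and maps compatible with coactions and walls are called cells. The left Kan
extension Tₙ is then a representing object for multimaps (`IsKan.isUniversal`).

What remains is the theory of bimodules over monoids for multimaps that are only partly
representable. It is carried out inside the bicategory of comodules, where a left coaction of E on M
is recorded as a 2-cell M ⟶ E ⊗ M; the operation E ⊗ - is axiomatized as `CentralAction`. The
conditions on 𝒳 enter as follows.

Conditions (4) and (5) put Tₙ(X₁, …, Xₙ) in 𝒳: the iterated cotensor product lies in 𝒳, and its map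
to Tₙ is an epimorphism of comodules, because multimaps out of Tₙ are determined on it
(`IsKan.mem`).

Condition (2) makes a tensor product of universal multimaps universal. The block map followed by the
universal map t' is the universal map t followed by β; with β invertible, factorization and
uniqueness transfer from t and t' to the block map (`Blocks.isUniversal`). Since T₁(X) = X, a
universal multimap stays universal when further variables from 𝒳 are adjoined.

Condition (3) does the same for the coequalizer which defines M • N. The parallel pair is reflexive,
a section being given by the unit of A₂. Its coequalizer of comodules is also one of underlying
objects, because cofree comodules exist. Hence it survives cotensoring with members of 𝒳. Together
with the previous point, M ⊗ N ⟶ M • N is a coequalizer with respect to multimaps, also in the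
presence of one more variable, and is epimorphic in the presence of two (`IsBulletMap.isTensor`).

These stability properties are all that the classical arguments for bimodules use: actions,
associators and unitors are induced on coequalizers, and every axiom is tested on the universal maps
(`IsTensor.mod`, `IsProd.assoc`, `ModuleFamily.bicategory`). Finally, a two-sided action γ amounts
to a commuting pair of a left and a right action, which identifies the modules of the statement with
those of the abstract theory (`TwoSided.algModule`, `AlgModule.twoSided`). -/

namespace QuantumModules

/-! ### Invertibility of the associativity and unit maps of comodules -/

section ComoduleBicategory

variable {V : Type u} [Category.{v} V] [MonoidalCategory V]

namespace Bicomod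

variable {A B C D E : Comon V}

/-- A map of comodules which is invertible in the base category is invertible. -/
@[simps] def isoMk {M N : Bicomod A B} (f : M ⟶ N) (g : N.X ⟶ M.X) (h₁ : f.hom ≫ g = 𝟙 _)
    (h₂ : g ≫ f.hom = 𝟙 _) : M ≅ N where
  hom := f
  inv :=
    { hom := g
      left := by
        have : A.X ◁ f.hom ≫ A.X ◁ g = 𝟙 _ := by
          rw [← MonoidalCategory.whiskerLeft_comp, h₁, MonoidalCategory.whiskerLeft_id]
        rw [← Category.id_comp (N.lact ≫ _), ← h₂, Category.assoc, ← reassoc_of% f.left, this,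
          Category.comp_id]
      right := by
        have : f.hom ▷ B.X ≫ g ▷ B.X = 𝟙 _ := by
          rw [← comp_whiskerRight, h₁, id_whiskerRight]
        rw [← Category.id_comp (N.ract ≫ _), ← h₂, Category.assoc, ← reassoc_of% f.right, this,
          Category.comp_id] }
  hom_inv_id := Hom.ext h₁
  inv_hom_id := Hom.ext h₂

variable [BraidedCategory V]
  [HasCoreflexiveEqualizers V] [∀ Z : V, PreservesCoreflexiveEqualizers (tensorLeft Z)]

lemma compMap_hom_ι {M M' : Bicomod A B} {N N' : Bicomod B D} (f : M ⟶ M') (g : N ⟶ N') :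
    (compMap f g).hom ≫ (compι M' N').hom = (compι M N).hom ≫ (f.hom ⊗ₘ g.hom) :=
  congrArg Hom.hom (compLift_ι (compι M N ≫ outerMap f g) _)

lemma lunitInv_hom_ι (N : Bicomod C D) : (lunitInv N).hom ≫ (compι _ N).hom = N.lact :=
  congrArg Hom.hom (compLift_ι _ _)

lemma runitInv_hom_ι (N : Bicomod C D) : (runitInv N).hom ≫ (compι N _).hom = N.ract :=
  congrArg Hom.hom (compLift_ι _ _)

lemma assocInv_hom_ι (M : Bicomod A B) (N : Bicomod B C) (K : Bicomod C D) :
    (assocInv M N K).hom ≫ (compι (comp M N) K).hom ≫ (compι M N).hom ▷ K.X =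
      (compι M (comp N K)).hom ≫ M.X ◁ (compι N K).hom ≫ (α_ M.X N.X K.X).inv := by
  have h : (assocInv M N K).hom ≫ (compι (comp M N) K).hom = (exists_assoc M N K).choose := by
    rw [← comp_hom, assocInv, compLift_ι]
  rw [reassoc_of% h, (exists_assoc M N K).choose_spec]

/-- The object N ⊗_C K is a coreflexive equalizer, and M ⊗ - preserves it. The equalizer condition
of (M ⊗_B N) ⊗_C K is exactly what is needed to factor through M ⊗ (N ⊗_C K). -/
lemma exists_assoc_symm (M : Bicomod A B) (N : Bicomod B C) (K : Bicomod C D) :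
    ∃ s : (comp (comp M N) K).X ⟶ M.X ⊗ (comp N K).X, s ≫ M.X ◁ (compι N K).hom =
      (compι (comp M N) K).hom ≫ (compι M N).hom ▷ K.X ≫ (α_ M.X N.X K.X).hom :=
  exists_whiskerLeft_lift _ _ _ _ (by
    have h := congrArg (· ▷ K.X) (compι M N).right
    have h' := h =≫ (α_ M.X N.X C.X).hom ▷ K.X
    simp only [comp_whiskerRight, Category.assoc, inv_hom_whiskerRight, Category.comp_id] at h'
    simp only [Category.assoc, MonoidalCategory.whiskerLeft_comp]
    rw [← associator_naturality_middle, ← reassoc_of% h', reassoc_of% comp_condition,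
      ← associator_naturality_right_assoc, ← whisker_exchange_assoc,
      ← associator_inv_naturality_left_assoc]
    simp)

/-- The map of `exists_assoc_symm` is balanced over B because M ⊗_B N is; this may be tested in M ⊗
B ⊗ N ⊗ K, since the inclusion of N ⊗_C K stays monic. -/
lemma exists_assocHom (M : Bicomod A B) (N : Bicomod B C) (K : Bicomod C D) :
    ∃ s : (comp (comp M N) K).X ⟶ (comp M (comp N K)).X,
      s ≫ (compι M (comp N K)).hom ≫ M.X ◁ (compι N K).hom =
      (compι (comp M N) K).hom ≫ (compι M N).hom ▷ K.X ≫ (α_ M.X N.X K.X).hom := by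
  obtain ⟨s, hs⟩ := exists_assoc_symm M N K
  obtain ⟨t, ht⟩ := exists_compLift M (comp N K) s (by
    have h := congrArg (M.X ◁ ·) (compι N K).left
    have h2 := congrArg (· ▷ K.X) (comp_condition M N)
    simp only [comp_whiskerRight, MonoidalCategory.whiskerLeft_comp] at h h2
    rw [← cancel_mono ((M.X ⊗ B.X) ◁ (compι N K).hom)]
    simp only [Category.assoc]
    rw [← whisker_exchange, reassoc_of% hs, ← associator_inv_naturality_right, reassoc_of% h,
      reassoc_of% hs, ← associator_naturality_left, reassoc_of% h2]
    simp)
  exact ⟨t, by rw [reassoc_of% ht, hs]⟩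

/-- Associativity of the composition of comodules. -/
noncomputable def assocIso (M : Bicomod A B) (N : Bicomod B C) (K : Bicomod C D) :
    comp (comp M N) K ≅ comp M (comp N K) :=
  (isoMk (assocInv M N K) (exists_assocHom M N K).choose
    (by
      have h := (exists_assocHom M N K).choose_spec
      rw [← cancel_mono (compι M (comp N K)).hom, ← cancel_mono (M.X ◁ (compι N K).hom)]
      simp only [Category.assoc]
      rw [h, reassoc_of% assocInv_hom_ι]
      simp)
    (by
      have h := (exists_assocHom M N K).choose_spec
      rw [← cancel_mono (compι (comp M N) K).hom, ← cancel_mono ((compι M N).hom ▷ K.X)]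
      simp only [Category.assoc]
      rw [assocInv_hom_ι, reassoc_of% h]
      simp)).symm

@[simp] lemma assocIso_inv (M : Bicomod A B) (N : Bicomod B C) (K : Bicomod C D) :
    (assocIso M N K).inv = assocInv M N K := rfl

lemma assocIso_hom_ι (M : Bicomod A B) (N : Bicomod B C) (K : Bicomod C D) :
    (assocIso M N K).hom.hom ≫ (compι M (comp N K)).hom ≫ M.X ◁ (compι N K).hom =
      (compι (comp M N) K).hom ≫ (compι M N).hom ▷ K.X ≫ (α_ M.X N.X K.X).hom :=
  (exists_assocHom M N K).choose_spec

/-- The left unit law for the composition of comodules. -/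
noncomputable def lunitIso (N : Bicomod C D) : comp (regular C) N ≅ N :=
  (isoMk (lunitInv N) ((compι (regular C) N).hom ≫ ε[C.X] ▷ N.X ≫ (λ_ N.X).hom)
    (by rw [reassoc_of% lunitInv_hom_ι, reassoc_of% N.lact_counit]; simp)
    (by
      rw [← cancel_mono (compι (regular C) N).hom]
      simp only [Category.assoc]
      have h := comp_condition (regular C) N
      -- Applying the counit to the first copy of C in the equalizer condition expresses the
      -- inclusion as its own contraction followed by the coaction of N, which is the required
      -- identity.
      have h' := h =≫ ((ε[C.X] ▷ C.X ≫ (λ_ C.X).hom) ▷ N.X)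
      have e : Δ[C.X] ≫ ε[C.X] ▷ C.X ≫ (λ_ C.X).hom = 𝟙 _ := by simp
      simp only [Category.assoc] at h'
      change _ ≫ Δ[C.X] ▷ N.X ≫ _ = _ at h'
      rw [← comp_whiskerRight Δ[C.X], e] at h'
      rw [lunitInv_hom_ι, Category.id_comp]
      refine Eq.trans ?_ (h'.symm.trans (by simp))
      have e2 := whisker_exchange ε[C.X] N.lact
      change _ ≫ _ = _ ≫ C.X ◁ N.lact ≫ _
      rw [← leftUnitor_naturality, ← reassoc_of% e2]
      simp)).symm

@[simp] lemma lunitIso_inv (N : Bicomod C D) : (lunitIso N).inv = lunitInv N := rfl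

lemma lunitIso_hom_hom (N : Bicomod C D) :
    (lunitIso N).hom.hom = (compι (regular C) N).hom ≫ ε[C.X] ▷ N.X ≫ (λ_ N.X).hom := rfl

/-- The right unit law for the composition of comodules. -/
noncomputable def runitIso (N : Bicomod C D) : comp N (regular D) ≅ N :=
  (isoMk (runitInv N) ((compι N (regular D)).hom ≫ N.X ◁ ε[D.X] ≫ (ρ_ N.X).hom)
    (by rw [reassoc_of% runitInv_hom_ι, reassoc_of% N.ract_counit]; simp)
    (by
      rw [← cancel_mono (compι N (regular D)).hom]
      simp only [Category.assoc]
      have h := comp_condition N (regular D)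
      have h' := h =≫ ((N.X ⊗ D.X) ◁ ε[D.X])
      have e : Δ[D.X] ≫ D.X ◁ ε[D.X] ≫ (ρ_ D.X).hom = 𝟙 _ := by simp
      simp only [Category.assoc] at h'
      rw [← whisker_exchange] at h'
      rw [runitInv_hom_ι, Category.id_comp, ← rightUnitor_naturality, reassoc_of% h']
      have e' := congrArg (N.X ◁ ·) e
      simp only [MonoidalCategory.whiskerLeft_comp, MonoidalCategory.whiskerLeft_id] at e'
      rw [← Category.comp_id (compι N (regular D)).hom]
      simp only [Category.assoc, Category.id_comp]
      congr 1
      refine Eq.trans ?_ e'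
      monoidal)).symm

@[simp] lemma runitIso_inv (N : Bicomod C D) : (runitIso N).inv = runitInv N := rfl

lemma runitIso_hom_hom (N : Bicomod C D) :
    (runitIso N).hom.hom = (compι N (regular D)).hom ≫ N.X ◁ ε[D.X] ≫ (ρ_ N.X).hom := rfl

/-- The iterated equalizer embeds in M ⊗ N ⊗ L because M ⊗ - keeps the inner inclusion monic. This
reduces the coherence laws to those of the base category. -/
lemma comp_hom_ext₃ {K : Bicomod A D} {M : Bicomod A B} {N : Bicomod B C} {L : Bicomod C D}
    {f g : K ⟶ comp M (comp N L)}
    (h : f.hom ≫ (compι M (comp N L)).hom ≫ M.X ◁ (compι N L).hom =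
      g.hom ≫ (compι M (comp N L)).hom ≫ M.X ◁ (compι N L).hom) : f = g := by
  ext
  rw [← cancel_mono (compι M (comp N L)).hom, ← cancel_mono (M.X ◁ (compι N L).hom)]
  simpa using h

end Bicomod
end ComoduleBicategory

/-! ### Naturality, coherence and the bicategory of comodules -/

section ComoduleBicategory

variable {V : Type u} [Category.{v} V] [MonoidalCategory V] [BraidedCategory V]
  [HasCoreflexiveEqualizers V] [∀ Z : V, PreservesCoreflexiveEqualizers (tensorLeft Z)]

open Bicomod

variable (V) in
/-- The bicategory `Comod V`: its objects are the comonoids, its 1-cells the comodules. -/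
structure ComodBicat where
  base : Comon V

namespace Bicomod
variable {A B C D E : Comon V}

lemma whiskerL_hom_ι (M : Bicomod A B) {N N' : Bicomod B D} (g : N ⟶ N') :
    (compMap (𝟙 M) g).hom ≫ (compι M N').hom = (compι M N).hom ≫ M.X ◁ g.hom := by
  rw [compMap_hom_ι]; simp

lemma whiskerR_hom_ι {M M' : Bicomod A B} (f : M ⟶ M') (N : Bicomod B D) :
    (compMap f (𝟙 N)).hom ≫ (compι M' N).hom = (compι M N).hom ≫ f.hom ▷ N.X := by
  rw [compMap_hom_ι]; simp

lemma comp_hom_ext' {K : Bicomod A D} {M : Bicomod A B} {N : Bicomod B D} {f g : K ⟶ comp M N}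
    (h : f.hom ≫ (compι M N).hom = g.hom ≫ (compι M N).hom) : f = g :=
  Hom.ext ((cancel_mono (compι M N).hom).1 h)

lemma compMap_id_assoc (M : Bicomod A B) (N : Bicomod B C) {K K' : Bicomod C D} (f : K ⟶ K') :
    compMap (𝟙 (comp M N)) f ≫ (assocIso M N K').hom =
      (assocIso M N K).hom ≫ compMap (𝟙 M) (compMap (𝟙 N) f) := by
  apply comp_hom_ext₃
  have h := congrArg (M.X ◁ ·) (whiskerL_hom_ι N f)
  simp only [MonoidalCategory.whiskerLeft_comp] at h
  simp only [comp_hom, Category.assoc]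
  rw [assocIso_hom_ι, reassoc_of% whiskerL_hom_ι, reassoc_of% whiskerL_hom_ι, h,
    reassoc_of% assocIso_hom_ι, whisker_exchange_assoc]
  simp

lemma compMap_assoc_id {M M' : Bicomod A B} (f : M ⟶ M') (N : Bicomod B C) (K : Bicomod C D) :
    compMap (compMap f (𝟙 N)) (𝟙 K) ≫ (assocIso M' N K).hom =
      (assocIso M N K).hom ≫ compMap f (𝟙 (comp N K)) := by
  apply comp_hom_ext₃
  have h := congrArg (· ▷ K.X) (whiskerR_hom_ι f N)
  simp only [comp_whiskerRight] at h
  simp only [comp_hom, Category.assoc]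
  rw [assocIso_hom_ι, reassoc_of% whiskerR_hom_ι, reassoc_of% whiskerR_hom_ι, reassoc_of% h,
    ← whisker_exchange, reassoc_of% assocIso_hom_ι]
  simp

lemma compMap_assoc_mid (M : Bicomod A B) {N N' : Bicomod B C} (f : N ⟶ N') (K : Bicomod C D) :
    compMap (compMap (𝟙 M) f) (𝟙 K) ≫ (assocIso M N' K).hom =
      (assocIso M N K).hom ≫ compMap (𝟙 M) (compMap f (𝟙 K)) := by
  apply comp_hom_ext₃
  have h := congrArg (· ▷ K.X) (whiskerL_hom_ι M f)
  have h2 := congrArg (M.X ◁ ·) (whiskerR_hom_ι f K)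
  simp only [comp_whiskerRight, MonoidalCategory.whiskerLeft_comp] at h h2
  simp only [comp_hom, Category.assoc]
  rw [assocIso_hom_ι, reassoc_of% whiskerL_hom_ι, reassoc_of% whiskerR_hom_ι, h2, reassoc_of% h,
    reassoc_of% assocIso_hom_ι]
  simp

lemma comp_pentagon (M : Bicomod A B) (N : Bicomod B C) (K : Bicomod C D) (L : Bicomod D E) :
    compMap (assocIso M N K).hom (𝟙 L) ≫ (assocIso M (comp N K) L).hom ≫
        compMap (𝟙 M) (assocIso N K L).hom =
      (assocIso (comp M N) K L).hom ≫ (assocIso M N (comp K L)).hom := by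
  apply comp_hom_ext₃
  have : Mono (M.X ◁ N.X ◁ (compι K L).hom) :=
    mono_whiskerLeft_whiskerLeft_ι (compL K L) (compR K L) N.X M.X
  rw [← cancel_mono (M.X ◁ N.X ◁ (compι K L).hom)]
  have h := congrArg (M.X ◁ ·) (assocIso_hom_ι N K L)
  have h2 := congrArg (· ▷ L.X) (assocIso_hom_ι M N K)
  simp only [comp_whiskerRight, MonoidalCategory.whiskerLeft_comp] at h h2
  simp only [comp_hom, Category.assoc]
  rw [reassoc_of% whiskerL_hom_ι, h, reassoc_of% assocIso_hom_ι, reassoc_of% whiskerR_hom_ι,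
    reassoc_of% assocIso_hom_ι, ← associator_naturality_middle_assoc, reassoc_of% h2,
    ← associator_naturality_right, ← whisker_exchange_assoc, reassoc_of% assocIso_hom_ι]
  simp

/-- Precomposing with the inverse unit map, which is the coaction of M, makes the right-hand side an
identity and turns the left-hand side into the counit law of M. -/
lemma comp_triangle (M : Bicomod A B) (N : Bicomod B C) :
    (assocIso M (regular B) N).hom ≫ compMap (𝟙 M) (lunitIso N).hom =
      compMap (runitIso M).hom (𝟙 N) := by
  have : IsIso (compMap (runitIso M).inv (𝟙 N)) := ⟨compMap (runitIso M).hom (𝟙 N),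
    by rw [← compMap_comp, Iso.inv_hom_id, Category.id_comp, compMap_id],
    by rw [← compMap_comp, Iso.hom_inv_id, Category.id_comp, compMap_id]⟩
  rw [← cancel_epi (compMap (runitIso M).inv (𝟙 N)), ← compMap_comp, Iso.inv_hom_id]
  apply comp_hom_ext'
  have h := congrArg (· ▷ N.X) (runitInv_hom_ι M)
  simp only [comp_whiskerRight] at h
  simp only [comp_hom, Category.assoc, whiskerL_hom_ι, lunitIso_hom_hom,
    MonoidalCategory.whiskerLeft_comp]
  rw [reassoc_of% assocIso_hom_ι, reassoc_of% whiskerR_hom_ι, runitIso_inv, reassoc_of% h]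
  have h3 := congrArg (· ▷ N.X) M.ract_counit
  simp only [comp_whiskerRight] at h3
  rw [← associator_naturality_middle_assoc, reassoc_of% h3]
  simp

lemma lunit_naturality {M N : Bicomod A B} (f : M ⟶ N) :
    compMap (𝟙 (regular A)) f ≫ (lunitIso N).hom = (lunitIso M).hom ≫ f := by
  ext
  simp only [comp_hom, lunitIso_hom_hom, Category.assoc]
  rw [reassoc_of% whiskerL_hom_ι]
  have h := whisker_exchange ε[A.X] f.hom
  change _ ≫ A.X ◁ _ ≫ _ = _
  rw [reassoc_of% h]
  simp

lemma runit_naturality {M N : Bicomod A B} (f : M ⟶ N) :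
    compMap f (𝟙 (regular B)) ≫ (runitIso N).hom = (runitIso M).hom ≫ f := by
  ext
  simp only [comp_hom, runitIso_hom_hom, Category.assoc]
  rw [reassoc_of% whiskerR_hom_ι]
  have h := whisker_exchange f.hom ε[B.X]
  change _ ≫ _ ▷ B.X ≫ _ = _
  rw [← reassoc_of% h]
  simp

end Bicomod

/-- The inverse structure cells are by definition `assocInv`, `lunitInv` and `runitInv`, so the
axioms of algebroids and modules can be read in this bicategory as they stand. -/
noncomputable instance : Bicategory.{v, max u v} (ComodBicat V) where
  Hom C D := Bicomod C.base D.base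
  id C := regular C.base
  comp M N := comp M N
  homCategory C D := inferInstanceAs (Category (Bicomod C.base D.base))
  whiskerLeft M _ _ g := compMap (𝟙 M) g
  whiskerRight f N := compMap f (𝟙 N)
  associator M N K := assocIso M N K
  leftUnitor M := lunitIso M
  rightUnitor M := runitIso M
  whiskerLeft_id M N := compMap_id M N
  whiskerLeft_comp M _ _ _ f g := by
    have h := compMap_comp (𝟙 M) (𝟙 M) f g
    rwa [Category.id_comp] at h
  id_whiskerLeft f := by
    rw [← Category.assoc, Iso.eq_comp_inv]; exact lunit_naturality f
  comp_whiskerLeft M N _ _ f := by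
    rw [← Category.assoc, Iso.eq_comp_inv]; exact compMap_id_assoc M N f
  id_whiskerRight M N := compMap_id M N
  comp_whiskerRight f g K := by
    have h := compMap_comp f g (𝟙 K) (𝟙 K)
    rwa [Category.id_comp] at h
  whiskerRight_id f := by
    rw [← Category.assoc, Iso.eq_comp_inv]; exact runit_naturality f
  whiskerRight_comp f N K := by
    rw [Iso.eq_inv_comp]; exact (compMap_assoc_id f N K).symm
  whisker_assoc M _ _ f K := by
    rw [← Category.assoc, Iso.eq_comp_inv]; exact compMap_assoc_mid M f K
  whisker_exchange f g := by
    have h := compMap_comp (𝟙 _) f g (𝟙 _)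
    have h2 := compMap_comp f (𝟙 _) (𝟙 _) g
    rw [Category.id_comp, Category.comp_id] at h h2
    exact h.symm.trans h2
  pentagon M N K L := comp_pentagon M N K L
  triangle M N := comp_triangle M N

end ComoduleBicategory

/-! ### Coactions and walls on the 1-cells of a bicategory -/

section Walled

universe w₁ v₁ u₁

local infixr:81 " ◃ " => Bicategory.whiskerLeft
local infixl:81 " ▹ " => Bicategory.whiskerRight
local notation "𝖺" => Bicategory.associator
local notation "𝗅" => Bicategory.leftUnitor
local notation "𝗋" => Bicategory.rightUnitor

/-- An action of the objects of a bicategory on its hom-categories which commutes with the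
composition of 1-cells. For comodules, `act e M` is `e ⊗ M`. -/
class CentralAction (B : Type u₁) [Bicategory.{w₁, v₁} B] where
  act : B → ∀ {a b : B}, (a ⟶ b) → (a ⟶ b)
  map (e : B) {a b : B} {f g : a ⟶ b} (η : f ⟶ g) : act e f ⟶ act e g
  map_id (e : B) {a b : B} (f : a ⟶ b) : map e (𝟙 f) = 𝟙 (act e f)
  map_comp (e : B) {a b : B} {f g h : a ⟶ b} (η : f ⟶ g) (θ : g ⟶ h) :
    map e (η ≫ θ) = map e η ≫ map e θ
  strL (e : B) {a b c : B} (L : a ⟶ b) (Z : b ⟶ c) : L ≫ act e Z ⟶ act e (L ≫ Z)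
  strR (e : B) {a b c : B} (Z : a ⟶ b) (R : b ⟶ c) : act e Z ≫ R ⟶ act e (Z ≫ R)
  strL_whiskerLeft (e : B) {a b c : B} (L : a ⟶ b) {Z Z' : b ⟶ c} (f : Z ⟶ Z') :
    L ◃ map e f ≫ strL e L Z' = strL e L Z ≫ map e (L ◃ f)
  strL_whiskerRight (e : B) {a b c : B} {L L' : a ⟶ b} (f : L ⟶ L') (Z : b ⟶ c) :
    f ▹ act e Z ≫ strL e L' Z = strL e L Z ≫ map e (f ▹ Z)
  strR_whiskerRight (e : B) {a b c : B} {Z Z' : a ⟶ b} (f : Z ⟶ Z') (R : b ⟶ c) :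
    map e f ▹ R ≫ strR e Z' R = strR e Z R ≫ map e (f ▹ R)
  strR_whiskerLeft (e : B) {a b c : B} (Z : a ⟶ b) {R R' : b ⟶ c} (f : R ⟶ R') :
    act e Z ◃ f ≫ strR e Z R' = strR e Z R ≫ map e (Z ◃ f)
  strL_comp (e : B) {a b c d : B} (L : a ⟶ b) (L' : b ⟶ c) (Z : c ⟶ d) :
    L ◃ strL e L' Z ≫ strL e L (L' ≫ Z) =
      (𝖺 L L' (act e Z)).inv ≫ strL e (L ≫ L') Z ≫ map e (𝖺 L L' Z).hom
  strR_comp (e : B) {a b c d : B} (Z : a ⟶ b) (R : b ⟶ c) (R' : c ⟶ d) :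
    strR e Z R ▹ R' ≫ strR e (Z ≫ R) R' =
      (𝖺 (act e Z) R R').hom ≫ strR e Z (R ≫ R') ≫ map e (𝖺 Z R R').inv
  str_mid (e : B) {a b c d : B} (L : a ⟶ b) (Z : b ⟶ c) (R : c ⟶ d) :
    strL e L Z ▹ R ≫ strR e (L ≫ Z) R =
      (𝖺 L (act e Z) R).hom ≫ L ◃ strR e Z R ≫ strL e L (Z ≫ R) ≫ map e (𝖺 L Z R).inv
  strL_id (e : B) {a b : B} (Z : a ⟶ b) :
    strL e (𝟙 a) Z ≫ map e (𝗅 Z).hom = (𝗅 (act e Z)).hom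
  strR_id (e : B) {a b : B} (Z : a ⟶ b) :
    strR e Z (𝟙 b) ≫ map e (𝗋 Z).hom = (𝗋 (act e Z)).hom

namespace CentralAction
attribute [simp] map_id
end CentralAction

open CentralAction

variable {B : Type u₁} [Bicategory.{w₁, v₁} B] [CentralAction B]

/-- A 1-cell `a ⟶ b` with outer coactions of `a` and `b` and with walls: pairs of coactions which
multimaps are required to identify. -/
structure Walled (a b : B) where
  obj : a ⟶ b
  lo : obj ⟶ act a obj
  l : obj ⟶ act b obj
  bal : ∀ e : B, (obj ⟶ act e obj) → (obj ⟶ act e obj) → Prop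

namespace Walled

variable {a b c d : B}

/-- A 1-cell with coactions and without walls. -/
def Plain (W : Walled a b) : Prop := ∀ e φ ψ, ¬ W.bal e φ ψ

/-- The coaction on `X ≫ Y` given by a coaction on `X`. -/
def coL {e : B} {X : a ⟶ b} (φ : X ⟶ act e X) (Y : b ⟶ c) : X ≫ Y ⟶ act e (X ≫ Y) :=
  φ ▹ Y ≫ strR e X Y

/-- The coaction on `X ≫ Y` given by a coaction on `Y`. -/
def coR {e : B} (X : a ⟶ b) {Y : b ⟶ c} (φ : Y ⟶ act e Y) : X ≫ Y ⟶ act e (X ≫ Y) :=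
  X ◃ φ ≫ strL e X Y

/-- The walls of a composite. -/
inductive TensorBal (W : Walled a b) (W' : Walled b c) :
    ∀ e : B, (W.obj ≫ W'.obj ⟶ act e (W.obj ≫ W'.obj)) →
      (W.obj ≫ W'.obj ⟶ act e (W.obj ≫ W'.obj)) → Prop
  | left {e : B} {φ ψ : W.obj ⟶ act e W.obj} (h : W.bal e φ ψ) :
      TensorBal W W' e (coL φ W'.obj) (coL ψ W'.obj)
  | right {e : B} {φ ψ : W'.obj ⟶ act e W'.obj} (h : W'.bal e φ ψ) :
      TensorBal W W' e (coR W.obj φ) (coR W.obj ψ)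
  | mid : TensorBal W W' b (coL W.l W'.obj) (coR W.obj W'.lo)

/-- The composite of 1-cells with walls. -/
abbrev tensor (W : Walled a b) (W' : Walled b c) : Walled a c where
  obj := W.obj ≫ W'.obj
  lo := coL W.lo W'.obj
  l := coR W.obj W'.l
  bal := TensorBal W W'

/-- A 2-cell intertwines two coactions. -/
def Tw {X Y : a ⟶ b} (f : X ⟶ Y) {e : B} (φ : X ⟶ act e X) (ψ : Y ⟶ act e Y) : Prop :=
  φ ≫ map e f = f ≫ ψ

lemma Tw.comp {X Y Z : a ⟶ b} {f : X ⟶ Y} {g : Y ⟶ Z} {e : B} {φ : X ⟶ act e X}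
    {ψ : Y ⟶ act e Y} {χ : Z ⟶ act e Z} (h : Tw f φ ψ) (h' : Tw g ψ χ) : Tw (f ≫ g) φ χ := by
  unfold Tw at *
  rw [map_comp, reassoc_of% h, h', Category.assoc]

lemma Tw.id {X : a ⟶ b} {e : B} (φ : X ⟶ act e X) : Tw (𝟙 X) φ φ := by simp [Tw]

lemma Tw.whiskerLeft (L : a ⟶ b) {X Y : b ⟶ c} {f : X ⟶ Y} {e : B} {φ : X ⟶ act e X}
    {ψ : Y ⟶ act e Y} (h : Tw f φ ψ) : Tw (L ◃ f) (coR L φ) (coR L ψ) := by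
  unfold Tw coR at *
  rw [Category.assoc, ← strL_whiskerLeft, ← Bicategory.whiskerLeft_comp_assoc, h]
  simp

lemma Tw.whiskerRight {X Y : a ⟶ b} {f : X ⟶ Y} {e : B} {φ : X ⟶ act e X}
    {ψ : Y ⟶ act e Y} (h : Tw f φ ψ) (R : b ⟶ c) : Tw (f ▹ R) (coL φ R) (coL ψ R) := by
  unfold Tw coL at *
  rw [Category.assoc, ← strR_whiskerRight, ← Bicategory.comp_whiskerRight_assoc, h]
  simp

/-- The coaction lives on the other factor, so this is the interchange law. -/
lemma Tw.whiskerRight_coR {X Y : a ⟶ b} (f : X ⟶ Y) {e : B} {R : b ⟶ c} (φ : R ⟶ act e R) :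
    Tw (f ▹ R) (coR X φ) (coR Y φ) := by
  unfold Tw coR
  rw [Category.assoc, ← strL_whiskerRight, ← Category.assoc, Bicategory.whisker_exchange,
      Category.assoc]

lemma Tw.whiskerLeft_coL {L : a ⟶ b} {X Y : b ⟶ c} (f : X ⟶ Y) {e : B} (φ : L ⟶ act e L) :
    Tw (L ◃ f) (coL φ X) (coL φ Y) := by
  unfold Tw coL
  rw [Category.assoc, ← strR_whiskerLeft, ← Category.assoc, ← Bicategory.whisker_exchange,
      Category.assoc]

lemma Tw.inv {X Y : a ⟶ b} {f : X ≅ Y} {e : B} {φ : X ⟶ act e X} {ψ : Y ⟶ act e Y}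
    (h : Tw f.hom φ ψ) : Tw f.inv ψ φ := by
  unfold Tw at *
  rw [Iso.eq_inv_comp, ← reassoc_of% h, ← map_comp, f.hom_inv_id, map_id, Category.comp_id]

lemma Tw.assocLL {X : a ⟶ b} (Y : b ⟶ c) (Z : c ⟶ d) {e : B} (φ : X ⟶ act e X) :
    Tw (𝖺 X Y Z).hom (coL (coL φ Y) Z) (coL φ (Y ≫ Z)) := by
  unfold Tw coL
  simp only [Bicategory.comp_whiskerRight, Category.assoc]
  rw [reassoc_of% strR_comp, ← map_comp, Iso.inv_hom_id, map_id]
  simp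

lemma Tw.assocRR (X : a ⟶ b) (Y : b ⟶ c) {Z : c ⟶ d} {e : B} (φ : Z ⟶ act e Z) :
    Tw (𝖺 X Y Z).hom (coR (X ≫ Y) φ) (coR X (coR Y φ)) := by
  unfold Tw coR
  simp only [Bicategory.whiskerLeft_comp, Category.assoc]
  rw [strL_comp]
  simp

lemma Tw.assocMid (X : a ⟶ b) {Y : b ⟶ c} (Z : c ⟶ d) {e : B} (φ : Y ⟶ act e Y) :
    Tw (𝖺 X Y Z).hom (coL (coR X φ) Z) (coR X (coL φ Z)) := by
  unfold Tw coR coL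
  simp only [Bicategory.whiskerLeft_comp, Bicategory.comp_whiskerRight, Category.assoc]
  rw [reassoc_of% str_mid, ← map_comp, Iso.inv_hom_id, map_id]
  simp

/-- Inserting a map out of the identity 1-cell on the left does not touch a coaction of the right
factor. -/
lemma Tw.unitLeft {A : a ⟶ a} (η : 𝟙 a ⟶ A) {R : a ⟶ b} {e : B} (φ : R ⟶ act e R) :
    Tw ((𝗅 R).inv ≫ η ▹ R) φ (coR A φ) := by
  have h : Tw (𝗅 R).inv φ (coR (𝟙 a) φ) := by
    refine Tw.inv (f := 𝗅 R) ?_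
    unfold Tw coR
    rw [Category.assoc, strL_id]
    simp
  exact h.comp (Tw.whiskerRight_coR η φ)

lemma Tw.unitRight {A : b ⟶ b} (η : 𝟙 b ⟶ A) {L : a ⟶ b} {e : B} (φ : L ⟶ act e L) :
    Tw ((𝗋 L).inv ≫ L ◃ η) φ (coL φ A) := by
  have h : Tw (𝗋 L).inv φ (coL φ (𝟙 b)) := by
    refine Tw.inv (f := 𝗋 L) ?_
    unfold Tw coL
    rw [Category.assoc, strR_id]
    simp
  exact h.comp (Tw.whiskerLeft_coL η φ)

/-- Maps which respect the outer coactions and the walls. -/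
structure IsCell (W W' : Walled a b) (f : W.obj ⟶ W'.obj) : Prop where
  lo : Tw f W.lo W'.lo
  l : Tw f W.l W'.l
  bal : ∀ e φ ψ, W.bal e φ ψ → φ ≫ map e f = ψ ≫ map e f ∨
    ∃ φ' ψ', W'.bal e φ' ψ' ∧ Tw f φ φ' ∧ Tw f ψ ψ'

namespace IsCell

variable {W W' W'' : Walled a b}

lemma id (W : Walled a b) : IsCell W W (𝟙 W.obj) :=
  ⟨Tw.id _, Tw.id _, fun _ φ ψ h => Or.inr ⟨φ, ψ, h, Tw.id _, Tw.id _⟩⟩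

/-- The disjunction in the definition of a cell makes cells compose: a wall is carried to walls
until some map coequalizes it, and from then on it stays coequalized. -/
lemma comp {f : W.obj ⟶ W'.obj} {g : W'.obj ⟶ W''.obj} (hf : IsCell W W' f)
    (hg : IsCell W' W'' g) : IsCell W W'' (f ≫ g) where
  lo := hf.lo.comp hg.lo
  l := hf.l.comp hg.l
  bal e φ ψ h := by
    rcases hf.bal e φ ψ h with h | ⟨φ', ψ', h, h1, h2⟩
    · exact Or.inl (by rw [map_comp, reassoc_of% h])
    · rcases hg.bal e φ' ψ' h with h | ⟨φ'', ψ'', h, h3, h4⟩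
      · unfold Tw at h1 h2
        exact Or.inl (by rw [map_comp, reassoc_of% h1, reassoc_of% h2, h])
      · exact Or.inr ⟨φ'', ψ'', h, h1.comp h3, h2.comp h4⟩

/-- Without walls in the target only the first alternative survives, so a cell into a plain 1-cell
is a genuine multimap. -/
lemma bal_eq {f : W.obj ⟶ W'.obj} (hf : IsCell W W' f) (hW : W'.Plain) {e : B}
    {φ ψ : W.obj ⟶ act e W.obj} (h : W.bal e φ ψ) : φ ≫ map e f = ψ ≫ map e f := by
  rcases hf.bal e φ ψ h with h | ⟨φ', ψ', h, -⟩
  · exact h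
  · exact (hW _ _ _ h).elim

lemma whiskerLeft (L : Walled a b) {W W' : Walled b c} {f : W.obj ⟶ W'.obj} (hf : IsCell W W' f) :
    IsCell (L.tensor W) (L.tensor W') (L.obj ◃ f) where
  lo := Tw.whiskerLeft_coL f L.lo
  l := hf.l.whiskerLeft L.obj
  bal e φ ψ h := by
    cases h with
    | left h => exact Or.inr ⟨_, _, .left h, Tw.whiskerLeft_coL f _, Tw.whiskerLeft_coL f _⟩
    | right h =>
      rcases hf.bal _ _ _ h with h | ⟨φ', ψ', h, h1, h2⟩
      · refine Or.inl ?_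
        unfold coR
        rw [Category.assoc, Category.assoc, ← strL_whiskerLeft, ← Bicategory.whiskerLeft_comp_assoc,
            h]
        simp
      · exact Or.inr ⟨_, _, .right h, h1.whiskerLeft _, h2.whiskerLeft _⟩
    | mid => exact Or.inr ⟨_, _, .mid, Tw.whiskerLeft_coL f _, hf.lo.whiskerLeft _⟩

lemma whiskerRight {W W' : Walled a b} {f : W.obj ⟶ W'.obj} (hf : IsCell W W' f) (R : Walled b c) :
    IsCell (W.tensor R) (W'.tensor R) (f ▹ R.obj) where
  lo := hf.lo.whiskerRight R.obj
  l := Tw.whiskerRight_coR f R.l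
  bal e φ ψ h := by
    cases h with
    | right h => exact Or.inr ⟨_, _, .right h, Tw.whiskerRight_coR f _, Tw.whiskerRight_coR f _⟩
    | left h =>
      rcases hf.bal _ _ _ h with h | ⟨φ', ψ', h, h1, h2⟩
      · refine Or.inl ?_
        unfold coL
        rw [Category.assoc, Category.assoc, ← strR_whiskerRight,
            ← Bicategory.comp_whiskerRight_assoc, h]
        simp
      · exact Or.inr ⟨_, _, .left h, h1.whiskerRight _, h2.whiskerRight _⟩
    | mid => exact Or.inr ⟨_, _, .mid, hf.l.whiskerRight _, Tw.whiskerRight_coR f _⟩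

/-- Both bracketings have the same walls, namely those of the three factors and the two between
neighbours. The associator matches them one by one. -/
lemma assocHom (X : Walled a b) (Y : Walled b c) (Z : Walled c d) :
    IsCell ((X.tensor Y).tensor Z) (X.tensor (Y.tensor Z)) (𝖺 X.obj Y.obj Z.obj).hom where
  lo := Tw.assocLL _ _ _
  l := Tw.assocRR _ _ _
  bal e φ ψ h := by
    refine Or.inr ?_
    cases h with
    | left h =>
      cases h with
      | left h => exact ⟨_, _, .left h, Tw.assocLL _ _ _, Tw.assocLL _ _ _⟩
      | right h => exact ⟨_, _, .right (.left h), Tw.assocMid _ _ _, Tw.assocMid _ _ _⟩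
      | mid => exact ⟨_, _, .mid, Tw.assocLL _ _ _, Tw.assocMid _ _ _⟩
    | right h => exact ⟨_, _, .right (.right h), Tw.assocRR _ _ _, Tw.assocRR _ _ _⟩
    | mid => exact ⟨_, _, .right .mid, Tw.assocMid _ _ _, Tw.assocRR _ _ _⟩

lemma assocInv (X : Walled a b) (Y : Walled b c) (Z : Walled c d) :
    IsCell (X.tensor (Y.tensor Z)) ((X.tensor Y).tensor Z) (𝖺 X.obj Y.obj Z.obj).inv where
  lo := (Tw.assocLL _ _ _).inv
  l := (Tw.assocRR _ _ _).inv
  bal e φ ψ h := by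
    refine Or.inr ?_
    cases h with
    | left h => exact ⟨_, _, .left (.left h), (Tw.assocLL _ _ _).inv, (Tw.assocLL _ _ _).inv⟩
    | right h =>
      cases h with
      | left h => exact ⟨_, _, .left (.right h), (Tw.assocMid _ _ _).inv, (Tw.assocMid _ _ _).inv⟩
      | right h => exact ⟨_, _, .right h, (Tw.assocRR _ _ _).inv, (Tw.assocRR _ _ _).inv⟩
      | mid => exact ⟨_, _, .mid, (Tw.assocMid _ _ _).inv, (Tw.assocRR _ _ _).inv⟩
    | mid => exact ⟨_, _, .left .mid, (Tw.assocLL _ _ _).inv, (Tw.assocMid _ _ _).inv⟩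

/-- Maps `𝟙 a ⟶ A` which identify the two coactions. -/
def _root_.QuantumModules.Walled.IsUnitCell (A : Walled a a) (η : 𝟙 a ⟶ A.obj) : Prop :=
  η ≫ A.lo = η ≫ A.l

lemma unitWall {L : Walled a b} {A : Walled b b} {η : 𝟙 b ⟶ A.obj} (hη : A.IsUnitCell η) :
    L.obj ◃ η ≫ coR L.obj A.lo = L.obj ◃ η ≫ coR L.obj A.l := by
  unfold coR
  rw [← Bicategory.whiskerLeft_comp_assoc, hη]
  simp

lemma unitWall' {A : Walled a a} {R : Walled a b} {η : 𝟙 a ⟶ A.obj} (hη : A.IsUnitCell η) :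
    η ▹ R.obj ≫ coL A.lo R.obj = η ▹ R.obj ≫ coL A.l R.obj := by
  unfold coL
  rw [← Bicategory.comp_whiskerRight_assoc, hη]
  simp

/-- The wall between A and R trades the first coaction of R for the second coaction of A. On the
unit this equals the first coaction of A, which is the outer coaction that f respects. -/
lemma unitLeft {A : Walled a a} {η : 𝟙 a ⟶ A.obj} (hη : A.IsUnitCell η) {R Z : Walled a b}
    (hZ : Z.Plain) {f : A.obj ≫ R.obj ⟶ Z.obj} (hf : IsCell (A.tensor R) Z f) :
    IsCell R Z ((𝗅 R.obj).inv ≫ η ▹ R.obj ≫ f) := by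
  rw [← Category.assoc]
  refine ⟨?_, (Tw.unitLeft η R.l).comp hf.l, fun e φ ψ h => Or.inl ?_⟩
  · have h := hf.bal_eq hZ .mid
    have h1 := Tw.unitLeft η R.lo
    have h2 := hf.lo
    have h3 := unitWall' (R := R) hη
    unfold Tw at *
    dsimp only at h2
    rw [map_comp, reassoc_of% h1, ← h, ← reassoc_of% h3, h2]
    simp
  · have h := hf.bal_eq hZ (.right h)
    have h1 := Tw.unitLeft η φ
    have h2 := Tw.unitLeft η ψ
    unfold Tw at *
    rw [map_comp, reassoc_of% h1, h, reassoc_of% h2]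

lemma unitRight {A : Walled b b} {η : 𝟙 b ⟶ A.obj} (hη : A.IsUnitCell η) {L Z : Walled a b}
    (hZ : Z.Plain) {f : L.obj ≫ A.obj ⟶ Z.obj} (hf : IsCell (L.tensor A) Z f) :
    IsCell L Z ((𝗋 L.obj).inv ≫ L.obj ◃ η ≫ f) := by
  rw [← Category.assoc]
  refine ⟨(Tw.unitRight η L.lo).comp hf.lo, ?_, fun e φ ψ h => Or.inl ?_⟩
  · have h := hf.bal_eq hZ .mid
    have h1 := Tw.unitRight η L.l
    have h2 := hf.l
    have h3 := unitWall (L := L) hη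
    unfold Tw at *
    dsimp only at h2
    rw [map_comp, reassoc_of% h1, h, reassoc_of% h3, h2]
    simp
  · have h := hf.bal_eq hZ (.left h)
    have h1 := Tw.unitRight η φ
    have h2 := Tw.unitRight η ψ
    unfold Tw at *
    rw [map_comp, reassoc_of% h1, h, reassoc_of% h2]

/-- The wall between L and R is recovered from the two walls around A: the coaction of L passes to
the first coaction of A, which on the unit equals the second one, and this passes to the coaction of
R. The lemma produces the common section of the pair defining M • N. -/
lemma unitMid {A : Walled b b} {η : 𝟙 b ⟶ A.obj} (hη : A.IsUnitCell η) {L : Walled a b}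
    {R : Walled b c} {Z : Walled a c}
    (hZ : Z.Plain) {f : L.obj ≫ (A.obj ≫ R.obj) ⟶ Z.obj} (hf : IsCell (L.tensor (A.tensor R)) Z f) :
    IsCell (L.tensor R) Z (L.obj ◃ ((𝗅 R.obj).inv ≫ η ▹ R.obj) ≫ f) := by
  have hL {e : B} (φ : L.obj ⟶ act e L.obj) := Tw.whiskerLeft_coL ((𝗅 R.obj).inv ≫ η ▹ R.obj) φ
  have hR {e : B} (φ : R.obj ⟶ act e R.obj) := (Tw.unitLeft η φ).whiskerLeft L.obj
  refine ⟨(hL L.lo).comp hf.lo, (hR R.l).comp hf.l, fun e φ ψ h => Or.inl ?_⟩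
  cases h with
  | left h =>
    have h := hf.bal_eq hZ (.left h)
    unfold Tw at hL
    dsimp only at h hL
    rw [map_comp, reassoc_of% hL, h, reassoc_of% hL]
  | right h =>
    have h := hf.bal_eq hZ (.right (.right h))
    unfold Tw at hR
    dsimp only at h hR
    rw [map_comp, reassoc_of% hR, h, reassoc_of% hR]
  | mid =>
    have h1 := hf.bal_eq hZ .mid
    have h2 := hf.bal_eq hZ (.right .mid)
    have h3 : L.obj ◃ (η ▹ R.obj) ≫ coR L.obj (coL A.lo R.obj) =
        L.obj ◃ (η ▹ R.obj) ≫ coR L.obj (coL A.l R.obj) := by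
      unfold coR
      rw [← Bicategory.whiskerLeft_comp_assoc, unitWall' hη]
      simp
    unfold Tw at hR hL
    dsimp only at h1 h2 hR hL
    rw [map_comp, reassoc_of% hL, h1, reassoc_of% hR, ← h2]
    simp only [Bicategory.whiskerLeft_comp, Category.assoc, reassoc_of% h3]

end IsCell

end Walled

end Walled

/-! ### The operation E ⊗ - on comodules and its two strengths -/

section CentralActionComod

variable {V : Type u} [Category.{v} V] [MonoidalCategory V] [BraidedCategory V]

namespace Bicomod

variable {A B C D : Comon V}

/-- The comodule `E ⊗ M`, whose left coaction is braided past `E`. -/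
abbrev actObj (E : V) (M : Bicomod A B) : Bicomod A B where
  X := E ⊗ M.X
  lact := E ◁ M.lact ≫ (α_ E A.X M.X).inv ≫ (β_ A.X E).inv ▷ M.X ≫ (α_ A.X E M.X).hom
  ract := E ◁ M.ract ≫ (α_ E M.X B.X).inv
  lact_counit := by
    have h := congrArg (E ◁ ·) M.lact_counit
    have h2 := congrArg (· ▷ M.X) (BraidedCategory.braiding_inv_naturality_right E ε[A.X])
    simp only [MonoidalCategory.whiskerLeft_comp, comp_whiskerRight] at h h2
    calc _ = E ◁ M.lact ⊗≫ ((β_ A.X E).inv ▷ M.X ≫ ε[A.X] ▷ E ▷ M.X) ⊗≫ 𝟙 _ := by monoidal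
      _ = (E ◁ M.lact ≫ E ◁ ε[A.X] ▷ M.X) ⊗≫ (β_ (𝟙_ V) E).inv ▷ M.X ⊗≫ 𝟙 _ := by
        rw [← h2]; monoidal
      _ = _ := by rw [h]; simp; monoidal
  lact_coassoc := by
    have h := congrArg (E ◁ ·) M.lact_coassoc
    have h2 := congrArg (· ▷ M.X) (BraidedCategory.braiding_inv_naturality_right E Δ[A.X])
    simp only [MonoidalCategory.whiskerLeft_comp, comp_whiskerRight] at h h2
    calc _ = E ◁ M.lact ⊗≫ ((β_ A.X E).inv ▷ M.X ≫ (A.X ⊗ E) ◁ M.lact) ⊗≫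
          A.X ◁ (β_ A.X E).inv ▷ M.X ⊗≫ 𝟙 _ := by monoidal
      _ = (E ◁ M.lact ≫ E ◁ A.X ◁ M.lact) ⊗≫ (β_ A.X E).inv ▷ A.X ▷ M.X ⊗≫
          A.X ◁ (β_ A.X E).inv ▷ M.X ⊗≫ 𝟙 _ := by
        rw [← whisker_exchange]; monoidal
      _ = E ◁ M.lact ⊗≫ E ◁ Δ[A.X] ▷ M.X ⊗≫ (β_ A.X E).inv ▷ A.X ▷ M.X ⊗≫
          A.X ◁ (β_ A.X E).inv ▷ M.X ⊗≫ 𝟙 _ := by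
        rw [h]; monoidal
      _ = E ◁ M.lact ⊗≫ ((E ◁ Δ[A.X]) ▷ M.X ≫ (β_ (A.X ⊗ A.X) E).inv ▷ M.X) ⊗≫ 𝟙 _ := by
        rw [BraidedCategory.braiding_tensor_left_inv]; monoidal
      _ = _ := by
        rw [h2]; monoidal
  ract_counit := by
    have h := congrArg (E ◁ ·) M.ract_counit
    simp only [MonoidalCategory.whiskerLeft_comp] at h
    rw [Category.assoc, ← associator_inv_naturality_right, reassoc_of% h]
    simp
  ract_coassoc := by
    have h := congrArg (E ◁ ·) M.ract_coassoc
    simp only [MonoidalCategory.whiskerLeft_comp] at h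
    simp only [comp_whiskerRight, Category.assoc]
    rw [← associator_inv_naturality_middle_assoc, reassoc_of% h]
    simp
  comm := by
    have h := congrArg (E ◁ ·) M.comm
    simp only [MonoidalCategory.whiskerLeft_comp] at h
    calc _ = E ◁ M.lact ⊗≫ ((β_ A.X E).inv ▷ M.X ≫ (A.X ⊗ E) ◁ M.ract) ⊗≫ 𝟙 _ := by monoidal
      _ = (E ◁ M.lact ≫ E ◁ A.X ◁ M.ract) ⊗≫ (β_ A.X E).inv ▷ M.X ▷ B.X ⊗≫ 𝟙 _ := by
        rw [← whisker_exchange]; monoidal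
      _ = _ := by
        rw [h]; monoidal

/-- The map `E ⊗ f`. -/
abbrev actMap (E : V) {M N : Bicomod A B} (f : M ⟶ N) : actObj E M ⟶ actObj E N where
  hom := E ◁ f.hom
  left := by
    have h := congrArg (E ◁ ·) f.left
    simp only [MonoidalCategory.whiskerLeft_comp] at h
    calc _ = E ◁ M.lact ⊗≫ ((β_ A.X E).inv ▷ M.X ≫ (A.X ⊗ E) ◁ f.hom) ⊗≫ 𝟙 _ := by
          monoidal
      _ = (E ◁ M.lact ≫ E ◁ A.X ◁ f.hom) ⊗≫ (β_ A.X E).inv ▷ N.X ⊗≫ 𝟙 _ := by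
        rw [← whisker_exchange]; monoidal
      _ = _ := by
        rw [h]; monoidal
  right := by
    have h := congrArg (E ◁ ·) f.right
    simp only [MonoidalCategory.whiskerLeft_comp] at h
    simp only [Category.assoc]
    rw [← associator_inv_naturality_middle, reassoc_of% h]

/-- Moving `E` past `M`. -/
def past (M E N : V) : M ⊗ (E ⊗ N) ⟶ E ⊗ (M ⊗ N) :=
  (α_ M E N).inv ≫ (β_ M E).hom ▷ N ≫ (α_ E M N).hom

lemma past_naturality_left {M M' : V} (f : M ⟶ M') (E N : V) :
    f ▷ (E ⊗ N) ≫ past M' E N = past M E N ≫ E ◁ f ▷ N := by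
  have h := congrArg (· ▷ N) (BraidedCategory.braiding_naturality_left f E)
  simp only [comp_whiskerRight] at h
  unfold past
  calc _ = 𝟙 _ ⊗≫ (f ▷ E ▷ N ≫ (β_ M' E).hom ▷ N) ⊗≫ 𝟙 _ := by monoidal
    _ = _ := by rw [h]; monoidal

lemma past_naturality_right (M E : V) {N N' : V} (f : N ⟶ N') :
    M ◁ E ◁ f ≫ past M E N' = past M E N ≫ E ◁ M ◁ f := by
  unfold past
  calc _ = 𝟙 _ ⊗≫ ((M ⊗ E) ◁ f ≫ (β_ M E).hom ▷ N') ⊗≫ 𝟙 _ := by monoidal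
    _ = _ := by rw [whisker_exchange]; monoidal

variable [HasCoreflexiveEqualizers V] [∀ Z : V, PreservesCoreflexiveEqualizers (tensorLeft Z)]

instance mono_compι_wll (M : Bicomod A B) (N : Bicomod B D) (Z W : V) :
    Mono (Z ◁ W ◁ (compι M N).hom) :=
  mono_whiskerLeft_whiskerLeft_ι (compL M N) (compR M N) W Z

lemma past_ract (E : V) (L : Bicomod A B) (Z : V) :
    past L.X E Z ≫ E ◁ L.ract ▷ Z = L.ract ▷ (E ⊗ Z) ≫ past (L.X ⊗ B.X) E Z :=
  (past_naturality_left _ _ _).symm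

/-- Moving E to the left past L ⊗ B undoes the inverse braiding of B with E which is built into the
left coaction of E ⊗ Z. Hence the balancing over B becomes that of L ⊗_B Z, an equalizer preserved
by E ⊗ -. -/
lemma exists_strL (E : V) (L : Bicomod A B) (Z : Bicomod B C) :
    ∃ s : (comp L (actObj E Z)).X ⟶ E ⊗ (comp L Z).X, s ≫ E ◁ (compι L Z).hom =
      (compι L (actObj E Z)).hom ≫ past L.X E Z.X :=
  exists_whiskerLeft_lift _ _ _ _ (by
    have h := comp_condition L (actObj E Z)
    have h' := h =≫ past (L.X ⊗ B.X) E Z.X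
    simp only [Category.assoc] at h'
    simp only [Category.assoc]
    rw [past_ract, h']
    congr 1
    rw [MonoidalCategory.whiskerLeft_comp E, ← reassoc_of% past_naturality_right]
    simp only [MonoidalCategory.whiskerLeft_comp, Category.assoc]
    congr 1
    unfold past
    rw [BraidedCategory.braiding_tensor_left_hom]
    calc _ = 𝟙 _ ⊗≫ L.X ◁ ((β_ B.X E).inv ≫ (β_ B.X E).hom) ▷ Z.X ⊗≫
            (β_ L.X E).hom ▷ B.X ▷ Z.X ⊗≫ 𝟙 _ := by
          monoidal
      _ = _ := by
          rw [Iso.inv_hom_id]; monoidal)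

/-- The map `L ⊗_B (E ⊗ Z) ⟶ E ⊗ (L ⊗_B Z)`. -/
noncomputable def strL (E : V) (L : Bicomod A B) (Z : Bicomod B C) :
    comp L (actObj E Z) ⟶ actObj E (comp L Z) where
  hom := (exists_strL E L Z).choose
  left := by
    have h := (exists_strL E L Z).choose_spec
    have h1 := congrArg (E ◁ ·) (compι L Z).left
    have h2 := (compι L (actObj E Z)).left
    simp only [MonoidalCategory.whiskerLeft_comp] at h1
    rw [← cancel_mono (A.X ◁ E ◁ (compι L Z).hom)]
    simp only [Category.assoc, ← MonoidalCategory.whiskerLeft_comp, h]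
    simp only [MonoidalCategory.whiskerLeft_comp]
    rw [reassoc_of% h2]
    rw [← associator_naturality_right, ← whisker_exchange_assoc,
      ← associator_inv_naturality_right_assoc, reassoc_of% h1, reassoc_of% h]
    congr 1
    rw [← reassoc_of% past_naturality_left]
    unfold past
    rw [BraidedCategory.braiding_tensor_left_hom]
    congr 1
    calc _ = 𝟙 _ ⊗≫ A.X ◁ (β_ L.X E).hom ▷ Z.X ⊗≫
            ((β_ A.X E).hom ≫ (β_ A.X E).inv) ▷ L.X ▷ Z.X ⊗≫ 𝟙 _ := by
          rw [Iso.hom_inv_id]; monoidal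
      _ = _ := by
          monoidal
  right := by
    have h := (exists_strL E L Z).choose_spec
    have h1 := congrArg (E ◁ ·) (compι L Z).right
    have h2 := (compι L (actObj E Z)).right
    simp only [MonoidalCategory.whiskerLeft_comp] at h1
    have : Mono ((E ◁ (compι L Z).hom) ▷ C.X) := by
      have e : (E ◁ (compι L Z).hom) ▷ C.X = (α_ _ _ _).hom ≫ E ◁ (compι L Z).hom ▷ C.X ≫
        (α_ _ _ _).inv := by simp
      rw [e]; infer_instance
    rw [← cancel_mono ((E ◁ (compι L Z).hom) ▷ C.X)]
    simp only [Category.assoc, ← comp_whiskerRight, h]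
    simp only [comp_whiskerRight]
    rw [reassoc_of% h2, ← associator_inv_naturality_middle, reassoc_of% h1, reassoc_of% h,
      ← reassoc_of% past_naturality_right]
    congr 1
    unfold past
    monoidal

lemma strL_hom_ι (E : V) (L : Bicomod A B) (Z : Bicomod B C) :
    (strL E L Z).hom ≫ E ◁ (compι L Z).hom = (compι L (actObj E Z)).hom ≫ past L.X E Z.X :=
  (exists_strL E L Z).choose_spec

lemma exists_strR (E : V) (Z : Bicomod A B) (R : Bicomod B C) :
    ∃ s : (comp (actObj E Z) R).X ⟶ E ⊗ (comp Z R).X, s ≫ E ◁ (compι Z R).hom =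
      (compι (actObj E Z) R).hom ≫ (α_ E Z.X R.X).hom :=
  exists_whiskerLeft_lift _ _ _ _ (by
    have h := comp_condition (actObj E Z) R
    have h' := h =≫ ((α_ E Z.X B.X).hom ▷ R.X ≫ (α_ _ _ _).hom)
    simp only [Category.assoc] at h'
    simp only [Category.assoc]
    refine Eq.trans ?_ (h'.trans ?_)
    · congr 1; monoidal
    · congr 1; monoidal)

/-- The map `(E ⊗ Z) ⊗_B R ⟶ E ⊗ (Z ⊗_B R)`. -/
noncomputable def strR (E : V) (Z : Bicomod A B) (R : Bicomod B C) :
    comp (actObj E Z) R ⟶ actObj E (comp Z R) where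
  hom := (exists_strR E Z R).choose
  left := by
    have h := (exists_strR E Z R).choose_spec
    have h1 := congrArg (E ◁ ·) (compι Z R).left
    have h2 := (compι (actObj E Z) R).left
    simp only [MonoidalCategory.whiskerLeft_comp] at h1
    rw [← cancel_mono (A.X ◁ E ◁ (compι Z R).hom)]
    simp only [Category.assoc, ← MonoidalCategory.whiskerLeft_comp, h]
    simp only [MonoidalCategory.whiskerLeft_comp]
    rw [reassoc_of% h2]
    rw [← associator_naturality_right, ← whisker_exchange_assoc,
      ← associator_inv_naturality_right_assoc, reassoc_of% h1, reassoc_of% h]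
    congr 1
    monoidal
  right := by
    have h := (exists_strR E Z R).choose_spec
    have h1 := congrArg (E ◁ ·) (compι Z R).right
    have h2 := (compι (actObj E Z) R).right
    simp only [MonoidalCategory.whiskerLeft_comp] at h1
    have : Mono ((E ◁ (compι Z R).hom) ▷ C.X) := by
      have e : (E ◁ (compι Z R).hom) ▷ C.X = (α_ _ _ _).hom ≫ E ◁ (compι Z R).hom ▷ C.X ≫
        (α_ _ _ _).inv := by simp
      rw [e]; infer_instance
    rw [← cancel_mono ((E ◁ (compι Z R).hom) ▷ C.X)]
    simp only [Category.assoc, ← comp_whiskerRight, h]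
    simp only [comp_whiskerRight]
    rw [reassoc_of% h2, ← associator_inv_naturality_middle, reassoc_of% h1, reassoc_of% h]
    congr 1
    monoidal

lemma strR_hom_ι (E : V) (Z : Bicomod A B) (R : Bicomod B C) :
    (strR E Z R).hom ≫ E ◁ (compι Z R).hom = (compι (actObj E Z) R).hom ≫ (α_ E Z.X R.X).hom :=
  (exists_strR E Z R).choose_spec

end Bicomod
end CentralActionComod

/-! ### Naturality and coherence of the strengths -/

section CentralActionComod

variable {V : Type u} [Category.{v} V] [MonoidalCategory V] [BraidedCategory V]
  [HasCoreflexiveEqualizers V] [∀ Z : V, PreservesCoreflexiveEqualizers (tensorLeft Z)]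

namespace Bicomod

variable {A B C D : Comon V}

lemma act_hom_ext {E : V} {K : Bicomod A C} {M : Bicomod A B} {N : Bicomod B C}
    {f g : K ⟶ actObj E (comp M N)}
    (h : f.hom ≫ E ◁ (compι M N).hom = g.hom ≫ E ◁ (compι M N).hom) : f = g := by
  ext
  rwa [← cancel_mono (E ◁ (compι M N).hom)]

lemma strL_whiskerLeft (E : V) (L : Bicomod A B) {Z Z' : Bicomod B C} (f : Z ⟶ Z') :
    compMap (𝟙 L) (actMap E f) ≫ strL E L Z' = strL E L Z ≫ actMap E (compMap (𝟙 L) f) := by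
  apply act_hom_ext
  have h := congrArg (E ◁ ·) (whiskerL_hom_ι L f)
  simp only [MonoidalCategory.whiskerLeft_comp] at h
  simp only [comp_hom, Category.assoc]
  rw [strL_hom_ι, h, reassoc_of% strL_hom_ι, reassoc_of% whiskerL_hom_ι, past_naturality_right]

lemma strL_whiskerRight (E : V) {L L' : Bicomod A B} (f : L ⟶ L') (Z : Bicomod B C) :
    compMap f (𝟙 (actObj E Z)) ≫ strL E L' Z = strL E L Z ≫ actMap E (compMap f (𝟙 Z)) := by
  apply act_hom_ext
  have h := congrArg (E ◁ ·) (whiskerR_hom_ι f Z)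
  simp only [MonoidalCategory.whiskerLeft_comp] at h
  simp only [comp_hom, Category.assoc]
  rw [strL_hom_ι, h, reassoc_of% strL_hom_ι, reassoc_of% whiskerR_hom_ι, past_naturality_left]

lemma strR_whiskerRight (E : V) {Z Z' : Bicomod A B} (f : Z ⟶ Z') (R : Bicomod B C) :
    compMap (actMap E f) (𝟙 R) ≫ strR E Z' R = strR E Z R ≫ actMap E (compMap f (𝟙 R)) := by
  apply act_hom_ext
  have h := congrArg (E ◁ ·) (whiskerR_hom_ι f R)
  simp only [MonoidalCategory.whiskerLeft_comp] at h
  simp only [comp_hom, Category.assoc]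
  rw [strR_hom_ι, h, reassoc_of% strR_hom_ι, reassoc_of% whiskerR_hom_ι]
  simp

lemma strR_whiskerLeft (E : V) (Z : Bicomod A B) {R R' : Bicomod B C} (f : R ⟶ R') :
    compMap (𝟙 (actObj E Z)) f ≫ strR E Z R' = strR E Z R ≫ actMap E (compMap (𝟙 Z) f) := by
  apply act_hom_ext
  have h := congrArg (E ◁ ·) (whiskerL_hom_ι Z f)
  simp only [MonoidalCategory.whiskerLeft_comp] at h
  simp only [comp_hom, Category.assoc]
  rw [strR_hom_ι, h, reassoc_of% strR_hom_ι, reassoc_of% whiskerL_hom_ι]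
  simp

lemma act_hom_ext₃ {E : V} {K : Bicomod A D} {M : Bicomod A B} {N : Bicomod B C} {L : Bicomod C D}
    {f g : K ⟶ actObj E (comp M (comp N L))}
    (h : f.hom ≫ E ◁ (compι M (comp N L)).hom ≫ E ◁ M.X ◁ (compι N L).hom =
      g.hom ≫ E ◁ (compι M (comp N L)).hom ≫ E ◁ M.X ◁ (compι N L).hom) : f = g := by
  apply act_hom_ext
  rw [← cancel_mono (E ◁ M.X ◁ (compι N L).hom)]
  simpa using h

/-- This is the hexagon axiom for moving E past a tensor product. -/
lemma past_past (L M E N : V) :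
    L ◁ past M E N ≫ past L E (M ⊗ N) = (α_ L M (E ⊗ N)).inv ≫ past (L ⊗ M) E N ≫
      E ◁ (α_ L M N).hom := by
  unfold past
  rw [BraidedCategory.braiding_tensor_left_hom]
  monoidal

lemma strL_comp (E : V) (L : Bicomod A B) (L' : Bicomod B C) (Z : Bicomod C D) :
    compMap (𝟙 L) (strL E L' Z) ≫ strL E L (comp L' Z) =
      (assocIso L L' (actObj E Z)).inv ≫ strL E (comp L L') Z ≫
        actMap E (assocIso L L' Z).hom := by
  rw [← cancel_epi (assocIso L L' (actObj E Z)).hom, Iso.hom_inv_id_assoc]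
  apply act_hom_ext₃
  have h := congrArg (E ◁ ·) (assocIso_hom_ι L L' Z)
  have h2 := congrArg (L.X ◁ ·) (strL_hom_ι E L' Z)
  simp only [MonoidalCategory.whiskerLeft_comp] at h h2
  simp only [comp_hom, Category.assoc]
  rw [h, reassoc_of% strL_hom_ι, reassoc_of% strL_hom_ι, ← past_naturality_right,
    reassoc_of% whiskerL_hom_ι, reassoc_of% h2, past_past, reassoc_of% assocIso_hom_ι,
    ← reassoc_of% past_naturality_left]
  simp

lemma strR_comp (E : V) (Z : Bicomod A B) (R : Bicomod B C) (R' : Bicomod C D) :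
    compMap (strR E Z R) (𝟙 R') ≫ strR E (comp Z R) R' =
      (assocIso (actObj E Z) R R').hom ≫ strR E Z (comp R R') ≫
        actMap E (assocIso Z R R').inv := by
  have e : actMap E (assocIso Z R R').inv ≫ actMap E (assocIso Z R R').hom = 𝟙 _ := by
    ext
    change E ◁ _ ≫ E ◁ _ = _
    rw [← MonoidalCategory.whiskerLeft_comp, ← comp_hom, Iso.inv_hom_id]
    simp
  have e' : actMap E (assocIso Z R R').hom ≫ actMap E (assocIso Z R R').inv = 𝟙 _ := by
    ext
    change E ◁ _ ≫ E ◁ _ = _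
    rw [← MonoidalCategory.whiskerLeft_comp, ← comp_hom, Iso.hom_inv_id]
    simp
  have : IsIso (actMap E (assocIso Z R R').hom) := ⟨_, e', e⟩
  rw [← cancel_mono (actMap E (assocIso Z R R').hom)]
  simp only [Category.assoc]
  rw [e, Category.comp_id]
  apply act_hom_ext₃
  have h := congrArg (E ◁ ·) (assocIso_hom_ι Z R R')
  have h2 := congrArg (· ▷ R'.X) (strR_hom_ι E Z R)
  simp only [MonoidalCategory.whiskerLeft_comp, comp_whiskerRight] at h h2
  simp only [comp_hom, Category.assoc]
  rw [h, reassoc_of% strR_hom_ι, reassoc_of% whiskerR_hom_ι, ← associator_naturality_middle_assoc,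
    reassoc_of% h2, reassoc_of% strR_hom_ι, ← associator_naturality_right,
    reassoc_of% assocIso_hom_ι]
  simp

lemma str_mid (E : V) (L : Bicomod A B) (Z : Bicomod B C) (R : Bicomod C D) :
    compMap (strL E L Z) (𝟙 R) ≫ strR E (comp L Z) R =
      (assocIso L (actObj E Z) R).hom ≫ compMap (𝟙 L) (strR E Z R) ≫ strL E L (comp Z R) ≫
        actMap E (assocIso L Z R).inv := by
  have e : actMap E (assocIso L Z R).inv ≫ actMap E (assocIso L Z R).hom = 𝟙 _ := by
    ext
    change E ◁ _ ≫ E ◁ _ = _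
    rw [← MonoidalCategory.whiskerLeft_comp, ← comp_hom, Iso.inv_hom_id]
    simp
  have e' : actMap E (assocIso L Z R).hom ≫ actMap E (assocIso L Z R).inv = 𝟙 _ := by
    ext
    change E ◁ _ ≫ E ◁ _ = _
    rw [← MonoidalCategory.whiskerLeft_comp, ← comp_hom, Iso.hom_inv_id]
    simp
  have : IsIso (actMap E (assocIso L Z R).hom) := ⟨_, e', e⟩
  rw [← cancel_mono (actMap E (assocIso L Z R).hom)]
  simp only [Category.assoc]
  rw [e, Category.comp_id]
  apply act_hom_ext₃
  have h := congrArg (E ◁ ·) (assocIso_hom_ι L Z R)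
  have h2 := congrArg (· ▷ R.X) (strL_hom_ι E L Z)
  have h3 := congrArg (L.X ◁ ·) (strR_hom_ι E Z R)
  simp only [MonoidalCategory.whiskerLeft_comp, comp_whiskerRight] at h h2 h3
  simp only [comp_hom, Category.assoc]
  rw [h, reassoc_of% strR_hom_ι, reassoc_of% whiskerR_hom_ι, ← associator_naturality_middle_assoc,
    reassoc_of% h2, reassoc_of% strL_hom_ι, ← past_naturality_right,
    reassoc_of% whiskerL_hom_ι, reassoc_of% h3, reassoc_of% assocIso_hom_ι]
  unfold past
  congr 2
  monoidal

lemma strL_id (E : V) (Z : Bicomod A B) :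
    strL E (regular A) Z ≫ actMap E (lunitIso Z).hom = (lunitIso (actObj E Z)).hom := by
  ext
  simp only [comp_hom, lunitIso_hom_hom, MonoidalCategory.whiskerLeft_comp]
  rw [reassoc_of% strL_hom_ι]
  have h := past_naturality_left ε[A.X] E Z.X
  congr 1
  change past A.X E Z.X ≫ _ = _
  rw [← reassoc_of% h]
  unfold past
  simp

lemma strR_id (E : V) (Z : Bicomod A B) :
    strR E Z (regular B) ≫ actMap E (runitIso Z).hom = (runitIso (actObj E Z)).hom := by
  ext
  simp only [comp_hom, runitIso_hom_hom, MonoidalCategory.whiskerLeft_comp]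
  rw [reassoc_of% strR_hom_ι]
  simp

end Bicomod

/-- Only the underlying object of the comonoid e enters. Coactions of C and of Cᵒ are thus 2-cells
with the same target and can be compared, which is what a wall does. -/
noncomputable instance : CentralAction (ComodBicat V) where
  act e _ _ M := Bicomod.actObj e.base.X M
  map e _ _ _ _ f := Bicomod.actMap e.base.X f
  map_id _ _ _ _ := Bicomod.Hom.ext (MonoidalCategory.whiskerLeft_id _ _)
  map_comp _ _ _ _ _ _ _ _ := Bicomod.Hom.ext (MonoidalCategory.whiskerLeft_comp _ _ _)
  strL e _ _ _ L Z := Bicomod.strL e.base.X L Z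
  strR e _ _ _ Z R := Bicomod.strR e.base.X Z R
  strL_whiskerLeft _ _ _ _ L _ _ f := Bicomod.strL_whiskerLeft _ L f
  strL_whiskerRight _ _ _ _ _ _ f Z := Bicomod.strL_whiskerRight _ f Z
  strR_whiskerRight _ _ _ _ _ _ f R := Bicomod.strR_whiskerRight _ f R
  strR_whiskerLeft _ _ _ _ Z _ _ f := Bicomod.strR_whiskerLeft _ Z f
  strL_comp _ _ _ _ _ L L' Z := Bicomod.strL_comp _ L L' Z
  strR_comp _ _ _ _ _ Z R R' := Bicomod.strR_comp _ Z R R'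
  str_mid _ _ _ _ _ L Z R := Bicomod.str_mid _ L Z R
  strL_id _ _ _ Z := Bicomod.strL_id _ Z
  strR_id _ _ _ Z := Bicomod.strR_id _ Z

end CentralActionComod

/-! ### Maps into p ⊗_R Z in terms of an augmentation and an idempotent -/

section Evaluation

variable {V : Type u} [Category.{v} V] [MonoidalCategory V] [BraidedCategory V]

namespace Bicomod

variable {P Q R S a b c : Comon V}

/-- The two projections of a ⊗ c, paired along the comultiplication, give the identity.
Coassociativity then rebuilds the coaction from its two parts. -/
lemma ract_eq (M : Bicomod P (tensorComon a c)) :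
    M.ract = M.ractR ≫ M.ractL ▷ c.X ≫ (α_ M.X a.X c.X).hom := by
  have h2 : M.ractR ≫ M.ractL ▷ c.X =
      M.ract ≫ M.X ◁ (Δ[a.X ⊗ c.X] ≫ ((projL a c).hom ⊗ₘ (projR a c).hom)) ≫
        (α_ _ _ _).inv := by
    simp only [ractL, ractR, Category.assoc, comp_whiskerRight, MonoidalCategory.whiskerLeft_comp]
    rw [whisker_exchange_assoc, reassoc_of% M.ract_coassoc]
    simp [MonoidalCategory.tensorHom_def']
  rw [reassoc_of% h2, comul_projL_projR]
  simp

/-- A right coaction of Cᵒ ⊗ C' is rebuilt from its parts, and the left coaction of `bd` is the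
Cᵒ-part up to a braiding. This converts maps between the comodules `bd` back into maps of right
coactions. -/
lemma bd_hom_ract {M : Bicomod P (tensorComon (opComon a) c)}
    {N : Bicomod Q (tensorComon (opComon a) c)} (f : bd M ⟶ bd N) (g : M.X ⟶ N.X)
    (hg : f.hom = g) : M.ract ≫ g ▷ (a.X ⊗ c.X) = g ≫ N.ract := by
  have h1 : M.ractR ≫ g ▷ c.X = g ≫ N.ractR := by rw [← hg]; exact f.right
  have h2 : M.ractL ≫ g ▷ a.X = g ≫ N.ractL := by
    have h : (M.ractL ≫ (β_ a.X M.X).inv) ≫ a.X ◁ g = g ≫ N.ractL ≫ (β_ a.X N.X).inv := by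
      rw [← hg]; exact f.left
    rw [Category.assoc, ← BraidedCategory.braiding_inv_naturality_left] at h
    rw [← cancel_mono (β_ a.X N.X).inv, Category.assoc, Category.assoc]
    exact h
  have key (l : M.X ⟶ M.X ⊗ a.X) (l' : N.X ⟶ N.X ⊗ a.X) (h : l ≫ g ▷ a.X = g ≫ l') :
      (M.ractR ≫ l ▷ c.X ≫ (α_ M.X a.X c.X).hom) ≫ g ▷ (a.X ⊗ c.X) =
        g ≫ N.ractR ≫ l' ▷ c.X ≫ (α_ N.X a.X c.X).hom := by
    have h3 := congrArg (· ▷ c.X) h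
    simp only [comp_whiskerRight] at h3
    simp only [Category.assoc]
    rw [← associator_naturality_left, reassoc_of% h3, reassoc_of% h1]
  rw [ract_eq M, ract_eq N]
  exact key _ _ h2

/-- Passing from right Cᵒ-coactions to left C-coactions makes two coactions commute only up to a
braiding, and the inverse braiding in the left coaction of E ⊗ W cancels it. -/
lemma coact_left_aux {A E W : V} (m : W ⟶ P.X ⊗ W) (l : W ⟶ A ⊗ W) (u : P.X ⟶ E)
    (h : m ≫ P.X ◁ l = l ≫ A ◁ m ≫ (α_ A P.X W).inv ≫ (β_ A P.X).hom ▷ W ≫ (α_ P.X A W).hom) :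
    l ≫ A ◁ (m ≫ u ▷ W) = (m ≫ u ▷ W) ≫ E ◁ l ≫ (α_ E A W).inv ≫ (β_ A E).inv ▷ W ≫
        (α_ A E W).hom := by
  have h2 := congrArg (· ▷ W) (BraidedCategory.braiding_inv_naturality_left u A)
  simp only [comp_whiskerRight] at h2
  symm
  calc _ = m ≫ (u ▷ W ≫ E ◁ l) ⊗≫ (β_ A E).inv ▷ W ⊗≫ 𝟙 _ := by monoidal
    _ = (m ≫ P.X ◁ l) ≫ u ▷ (A ⊗ W) ⊗≫ (β_ A E).inv ▷ W ⊗≫ 𝟙 _ := by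
      rw [← whisker_exchange]; monoidal
    _ = l ≫ A ◁ m ⊗≫ (β_ A P.X).hom ▷ W ⊗≫ (u ▷ A ▷ W ≫ (β_ A E).inv ▷ W) ⊗≫ 𝟙 _ := by
      rw [h]; monoidal
    _ = l ≫ A ◁ m ⊗≫ ((β_ A P.X).hom ≫ (β_ A P.X).inv) ▷ W ⊗≫ A ◁ u ▷ W ⊗≫ 𝟙 _ := by
      rw [h2]; monoidal
    _ = _ := by
      rw [Iso.hom_inv_id]; monoidal

/-- The coaction obtained from the left coaction and a map out of the comonoid. -/
def coact (W : Bicomod P (tensorComon (opComon a) c)) {E : V} (u : P.X ⟶ E) :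
    bd W ⟶ actObj E (bd W) where
  hom := W.lact ≫ u ▷ W.X
  left := coact_left_aux (A := a.X) W.lact (bd W).lact u W.bd_lact_lact
  right := by
    have h := W.ractR_comm
    change W.ractR ≫ (W.lact ≫ u ▷ W.X) ▷ c.X =
      (W.lact ≫ u ▷ W.X) ≫ E ◁ W.ractR ≫ (α_ E W.X c.X).inv
    simp only [comp_whiskerRight, Category.assoc]
    rw [← whisker_exchange_assoc, reassoc_of% h]
    simp

/-- A comodule `p` with an augmentation which identifies it with the image of an idempotent on the
comonoid `P`, compatibly with a map of `P` onto the comonoid `R` which coacts on the right. -/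
structure EvalData (p : Bicomod P R) where
  aug : p.X ⟶ 𝟙_ V
  w : P.X ⟶ R.X
  r : P.X ⟶ p.X
  i : p.X ⟶ P.X
  lact_aug : p.lact ≫ P.X ◁ aug = i ≫ (ρ_ P.X).inv
  i_r : i ≫ r = 𝟙 _
  r_aug : r ≫ aug = ε[P.X]
  ract_i : p.ract ≫ i ▷ R.X = i ≫ Δ[P.X] ≫ P.X ◁ w

namespace EvalData

/-- The identity comodule. -/
def regular (C : Comon V) : EvalData (Bicomod.regular C) where
  aug := (ε[C.X] : C.X ⟶ 𝟙_ V)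
  w := 𝟙 C.X
  r := 𝟙 C.X
  i := 𝟙 C.X
  lact_aug := by
    change Δ[C.X] ≫ C.X ◁ ε[C.X] = _
    simp
  i_r := Category.id_comp _
  r_aug := Category.id_comp _
  ract_i := by
    change Δ[C.X] ≫ 𝟙 C.X ▷ C.X = 𝟙 C.X ≫ Δ[C.X] ≫ C.X ◁ 𝟙 C.X
    simp

/-- The evaluation comodule. -/
def e (C : Comon V) : EvalData (Bicomod.e C) where
  aug := (ε[C.X] : C.X ⟶ 𝟙_ V)
  w := ε[C.X ⊗ (opComon C).X]
  r := (C.X ◁ ε[C.X] ≫ (ρ_ C.X).hom : C.X ⊗ C.X ⟶ C.X)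
  i := (Δ[C.X] : C.X ⟶ C.X ⊗ C.X)
  lact_aug := by
    have h : (Δ[C.X] ≫ (β_ C.X C.X).hom) ≫ C.X ◁ ε[C.X] = (ρ_ C.X).inv :=
      (opComon C).comon.comul_counit
    change (Δ[C.X] ≫ C.X ◁ (Δ[C.X] ≫ (β_ C.X C.X).hom) ≫ (α_ C.X C.X C.X).inv) ≫
      (C.X ⊗ C.X) ◁ ε[C.X] = Δ[C.X] ≫ (ρ_ (C.X ⊗ C.X)).inv
    calc _ = Δ[C.X] ≫ C.X ◁ ((Δ[C.X] ≫ (β_ C.X C.X).hom) ≫ C.X ◁ ε[C.X]) ⊗≫ 𝟙 _ := by monoidal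
      _ = _ := by rw [h]; monoidal
  i_r := by
    change Δ[C.X] ≫ C.X ◁ ε[C.X] ≫ (ρ_ C.X).hom = 𝟙 C.X
    simp
  r_aug := by
    change (C.X ◁ ε[C.X] ≫ (ρ_ C.X).hom) ≫ ε[C.X] = (ε[C.X] ⊗ₘ ε[C.X]) ≫ (λ_ (𝟙_ V)).hom
    rw [MonoidalCategory.tensorHom_def', Category.assoc, Category.assoc, ← rightUnitor_naturality,
      unitors_equal]
  ract_i := by
    change (ρ_ C.X).inv ≫ Δ[C.X] ▷ 𝟙_ V = Δ[C.X] ≫ Δ[C.X ⊗ (opComon C).X] ≫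
      (C.X ⊗ (opComon C).X) ◁ ε[C.X ⊗ (opComon C).X]
    rw [ComonObj.comul_counit]
    simp

/-- Tensor products. -/
def tensor {P' R' : Comon V} {p : Bicomod P R} {p' : Bicomod P' R'} (d : EvalData p)
    (d' : EvalData p') : EvalData (Bicomod.tensor p p') where
  aug := ((d.aug ⊗ₘ d'.aug) ≫ (λ_ (𝟙_ V)).hom : p.X ⊗ p'.X ⟶ 𝟙_ V)
  w := d.w ⊗ₘ d'.w
  r := (d.r ⊗ₘ d'.r : P.X ⊗ P'.X ⟶ p.X ⊗ p'.X)
  i := (d.i ⊗ₘ d'.i : p.X ⊗ p'.X ⟶ P.X ⊗ P'.X)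
  lact_aug := by
    change ((p.lact ⊗ₘ p'.lact) ≫ tensorμ P.X p.X P'.X p'.X) ≫
      (P.X ⊗ P'.X) ◁ ((d.aug ⊗ₘ d'.aug) ≫ (λ_ (𝟙_ V)).hom) = (d.i ⊗ₘ d'.i) ≫ (ρ_ (P.X ⊗ P'.X)).inv
    rw [MonoidalCategory.whiskerLeft_comp, Category.assoc, reassoc_of% tensorμ_whiskerLeft,
      tensorHom_comp_tensorHom_assoc, d.lact_aug, d'.lact_aug,
      ← cancel_mono (ρ_ (P.X ⊗ P'.X)).hom]
    simp only [Category.assoc, ← rightUnitor_monoidal]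
    simp
  i_r := by
    change (d.i ⊗ₘ d'.i) ≫ (d.r ⊗ₘ d'.r) = 𝟙 (p.X ⊗ p'.X)
    rw [tensorHom_comp_tensorHom, d.i_r, d'.i_r, id_tensorHom_id]
  r_aug := by
    change (d.r ⊗ₘ d'.r) ≫ (d.aug ⊗ₘ d'.aug) ≫ (λ_ (𝟙_ V)).hom = _
    rw [tensorHom_comp_tensorHom_assoc, d.r_aug, d'.r_aug, Comon.tensorObj_counit]
  ract_i := by
    change ((p.ract ⊗ₘ p'.ract) ≫ tensorμ p.X R.X p'.X R'.X) ≫ (d.i ⊗ₘ d'.i) ▷ (R.X ⊗ R'.X) =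
      (d.i ⊗ₘ d'.i) ≫ Δ[P.X ⊗ P'.X] ≫ (P.X ⊗ P'.X) ◁ (d.w ⊗ₘ d'.w)
    rw [Category.assoc, tensorμ_whiskerRight, tensorHom_comp_tensorHom_assoc, d.ract_i, d'.ract_i,
      Comon.tensorObj_comul, Category.assoc, tensorμ_whiskerLeft, tensorHom_comp_tensorHom_assoc,
      tensorHom_comp_tensorHom_assoc]
    simp only [Category.assoc]

/-- Corestriction of the left coaction along an isomorphism of comonoids. -/
def mapL {p : Bicomod P R} (d : EvalData p) (u : P ≅ Q) :
    EvalData (p.mapL u.hom) where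
  aug := d.aug
  w := u.inv.hom ≫ d.w
  r := u.inv.hom ≫ d.r
  i := (d.i ≫ u.hom.hom : p.X ⟶ Q.X)
  lact_aug := by
    change (p.lact ≫ u.hom.hom ▷ p.X) ≫ Q.X ◁ d.aug = (d.i ≫ u.hom.hom) ≫ _
    rw [Category.assoc, ← whisker_exchange, reassoc_of% d.lact_aug]
    simp
  i_r := by
    have h : u.hom.hom ≫ u.inv.hom = 𝟙 P.X := congrArg Comon.Hom.hom u.hom_inv_id
    change (d.i ≫ u.hom.hom) ≫ u.inv.hom ≫ d.r = 𝟙 p.X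
    rw [Category.assoc, reassoc_of% h, d.i_r]
  r_aug := by
    change (u.inv.hom ≫ d.r) ≫ d.aug = ε[Q.X]
    rw [Category.assoc, d.r_aug, IsComonHom.hom_counit]
  ract_i := by
    have h : u.hom.hom ≫ u.inv.hom = 𝟙 P.X := congrArg Comon.Hom.hom u.hom_inv_id
    change p.ract ≫ (d.i ≫ u.hom.hom) ▷ R.X = (d.i ≫ u.hom.hom) ≫ Δ[Q.X] ≫
      Q.X ◁ (u.inv.hom ≫ d.w)
    rw [Category.assoc, IsComonHom.hom_comul_assoc, comp_whiskerRight, reassoc_of% d.ract_i,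
      MonoidalCategory.tensorHom_def, Category.assoc, MonoidalCategory.whiskerLeft_comp,
      whisker_exchange, ← MonoidalCategory.whiskerLeft_comp_assoc Q.X, h]
    simp only [MonoidalCategory.whiskerLeft_id, Category.id_comp]

/-- Corestriction of the right coaction. -/
def mapR {p : Bicomod P R} (d : EvalData p) (u : R ⟶ S) :
    EvalData (p.mapR u) where
  aug := d.aug
  w := d.w ≫ u.hom
  r := d.r
  i := d.i
  lact_aug := d.lact_aug
  i_r := d.i_r
  r_aug := d.r_aug
  ract_i := by
    change (p.ract ≫ p.X ◁ u.hom) ≫ d.i ▷ S.X = _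
    rw [Category.assoc, whisker_exchange, reassoc_of% d.ract_i, MonoidalCategory.whiskerLeft_comp]
    rfl

/-- Up to a unit isomorphism, the inclusion i is the coaction of p followed by the augmentation, so
its colinearity is coassociativity. -/
lemma i_colinear {p : Bicomod P R} (d : EvalData p) :
    p.lact ≫ P.X ◁ d.i = d.i ≫ Δ[P.X] := by
  have h := congrArg (P.X ◁ ·) d.lact_aug
  simp only [MonoidalCategory.whiskerLeft_comp] at h
  rw [← cancel_mono (P.X ◁ (ρ_ P.X).inv), Category.assoc, ← h, reassoc_of% p.lact_coassoc,
    ← associator_naturality_right, ← whisker_exchange_assoc, reassoc_of% d.lact_aug]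
  simp

lemma ract_aug {p : Bicomod P R} (d : EvalData p) :
    p.ract ≫ d.aug ▷ R.X = d.i ≫ d.w ≫ (λ_ R.X).inv := by
  have h : d.i ≫ ε[P.X] = d.aug := by rw [← d.r_aug, reassoc_of% d.i_r]
  rw [← h, comp_whiskerRight, reassoc_of% d.ract_i, whisker_exchange, ComonObj.counit_comul_assoc]
  simp

variable [HasCoreflexiveEqualizers V] [∀ Z : V, PreservesCoreflexiveEqualizers (tensorLeft Z)]
variable {p : Bicomod P R} (d : EvalData p) {W : Bicomod P S} {Z : Bicomod R S}

/-- The map underlying a map `W ⟶ p ⊗_R Z`. -/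
noncomputable def under (s : W ⟶ comp p Z) : W.X ⟶ Z.X :=
  s.hom ≫ (compι p Z).hom ≫ d.aug ▷ Z.X ≫ (λ_ Z.X).hom

/-- Contracting p and then coacting by P recovers the 2-cell itself, embedded by i. As i is split
monic, no information is lost in passing to underlying maps. -/
lemma lact_under (s : W ⟶ comp p Z) :
    W.lact ≫ P.X ◁ d.under s = (s.hom ≫ (compι p Z).hom) ≫ d.i ▷ Z.X := by
  have h : W.lact ≫ P.X ◁ (s.hom ≫ (compι p Z).hom) = (s.hom ≫ (compι p Z).hom) ≫ p.lact ▷ Z.X ≫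
      (α_ P.X p.X Z.X).hom := (s ≫ compι p Z).left
  have h2 := congrArg (· ▷ Z.X) d.lact_aug
  simp only [comp_whiskerRight] at h2
  unfold under
  rw [← Category.assoc s.hom, MonoidalCategory.whiskerLeft_comp, reassoc_of% h,
    MonoidalCategory.whiskerLeft_comp, ← associator_naturality_middle_assoc, reassoc_of% h2]
  simp

lemma under_injective {s t : W ⟶ comp p Z} (h : d.under s = d.under t) : s = t := by
  apply comp_hom_ext'
  have hs := d.lact_under s
  have ht := d.lact_under t
  have : Mono (d.i ▷ Z.X) := by
    have : IsSplitMono (d.i ▷ Z.X) := IsSplitMono.mk' ⟨d.r ▷ Z.X, by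
      rw [← comp_whiskerRight, d.i_r, id_whiskerRight]⟩
    infer_instance
  rw [← cancel_mono (d.i ▷ Z.X), ← hs, ← ht, h]

/-- This is the balancing condition over R, contracted with the augmentation: the right coaction of
p followed by the augmentation is w restricted along i. -/
lemma under_lin (s : W ⟶ comp p Z) :
    W.lact ≫ P.X ◁ d.under s ≫ d.w ▷ Z.X = d.under s ≫ Z.lact := by
  have h2 := congrArg (· ▷ Z.X) d.ract_aug
  simp only [comp_whiskerRight] at h2
  have h3 := reassoc_of% (comp_condition p Z)
  rw [reassoc_of% d.lact_under s]
  rw [← cancel_mono ((λ_ R.X).inv ▷ Z.X)]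
  simp only [Category.assoc]
  rw [← h2, h3]
  unfold under
  have h4 := whisker_exchange d.aug Z.lact
  simp only [Category.assoc]
  rw [← associator_inv_naturality_left, reassoc_of% h4]
  congr 3
  monoidal

/-- By `lact_under` the map in question factors through i, and i ≫ r = 1. -/
lemma under_inv (s : W ⟶ comp p Z) :
    W.lact ≫ P.X ◁ d.under s ≫ (d.r ≫ d.i) ▷ Z.X = W.lact ≫ P.X ◁ d.under s := by
  rw [reassoc_of% d.lact_under s, d.lact_under s, ← comp_whiskerRight, reassoc_of% d.i_r]
  simp

/-- The 2-cell is recovered as the coaction of P, then f, then the retraction r. Linearity makes it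
balanced over R, and invariance makes it colinear. -/
lemma exists_under (f : W.X ⟶ Z.X) (hf : W.ract ≫ f ▷ S.X = f ≫ Z.ract)
    (hlin : W.lact ≫ P.X ◁ f ≫ d.w ▷ Z.X = f ≫ Z.lact)
    (hinv : W.lact ≫ P.X ◁ f ≫ (d.r ≫ d.i) ▷ Z.X = W.lact ≫ P.X ◁ f) :
    ∃ s : W ⟶ comp p Z, d.under s = f := by
  -- By invariance nothing is lost on applying r, so all identities for the candidate may be checked
  -- after the split monomorphism i.
  have hki : (W.lact ≫ P.X ◁ f ≫ d.r ▷ Z.X) ≫ d.i ▷ Z.X = W.lact ≫ P.X ◁ f := by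
    rw [← hinv]; simp
  let k : W ⟶ outer p Z :=
    { hom := W.lact ≫ P.X ◁ f ≫ d.r ▷ Z.X
      left := by
        have : Mono (P.X ◁ d.i ▷ Z.X) := by
          have : IsSplitMono (P.X ◁ d.i ▷ Z.X) := IsSplitMono.mk' ⟨P.X ◁ d.r ▷ Z.X, by
            rw [← MonoidalCategory.whiskerLeft_comp, ← comp_whiskerRight, d.i_r, id_whiskerRight,
              MonoidalCategory.whiskerLeft_id]⟩
          infer_instance
        rw [← cancel_mono (P.X ◁ d.i ▷ Z.X)]
        have h1 := congrArg (· ▷ Z.X) d.i_colinear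
        simp only [comp_whiskerRight] at h1
        rw [Category.assoc, ← MonoidalCategory.whiskerLeft_comp, hki]
        simp only [Category.assoc]
        rw [← associator_naturality_middle, reassoc_of% h1]
        have hki' := reassoc_of% hki
        rw [hki', MonoidalCategory.whiskerLeft_comp, reassoc_of% W.lact_coassoc]
        rw [← associator_naturality_right, whisker_exchange_assoc]
      right := by
        simp only [comp_whiskerRight, Category.assoc]
        have hW := W.comm
        have h1 := congrArg (P.X ◁ ·) hf
        simp only [MonoidalCategory.whiskerLeft_comp] at h1
        rw [← whisker_exchange_assoc, ← reassoc_of% h1, reassoc_of% hW]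
        simp }
  -- After i, the right coaction of p becomes the comultiplication of P followed by w, and linearity
  -- turns w into the coaction of Z.
  have hk : k.hom ≫ p.ract ▷ Z.X = k.hom ≫ p.X ◁ Z.lact ≫ (α_ p.X R.X Z.X).inv := by
    change (W.lact ≫ P.X ◁ f ≫ d.r ▷ Z.X) ≫ p.ract ▷ Z.X =
      (W.lact ≫ P.X ◁ f ≫ d.r ▷ Z.X) ≫ p.X ◁ Z.lact ≫ (α_ p.X R.X Z.X).inv
    have : Mono (d.i ▷ R.X ▷ Z.X) := by
      have : IsSplitMono (d.i ▷ R.X ▷ Z.X) := IsSplitMono.mk' ⟨d.r ▷ R.X ▷ Z.X, by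
        rw [← comp_whiskerRight, ← comp_whiskerRight, d.i_r, id_whiskerRight, id_whiskerRight]⟩
      infer_instance
    rw [← cancel_mono (d.i ▷ R.X ▷ Z.X)]
    have h1 := congrArg (· ▷ Z.X) d.ract_i
    simp only [comp_whiskerRight] at h1
    have hki' := reassoc_of% hki
    have h2 := congrArg (P.X ◁ ·) hlin
    simp only [MonoidalCategory.whiskerLeft_comp] at h2
    simp only [Category.assoc] at hki' ⊢
    rw [h1, hki', ← associator_inv_naturality_left, whisker_exchange_assoc d.i Z.lact, hki',
      ← reassoc_of% h2, reassoc_of% W.lact_coassoc, whisker_exchange_assoc]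
    simp
  refine ⟨compLift k hk, ?_⟩
  have h : (compLift k hk).hom ≫ (compι p Z).hom = W.lact ≫ P.X ◁ f ≫ d.r ▷ Z.X :=
    congrArg Hom.hom (compLift_ι k hk)
  have h2 := congrArg (· ▷ Z.X) d.r_aug
  simp only [comp_whiskerRight] at h2
  have h3 := reassoc_of% h
  unfold under
  rw [h3, reassoc_of% h2, whisker_exchange_assoc, reassoc_of% W.lact_counit]
  simp

end EvalData
end Bicomod
end Evaluation

/-! ### Pairs of maps out of a comonoid and their effect on coactions -/

section Pairing

variable {V : Type u} [Category.{v} V] [MonoidalCategory V]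

/-- The map into a tensor product given by two maps out of a comonoid. -/
def pair {P : Comon V} {A B : V} (x : P.X ⟶ A) (y : P.X ⟶ B) : P.X ⟶ A ⊗ B := Δ[P.X] ≫ (x ⊗ₘ y)

variable {P : Comon V} {A B C : V}

lemma pair_tensorHom {A' B' : V} (x : P.X ⟶ A) (y : P.X ⟶ B) (f : A ⟶ A') (g : B ⟶ B') :
    pair x y ≫ (f ⊗ₘ g) = pair (x ≫ f) (y ≫ g) := by
  simp [pair]

lemma pair_assoc (x : P.X ⟶ A) (y : P.X ⟶ B) (z : P.X ⟶ C) :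
    pair (pair x y) z ≫ (α_ A B C).hom = pair x (pair y z) := by
  have h := ComonObj.comul_assoc_assoc P.X ((x ⊗ₘ (y ⊗ₘ z)))
  have h1 : (Δ[P.X] ≫ (x ⊗ₘ y)) ⊗ₘ z = Δ[P.X] ▷ P.X ≫ ((x ⊗ₘ y) ⊗ₘ z) := by
    rw [← tensorHom_id, tensorHom_comp_tensorHom, Category.id_comp]
  have h2 : x ⊗ₘ (Δ[P.X] ≫ (y ⊗ₘ z)) = P.X ◁ Δ[P.X] ≫ (x ⊗ₘ (y ⊗ₘ z)) := by
    rw [← id_tensorHom, tensorHom_comp_tensorHom, Category.id_comp]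
  simp only [pair, Category.assoc]
  rw [h1, h2, h, Category.assoc, associator_naturality]

lemma pair_assoc_inv (x : P.X ⟶ A) (y : P.X ⟶ B) (z : P.X ⟶ C) :
    pair x (pair y z) ≫ (α_ A B C).inv = pair (pair x y) z := by
  rw [Iso.comp_inv_eq, pair_assoc]

lemma pair_counit_right (x : P.X ⟶ A) : pair x ε[P.X] ≫ (ρ_ A).hom = x := by
  rw [pair, MonoidalCategory.tensorHom_def', Category.assoc, Category.assoc,
    ComonObj.comul_counit_assoc]
  simp

lemma pair_counit_left (x : P.X ⟶ A) : pair ε[P.X] x ≫ (λ_ A).hom = x := by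
  rw [pair, MonoidalCategory.tensorHom_def, Category.assoc, Category.assoc,
    ComonObj.counit_comul_assoc]
  simp

lemma pair_self {Q : Comon V} (a : P ⟶ Q) : pair a.hom a.hom = a.hom ≫ Δ[Q.X] := by
  rw [pair, IsComonHom.hom_comul]

variable {W Z : V}

/-- The maps `x` and `y` out of `P` agree on the coaction of `P` on `W` followed by `f`. -/
def CoRel (m : W ⟶ P.X ⊗ W) (f : W ⟶ Z) (x y : P.X ⟶ A) : Prop :=
  m ≫ P.X ◁ f ≫ x ▷ Z = m ≫ P.X ◁ f ≫ y ▷ Z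

namespace CoRel

variable {m : W ⟶ P.X ⊗ W} {f : W ⟶ Z} {x y z : P.X ⟶ A}

lemma comp (h : CoRel m f x y) (k : A ⟶ B) : CoRel m f (x ≫ k) (y ≫ k) := by
  unfold CoRel at *
  simp only [comp_whiskerRight, reassoc_of% h]

/-- By coassociativity, coacting along a pair is coacting along the second component first and along
the first component afterwards. Hence `CoRel.pair` can replace only a second component; a first
component must be moved there by the braiding. -/
lemma coaction_pair (hm : m ≫ P.X ◁ m = m ≫ Δ[P.X] ▷ W ≫ (α_ P.X P.X W).hom) (k : P.X ⟶ B)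
    (x : P.X ⟶ A) : m ≫ P.X ◁ f ≫ pair k x ▷ Z =
      m ≫ P.X ◁ (m ≫ P.X ◁ f ≫ x ▷ Z) ≫ (α_ P.X A Z).inv ≫ k ▷ A ▷ Z := by
  have h := reassoc_of% hm
  unfold pair
  simp only [MonoidalCategory.whiskerLeft_comp, Category.assoc]
  rw [h, comp_whiskerRight, whisker_exchange_assoc, MonoidalCategory.tensorHom_def']
  congr 2
  monoidal

lemma pair (hm : m ≫ P.X ◁ m = m ≫ Δ[P.X] ▷ W ≫ (α_ P.X P.X W).hom) (k : P.X ⟶ B)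
    (h : CoRel m f x y) : CoRel m f (pair k x) (pair k y) := by
  unfold CoRel at *
  rw [coaction_pair hm, coaction_pair hm, h]

lemma trans (h : CoRel m f x y) (h' : CoRel m f y z) : CoRel m f x z := Eq.trans h h'

end CoRel

variable [BraidedCategory V] {C D E T : Comon V}

lemma pair_projL (x : P.X ⟶ C.X) (y : P.X ⟶ D.X) (hy : y ≫ ε[D.X] = ε[P.X]) :
    pair x y ≫ (projL C D).hom = x := by
  change pair x y ≫ C.X ◁ ε[D.X] ≫ (ρ_ C.X).hom = x
  rw [← id_tensorHom, reassoc_of% pair_tensorHom, hy, Category.comp_id, pair_counit_right]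

lemma pair_projR (x : P.X ⟶ C.X) (y : P.X ⟶ D.X) (hx : x ≫ ε[C.X] = ε[P.X]) :
    pair x y ≫ (projR C D).hom = y := by
  change pair x y ≫ ε[C.X] ▷ D.X ≫ (λ_ D.X).hom = y
  rw [← tensorHom_id, reassoc_of% pair_tensorHom, hx, Category.comp_id, pair_counit_left]

/-- Although C ⊗ D is not a product, a comonoid map into it commutes with comultiplication and is
therefore determined by its two projections. -/
lemma hom_eq_pair (u : P ⟶ tensorComon C D) :
    u.hom = pair (u ≫ projL C D).hom (u ≫ projR C D).hom := by
  have h := comul_projL_projR C D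
  calc _ = u.hom ≫ Δ[C.X ⊗ D.X] ≫ ((projL C D).hom ⊗ₘ (projR C D).hom) := by
        rw [h]; exact (Category.comp_id _).symm
    _ = _ := by
        rw [IsComonHom.hom_comul_assoc, tensorHom_comp_tensorHom]; rfl

/-- The two components of a comonoid map into C ⊗ D commute up to the braiding. Arbitrary pairs of
maps do not have this property. -/
lemma pair_braiding (u : P ⟶ tensorComon C D) :
    pair (u ≫ projL C D).hom (u ≫ projR C D).hom ≫ (β_ C.X D.X).hom =
      pair (u ≫ projR C D).hom (u ≫ projL C D).hom := by
  rw [← hom_eq_pair, ← comul_projR_projL, IsComonHom.hom_comul_assoc, tensorHom_comp_tensorHom]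
  rfl

@[simp] lemma tensorComonHom_projL (f : C ⟶ E) (g : D ⟶ T) :
    tensorComonHom f g ≫ projL E T = projL C D ≫ f := by
  ext
  change (f.hom ⊗ₘ g.hom) ≫ E.X ◁ ε[T.X] ≫ (ρ_ E.X).hom = (C.X ◁ ε[D.X] ≫ (ρ_ C.X).hom) ≫ f.hom
  have h : g.hom ≫ ε[T.X] = ε[D.X] := IsComonHom.hom_counit _
  rw [← id_tensorHom, tensorHom_comp_tensorHom_assoc, h]
  simp [MonoidalCategory.tensorHom_def']

@[simp] lemma tensorComonHom_projR (f : C ⟶ E) (g : D ⟶ T) :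
    tensorComonHom f g ≫ projR E T = projR C D ≫ g := by
  ext
  change (f.hom ⊗ₘ g.hom) ≫ ε[E.X] ▷ T.X ≫ (λ_ T.X).hom = (ε[C.X] ▷ D.X ≫ (λ_ D.X).hom) ≫ g.hom
  have h : f.hom ≫ ε[E.X] = ε[C.X] := IsComonHom.hom_counit _
  rw [← tensorHom_id, tensorHom_comp_tensorHom_assoc, h]
  simp [MonoidalCategory.tensorHom_def]

end Pairing

/-! ### The idempotent of an evaluation followed by further evaluations -/

section EvalCons

variable {V : Type u} [Category.{v} V] [MonoidalCategory V] [BraidedCategory V]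

namespace Bicomod.EvalData

variable {C R S T : Comon V}

/-- The associator, as an isomorphism of comonoids. -/
def assocComonIso (C D E : Comon V) :
    tensorComon (tensorComon C D) E ≅ tensorComon C (tensorComon D E) := α_ C D E

/-- The tensor product with an evaluation comodule on the left. -/
def cons (C : Comon V) {p : Bicomod T R} (d : EvalData p) :
    EvalData (((Bicomod.tensor (Bicomod.e C) p).mapL (assocComon C (opComon C) T)).mapR
      (lunitComon R)) :=
  (((e C).tensor d).mapL (assocComonIso C (opComon C) T)).mapR (lunitComon R)

lemma assocComonIso_inv_hom (C D E : Comon V) :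
    (assocComonIso C D E).inv.hom = (α_ C.X D.X E.X).inv := by
  change ((α_ C D E).inv : C ⊗ (D ⊗ E) ⟶ _).hom = (α_ C.X D.X E.X).inv
  simp only [Comon.monoidal_associator_inv_hom]
  change C.X ◁ 𝟙 (D.X ⊗ E.X) ≫ (α_ C.X D.X E.X).inv ≫ 𝟙 (C.X ⊗ D.X) ▷ E.X = _
  simp

lemma assocComonIso_hom_hom (C D E : Comon V) :
    (assocComonIso C D E).hom.hom = (α_ C.X D.X E.X).hom := by
  have h : (assocComonIso C D E).inv.hom ≫ (assocComonIso C D E).hom.hom = 𝟙 _ :=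
    congrArg Comon.Hom.hom (assocComonIso C D E).inv_hom_id
  rw [assocComonIso_inv_hom, Iso.inv_comp_eq] at h
  exact h.trans (Category.comp_id _)

/-- The evaluated pair C ⊗ Cᵒ contributes only its counit, so the right-hand comonoid is reached
through the tail alone. -/
lemma cons_w {p : Bicomod T R} (d : EvalData p) :
    (cons C d).w = (projR C _).hom ≫ (projR (opComon C) T).hom ≫ d.w := by
  change ((assocComonIso C (opComon C) T).inv.hom ≫
      (((ε[C.X] ⊗ₘ ε[C.X]) ≫ (λ_ (𝟙_ V)).hom) ⊗ₘ d.w)) ≫ 𝟙 (𝟙_ V) ▷ R.X ≫ (λ_ R.X).hom =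
    (ε[C.X] ▷ (C.X ⊗ T.X) ≫ (λ_ (C.X ⊗ T.X)).hom) ≫ (ε[C.X] ▷ T.X ≫ (λ_ T.X).hom) ≫ d.w
  rw [assocComonIso_inv_hom]
  simp only [MonoidalCategory.tensorHom_def]
  have h := whisker_exchange ε[C.X] d.w
  calc _ = (ε[C.X] ▷ (C.X ⊗ T.X) ≫ 𝟙_ V ◁ (ε[C.X] ▷ T.X ≫ 𝟙_ V ◁ d.w)) ⊗≫ 𝟙 _ := by monoidal
    _ = _ := by monoidal

variable {P : Comon V}

/-- In terms of components the idempotent sends (a, b, t) to (a, a, t'), with t' the image of t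
under the idempotent of the tail: evaluation discards b by the counit and duplicates a. -/
lemma comp_cons_r_i {p : Bicomod T R} (d : EvalData p)
    (u : P ⟶ tensorComon C (tensorComon (opComon C) T)) :
    u.hom ≫ (cons C d).r ≫ (cons C d).i = pair (u ≫ projL _ _).hom (pair (u ≫ projL _ _).hom
      ((u ≫ projR _ _ ≫ projR _ _).hom ≫ d.r ≫ d.i)) := by
  have h1 := hom_eq_pair u
  have h2 := hom_eq_pair (u ≫ projR _ _)
  simp only [Category.assoc] at h2
  have key (a b : P.X ⟶ C.X) (t : P.X ⟶ T.X) (hb : b ≫ ε[C.X] = ε[P.X])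
      (ha : pair a a = a ≫ Δ[C.X]) :
      pair a (pair b t) ≫ ((assocComonIso C (opComon C) T).inv.hom ≫
        ((C.X ◁ ε[C.X] ≫ (ρ_ C.X).hom) ⊗ₘ d.r)) ≫
        (Δ[C.X] ⊗ₘ d.i) ≫ (assocComonIso C (opComon C) T).hom.hom =
          pair a (pair a (t ≫ d.r ≫ d.i)) := by
    rw [assocComonIso_inv_hom, assocComonIso_hom_hom, Category.assoc, reassoc_of% pair_assoc_inv,
      tensorHom_comp_tensorHom_assoc, reassoc_of% pair_tensorHom, Category.assoc, ← id_tensorHom,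
      reassoc_of% pair_tensorHom, hb, Category.comp_id, reassoc_of% pair_counit_right, ← ha,
          pair_assoc]
  refine (congrArg (· ≫ (cons C d).r ≫ (cons C d).i)
    (h1.trans (congrArg (pair _) h2))).trans ?_
  exact key _ _ _ (IsComonHom.hom_counit (u ≫ projR _ _ ≫ projL _ _).hom) (pair_self _)

variable {W Z : V} {m : W ⟶ P.X ⊗ W} {f : W ⟶ Z}

lemma counit_r_i {p : Bicomod T R} (d : EvalData p) : (d.r ≫ d.i) ≫ ε[T.X] = ε[T.X] := by
  rw [← d.r_aug, Category.assoc, reassoc_of% d.i_r]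

/-- Counits on the remaining factors extract each component from the invariance of the triple, which
gives one direction. In the other direction the components are replaced one at a time. -/
lemma coRel_pair_iff (hm : m ≫ P.X ◁ m = m ≫ Δ[P.X] ▷ W ≫ (α_ P.X P.X W).hom)
    {p : Bicomod T R} (d : EvalData p) (a b : P.X ⟶ C.X) (t : P.X ⟶ T.X)
    (h1 : pair a t ≫ (β_ C.X T.X).hom = pair t a) (h2 : pair b t ≫ (β_ C.X T.X).hom = pair t b)
    (ha : a ≫ ε[C.X] = ε[P.X]) (hb : b ≫ ε[C.X] = ε[P.X]) (ht : t ≫ ε[T.X] = ε[P.X]) :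
    CoRel m f (pair a (pair a (t ≫ d.r ≫ d.i))) (pair a (pair b t)) ↔
      CoRel m f a b ∧ CoRel m f (t ≫ d.r ≫ d.i) t := by
  have ht' : (t ≫ d.r ≫ d.i) ≫ ε[T.X] = ε[P.X] := by rw [Category.assoc, counit_r_i, ht]
  constructor
  · intro h
    have h3 := h.comp (projR C (tensorComon C T)).hom
    rw [pair_projR (D := tensorComon C T) _ _ ha, pair_projR (D := tensorComon C T) _ _ ha] at h3
    have h4 := h3.comp (projL C T).hom
    have h5 := h3.comp (projR C T).hom
    rw [pair_projL _ _ ht', pair_projL _ _ ht] at h4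
    rw [pair_projR _ _ ha, pair_projR _ _ hb] at h5
    exact ⟨h4, h5⟩
  · rintro ⟨h3, h4⟩
    -- First t is replaced inside two pairings. The replacement of a by b in a first component is
    -- then made after exchanging it with t by the braiding, so that it concerns a second component.
    refine ((h4.pair hm a).pair hm a).trans (CoRel.pair hm a ?_)
    have h5 := (h3.pair hm t).comp (β_ C.X T.X).inv
    rwa [← h1, ← h2, Category.assoc, Iso.hom_inv_id, Category.comp_id, Category.assoc,
      Iso.hom_inv_id, Category.comp_id] at h5

/-- Invariance under the idempotent of `cons` amounts to invariance under the idempotent of the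
tail and to the agreement of the two coactions which `C` evaluates. -/
lemma coRel_cons_iff (hm : m ≫ P.X ◁ m = m ≫ Δ[P.X] ▷ W ≫ (α_ P.X P.X W).hom)
    {p : Bicomod T R} (d : EvalData p) (u : P ⟶ tensorComon C (tensorComon (opComon C) T)) :
    CoRel m f (u.hom ≫ (cons C d).r ≫ (cons C d).i) u.hom ↔
      CoRel m f (u ≫ projL _ _).hom (u ≫ projR _ _ ≫ projL _ _).hom ∧
      CoRel m f ((u ≫ projR _ _ ≫ projR _ _).hom ≫ d.r ≫ d.i) (u ≫ projR _ _ ≫ projR _ _).hom := by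
  rw [comp_cons_r_i]
  have h1 := hom_eq_pair u
  have h2 := hom_eq_pair (u ≫ projR _ _)
  have h3 := pair_braiding (u ≫ tensorComonHom (𝟙 C) (projR (opComon C) T))
  simp only [Category.assoc, tensorComonHom_projL, tensorComonHom_projR, Category.comp_id] at h2 h3
  have h4 : pair (u ≫ projR C (tensorComon (opComon C) T) ≫ projL (opComon C) T).hom
      (u ≫ projR C (tensorComon (opComon C) T) ≫ projR (opComon C) T).hom ≫ (β_ C.X T.X).hom =
    pair (u ≫ projR C (tensorComon (opComon C) T) ≫ projR (opComon C) T).hom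
      (u ≫ projR C (tensorComon (opComon C) T) ≫ projL (opComon C) T).hom := by
    have h := pair_braiding (u ≫ projR C (tensorComon (opComon C) T))
    simp only [Category.assoc] at h
    exact h
  have h5 := h1.trans (congrArg (pair _) h2)
  have hεa : (u ≫ projL C (tensorComon (opComon C) T)).hom ≫ ε[C.X] = ε[P.X] :=
    IsComonHom.hom_counit _
  have hεb : (u ≫ projR C (tensorComon (opComon C) T) ≫ projL (opComon C) T).hom ≫
      ε[C.X] = ε[P.X] :=
    IsComonHom.hom_counit (u ≫ projR C (tensorComon (opComon C) T) ≫ projL (opComon C) T).hom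
  have hεt : (u ≫ projR C (tensorComon (opComon C) T) ≫ projR (opComon C) T).hom ≫
      ε[T.X] = ε[P.X] := IsComonHom.hom_counit _
  change CoRel (A := C.X ⊗ (C.X ⊗ T.X)) m f _ _ ↔ CoRel (A := C.X) m f _ _ ∧ _
  rw [h5]
  revert h3 h4 hεa hεb hεt
  generalize (u ≫ projL C (tensorComon (opComon C) T)).hom = a
  generalize (u ≫ projR C (tensorComon (opComon C) T) ≫ projR (opComon C) T).hom = t
  generalize (u ≫ projR C (tensorComon (opComon C) T) ≫ projL (opComon C) T).hom = b
  exact coRel_pair_iff hm d a b t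

end Bicomod.EvalData
end EvalCons

/-! ### The walls of a list, as pairs of projections -/

section ChainCells

variable {V : Type u} [Category.{v} V] [MonoidalCategory V] [BraidedCategory V]

open Bicomod

namespace Chain

/-- The augmented idempotent which presents `e ⊗ … ⊗ e ⊗ Cₙ`. -/
def tailData : {c d : Comon V} → (l : Chain c d) → EvalData (evTail l)
  | _, d, single _ => EvalData.regular d
  | _, _, @cons _ _ _ _ _ e _ _ l => EvalData.cons e (tailData l)

/-- The augmented idempotent which presents `p`. -/
def evData {c d : Comon V} (l : Chain c d) : EvalData (ev l) :=
  (EvalData.regular (opComon c)).tensor (tailData l)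

lemma tailData_aug {c d : Comon V} (l : Chain c d) : (tailData l).aug = augTail l := by
  induction l with
  | single X => rfl
  | cons X l ih =>
    change (_ ⊗ₘ (tailData l).aug) ≫ _ = _
    rw [ih]
    rfl

lemma evData_aug {c d : Comon V} (l : Chain c d) : (evData l).aug = aug l := by
  change (_ ⊗ₘ (tailData l).aug) ≫ _ = _
  rw [tailData_aug]
  rfl

/-- The projection to the last comonoid. -/
def last {c d : Comon V} (l : Chain c d) : (tail l).X ⟶ d.X := (tailData l).w

lemma last_cons {c e d : Comon V} (X : EndoComod c e) (l : Chain e d) :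
    last (cons X l) = (projR e (tensorComon (opComon e) (tail l))).hom ≫
      (projR (opComon e) (tail l)).hom ≫ last l :=
  EvalData.cons_w _

/-- The pairs of projections to the comonoids `Cᵢ` and `Cᵢᵒ`, for `0 < i < n`. -/
inductive TailWall : {c d : Comon V} → (l : Chain c d) → (e : Comon V) →
    ((tail l).X ⟶ e.X) → ((tail l).X ⟶ e.X) → Prop
  | mid {c e d : Comon V} (X : EndoComod c e) (l : Chain e d) :
      TailWall (cons X l) e (projL e (tensorComon (opComon e) (tail l))).hom
        ((projR e (tensorComon (opComon e) (tail l))).hom ≫ (projL (opComon e) (tail l)).hom)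
  | tail {c e d : Comon V} (X : EndoComod c e) {l : Chain e d} {e' : Comon V}
      {x y : (tail l).X ⟶ e'.X} (h : TailWall l e' x y) :
      TailWall (cons X l) e'
        ((projR e (tensorComon (opComon e) (tail l))).hom ≫ (projR (opComon e) (tail l)).hom ≫ x)
        ((projR e (tensorComon (opComon e) (tail l))).hom ≫ (projR (opComon e) (tail l)).hom ≫ y)

lemma coRel_comp_proj_proj {P C D T : Comon V} {E W Z : V} {m : W ⟶ P.X ⊗ W} {f : W ⟶ Z}
    (u : P ⟶ tensorComon C (tensorComon D T)) (x y : T.X ⟶ E) :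
    CoRel m f ((u ≫ projR C (tensorComon D T) ≫ projR D T).hom ≫ x)
        ((u ≫ projR C (tensorComon D T) ≫ projR D T).hom ≫ y) ↔
      CoRel m f (u.hom ≫ (projR C (tensorComon D T)).hom ≫ (projR D T).hom ≫ x)
        (u.hom ≫ (projR C (tensorComon D T)).hom ≫ (projR D T).hom ≫ y) := by
  have h (x : T.X ⟶ E) : (u ≫ projR C (tensorComon D T) ≫ projR D T).hom ≫ x =
      u.hom ≫ (projR C (tensorComon D T)).hom ≫ (projR D T).hom ≫ x := by
    change (u.hom ≫ (projR C (tensorComon D T)).hom ≫ (projR D T).hom) ≫ x = _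
    simp only [Category.assoc]
  rw [h, h]

lemma proj_proj_counit {C D T E : Comon V} (x : T.X ⟶ E.X) (h : x ≫ ε[E.X] = ε[T.X]) :
    ((projR C (tensorComon D T)).hom ≫ (projR D T).hom ≫ x) ≫ ε[E.X] =
      ε[(tensorComon C (tensorComon D T)).X] := by
  rw [Category.assoc, Category.assoc, h]
  exact (congrArg (_ ≫ ·) (IsComonHom.hom_counit (projR D T).hom)).trans (IsComonHom.hom_counit _)

lemma last_counit {c d : Comon V} (l : Chain c d) : last l ≫ ε[d.X] = ε[(tail l).X] := by
  induction l with
  | single X => exact Category.id_comp _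
  | @cons c e d X l ih =>
    rw [last_cons]
    exact proj_proj_counit _ ih

section

variable {P : Comon V} {W Z : V} {m : W ⟶ P.X ⊗ W} {f : W ⟶ Z}
  (hm : m ≫ P.X ◁ m = m ≫ Δ[P.X] ▷ W ≫ (α_ P.X P.X W).hom)
include hm

/-- The map u is arbitrary so that the induction hypothesis applies to its composite with the
projections to the shorter tail. -/
lemma coRel_of_tailWall {c d : Comon V} {l : Chain c d} {e : Comon V} {x y : (tail l).X ⟶ e.X}
    (h : TailWall l e x y) (u : P ⟶ tail l)
    (hu : CoRel m f (u.hom ≫ (tailData l).r ≫ (tailData l).i) u.hom) :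
    CoRel m f (u.hom ≫ x) (u.hom ≫ y) := by
  induction h with
  | mid X l => exact ((EvalData.coRel_cons_iff hm (tailData l) u).1 hu).1
  | @tail c e d X l e' x y h ih =>
    have h1 := ih (u ≫ projR _ _ ≫ projR _ _) ((EvalData.coRel_cons_iff hm (tailData _) u).1 hu).2
    exact (coRel_comp_proj_proj u x y).1 h1

/-- This is the converse of `coRel_of_tailWall`: each evaluation contributes exactly one wall, so
agreement on all walls builds up invariance under the whole idempotent. -/
lemma coRel_tail {c d : Comon V} (l : Chain c d) (u : P ⟶ tail l)
    (hu : ∀ e x y, TailWall l e x y → CoRel m f (u.hom ≫ x) (u.hom ≫ y)) :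
    CoRel m f (u.hom ≫ (tailData l).r ≫ (tailData l).i) u.hom := by
  induction l with
  | single X =>
    have h : u.hom ≫ 𝟙 _ ≫ 𝟙 _ = u.hom := by
      rw [Category.id_comp, Category.comp_id]
    exact congrArg (fun k => m ≫ P.X ◁ f ≫ k ▷ Z) h
  | cons X l ih =>
    refine (EvalData.coRel_cons_iff hm (tailData l) u).2 ⟨hu _ _ _ (.mid X l), ?_⟩
    refine ih (u ≫ projR _ _ ≫ projR _ _) (fun e x y h => ?_)
    exact (coRel_comp_proj_proj u x y).2 (hu _ _ _ (.tail X h))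

end

end Chain
end ChainCells

/-! ### 2-cells p ∘ (X₁ ⊗ … ⊗ Xₙ) ⇒ Z ∘ p as cells -/

section TotalObjects

variable {V : Type u} [Category.{v} V] [MonoidalCategory V] [BraidedCategory V]
  [HasCoreflexiveEqualizers V] [∀ Z : V, PreservesCoreflexiveEqualizers (tensorLeft Z)]

open Bicomod

lemma tw_iff {a b e : ComodBicat V} {M N : a ⟶ b} {f : M ⟶ N} {φ : M ⟶ CentralAction.act e M}
    {ψ : N ⟶ CentralAction.act e N} : Walled.Tw f φ ψ ↔
      Bicomod.Hom.hom φ ≫ e.base.X ◁ Bicomod.Hom.hom f = Bicomod.Hom.hom f ≫ Bicomod.Hom.hom ψ :=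
  ⟨fun h => congrArg Bicomod.Hom.hom h, fun h => Bicomod.Hom.ext h⟩

namespace Chain

/-- A comodule `Cᵒ ⊗ C' ⇸ Cᵒ ⊗ C'` as a 1-cell with coactions. -/
abbrev endoObj {c d : Comon V} (X : EndoComod c d) : Walled (⟨c⟩ : ComodBicat V) ⟨d⟩ where
  obj := bd X
  lo := coact X (projL (opComon c) d).hom
  l := coact X (projR (opComon c) d).hom
  bal _ _ _ := False

lemma endoObj_plain {c d : Comon V} (X : EndoComod c d) : (endoObj X).Plain := fun _ _ _ h => h

/-- `X₁ ⊗_{C₁} … ⊗ Xₙ` as a 1-cell with coactions and with a wall for each `Cᵢ`, `0 < i < n`. -/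
noncomputable abbrev totObj {c d : Comon V} (l : Chain c d) : Walled (⟨c⟩ : ComodBicat V) ⟨d⟩ where
  obj := bd (tot l)
  lo := coact (tot l) (projL (opComon c) (tail l)).hom
  l := coact (tot l) ((projR (opComon c) (tail l)).hom ≫ last l)
  bal e φ ψ := ∃ x y, TailWall l e.base x y ∧
    φ = coact (tot l) ((projR (opComon c) (tail l)).hom ≫ x) ∧
    ψ = coact (tot l) ((projR (opComon c) (tail l)).hom ≫ y)

lemma evData_r_i {c d : Comon V} (l : Chain c d) : (evData l).r ≫ (evData l).i =
    (c.X ◁ ((tailData l).r ≫ (tailData l).i) : c.X ⊗ (tail l).X ⟶ c.X ⊗ (tail l).X) := by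
  change (𝟙 c.X ⊗ₘ (tailData l).r) ≫ (𝟙 c.X ⊗ₘ (tailData l).i) = _
  rw [tensorHom_comp_tensorHom, Category.comp_id, id_tensorHom]

lemma evData_w {c d : Comon V} (l : Chain c d) : (evData l).w =
    (c.X ◁ last l : c.X ⊗ (tail l).X ⟶ c.X ⊗ d.X) :=
  id_tensorHom _ _

/-- The idempotent for p is the identity of C₀ tensored with the idempotent of the tail, so the
first comonoid imposes no condition and only inner walls remain. -/
lemma evData_inv_iff {c d : Comon V} (l : Chain c d) {W Z : V}
    {m : W ⟶ (tensorComon (opComon c) (tail l)).X ⊗ W} {f : W ⟶ Z}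
    (hm : m ≫ (tensorComon (opComon c) (tail l)).X ◁ m =
      m ≫ Δ[(tensorComon (opComon c) (tail l)).X] ▷ W ≫ (α_ _ _ W).hom) :
    CoRel m f ((evData l).r ≫ (evData l).i) (𝟙 _) ↔
      ∀ e x y, TailWall l e x y → CoRel m f ((projR (opComon c) (tail l)).hom ≫ x)
        ((projR (opComon c) (tail l)).hom ≫ y) := by
  have h1 : (projR (opComon c) (tail l)).hom ≫ (tailData l).r ≫ (tailData l).i =
      ((evData l).r ≫ (evData l).i) ≫ (projR (opComon c) (tail l)).hom := by
    rw [evData_r_i]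
    change (ε[c.X] ▷ (tail l).X ≫ (λ_ (tail l).X).hom) ≫ _ =
      c.X ◁ _ ≫ ε[c.X] ▷ (tail l).X ≫ (λ_ (tail l).X).hom
    rw [Category.assoc, ← leftUnitor_naturality, whisker_exchange_assoc]
  constructor
  · intro h e x y hw
    refine coRel_of_tailWall hm hw _ ?_
    have h2 := h.comp (projR (opComon c) (tail l)).hom
    rw [Category.id_comp] at h2
    rw [h1]
    exact h2
  · intro h
    -- Pairing with the projection to C₀ᵒ restores the factor forgotten by projecting to the tail;
    -- the two projections together form the identity.
    have h2 := CoRel.pair hm (projL (opComon c) (tail l)).hom (coRel_tail hm l _ h)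
    have h3 : pair (projL (opComon c) (tail l)).hom (projR (opComon c) (tail l)).hom = 𝟙 _ :=
      comul_projL_projR _ _
    have h4 : pair (projL (opComon c) (tail l)).hom ((projR (opComon c) (tail l)).hom ≫
        (tailData l).r ≫ (tailData l).i) = (evData l).r ≫ (evData l).i := by
      have h := pair_tensorHom (projL (opComon c) (tail l)).hom (projR (opComon c) (tail l)).hom
        (𝟙 _) ((tailData l).r ≫ (tailData l).i)
      rw [Category.comp_id] at h
      rw [← h, h3, Category.id_comp, evData_r_i, id_tensorHom]
    rw [h3, h4] at h2
    exact h2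

/-- A coaction of C₀ᵒ ⊗ Cₙ consists of two coactions, and w is the pairing of the projections to C₀ᵒ
and to Cₙ. These are the two outer coactions of the total object. -/
lemma evData_lin_iff {c d : Comon V} (l : Chain c d) {W : V}
    {m : W ⟶ (tensorComon (opComon c) (tail l)).X ⊗ W} (Z : EndoComod c d) {f : W ⟶ Z.X}
    (hm : m ≫ (tensorComon (opComon c) (tail l)).X ◁ m =
      m ≫ Δ[(tensorComon (opComon c) (tail l)).X] ▷ W ≫ (α_ _ _ W).hom) :
    m ≫ _ ◁ f ≫ (evData l).w ▷ Z.X = f ≫ Z.lact ↔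
      (m ≫ _ ◁ f ≫ (projL (opComon c) (tail l)).hom ▷ Z.X =
        f ≫ Z.lact ≫ (projL (opComon c) d).hom ▷ Z.X) ∧
      (m ≫ _ ◁ f ≫ ((projR (opComon c) (tail l)).hom ≫ last l) ▷ Z.X =
        f ≫ Z.lact ≫ (projR (opComon c) d).hom ▷ Z.X) := by
  have h1 : (evData l).w ≫ (projL (opComon c) d).hom = (projL (opComon c) (tail l)).hom := by
    rw [evData_w]
    change c.X ◁ last l ≫ c.X ◁ ε[d.X] ≫ (ρ_ c.X).hom = c.X ◁ ε[(tail l).X] ≫ (ρ_ c.X).hom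
    rw [← MonoidalCategory.whiskerLeft_comp_assoc, last_counit]
  have h2 : (evData l).w ≫ (projR (opComon c) d).hom =
      (projR (opComon c) (tail l)).hom ≫ last l := by
    rw [evData_w]
    change c.X ◁ last l ≫ ε[c.X] ▷ d.X ≫ (λ_ d.X).hom =
      (ε[c.X] ▷ (tail l).X ≫ (λ_ (tail l).X).hom) ≫ last l
    rw [Category.assoc, ← leftUnitor_naturality, whisker_exchange_assoc]
  constructor
  · intro h
    have h' := reassoc_of% h
    rw [← h1, ← h2]
    exact ⟨by rw [comp_whiskerRight, h'], by rw [comp_whiskerRight, h']⟩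
  · rintro ⟨h3, h4⟩
    have h5 : (evData l).w =
        pair (projL (opComon c) (tail l)).hom ((projR (opComon c) (tail l)).hom ≫ last l) := by
      have h := pair_tensorHom (projL (opComon c) (tail l)).hom (projR (opComon c) (tail l)).hom
        (𝟙 _) (last l)
      have h' : pair (projL (opComon c) (tail l)).hom (projR (opComon c) (tail l)).hom = 𝟙 _ :=
        comul_projL_projR _ _
      rw [Category.comp_id, h', Category.id_comp, id_tensorHom] at h
      rw [evData_w]
      exact h
    have h6 : pair (projL (opComon c) d).hom (projR (opComon c) d).hom = 𝟙 _ :=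
      comul_projL_projR _ _
    -- Applied to Z itself, where the pairing of the two projections is the identity, this splits
    -- the coaction of Z into two successive ones.
    have h7 := CoRel.coaction_pair (f := 𝟙 Z.X) Z.lact_coassoc (projL (opComon c) d).hom
      (projR (opComon c) d).hom
    rw [h6] at h7
    simp only [MonoidalCategory.whiskerLeft_id, id_whiskerRight, Category.comp_id,
      Category.id_comp] at h7
    have h3' := reassoc_of% h3
    rw [h5, h7, CoRel.coaction_pair hm, h4]
    simp only [MonoidalCategory.whiskerLeft_comp, Category.assoc]
    rw [← associator_inv_naturality_left, whisker_exchange_assoc, whisker_exchange_assoc, h3']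
    rw [← whisker_exchange_assoc, ← whisker_exchange_assoc, associator_inv_naturality_left]

/-- The map underlying a 2-cell, as the map given by the augmented idempotent. -/
lemma map_hom {c d : Comon V} {l : Chain c d} {Z : EndoComod c d} (s : Cell l Z) :
    s.map.hom = (evData l).under s := by
  unfold Cell.map
  rw [← evData_aug]
  rfl

lemma Cell.map_injective {c d : Comon V} {l : Chain c d} {Z : EndoComod c d} {s t : Cell l Z}
    (h : s.map = t.map) : s = t := by
  apply (evData l).under_injective
  rw [← map_hom, ← map_hom, h]

/-- Linearity along w is compatibility with the outer coactions, and invariance under the idempotent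
is equality along the walls. The right coactions are already respected, since f is a map of
comodules C₀ ⇸ Cₙ. -/
lemma isCell_iff {c d : Comon V} {l : Chain c d} {Z : EndoComod c d} (f : bd (tot l) ⟶ bd Z)
    (g : (tot l).X ⟶ Z.X) (hg : f.hom = g) : Walled.IsCell (totObj l) (endoObj Z) f ↔
      (tot l).lact ≫ _ ◁ g ≫ (evData l).w ▷ Z.X = g ≫ Z.lact ∧
      (tot l).lact ≫ _ ◁ g ≫ ((evData l).r ≫ (evData l).i) ▷ Z.X = (tot l).lact ≫ _ ◁ g := by
  have h0 {E : Comon V} (x : (tensorComon (opComon c) (tail l)).X ⟶ E.X) :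
      ((tot l).lact ≫ x ▷ (tot l).X) ≫ E.X ◁ g = (tot l).lact ≫ _ ◁ g ≫ x ▷ Z.X := by
    rw [Category.assoc, whisker_exchange]
  have h1 : (tot l).lact ≫ _ ◁ g ≫ ((evData l).r ≫ (evData l).i) ▷ Z.X =
      (tot l).lact ≫ _ ◁ g ↔ CoRel (tot l).lact g ((evData l).r ≫ (evData l).i) (𝟙 _) := by
    unfold CoRel
    rw [id_whiskerRight, Category.comp_id]
  rw [h1, evData_inv_iff l (tot l).lact_coassoc, evData_lin_iff l Z (tot l).lact_coassoc]
  have tw {E : Comon V} (x : (tensorComon (opComon c) (tail l)).X ⟶ E.X)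
      (y : (tensorComon (opComon c) d).X ⟶ E.X) :
      Walled.Tw (e := (⟨E⟩ : ComodBicat V)) f (coact (tot l) x) (coact Z y) ↔
        (tot l).lact ≫ _ ◁ g ≫ x ▷ Z.X = g ≫ Z.lact ≫ y ▷ Z.X := by
    rw [tw_iff, ← h0, ← hg]
    rfl
  constructor
  · intro h
    refine ⟨⟨(tw _ _).1 h.lo, (tw _ _).1 h.l⟩, fun e x y hw => ?_⟩
    have h2 := h.bal_eq (endoObj_plain Z) (e := ⟨e⟩) ⟨x, y, hw, rfl, rfl⟩
    have h3 := congrArg Bicomod.Hom.hom h2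
    unfold CoRel
    rw [← h0, ← h0, ← hg]
    exact h3
  · rintro ⟨⟨h2, h3⟩, h4⟩
    refine ⟨(tw _ _).2 h2, (tw _ _).2 h3, ?_⟩
    rintro e _ _ ⟨x, y, hw, rfl, rfl⟩
    refine Or.inl (Bicomod.Hom.ext ?_)
    have h5 := h4 _ _ _ hw
    unfold CoRel at h5
    rw [← h0, ← h0, ← hg] at h5
    exact h5

/-- The map underlying a 2-cell respects the coactions and the walls. -/
lemma Cell.isCell {c d : Comon V} {l : Chain c d} {Z : EndoComod c d} (s : Cell l Z) :
    Walled.IsCell (totObj l) (endoObj Z) s.map :=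
  (isCell_iff s.map _ (map_hom s)).2 ⟨(evData l).under_lin s, (evData l).under_inv s⟩

/-- A map which respects the coactions and the walls underlies a 2-cell. -/
lemma exists_cell {c d : Comon V} {l : Chain c d} {Z : EndoComod c d} (f : bd (tot l) ⟶ bd Z)
    (hf : Walled.IsCell (totObj l) (endoObj Z) f) : ∃ s : Cell l Z, s.map = f := by
  obtain ⟨h1, h2⟩ := (isCell_iff f _ rfl).1 hf
  obtain ⟨s, hs⟩ := (evData l).exists_under f.hom (bd_hom_ract f _ rfl) h1 h2
  exact ⟨s, Bicomod.Hom.ext (by rw [map_hom, hs])⟩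

/-- The augmentation acts on p and the comodule map acts on Z, so they interchange. This transports
the factorizations in the definition of a Kan extension to underlying maps. -/
lemma Cell.map_comp {c d : Comon V} {l : Chain c d} {Z Z' : EndoComod c d} (s : Cell l Z)
    (f : Z ⟶ Z') : Cell.map (s ≫ compMap (𝟙 (ev l)) f) = s.map ≫ bdHom f := by
  apply Bicomod.Hom.ext
  have h := whiskerL_hom_ι (ev l) f
  change (s.hom ≫ (compMap (𝟙 (ev l)) f).hom) ≫ (compι _ _).hom ≫ aug l ▷ Z'.X ≫ (λ_ Z'.X).hom =
    (s.hom ≫ (compι _ _).hom ≫ aug l ▷ Z.X ≫ (λ_ Z.X).hom) ≫ f.hom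
  simp only [Category.assoc]
  rw [reassoc_of% h, whisker_exchange_assoc, leftUnitor_naturality]

/-- A list of length one has no walls, and its projection to the last comonoid is an identity, so
only the form of the second coaction differs. -/
lemma isCell_single_iff {c d : Comon V} {Y Z : EndoComod c d} (f : bd Y ⟶ bd Z) :
    Walled.IsCell (totObj (single Y)) (endoObj Z) f ↔ Walled.IsCell (endoObj Y) (endoObj Z) f := by
  have h : coact Y ((projR (opComon c) d).hom ≫ last (single Y)) =
      coact Y (projR (opComon c) d).hom := by
    have h : (projR (opComon c) d).hom ≫ last (single Y) = (projR (opComon c) d).hom :=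
      Category.comp_id _
    exact congrArg (coact Y) h
  have hl : Walled.Tw f (totObj (single Y)).l (endoObj Z).l ↔
      Walled.Tw f (endoObj Y).l (endoObj Z).l := by
    have h' := congrArg Bicomod.Hom.hom h
    exact (tw_iff.trans (Eq.to_iff (congrArg (fun k => k ≫ d.X ◁ Bicomod.Hom.hom f = _) h'))).trans
      tw_iff.symm
  refine ⟨fun hf => ⟨hf.lo, hl.1 hf.l, fun _ _ _ h => h.elim⟩, fun hf => ⟨hf.lo, hl.2 hf.l, ?_⟩⟩
  rintro e _ _ ⟨x, y, hw, -, -⟩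
  cases hw

/-- For a list of length one both w and the idempotent are identities, so `isCell_iff` leaves just
left colinearity. -/
lemma isCell_endo_iff {c d : Comon V} {Y Z : EndoComod c d} (f : bd Y ⟶ bd Z)
    (g : Y.X ⟶ Z.X) (hg : f.hom = g) : Walled.IsCell (endoObj Y) (endoObj Z) f ↔
      Y.lact ≫ _ ◁ g = g ≫ Z.lact := by
  have h1 : (evData (single Y)).w = 𝟙 _ :=
    (evData_w (single Y)).trans (MonoidalCategory.whiskerLeft_id _ _)
  have h2 : (evData (single Y)).r ≫ (evData (single Y)).i = 𝟙 _ := by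
    refine (evData_r_i (single Y)).trans ?_
    refine (congrArg (fun k => _ ◁ k) (Category.id_comp _)).trans ?_
    exact MonoidalCategory.whiskerLeft_id _ _
  have h3 (q : (tensorComon (opComon c) d).X ⟶ (tensorComon (opComon c) d).X) (hq : q = 𝟙 _) :
      Y.lact ≫ _ ◁ g ≫ q ▷ Z.X = Y.lact ≫ _ ◁ g := by
    rw [hq, id_whiskerRight, Category.comp_id]
  rw [← isCell_single_iff, isCell_iff (l := single Y) f g hg]
  exact ⟨fun h => (h3 _ h1).symm.trans h.1, fun h => ⟨(h3 _ h1).trans h, h3 _ h2⟩⟩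

/-- Comodule maps are maps of 1-cells with coactions. -/
lemma isCell_bdHom {c d : Comon V} {Y Z : EndoComod c d} (f : Y ⟶ Z) :
    Walled.IsCell (endoObj Y) (endoObj Z) (bdHom f) :=
  (isCell_endo_iff _ f.hom rfl).2 f.left

lemma exists_bdHom {c d : Comon V} {Y Z : EndoComod c d} (f : bd Y ⟶ bd Z)
    (hf : Walled.IsCell (endoObj Y) (endoObj Z) f) : ∃ g : Y ⟶ Z, bdHom g = f :=
  ⟨⟨f.hom, (isCell_endo_iff _ f.hom rfl).1 hf, bd_hom_ract f _ rfl⟩, rfl⟩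

lemma bdHom_injective {c d : Comon V} {Y Z : EndoComod c d} {f g : Y ⟶ Z}
    (h : bdHom f = bdHom g) : f = g :=
  Bicomod.Hom.ext (congrArg Bicomod.Hom.hom h :)

end Chain
end TotalObjects

/-! ### Isomorphisms compatible with coactions and walls -/

section CellIsos

universe w₁ v₁ u₁

local infixr:81 " ◃ " => Bicategory.whiskerLeft
local infixl:81 " ▹ " => Bicategory.whiskerRight
local notation "𝖺" => Bicategory.associator

namespace Walled

variable {B : Type u₁} [Bicategory.{w₁, v₁} B] [CentralAction B] {a b c d : B}

/-- Isomorphisms which respect the coactions and the walls in both directions. -/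
structure IsCellIso (W W' : Walled a b) (f : W.obj ≅ W'.obj) : Prop where
  hom : IsCell W W' f.hom
  inv : IsCell W' W f.inv

namespace IsCellIso

variable {W W' W'' : Walled a b}

lemma symm {f : W.obj ≅ W'.obj} (h : IsCellIso W W' f) : IsCellIso W' W f.symm := ⟨h.inv, h.hom⟩

lemma trans {f : W.obj ≅ W'.obj} {g : W'.obj ≅ W''.obj} (h : IsCellIso W W' f)
    (h' : IsCellIso W' W'' g) : IsCellIso W W'' (f ≪≫ g) :=
  ⟨h.hom.comp h'.hom, h'.inv.comp h.inv⟩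

lemma whiskerLeft (L : Walled a b) {W W' : Walled b c} {f : W.obj ≅ W'.obj}
    (h : IsCellIso W W' f) :
    IsCellIso (L.tensor W) (L.tensor W') (Bicategory.whiskerLeftIso L.obj f) :=
  ⟨h.hom.whiskerLeft L, h.inv.whiskerLeft L⟩

lemma whiskerRight {W W' : Walled a b} {f : W.obj ≅ W'.obj} (h : IsCellIso W W' f)
    (R : Walled b c) :
    IsCellIso (W.tensor R) (W'.tensor R) (Bicategory.whiskerRightIso f R.obj) :=
  ⟨h.hom.whiskerRight R, h.inv.whiskerRight R⟩

lemma assoc (X : Walled a b) (Y : Walled b c) (Z : Walled c d) :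
    IsCellIso ((X.tensor Y).tensor Z) (X.tensor (Y.tensor Z)) (𝖺 X.obj Y.obj Z.obj) :=
  ⟨.assocHom X Y Z, .assocInv X Y Z⟩

end IsCellIso
end Walled
end CellIsos

/-! ### Coactions and walls of X ⊗_C Y -/

section Cotensors

variable {V : Type u} [Category.{v} V] [MonoidalCategory V] [BraidedCategory V]

/-- Projecting P ⊗ Q to P applies the counit to the coaction of Y, which therefore disappears. The
same happens with the roles exchanged in the next lemma, where E must in addition be moved past X.
-/
lemma tensorμ_projL_left {P Q : Comon V} {X Y E : V} (l : X ⟶ P.X ⊗ X) (m : Y ⟶ Q.X ⊗ Y)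
    (hm : m ≫ ε[Q.X] ▷ Y = (λ_ Y).inv) (x : P.X ⟶ E) :
    (l ⊗ₘ m) ≫ tensorμ P.X X Q.X Y ≫ ((projL P Q).hom ≫ x) ▷ (X ⊗ Y) =
      (l ≫ x ▷ X) ▷ Y ≫ (α_ E X Y).hom := by
  change _ ≫ _ ≫ ((P.X ◁ ε[Q.X] ≫ (ρ_ P.X).hom) ≫ x) ▷ _ = _
  have h := tensorμ_whiskerRight (X₂ := X) (Y₂ := Y) (𝟙 P.X) ε[Q.X]
  rw [id_tensorHom] at h
  rw [comp_whiskerRight, comp_whiskerRight, Category.assoc, reassoc_of% h,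
    tensorHom_comp_tensorHom_assoc, hm, tensorμ, MonoidalCategory.tensorHom_def,
    braiding_tensorUnit_right]
  simp only [id_whiskerRight, Category.comp_id, comp_whiskerRight, Category.assoc]
  calc _ = l ▷ Y ⊗≫ x ▷ (X ⊗ Y) := by monoidal
    _ = _ := by monoidal

lemma tensorμ_projR_left {P Q : Comon V} {X Y E : V} (l : X ⟶ P.X ⊗ X) (m : Y ⟶ Q.X ⊗ Y)
    (hl : l ≫ ε[P.X] ▷ X = (λ_ X).inv) (y : Q.X ⟶ E) :
    (l ⊗ₘ m) ≫ tensorμ P.X X Q.X Y ≫ ((projR P Q).hom ≫ y) ▷ (X ⊗ Y) =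
      X ◁ (m ≫ y ▷ Y) ≫ Bicomod.past X E Y := by
  change _ ≫ _ ≫ ((ε[P.X] ▷ Q.X ≫ (λ_ Q.X).hom) ≫ y) ▷ _ = _
  have h := tensorμ_whiskerRight (X₂ := X) (Y₂ := Y) ε[P.X] (𝟙 Q.X)
  rw [tensorHom_id] at h
  have h2 := congrArg (· ▷ Y) (BraidedCategory.braiding_naturality_right X y)
  simp only [comp_whiskerRight] at h2
  rw [comp_whiskerRight, comp_whiskerRight, Category.assoc, reassoc_of% h,
    tensorHom_comp_tensorHom_assoc, hl, tensorμ, MonoidalCategory.tensorHom_def']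
  unfold Bicomod.past
  calc _ = X ◁ m ⊗≫ ((β_ X Q.X).hom ▷ Y ≫ y ▷ X ▷ Y) ⊗≫ 𝟙 _ := by
        simp only [id_whiskerRight, Category.comp_id]
        monoidal
    _ = _ := by
        rw [← h2]; monoidal

/-- Two coactions on a subobject are compared after the inclusion tensored with E, which is monic;
there they are restrictions of a coaction on the ambient object. -/
lemma restrict_coaction {K N P Q E : V} (i : K ⟶ N) [Mono (E ◁ i)] (l : K ⟶ P ⊗ K)
    (m : N ⟶ P ⊗ N) (h : l ≫ P ◁ i = i ≫ m) (z : P ⟶ E) (f : K ⟶ Q) (s : Q ⟶ E ⊗ K) (k : N ⟶ E ⊗ N)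
    (hs : f ≫ s ≫ E ◁ i = i ≫ k) (hk : m ≫ z ▷ N = k) :
    (l ≫ z ▷ K) ≫ E ◁ 𝟙 K = 𝟙 K ≫ f ≫ s := by
  rw [← cancel_mono (E ◁ i), MonoidalCategory.whiskerLeft_id, Category.comp_id, Category.id_comp,
    Category.assoc, Category.assoc, hs, ← hk, ← whisker_exchange, reassoc_of% h]

variable [HasCoreflexiveEqualizers V] [∀ Z : V, PreservesCoreflexiveEqualizers (tensorLeft Z)]

namespace Bicomod

variable {P Q a b c : Comon V}

lemma cot_lact (X : Bicomod P (tensorComon (opComon a) c))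
    (Y : Bicomod Q (tensorComon (opComon c) b)) :
    (cot X Y).lact ≫ (P.X ⊗ Q.X) ◁ cotι X Y =
      cotι X Y ≫ (X.lact ⊗ₘ Y.lact) ≫ tensorμ P.X X.X Q.X Y.X :=
  @sub_lact V _ _ _ _ _ _ _ (tensor (X.mapR (projL (opComon a) c)) (Y.mapR (projR (opComon c) b)))
    _ (cotL X Y) (cotR X Y) (isCoreflexivePair_cot X Y) _ _

/-- Both coactions restrict the coaction of X on X ⊗ Y. One is obtained through the tensor comonoid
and its projection, the other through the strength of E ⊗ -. -/
lemma cotIso_tw_left (X : Bicomod P (tensorComon (opComon a) c))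
    (Y : Bicomod Q (tensorComon (opComon c) b)) {E : Comon V} (x : P.X ⟶ E.X) :
    Walled.Tw (B := ComodBicat V) (a := ⟨a⟩) (b := ⟨b⟩) (e := ⟨E⟩) (cotIso X Y).hom
      (coact (cot X Y) ((projL P Q).hom ≫ x))
      (Walled.coL (a := (⟨a⟩ : ComodBicat V)) (b := ⟨c⟩) (c := ⟨b⟩) (e := ⟨E⟩) (X := bd X)
        (coact X x) (bd Y)) := by
  refine tw_iff.2 ?_
  have : Mono (E.X ◁ cotι X Y) := mono_compι_wl (bd X) (bd Y) E.X
  have h1 : (strR E.X (bd X) (bd Y)).hom ≫ E.X ◁ cotι X Y =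
    (compι (actObj E.X (bd X)) (bd Y)).hom ≫ (α_ E.X X.X Y.X).hom := strR_hom_ι _ _ _
  have h2 : (compMap (coact X x) (𝟙 (bd Y))).hom ≫ (compι (actObj E.X (bd X)) (bd Y)).hom =
    cotι X Y ≫ (X.lact ≫ x ▷ X.X) ▷ Y.X := whiskerR_hom_ι _ _
  have h3 := (congrArg ((compMap (coact X x) (𝟙 (bd Y))).hom ≫ ·) h1).trans
    ((Category.assoc _ _ _).symm.trans (congrArg (· ≫ (α_ E.X X.X Y.X).hom) h2))
  exact restrict_coaction (cotι X Y) (cot X Y).lact _ (cot_lact X Y) _ _ _ _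
    (h3.trans (Category.assoc _ _ _))
    ((Category.assoc _ _ _).trans (tensorμ_projL_left _ _ Y.lact_counit _))

lemma cotIso_tw_right (X : Bicomod P (tensorComon (opComon a) c))
    (Y : Bicomod Q (tensorComon (opComon c) b)) {E : Comon V} (y : Q.X ⟶ E.X) :
    Walled.Tw (B := ComodBicat V) (a := ⟨a⟩) (b := ⟨b⟩) (e := ⟨E⟩) (cotIso X Y).hom
      (coact (cot X Y) ((projR P Q).hom ≫ y))
      (Walled.coR (a := (⟨a⟩ : ComodBicat V)) (b := ⟨c⟩) (c := ⟨b⟩) (e := ⟨E⟩) (bd X) (Y := bd Y)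
        (coact Y y)) := by
  refine tw_iff.2 ?_
  have : Mono (E.X ◁ cotι X Y) := mono_compι_wl (bd X) (bd Y) E.X
  have h1 : (strL E.X (bd X) (bd Y)).hom ≫ E.X ◁ cotι X Y =
    (compι (bd X) (actObj E.X (bd Y))).hom ≫ past X.X E.X Y.X := strL_hom_ι _ _ _
  have h2 : (compMap (𝟙 (bd X)) (coact Y y)).hom ≫ (compι (bd X) (actObj E.X (bd Y))).hom =
    cotι X Y ≫ X.X ◁ (Y.lact ≫ y ▷ Y.X) := whiskerL_hom_ι _ _
  have h3 := (congrArg ((compMap (𝟙 (bd X)) (coact Y y)).hom ≫ ·) h1).trans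
    ((Category.assoc _ _ _).symm.trans (congrArg (· ≫ past X.X E.X Y.X) h2))
  exact restrict_coaction (cotι X Y) (cot X Y).lact _ (cot_lact X Y) _ _ _ _
    (h3.trans (Category.assoc _ _ _))
    ((Category.assoc _ _ _).trans (tensorμ_projR_left _ _ X.lact_counit _))

lemma coact_mapL {P' : Comon V} (k : P ⟶ P') (W : Bicomod P (tensorComon (opComon a) c)) {E : V}
    (u : P'.X ⟶ E) : coact (W.mapL k) u = coact W (k.hom ≫ u) := by
  ext
  change (W.lact ≫ k.hom ▷ W.X) ≫ u ▷ W.X = W.lact ≫ (k.hom ≫ u) ▷ W.X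
  rw [comp_whiskerRight, Category.assoc]

end Bicomod

open Bicomod

namespace Chain

lemma assocComon_projL {C D E : Comon V} :
    (assocComon C D E).hom ≫ (projL C (tensorComon D E)).hom =
      (projL (tensorComon C D) E).hom ≫ (projL C D).hom := by
  rw [show (assocComon C D E).hom = (α_ C.X D.X E.X).hom from
    EvalData.assocComonIso_hom_hom C D E]
  change (α_ C.X D.X E.X).hom ≫ C.X ◁ ((ε[D.X] ⊗ₘ ε[E.X]) ≫ (λ_ (𝟙_ V)).hom) ≫ (ρ_ C.X).hom =
    ((C.X ⊗ D.X) ◁ ε[E.X] ≫ (ρ_ (C.X ⊗ D.X)).hom) ≫ C.X ◁ ε[D.X] ≫ (ρ_ C.X).hom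
  rw [MonoidalCategory.tensorHom_def']
  monoidal

lemma assocComon_projR_projL {C D E : Comon V} :
    (assocComon C D E).hom ≫ (projR C (tensorComon D E)).hom ≫ (projL D E).hom =
      (projL (tensorComon C D) E).hom ≫ (projR C D).hom := by
  rw [show (assocComon C D E).hom = (α_ C.X D.X E.X).hom from
    EvalData.assocComonIso_hom_hom C D E]
  change (α_ C.X D.X E.X).hom ≫ (ε[C.X] ▷ (D.X ⊗ E.X) ≫ (λ_ (D.X ⊗ E.X)).hom) ≫
      D.X ◁ ε[E.X] ≫ (ρ_ D.X).hom =
    ((C.X ⊗ D.X) ◁ ε[E.X] ≫ (ρ_ (C.X ⊗ D.X)).hom) ≫ ε[C.X] ▷ D.X ≫ (λ_ D.X).hom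
  calc _ = 𝟙 _ ⊗≫ (ε[C.X] ▷ (D.X ⊗ E.X) ≫ _ ◁ (D.X ◁ ε[E.X])) ⊗≫ 𝟙 _ := by monoidal
    _ = _ := by rw [← whisker_exchange]; monoidal

lemma assocComon_projR_projR {C D E : Comon V} :
    (assocComon C D E).hom ≫ (projR C (tensorComon D E)).hom ≫ (projR D E).hom =
      (projR (tensorComon C D) E).hom := by
  rw [show (assocComon C D E).hom = (α_ C.X D.X E.X).hom from
    EvalData.assocComonIso_hom_hom C D E]
  change (α_ C.X D.X E.X).hom ≫ (ε[C.X] ▷ (D.X ⊗ E.X) ≫ (λ_ (D.X ⊗ E.X)).hom) ≫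
      ε[D.X] ▷ E.X ≫ (λ_ E.X).hom =
    ((ε[C.X] ⊗ₘ ε[D.X]) ≫ (λ_ (𝟙_ V)).hom) ▷ E.X ≫ (λ_ E.X).hom
  rw [MonoidalCategory.tensorHom_def]
  monoidal

/-- The bracketing `X₁ ⊗ (X₂ ⊗ … ⊗ Xₙ)` respects the coactions and the walls. -/
lemma isCellIso_consIso {c e d : Comon V} (X : EndoComod c e) (l : Chain e d) :
    Walled.IsCellIso (totObj (cons X l)) ((endoObj X).tensor (totObj l)) (consIso X l) := by
  -- A projection of the reassociated comonoid which factors through the first factor coacts through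
  -- X, and one which factors through the second coacts through the rest of the list; these are `hL`
  -- and `hR`.
  have hL {E : Comon V} (u : (tensorComon (opComon c) (tensorComon e (tensorComon (opComon e)
      (tail l)))).X ⟶ E.X)
      (x : (tensorComon (opComon c) e).X ⟶ E.X)
      (h : (assocComon (opComon c) e (tensorComon (opComon e) (tail l))).hom ≫ u =
        (projL _ _).hom ≫ x) :
      Walled.Tw (B := ComodBicat V) (a := ⟨c⟩) (b := ⟨d⟩) (e := ⟨E⟩) (consIso X l).hom
        (coact (tot (cons X l)) u) (Walled.coL (a := (⟨c⟩ : ComodBicat V)) (b := ⟨e⟩) (c := ⟨d⟩)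
          (e := ⟨E⟩) (X := bd X) (coact X x) (bd (tot l))) := by
    have h1 := cotIso_tw_left X (tot l) x
    rw [← h, ← coact_mapL] at h1
    exact h1
  have hR {E : Comon V} (u : (tensorComon (opComon c) (tensorComon e (tensorComon (opComon e)
      (tail l)))).X ⟶ E.X)
      (x : (tensorComon (opComon e) (tail l)).X ⟶ E.X)
      (h : (assocComon (opComon c) e (tensorComon (opComon e) (tail l))).hom ≫ u =
        (projR _ _).hom ≫ x) :
      Walled.Tw (B := ComodBicat V) (a := ⟨c⟩) (b := ⟨d⟩) (e := ⟨E⟩) (consIso X l).hom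
        (coact (tot (cons X l)) u) (Walled.coR (a := (⟨c⟩ : ComodBicat V)) (b := ⟨e⟩) (c := ⟨d⟩)
          (e := ⟨E⟩) (bd X) (Y := bd (tot l)) (coact (tot l) x)) := by
    have h1 := cotIso_tw_right X (tot l) x
    rw [← h, ← coact_mapL] at h1
    exact h1
  have h0 {E : V} (z : (tensorComon (opComon e) (tail l)).X ⟶ E) :
      (assocComon (opComon c) e (tensorComon (opComon e) (tail l))).hom ≫
        (projR (opComon c) _).hom ≫ (projR e _).hom ≫ z = (projR (tensorComon
            (opComon c) e) _).hom ≫ z := by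
    rw [← assocComon_projR_projR, Category.assoc, Category.assoc]
  -- The five relations concern the two outer coactions, the two sides of the wall between X and the
  -- rest, and the walls inside the rest.
  have h1 := hL (E := opComon c) (projL (opComon c) _).hom _
    assocComon_projL
  have h2 := hR (E := d) ((projR (opComon c) _).hom ≫ last (cons X l))
    ((projR (opComon e) (tail l)).hom ≫ last l)
    ((congrArg (fun z => (assocComon (opComon c) e _).hom ≫ (projR _ _).hom ≫ z)
      (last_cons X l)).trans (h0 _))
  have h3 := hL (E := e) ((projR (opComon c) _).hom ≫ (projL e _).hom)
    (projR (opComon c) e).hom assocComon_projR_projL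
  have h4 := hR (E := opComon e) ((projR (opComon c) _).hom ≫
    (projR e (tensorComon (opComon e) (tail l))).hom ≫ (projL (opComon e) (tail l)).hom)
    (projL (opComon e) (tail l)).hom (h0 _)
  have h5 {E : Comon V} (x : (tail l).X ⟶ E.X) := hR (E := E) ((projR (opComon c) _).hom ≫
    (projR e (tensorComon (opComon e) (tail l))).hom ≫ (projR (opComon e) (tail l)).hom ≫ x)
    ((projR (opComon e) (tail l)).hom ≫ x) (h0 _)
  constructor
  · refine ⟨h1, h2, ?_⟩
    rintro E _ _ ⟨x, y, hw, rfl, rfl⟩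
    refine Or.inr ?_
    cases hw with
    | mid => exact ⟨_, _, .mid, h3, h4⟩
    | tail _ hw => exact ⟨_, _, .right ⟨_, _, hw, rfl, rfl⟩, h5 _, h5 _⟩
  · refine ⟨h1.inv, h2.inv, ?_⟩
    intro E φ ψ hw
    refine Or.inr ?_
    cases hw with
    | mid => exact ⟨_, _, ⟨_, _, .mid X l, rfl, rfl⟩, h3.inv, h4.inv⟩
    | left hw => exact hw.elim
    | right hw =>
      obtain ⟨x, y, hw, rfl, rfl⟩ := hw
      exact ⟨_, _, ⟨_, _, .tail X hw, rfl, rfl⟩, (h5 _).inv, (h5 _).inv⟩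

end Chain
end Cotensors

/-! ### Kan extensions as universal multimaps, and consequences of admissibility -/

section KanExtensions

variable {V : Type u} [Category.{v} V] [MonoidalCategory V] [BraidedCategory V]
  [HasCoreflexiveEqualizers V] [∀ Z : V, PreservesCoreflexiveEqualizers (tensorLeft Z)]

local infixr:81 " ◃ " => Bicategory.whiskerLeft
local infixl:81 " ▹ " => Bicategory.whiskerRight

open Bicomod Walled

namespace Chain

lemma compMap_eq {c d e : ComodBicat V} {M M' : c ⟶ d} {N N' : d ⟶ e} (f : M ⟶ M') (g : N ⟶ N') :
    (compMap f g : (M ≫ N : c ⟶ e) ⟶ M' ≫ N') = f ▹ N ≫ M' ◃ g := by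
  have h := compMap_comp f (𝟙 M') (𝟙 N) g
  rw [Category.comp_id, Category.id_comp] at h
  exact h

lemma isCellIso_single {c d : Comon V} (X : EndoComod c d) :
    IsCellIso (totObj (single X)) (endoObj X) (Iso.refl _) := by
  have h : IsCell (totObj (single X)) (endoObj X) (𝟙 (bd X)) :=
    (isCell_single_iff _).2 (IsCell.id (endoObj X))
  refine ⟨h, ⟨?_, ?_, fun _ _ _ h => h.elim⟩⟩
  · exact Tw.inv (f := Iso.refl (totObj (single X)).obj) h.lo
  · exact Tw.inv (f := Iso.refl (totObj (single X)).obj) h.l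

/-- Concatenation of lists is bracketing of total objects, and the walls on the two sides
correspond; the wall at the junction is the middle one of the tensor product. -/
lemma exists_splitIso {c e d : Comon V} (l : Chain c e) (m : Chain e d) :
    ∃ i : (totObj (append l m)).obj ≅ ((totObj l).tensor (totObj m)).obj,
      i.hom = split l m ∧ IsCellIso (totObj (append l m)) ((totObj l).tensor (totObj m)) i := by
  induction l with
  | single X =>
    refine ⟨consIso X m ≪≫ Bicategory.whiskerRightIso (Iso.refl (totObj (single X)).obj).symm
      (totObj m).obj, ?_, (isCellIso_consIso X m).trans ((isCellIso_single X).symm.whiskerRight _)⟩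
    exact (congrArg ((consIso X m).hom ≫ ·) (compMap_id (bd X) (bd (tot m)))).trans
      (Category.comp_id _)
  | cons X l ih =>
    obtain ⟨i, hi, h⟩ := ih m
    refine ⟨consIso X (append l m) ≪≫ Bicategory.whiskerLeftIso (endoObj X).obj i ≪≫
      (Bicategory.associator (endoObj X).obj (totObj l).obj (totObj m).obj).symm ≪≫
        Bicategory.whiskerRightIso (consIso X l).symm (totObj m).obj, ?_, ?_⟩
    · exact congrArg (fun k => (consIso X (append l m)).hom ≫ compMap (𝟙 (bd X)) k ≫
        assocInv _ _ _ ≫ compMap (consIso X l).inv (𝟙 (bd (tot m)))) hi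
    · exact (isCellIso_consIso X (append l m)).trans ((h.whiskerLeft _).trans
        ((IsCellIso.assoc _ _ _).symm.trans ((isCellIso_consIso X l).symm.whiskerRight _)))

lemma Blocks.isCell {c d : Comon V} {l m : Chain c d} (b : Blocks l m) :
    IsCell (totObj l) (totObj m) b.map := by
  induction b with
  | single t =>
    have h := t.isCell.comp (isCellIso_single _).inv
    exact (Category.comp_id _).subst (motive := fun k => IsCell _ _ k) h
  | @cons c e d l T t m n b ih =>
    obtain ⟨i, hi, h⟩ := exists_splitIso l m
    have h2 := (h.hom.comp ((t.isCell.whiskerRight (totObj m)).comp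
      (ih.whiskerLeft (endoObj T)))).comp (isCellIso_consIso T n).inv
    rw [hi, ← compMap_eq, Category.assoc] at h2
    exact h2

/-- A map which respects the coactions and the walls and which is universal among the maps to
comodules `Cᵒ ⊗ C' ⇸ Cᵒ ⊗ C'`. -/
structure IsUniversal {c d : Comon V} (W W' : Walled (⟨c⟩ : ComodBicat V) ⟨d⟩)
    (f : W.obj ⟶ W'.obj) : Prop where
  isCell : IsCell W W' f
  exists_lift : ∀ (Z : EndoComod c d) (h : W.obj ⟶ (endoObj Z).obj), IsCell W (endoObj Z) h →
    ∃ k : W'.obj ⟶ (endoObj Z).obj, IsCell W' (endoObj Z) k ∧ f ≫ k = h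
  hom_ext : ∀ (Z : EndoComod c d) (k k' : W'.obj ⟶ (endoObj Z).obj), IsCell W' (endoObj Z) k →
    IsCell W' (endoObj Z) k' → f ≫ k = f ≫ k' → k = k'

namespace IsUniversal

variable {c d : Comon V} {W W' W'' : Walled (⟨c⟩ : ComodBicat V) ⟨d⟩}

lemma conj {W₁ W₁' : Walled (⟨c⟩ : ComodBicat V) ⟨d⟩} {f : W.obj ⟶ W'.obj} {g : W₁.obj ⟶ W₁'.obj}
    (hf : IsUniversal W W' f) {i : W₁.obj ≅ W.obj} {j : W₁'.obj ≅ W'.obj} (hi : IsCellIso W₁ W i)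
    (hj : IsCellIso W₁' W' j) (h : g ≫ j.hom = i.hom ≫ f) : IsUniversal W₁ W₁' g := by
  have hg : g = i.hom ≫ f ≫ j.inv := by rw [← reassoc_of% h]; simp
  subst hg
  refine ⟨hi.hom.comp (hf.isCell.comp hj.inv), fun Z k hk => ?_, fun Z k k' hk hk' e => ?_⟩
  · obtain ⟨k', hk', e⟩ := hf.exists_lift Z (i.inv ≫ k) (hi.inv.comp hk)
    exact ⟨j.hom ≫ k', hj.hom.comp hk', by simp [e]⟩
  · have h1 := hf.hom_ext Z _ _ (hj.inv.comp hk) (hj.inv.comp hk')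
      (by simpa using congrArg (i.inv ≫ ·) e)
    simpa using congrArg (j.hom ≫ ·) h1

end IsUniversal

section Kan

variable {c d : Comon V} {l : Chain c d} {T : EndoComod c d} {t : Cell l T}

/-- Under the correspondence of 2-cells with cells, and of comodule maps with cells between plain
objects, the Kan property is literally unique factorization. -/
lemma IsKan.isUniversal (ht : IsKan t) : IsUniversal (totObj l) (endoObj T) t.map := by
  refine ⟨t.isCell, fun Z h hh => ?_, fun Z k k' hk hk' e => ?_⟩
  · obtain ⟨s, rfl⟩ := exists_cell h hh
    obtain ⟨g, hg, -⟩ := ht Z s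
    refine ⟨bdHom g, isCell_bdHom g, ?_⟩
    rw [← hg]
    exact (Cell.map_comp t g).symm
  · obtain ⟨g, rfl⟩ := exists_bdHom k hk
    obtain ⟨g', rfl⟩ := exists_bdHom k' hk'
    have e' := (Cell.map_comp t g).trans (Eq.trans e (Cell.map_comp t g').symm)
    rw [(ht Z (t ≫ compMap (𝟙 (ev l)) g')).unique (Cell.map_injective e') rfl]

lemma IsUniversal.isKan (ht : IsUniversal (totObj l) (endoObj T) t.map) : IsKan t := by
  intro Z s
  obtain ⟨k, hk, e⟩ := ht.exists_lift Z s.map s.isCell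
  obtain ⟨g, rfl⟩ := exists_bdHom k hk
  refine ⟨g, Cell.map_injective ((Cell.map_comp t g).trans e), fun g' hg' => ?_⟩
  dsimp only at hg'
  have h := ht.hom_ext Z (bdHom g') (bdHom g) (isCell_bdHom _) (isCell_bdHom _)
    (((Cell.map_comp t g').symm.trans (congrArg Cell.map hg')).trans e.symm)
  exact bdHom_injective h

end Kan

/-- This is T₁(X) = X. It lets an unchanged variable count as a block of a partition, which is how
whiskering is brought under condition (2). -/
lemma exists_idCell {c d : Comon V} (X : EndoComod c d) :
    ∃ s : Cell (single X) X, s.map = 𝟙 (bd X) ∧ IsKan s := by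
  obtain ⟨s, hs⟩ := exists_cell (l := single X) (Z := X) _ (isCellIso_single X).hom
  refine ⟨s, hs, IsUniversal.isKan ?_⟩
  rw [hs]
  refine ⟨(isCellIso_single X).hom, fun Z h hh => ⟨h, ?_, Category.id_comp _⟩,
      fun Z k k' _ _ e => ?_⟩
  · exact (isCell_single_iff _).1 hh
  · exact (Category.id_comp _).symm.trans (e.trans (Category.id_comp _))

/-- The bracketing of `X ⊗_E Y` respects the coactions. -/
lemma isCell_cotensor {c e d : Comon V} (X : EndoComod c e) (Y : EndoComod e d) :
    IsCell (endoObj (cotensor X Y)) ((endoObj X).tensor (endoObj Y)) (cotIso X Y).hom := by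
  have h1 := cotIso_tw_left X Y (projL (opComon c) e).hom
  have h2 := cotIso_tw_right X Y (projR (opComon e) d).hom
  have h3 : (tensorComonHom (projL (opComon c) e) (projR (opComon e) d)).hom ≫
      (projL (opComon c) d).hom = (projL _ _).hom ≫ (projL (opComon c) e).hom :=
    congrArg Comon.Hom.hom (tensorComonHom_projL (projL (opComon c) e) (projR (opComon e) d))
  have h4 : (tensorComonHom (projL (opComon c) e) (projR (opComon e) d)).hom ≫
      (projR (opComon c) d).hom = (projR _ _).hom ≫ (projR (opComon e) d).hom :=
    congrArg Comon.Hom.hom (tensorComonHom_projR (projL (opComon c) e) (projR (opComon e) d))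
  rw [← h3, ← coact_mapL] at h1
  rw [← h4, ← coact_mapL] at h2
  exact ⟨h1, h2, fun _ _ _ h => h.elim⟩

section Admissible

variable {𝒳 : ∀ c d : Comon V, EndoComod c d → Prop} (h𝒳 : IsAdmissible 𝒳)
include h𝒳

/-- The iterated cotensor product of comodules in `𝒳` is in `𝒳`. -/
lemma exists_cotensor {c d : Comon V} (l : Chain c d) (hl : l.All 𝒳) :
    ∃ (D : EndoComod c d) (i : (endoObj D).obj ≅ (totObj l).obj), 𝒳 c d D ∧
      IsCell (endoObj D) (totObj l) i.hom := by
  induction l with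
  | single X => exact ⟨X, Iso.refl _, hl, (isCellIso_single X).inv⟩
  | cons X l ih =>
    obtain ⟨D, i, hD, hi⟩ := ih hl.2
    refine ⟨cotensor X D, cotIso X D ≪≫ Bicategory.whiskerLeftIso (endoObj X).obj i ≪≫
      (consIso X l).symm, h𝒳.cotensor_mem X D hl.1 hD, ?_⟩
    exact (isCell_cotensor X D).comp ((hi.whiskerLeft (endoObj X)).comp (isCellIso_consIso X l).inv)

/-- The iterated cotensor product D lies in the class by (4). It forgets the walls, so the universal
map restricts to a comodule map D ⟶ T; this is epi because the universal map is, and (5) applies. -/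
lemma IsKan.mem {c d : Comon V} {l : Chain c d} (hl : l.All 𝒳) {T : EndoComod c d} {t : Cell l T}
    (ht : IsKan t) : 𝒳 c d T := by
  obtain ⟨D, i, hD, hi⟩ := exists_cotensor h𝒳 l hl
  obtain ⟨g, hg⟩ := exists_bdHom _ (hi.comp t.isCell)
  -- The underlying objects of D and of the total object are isomorphic, so equality after g is
  -- equality after the universal map.
  have : Epi g := ⟨fun x y e => by
    have h1 : bdHom g ≫ bdHom x = bdHom g ≫ bdHom y := congrArg bdHom e
    rw [hg] at h1
    have h2 : t.map ≫ bdHom x = t.map ≫ bdHom y := by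
      let i' : bd D ≅ bd (tot l) := i
      have h3 : (i'.hom ≫ t.map) ≫ bdHom x = (i'.hom ≫ t.map) ≫ bdHom y := h1
      rw [Category.assoc, Category.assoc] at h3
      exact (cancel_epi i'.hom).1 h3
    exact bdHom_injective (ht.isUniversal.hom_ext _ _ _ (isCell_bdHom _) (isCell_bdHom _) h2)⟩
  exact h𝒳.of_epi g hD

omit h𝒳 in
lemma all_of_append {c e d : Comon V} {l : Chain c e} {m : Chain e d} (h : (append l m).All 𝒳) :
    l.All 𝒳 ∧ m.All 𝒳 := by
  induction l with
  | single X => exact h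
  | cons X l ih => exact ⟨⟨h.1, (ih h.2).1⟩, (ih h.2).2⟩

omit h𝒳 in
lemma all_append {c e d : Comon V} {l : Chain c e} {m : Chain e d} (h : l.All 𝒳) (h' : m.All 𝒳) :
    (append l m).All 𝒳 := by
  induction l with
  | single X => exact ⟨h, h'⟩
  | cons X l ih => exact ⟨h.1, ih h.2 h'⟩

lemma Blocks.all {c d : Comon V} {l m : Chain c d} (b : Blocks l m) (hb : b.AllKan)
    (hl : l.All 𝒳) : m.All 𝒳 := by
  induction b with
  | single t => exact IsKan.mem h𝒳 hl hb
  | cons t b ih => exact ⟨IsKan.mem h𝒳 (all_of_append hl).1 hb.1, ih hb.2 (all_of_append hl).2⟩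

/-- The tensor product of universal 2-cells is universal. -/
lemma Blocks.isUniversal {c d : Comon V} {l m : Chain c d} (b : Blocks l m) (hb : b.AllKan)
    (hl : l.All 𝒳) : IsUniversal (totObj l) (totObj m) b.map := by
  obtain ⟨T, t, ht⟩ := h𝒳.exists_kan l hl
  obtain ⟨T', t', ht'⟩ := h𝒳.exists_kan m (b.all h𝒳 hb hl)
  obtain ⟨k, hk, e⟩ := ht.isUniversal.exists_lift T' _ (b.isCell.comp t'.isCell)
  obtain ⟨β, rfl⟩ := exists_bdHom k hk
  -- The map β is obtained by factoring the block map followed by t' through t, which is the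
  -- defining property of the associativity map; condition (2) makes it invertible.
  have hβ := h𝒳.isIso_assoc b hl hb t t' ht ht' β e
  have e1 : t.map ≫ bdHom β = b.map ≫ t'.map := e
  have e2 : bdHom β ≫ bdHom (inv β) = 𝟙 _ := congrArg bdHom (IsIso.hom_inv_id β)
  refine ⟨b.isCell, fun Z h hh => ?_, fun Z h h' hh hh' e3 => ?_⟩
  · obtain ⟨k, hk, e3⟩ := ht.isUniversal.exists_lift Z h hh
    -- With k the factorization of h through t, passing through t' and back along β gives a
    -- factorization through the block map.
    refine ⟨t'.map ≫ bdHom (inv β) ≫ k, t'.isCell.comp ((isCell_bdHom _).comp hk), ?_⟩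
    have e4 : b.map ≫ t'.map ≫ bdHom (inv β) ≫ k = t.map ≫ k := by
      rw [← reassoc_of% e1, reassoc_of% e2]
    exact e4.trans e3
  -- Both candidates factor through t'. Equality after the block map becomes equality after t
  -- followed by β, and both of these can be cancelled.
  · obtain ⟨k, hk, rfl⟩ := ht'.isUniversal.exists_lift Z h hh
    obtain ⟨k', hk', rfl⟩ := ht'.isUniversal.exists_lift Z h' hh'
    have e4 : t.map ≫ bdHom β ≫ k = t.map ≫ bdHom β ≫ k' := by
      have e5 : b.map ≫ t'.map ≫ k = b.map ≫ t'.map ≫ k' := e3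
      rw [reassoc_of% e1, reassoc_of% e1, e5]
    have e5 := ht.isUniversal.hom_ext Z _ _ ((isCell_bdHom β).comp hk)
        ((isCell_bdHom β).comp hk') e4
    have e6 : bdHom β ≫ k = bdHom β ≫ k' := e5
    have e7 : bdHom (inv β) ≫ bdHom β = 𝟙 _ := congrArg bdHom (IsIso.inv_hom_id β)
    have e8 : k = k' := by
      have h := congrArg (bdHom (inv β) ≫ ·) e6
      rw [reassoc_of% e7, reassoc_of% e7] at h
      exact h
    rw [e8]

end Admissible

end Chain
end KanExtensions

/-! ### A two-sided action as a commuting pair of one-sided actions -/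

section Actions

universe w₁ v₁ u₁

local infixr:81 " ◃ " => Bicategory.whiskerLeft
local infixl:81 " ▹ " => Bicategory.whiskerRight
local notation "𝖺" => Bicategory.associator
local notation "𝗅" => Bicategory.leftUnitor
local notation "𝗋" => Bicategory.rightUnitor

variable {B : Type u₁} [Bicategory.{w₁, v₁} B] {a b : B}

section TwoSided

variable {A : a ⟶ a} {μ : A ≫ A ⟶ A} {η : 𝟙 a ⟶ A} {C : b ⟶ b} {ν : C ≫ C ⟶ C} {ζ : 𝟙 b ⟶ C}
  {M : a ⟶ b}

/-- The associativity of a two-sided action, with maps inserted at its arguments. -/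
lemma twoSided_assoc {γ : A ≫ M ≫ C ⟶ M}
    (hγ : A ◃ (A ◃ (𝖺 M C C).inv ≫ (𝖺 A (M ≫ C) C).inv ≫ γ ▹ C) ≫ γ =
      (𝖺 A A (M ≫ C ≫ C)).inv ≫ μ ▹ (M ≫ C ≫ C) ≫ A ◃ M ◃ ν ≫ γ)
    {P P' : a ⟶ a} {Q Q' : b ⟶ b} (x : P ⟶ A) (x' : P' ⟶ A) (y : Q ⟶ C) (y' : Q' ⟶ C) :
    P ◃ ((x' ▹ _ ≫ A ◃ M ◃ y' ≫ γ) ▹ Q) ≫ x ▹ _ ≫ A ◃ M ◃ y ≫ γ =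
      P ◃ (𝖺 P' (M ≫ Q') Q).hom ≫ P ◃ P' ◃ (𝖺 M Q' Q).hom ≫ (𝖺 P P' _).inv ≫
        (x ▹ P' ≫ A ◃ x' ≫ μ) ▹ _ ≫ A ◃ M ◃ (y' ▹ Q ≫ C ◃ y ≫ ν) ≫ γ := by
  -- Associativity solved for the iterated action. The four inserted maps are then collected on the
  -- outer and on the inner copy of γ; in the applications each of them is an identity or a unit.
  have h : A ◃ (γ ▹ C) ≫ γ = A ◃ ((𝖺 A (M ≫ C) C).hom ≫ A ◃ (𝖺 M C C).hom) ≫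
      (𝖺 A A (M ≫ C ≫ C)).inv ≫ μ ▹ (M ≫ C ≫ C) ≫ A ◃ M ◃ ν ≫ γ := by
    rw [← hγ]
    simp only [← Category.assoc]
    congr 2
    simp
  calc _ = (P ◃ ((x' ▹ _ ≫ A ◃ M ◃ y' ≫ γ) ▹ Q) ≫ x ▹ _) ≫ A ◃ M ◃ y ≫ γ := by
        rw [Category.assoc]
    _ = x ▹ _ ≫ A ◃ ((x' ▹ _ ≫ A ◃ M ◃ y') ▹ Q) ≫ A ◃ (γ ▹ Q ≫ M ◃ y) ≫ γ := by
        rw [Bicategory.whisker_exchange x]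
        simp only [Bicategory.whiskerLeft_comp, Bicategory.comp_whiskerRight, Category.assoc]
    _ = x ▹ _ ≫ A ◃ ((x' ▹ _ ≫ A ◃ M ◃ y') ▹ Q) ≫ A ◃ ((A ≫ M ≫ C) ◃ y) ≫ A ◃ (γ ▹ C) ≫ γ := by
        rw [← Bicategory.whisker_exchange γ y]
        simp only [Bicategory.whiskerLeft_comp, Category.assoc]
    _ = P ◃ (𝖺 P' (M ≫ Q') Q).hom ≫ P ◃ P' ◃ (𝖺 M Q' Q).hom ≫ (𝖺 P P' _).inv ≫
        (x ▹ P' ≫ A ◃ x') ▹ _ ≫ (μ ▹ _ ≫ A ◃ M ◃ (y' ▹ Q ≫ C ◃ y)) ≫ A ◃ M ◃ ν ≫ γ := by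
        rw [h, ← Bicategory.whisker_exchange μ]
        bicategory
    _ = _ := by
        simp only [Bicategory.whiskerLeft_comp, Bicategory.comp_whiskerRight, Category.assoc]

section

variable {γ : A ≫ M ≫ C ⟶ M}
    (hγ : A ◃ (A ◃ (𝖺 M C C).inv ≫ (𝖺 A (M ≫ C) C).inv ≫ γ ▹ C) ≫ γ =
      (𝖺 A A (M ≫ C ≫ C)).inv ≫ μ ▹ (M ≫ C ≫ C) ≫ A ◃ M ◃ ν ≫ γ)
    {l : A ≫ M ⟶ M} (hl : A ◃ ((𝗋 M).inv ≫ M ◃ ζ) ≫ γ = l)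
    {r : M ≫ C ⟶ M} (hr : (𝗅 (M ≫ C)).inv ≫ η ▹ (M ≫ C) ≫ γ = r)

/-- In the general associativity both arguments from A are left free and both arguments from C are
units; the product of two units is a unit. -/
lemma twoSided_l_assoc (hγ : A ◃ (A ◃ (𝖺 M C C).inv ≫ (𝖺 A (M ≫ C) C).inv ≫ γ ▹ C) ≫ γ =
      (𝖺 A A (M ≫ C ≫ C)).inv ≫ μ ▹ (M ≫ C ≫ C) ≫ A ◃ M ◃ ν ≫ γ)
    (hl : A ◃ ((𝗋 M).inv ≫ M ◃ ζ) ≫ γ = l) (hC₂ : (𝗋 C).inv ≫ C ◃ ζ ≫ ν = 𝟙 C) :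
    (𝖺 A A M).inv ≫ μ ▹ M ≫ l = A ◃ l ≫ l := by
  have h := twoSided_assoc hγ (𝟙 A) (𝟙 A) ζ ζ
  have h1 : ζ ▹ 𝟙 b ≫ C ◃ ζ ≫ ν = (𝗋 _).hom ≫ ζ := by
    rw [(Iso.inv_comp_eq _).1 hC₂]
    simp
  rw [h1] at h
  have e : A ◃ l ≫ l = A ◃ A ◃ (𝗋 M).inv ≫ A ◃ (A ◃ M ◃ ζ ≫ γ) ≫
      A ◃ (𝗋 M).inv ≫ A ◃ M ◃ ζ ≫ γ := by
    rw [← hl]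
    simp only [Bicategory.whiskerLeft_comp, Category.assoc]
  have e2 : A ◃ (A ◃ M ◃ ζ ≫ γ) ≫ A ◃ (𝗋 M).inv = A ◃ (𝗋 _).inv ≫
      A ◃ ((A ◃ M ◃ ζ ≫ γ) ▹ 𝟙 b) := by
    rw [← Bicategory.whiskerLeft_comp, Bicategory.rightUnitor_inv_naturality,
      Bicategory.whiskerLeft_comp]
  simp only [Bicategory.id_whiskerRight, Category.id_comp, Bicategory.whiskerLeft_id] at h
  rw [e, reassoc_of% e2, h, ← hl]
  calc _ = (𝖺 A A M).inv ≫ (μ ▹ M ≫ A ◃ ((𝗋 M).inv ≫ M ◃ ζ)) ≫ γ := by simp only [Category.assoc]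
    _ = _ := by
      rw [← Bicategory.whisker_exchange]
      have e3 : μ ▹ (M ≫ 𝟙 b ≫ 𝟙 b) ≫ A ◃ M ◃ (𝗋 (𝟙 b)).hom ≫ A ◃ M ◃ ζ ≫ γ =
        (A ≫ A) ◃ (M ◃ (𝗋 (𝟙 b)).hom ≫ M ◃ ζ) ≫ μ ▹ (M ≫ C) ≫ γ := by
        rw [← Category.assoc ((A ≫ A) ◃ _), Bicategory.whisker_exchange]
        simp only [Bicategory.whiskerLeft_comp, Category.assoc]
      simp only [Bicategory.whiskerLeft_comp, Category.assoc] at e3 ⊢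
      rw [e3]
      bicategory

/-- Here the two arguments from A are units and those from C are free. -/
lemma twoSided_r_assoc (hγ : A ◃ (A ◃ (𝖺 M C C).inv ≫ (𝖺 A (M ≫ C) C).inv ≫ γ ▹ C) ≫ γ =
      (𝖺 A A (M ≫ C ≫ C)).inv ≫ μ ▹ (M ≫ C ≫ C) ≫ A ◃ M ◃ ν ≫ γ)
    (hr : (𝗅 (M ≫ C)).inv ≫ η ▹ (M ≫ C) ≫ γ = r) (hA₁ : (𝗅 A).inv ≫ η ▹ A ≫ μ = 𝟙 A) :
    (𝖺 M C C).hom ≫ M ◃ ν ≫ r = r ▹ C ≫ r := by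
  have h := twoSided_assoc hγ η η (𝟙 C) (𝟙 C)
  have h1 : η ▹ 𝟙 a ≫ A ◃ η ≫ μ = (𝗅 _).hom ≫ η := by
    rw [← Bicategory.whisker_exchange_assoc, (Iso.inv_comp_eq _).1 hA₁]
    simp
  rw [h1] at h
  simp only [Bicategory.id_whiskerRight, Category.id_comp, Bicategory.whiskerLeft_id] at h
  have e : r ▹ C ≫ r = (𝗅 (M ≫ C)).inv ▹ C ≫ (𝗅 _).inv ≫ 𝟙 a ◃ (η ▹ (M ≫ C) ≫ γ) ▹ C ≫
      η ▹ (M ≫ C) ≫ γ := by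
    rw [← Bicategory.leftUnitor_inv_naturality_assoc, hr, ← hr]
    simp
  rw [e, h, ← hr]
  calc _ = (𝖺 M C C).hom ≫ (𝗅 _).inv ≫ (𝟙 a ◃ M ◃ ν ≫ η ▹ (M ≫ C)) ≫ γ := by
        rw [Category.assoc, ← Bicategory.leftUnitor_inv_naturality_assoc]
    _ = _ := by
      rw [Bicategory.whisker_exchange]
      bicategory

/-- The inner action receives the unit of A and the outer action the unit of C. This is the right
action followed by the left one, and the unit laws absorb both units. -/
lemma twoSided_eq_left (hγ : A ◃ (A ◃ (𝖺 M C C).inv ≫ (𝖺 A (M ≫ C) C).inv ≫ γ ▹ C) ≫ γ =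
      (𝖺 A A (M ≫ C ≫ C)).inv ≫ μ ▹ (M ≫ C ≫ C) ≫ A ◃ M ◃ ν ≫ γ)
    (hl : A ◃ ((𝗋 M).inv ≫ M ◃ ζ) ≫ γ = l)
    (hr : (𝗅 (M ≫ C)).inv ≫ η ▹ (M ≫ C) ≫ γ = r) (hA₂ : (𝗋 A).inv ≫ A ◃ η ≫ μ = 𝟙 A)
    (hC₂ : (𝗋 C).inv ≫ C ◃ ζ ≫ ν = 𝟙 C) : A ◃ r ≫ l = γ := by
  have h := twoSided_assoc hγ (𝟙 A) η ζ (𝟙 C)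
  simp only [Bicategory.id_whiskerRight, Category.id_comp, Bicategory.whiskerLeft_id] at h
  rw [(Iso.inv_comp_eq _).1 hA₂, (Iso.inv_comp_eq _).1 hC₂] at h
  have e : A ◃ r ≫ l = A ◃ (𝗅 (M ≫ C)).inv ≫ A ◃ (𝗋 _).inv ≫
      A ◃ ((η ▹ (M ≫ C) ≫ γ) ▹ 𝟙 b) ≫ A ◃ M ◃ ζ ≫ γ := by
    rw [← hl, ← hr]
    simp only [← Bicategory.whiskerLeft_comp_assoc]
    congr 2
    simp
  rw [e, h]
  bicategory

/-- Exchanging the places of the units gives the opposite order of the two actions. Combined with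
`twoSided_eq_left` it shows that they commute. -/
lemma twoSided_eq_right (hγ : A ◃ (A ◃ (𝖺 M C C).inv ≫ (𝖺 A (M ≫ C) C).inv ≫ γ ▹ C) ≫ γ =
      (𝖺 A A (M ≫ C ≫ C)).inv ≫ μ ▹ (M ≫ C ≫ C) ≫ A ◃ M ◃ ν ≫ γ)
    (hl : A ◃ ((𝗋 M).inv ≫ M ◃ ζ) ≫ γ = l)
    (hr : (𝗅 (M ≫ C)).inv ≫ η ▹ (M ≫ C) ≫ γ = r) (hA₁ : (𝗅 A).inv ≫ η ▹ A ≫ μ = 𝟙 A)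
    (hC₁ : (𝗅 C).inv ≫ ζ ▹ C ≫ ν = 𝟙 C) : (𝖺 A M C).inv ≫ l ▹ C ≫ r = γ := by
  have h := twoSided_assoc hγ η (𝟙 A) (𝟙 C) ζ
  simp only [Bicategory.id_whiskerRight, Category.id_comp, Bicategory.whiskerLeft_id] at h
  have h1 : η ▹ A ≫ μ = (𝗅 A).hom := by simpa using (Iso.inv_comp_eq _).1 hA₁
  have h2 : ζ ▹ C ≫ ν = (𝗅 C).hom := by simpa using (Iso.inv_comp_eq _).1 hC₁
  rw [h1, h2] at h
  have e : l ▹ C ≫ r = (A ◃ (𝗋 M).inv) ▹ C ≫ (𝗅 _).inv ≫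
      𝟙 a ◃ ((A ◃ M ◃ ζ ≫ γ) ▹ C) ≫ η ▹ (M ≫ C) ≫ γ := by
    rw [← Bicategory.leftUnitor_inv_naturality_assoc, ← hl, ← hr]
    simp
  rw [e, h]
  bicategory

end

section

variable {l : A ≫ M ⟶ M} {r : M ≫ C ⟶ M}

/-- Commutation moves the inner left action past the outer right action, after which the two
one-sided associativities apply separately. -/
lemma twoSided_assoc_of (hl : (𝖺 A A M).inv ≫ μ ▹ M ≫ l = A ◃ l ≫ l)
    (hr : (𝖺 M C C).hom ≫ M ◃ ν ≫ r = r ▹ C ≫ r) (h : A ◃ r ≫ l = (𝖺 A M C).inv ≫ l ▹ C ≫ r) :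
    A ◃ (A ◃ (𝖺 M C C).inv ≫ (𝖺 A (M ≫ C) C).inv ≫ (A ◃ r ≫ l) ▹ C) ≫ A ◃ r ≫ l =
      (𝖺 A A (M ≫ C ≫ C)).inv ≫ μ ▹ (M ≫ C ≫ C) ≫ A ◃ M ◃ ν ≫ A ◃ r ≫ l := by
  have h' : l ▹ C ≫ r = (𝖺 A M C).hom ≫ A ◃ r ≫ l := by rw [h]; simp
  have hr' : (𝖺 M C C).inv ≫ r ▹ C ≫ r = M ◃ ν ≫ r := by rw [← hr]; simp
  calc _ = A ◃ (A ◃ (𝖺 M C C).inv ≫ (𝖺 A (M ≫ C) C).inv ≫ (A ◃ r) ▹ C ≫ l ▹ C ≫ r) ≫ l := by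
        simp only [Bicategory.whiskerLeft_comp, Bicategory.comp_whiskerRight, Category.assoc]
    _ = A ◃ A ◃ ((𝖺 M C C).inv ≫ r ▹ C ≫ r) ≫ A ◃ l ≫ l := by
        rw [h']
        bicategory
    _ = (𝖺 A A _).inv ≫ ((A ≫ A) ◃ (M ◃ ν ≫ r) ≫ μ ▹ M) ≫ l := by
        rw [hr', ← hl]
        simp
    _ = _ := by
        rw [Bicategory.whisker_exchange]
        simp

lemma twoSided_unit_of (hl : (𝗅 M).inv ≫ η ▹ M ≫ l = 𝟙 M) (hr : (𝗋 M).inv ≫ M ◃ ζ ≫ r = 𝟙 M) :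
    (𝗅 M).inv ≫ (η ▹ M ≫ A ◃ ((𝗋 M).inv ≫ M ◃ ζ)) ≫ A ◃ r ≫ l = 𝟙 M := by
  calc _ = (𝗅 M).inv ≫ η ▹ M ≫ A ◃ ((𝗋 M).inv ≫ M ◃ ζ ≫ r) ≫ l := by
        simp only [Bicategory.whiskerLeft_comp, Category.assoc]
    _ = _ := by rw [hr]; simpa using hl

lemma twoSided_left_of (hr : (𝗋 M).inv ≫ M ◃ ζ ≫ r = 𝟙 M) :
    A ◃ ((𝗋 M).inv ≫ M ◃ ζ) ≫ A ◃ r ≫ l = l := by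
  rw [← Bicategory.whiskerLeft_comp_assoc, Category.assoc, hr]
  simp

lemma twoSided_right_of (hl : (𝗅 M).inv ≫ η ▹ M ≫ l = 𝟙 M) :
    (𝗅 (M ≫ C)).inv ≫ η ▹ (M ≫ C) ≫ A ◃ r ≫ l = r := by
  rw [← Bicategory.whisker_exchange_assoc, ← Bicategory.leftUnitor_inv_naturality_assoc, hl]
  simp

end

section

variable {M' : a ⟶ b} {γ : A ≫ M ≫ C ⟶ M} {γ' : A ≫ M' ≫ C ⟶ M'} {f : M ⟶ M'}

/-- A map compatible with γ is compatible with what γ becomes when a unit is inserted, by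
interchange of the map with that unit. -/
lemma twoSided_hom_left (h : A ◃ (f ▹ C) ≫ γ' = γ ≫ f) :
    A ◃ f ≫ A ◃ ((𝗋 M').inv ≫ M' ◃ ζ) ≫ γ' = (A ◃ ((𝗋 M).inv ≫ M ◃ ζ) ≫ γ) ≫ f := by
  rw [Category.assoc, ← h]
  simp only [← Bicategory.whiskerLeft_comp_assoc]
  congr 2
  simp [Bicategory.whisker_exchange]

lemma twoSided_hom_right (h : A ◃ (f ▹ C) ≫ γ' = γ ≫ f) :
    f ▹ C ≫ (𝗅 (M' ≫ C)).inv ≫ η ▹ (M' ≫ C) ≫ γ' =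
      ((𝗅 (M ≫ C)).inv ≫ η ▹ (M ≫ C) ≫ γ) ≫ f := by
  rw [Category.assoc, Category.assoc, ← h, ← Bicategory.whisker_exchange_assoc]
  simp

lemma twoSided_hom_of {l : A ≫ M ⟶ M} {r : M ≫ C ⟶ M} {l' : A ≫ M' ⟶ M'} {r' : M' ≫ C ⟶ M'}
    (hl : A ◃ f ≫ l' = l ≫ f) (hr : f ▹ C ≫ r' = r ≫ f) :
    A ◃ (f ▹ C) ≫ A ◃ r' ≫ l' = (A ◃ r ≫ l) ≫ f := by
  rw [← Bicategory.whiskerLeft_comp_assoc, hr]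
  simp [hl]

end

end TwoSided

end Actions

/-! ### Monoids, bimodules and their tensor products with respect to multimaps -/

section Modules

universe w w₁ v₁ u₁

local infixr:81 " ◃ " => Bicategory.whiskerLeft
local infixl:81 " ▹ " => Bicategory.whiskerRight
local notation "𝖺" => Bicategory.associator
local notation "𝗅" => Bicategory.leftUnitor
local notation "𝗋" => Bicategory.rightUnitor

open Walled

/-- A family of 1-cells with outer coactions. -/
structure Carriers (B : Type u₁) [Bicategory.{w₁, v₁} B] [CentralAction B] where
  carrier : B → B → Type w
  wall {a b : B} (X : carrier a b) : Walled a b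
  plain {a b : B} (X : carrier a b) : (wall X).Plain

variable {B : Type u₁} [Bicategory.{w₁, v₁} B] [CentralAction B]

namespace Carriers

variable (J : Carriers.{w} B) {a b c d e : B}

/-- The underlying 1-cell. -/
abbrev one (X : J.carrier a b) : a ⟶ b := (J.wall X).obj

/-- Monoids with respect to multimaps. -/
structure Mon (a : B) where
  A : J.carrier a a
  μ : J.one A ≫ J.one A ⟶ J.one A
  η : 𝟙 a ⟶ J.one A
  isCell : IsCell ((J.wall A).tensor (J.wall A)) (J.wall A) μ
  isUnitCell : (J.wall A).IsUnitCell η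
  assoc : (𝖺 _ _ _).inv ≫ μ ▹ J.one A ≫ μ = J.one A ◃ μ ≫ μ
  one_mul : (𝗅 (J.one A)).inv ≫ η ▹ J.one A ≫ μ = 𝟙 _
  mul_one : (𝗋 (J.one A)).inv ≫ J.one A ◃ η ≫ μ = 𝟙 _

variable {J}

/-- Two-sided modules, given by commuting left and right actions. -/
structure TwoSidedMod (A : J.Mon a) (C : J.Mon b) where
  M : J.carrier a b
  l : J.one A.A ≫ J.one M ⟶ J.one M
  r : J.one M ≫ J.one C.A ⟶ J.one M
  isCell_l : IsCell ((J.wall A.A).tensor (J.wall M)) (J.wall M) l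
  isCell_r : IsCell ((J.wall M).tensor (J.wall C.A)) (J.wall M) r
  l_assoc : (𝖺 _ _ _).inv ≫ A.μ ▹ J.one M ≫ l = J.one A.A ◃ l ≫ l
  l_unit : (𝗅 (J.one M)).inv ≫ A.η ▹ J.one M ≫ l = 𝟙 _
  r_assoc : (𝖺 _ _ _).hom ≫ J.one M ◃ C.μ ≫ r = r ▹ J.one C.A ≫ r
  r_unit : (𝗋 (J.one M)).inv ≫ J.one M ◃ C.η ≫ r = 𝟙 _
  comm : J.one A.A ◃ r ≫ l = (𝖺 _ _ _).inv ≫ l ▹ J.one C.A ≫ r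

namespace TwoSidedMod

variable {A : J.Mon a} {C : J.Mon b}

/-- Maps of modules. -/
@[ext]
structure Hom (M N : TwoSidedMod A C) where
  hom : J.one M.M ⟶ J.one N.M
  isCell : IsCell (J.wall M.M) (J.wall N.M) hom
  left : J.one A.A ◃ hom ≫ N.l = M.l ≫ hom
  right : hom ▹ J.one C.A ≫ N.r = M.r ≫ hom

instance : Category (TwoSidedMod A C) where
  Hom := Hom
  id M := ⟨𝟙 _, IsCell.id _, by simp, by simp⟩
  comp f g := ⟨f.hom ≫ g.hom, f.isCell.comp g.isCell,
    by rw [Bicategory.whiskerLeft_comp, Category.assoc, g.left, reassoc_of% f.left],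
    by rw [Bicategory.comp_whiskerRight, Category.assoc, g.right, reassoc_of% f.right]⟩
  id_comp f := Hom.ext (Category.id_comp _)
  comp_id f := Hom.ext (Category.comp_id _)
  assoc f g h := Hom.ext (Category.assoc _ _ _)

@[simp] lemma id_hom (M : TwoSidedMod A C) : Hom.hom (𝟙 M) = 𝟙 (J.one M.M) := rfl
@[simp] lemma comp_hom {M N K : TwoSidedMod A C} (f : M ⟶ N) (g : N ⟶ K) :
    Hom.hom (f ≫ g) = f.hom ≫ g.hom := rfl

lemma hom_ext {M N : TwoSidedMod A C} {f g : M ⟶ N} (h : f.hom = g.hom) : f = g := Hom.ext h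

/-- A module map is invertible as soon as the underlying map is. -/
def isoMk {M N : TwoSidedMod A C} (f : M ⟶ N) (g : J.one N.M ⟶ J.one M.M)
    (hg : IsCell (J.wall N.M) (J.wall M.M) g) (h : f.hom ≫ g = 𝟙 _) (h' : g ≫ f.hom = 𝟙 _) :
    M ≅ N where
  hom := f
  inv :=
    { hom := g
      isCell := hg
      left := by
        have e : J.one A.A ◃ g ≫ J.one A.A ◃ f.hom = 𝟙 _ := by
          rw [← Bicategory.whiskerLeft_comp, h', Bicategory.whiskerLeft_id]
        calc _ = J.one A.A ◃ g ≫ (M.l ≫ f.hom) ≫ g := by rw [Category.assoc, h, Category.comp_id]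
          _ = _ := by rw [← f.left, Category.assoc, reassoc_of% e]
      right := by
        have e : g ▹ J.one C.A ≫ f.hom ▹ J.one C.A = 𝟙 _ := by
          rw [← Bicategory.comp_whiskerRight, h', Bicategory.id_whiskerRight]
        calc _ = g ▹ J.one C.A ≫ (M.r ≫ f.hom) ≫ g := by rw [Category.assoc, h, Category.comp_id]
          _ = _ := by rw [← f.right, Category.assoc, reassoc_of% e] }
  hom_inv_id := hom_ext h
  inv_hom_id := hom_ext h'

end TwoSidedMod

variable (J) in
/-- Multimaps out of the target of `f` are determined by their composites with `f`. -/
def IsEpi {X : a ⟶ b} (W : Walled a b) (f : X ⟶ W.obj) : Prop :=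
  ∀ (Z : J.carrier a b) (k k' : W.obj ⟶ J.one Z), IsCell W (J.wall Z) k →
    IsCell W (J.wall Z) k' → f ≫ k = f ≫ k' → k = k'

variable (J) in
/-- `f` is a coequalizer of `x` and `y` with respect to multimaps. -/
structure IsCoeq {X : a ⟶ b} (W W' : Walled a b) (x y : X ⟶ W.obj) (f : W.obj ⟶ W'.obj) :
    Prop where
  isCell : IsCell W W' f
  w : x ≫ f = y ≫ f
  exists_desc : ∀ (Z : J.carrier a b) (h : W.obj ⟶ J.one Z), IsCell W (J.wall Z) h →
    x ≫ h = y ≫ h → ∃ k : W'.obj ⟶ J.one Z, IsCell W' (J.wall Z) k ∧ f ≫ k = h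
  isEpi : J.IsEpi W' f

namespace IsCoeq

variable {X : a ⟶ b} {W W' : Walled a b} {x y : X ⟶ W.obj} {f : W.obj ⟶ W'.obj}
  (hf : J.IsCoeq W W' x y f) {Z : J.carrier a b} (h : W.obj ⟶ J.one Z)
  (hh : IsCell W (J.wall Z) h) (e : x ≫ h = y ≫ h)

/-- The map induced on a coequalizer. -/
noncomputable def desc : W'.obj ⟶ J.one Z := (hf.exists_desc Z h hh e).choose

lemma isCell_desc : IsCell W' (J.wall Z) (hf.desc h hh e) := (hf.exists_desc Z h hh e).choose_spec.1

lemma π_desc : f ≫ hf.desc h hh e = h := (hf.exists_desc Z h hh e).choose_spec.2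

end IsCoeq

section

variable {A : J.Mon a} {C : J.Mon b} {D : J.Mon c}

/-- `q` exhibits `K` as the tensor product of two modules, with respect to multimaps of several
variables. -/
structure IsTensor (M : TwoSidedMod A C) (N : TwoSidedMod C D) (K : J.carrier a c)
    (q : J.one M.M ≫ J.one N.M ⟶ J.one K) : Prop where
  coeq : J.IsCoeq ((J.wall M.M).tensor (J.wall N.M)) (J.wall K)
    (J.one M.M ◃ N.l) ((𝖺 _ _ _).inv ≫ M.r ▹ J.one N.M) q
  coeqL {a' : B} (X : J.carrier a' a) :
    J.IsCoeq ((J.wall X).tensor ((J.wall M.M).tensor (J.wall N.M))) ((J.wall X).tensor (J.wall K))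
      (J.one X ◃ J.one M.M ◃ N.l) (J.one X ◃ ((𝖺 _ _ _).inv ≫ M.r ▹ J.one N.M)) (J.one X ◃ q)
  coeqR {c' : B} (Y : J.carrier c c') :
    J.IsCoeq (((J.wall M.M).tensor (J.wall N.M)).tensor (J.wall Y)) ((J.wall K).tensor (J.wall Y))
      ((J.one M.M ◃ N.l) ▹ J.one Y) (((𝖺 _ _ _).inv ≫ M.r ▹ J.one N.M) ▹ J.one Y) (q ▹ J.one Y)
  epiLL {a' a'' : B} (X' : J.carrier a'' a') (X : J.carrier a' a) :
    J.IsEpi ((J.wall X').tensor ((J.wall X).tensor (J.wall K))) (J.one X' ◃ J.one X ◃ q)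
  epiLR {a' c' : B} (X : J.carrier a' a) (Y : J.carrier c c') :
    J.IsEpi ((J.wall X).tensor ((J.wall K).tensor (J.wall Y))) (J.one X ◃ (q ▹ J.one Y))
  epiRR {c' c'' : B} (Y : J.carrier c c') (Y' : J.carrier c' c'') :
    J.IsEpi (((J.wall K).tensor (J.wall Y)).tensor (J.wall Y')) ((q ▹ J.one Y) ▹ J.one Y')

end

namespace IsTensor

variable {A : J.Mon a} {C : J.Mon b} {D : J.Mon c} {M : TwoSidedMod A C} {N : TwoSidedMod C D}
  {K : J.carrier a c} {q : J.one M.M ≫ J.one N.M ⟶ J.one K} (hq : IsTensor M N K q)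

-- The left action on M commutes with the right action of C on M and, acting on another factor, with
-- the left action on N. It therefore descends to the coequalizer.
include hq in
lemma left_cond : (J.one A.A ◃ J.one M.M ◃ N.l) ≫ (𝖺 _ _ _).inv ≫ M.l ▹ J.one N.M ≫ q =
    J.one A.A ◃ ((𝖺 _ _ _).inv ≫ M.r ▹ J.one N.M) ≫ (𝖺 _ _ _).inv ≫ M.l ▹ J.one N.M ≫ q := by
  have h := hq.coeq.w
  rw [Category.assoc] at h
  calc _ = (𝖺 _ _ _).inv ≫ ((J.one A.A ≫ J.one M.M) ◃ N.l ≫ M.l ▹ J.one N.M) ≫ q := by simp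
    _ = (𝖺 _ _ _).inv ≫ M.l ▹ _ ≫ (𝖺 _ _ _).inv ≫ M.r ▹ J.one N.M ≫ q := by
      rw [Bicategory.whisker_exchange, Category.assoc, h]
    _ = (𝖺 _ _ _).inv ≫ (𝖺 _ _ _).inv ≫ (𝖺 _ _ _).hom ▹ J.one N.M ≫
          ((𝖺 _ _ _).inv ≫ M.l ▹ J.one C.A ≫ M.r) ▹ J.one N.M ≫ q := by
      bicategory
    _ = _ := by
      rw [← M.comm]
      bicategory

-- By the mirror-image argument the right action on N commutes with the left action of C on N.
include hq in
lemma right_cond : (J.one M.M ◃ N.l) ▹ J.one D.A ≫ (𝖺 _ _ _).hom ≫ J.one M.M ◃ N.r ≫ q =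
    ((𝖺 _ _ _).inv ≫ M.r ▹ J.one N.M) ▹ J.one D.A ≫ (𝖺 _ _ _).hom ≫ J.one M.M ◃ N.r ≫ q := by
  have h := hq.coeq.w
  rw [Category.assoc] at h
  have hN : N.l ▹ J.one D.A ≫ N.r = (𝖺 _ _ _).hom ≫ J.one C.A ◃ N.r ≫ N.l := by
    rw [N.comm]; simp
  symm
  calc _ = (𝖺 _ _ _).inv ▹ _ ≫ (𝖺 _ _ _).hom ≫ (M.r ▹ (J.one N.M ≫ J.one D.A) ≫
        J.one M.M ◃ N.r) ≫ q := by simp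
    _ = (𝖺 _ _ _).inv ▹ _ ≫ (𝖺 _ _ _).hom ≫ (𝖺 _ _ _).hom ≫ J.one M.M ◃ J.one C.A ◃ N.r ≫
        (𝖺 _ _ _).inv ≫ M.r ▹ J.one N.M ≫ q := by
      rw [← Bicategory.whisker_exchange]
      simp
    _ = (𝖺 _ _ _).hom ≫ J.one M.M ◃ ((𝖺 _ _ _).hom ≫ J.one C.A ◃ N.r ≫ N.l) ≫ q := by
      rw [← h]
      bicategory
    _ = _ := by
      rw [← hN]
      bicategory

/-- The left action on a tensor product. -/
noncomputable def left : J.one A.A ≫ J.one K ⟶ J.one K :=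
  (hq.coeqL A.A).desc ((𝖺 _ _ _).inv ≫ M.l ▹ J.one N.M ≫ q)
    ((IsCell.assocInv _ _ _).comp ((M.isCell_l.whiskerRight _).comp hq.coeq.isCell)) hq.left_cond

/-- The right action on a tensor product. -/
noncomputable def right : J.one K ≫ J.one D.A ⟶ J.one K :=
  (hq.coeqR D.A).desc ((𝖺 _ _ _).hom ≫ J.one M.M ◃ N.r ≫ q)
    ((IsCell.assocHom _ _ _).comp ((N.isCell_r.whiskerLeft _).comp hq.coeq.isCell)) hq.right_cond

lemma isCell_left : IsCell ((J.wall A.A).tensor (J.wall K)) (J.wall K) hq.left :=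
  IsCoeq.isCell_desc ..

lemma isCell_right : IsCell ((J.wall K).tensor (J.wall D.A)) (J.wall K) hq.right :=
  IsCoeq.isCell_desc ..

lemma π_left : J.one A.A ◃ q ≫ hq.left = (𝖺 _ _ _).inv ≫ M.l ▹ J.one N.M ≫ q :=
  IsCoeq.π_desc (hq.coeqL A.A) _ _ _

lemma π_right : q ▹ J.one D.A ≫ hq.right = (𝖺 _ _ _).hom ≫ J.one M.M ◃ N.r ≫ q :=
  (hq.coeqR D.A).π_desc _ _ _

/-- The tensor product of two modules is a module. -/
noncomputable def mod : TwoSidedMod A D where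
  M := K
  l := hq.left
  r := hq.right
  isCell_l := hq.isCell_left
  isCell_r := hq.isCell_right
  l_assoc := by
    -- Both sides are multimaps in A, A and K, hence determined on A ⊗ A ⊗ M ⊗ N, where the identity
    -- is associativity of the action on M.
    refine hq.epiLL A.A A.A K _ _ ?_ ?_ ?_
    · exact (IsCell.assocInv _ _ _).comp ((A.isCell.whiskerRight _).comp hq.isCell_left)
    · exact (hq.isCell_left.whiskerLeft _).comp hq.isCell_left
    · calc _ = (𝖺 _ _ _).inv ≫ ((J.one A.A ≫ J.one A.A) ◃ q ≫ A.μ ▹ J.one K) ≫ hq.left := by simp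
        _ = (𝖺 _ _ _).inv ≫ A.μ ▹ _ ≫ (𝖺 _ _ _).inv ≫ M.l ▹ J.one N.M ≫ q := by
          rw [Bicategory.whisker_exchange, Category.assoc, hq.π_left]
        _ = J.one A.A ◃ (𝖺 _ _ _).inv ≫ (𝖺 _ _ _).inv ≫
            ((𝖺 _ _ _).inv ≫ A.μ ▹ J.one M.M ≫ M.l) ▹ J.one N.M ≫ q := by
          bicategory
        _ = J.one A.A ◃ ((𝖺 _ _ _).inv ≫ M.l ▹ J.one N.M) ≫ (𝖺 _ _ _).inv ≫
            M.l ▹ J.one N.M ≫ q := by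
          rw [M.l_assoc]
          bicategory
        _ = _ := by
          rw [← hq.π_left]
          simp only [← Bicategory.whiskerLeft_comp_assoc, Category.assoc, ← hq.π_left]
  l_unit := by
    -- That inserting the unit yields a cell is not automatic: it relies on the unit identifying the
    -- two coactions of A.
    refine hq.coeq.isEpi K _ _ ?_ (IsCell.id _) ?_
    · exact IsCell.unitLeft A.isUnitCell (J.plain K) hq.isCell_left
    · calc _ = (𝗅 _).inv ≫ (𝟙 _ ◃ q ≫ A.η ▹ _) ≫ hq.left := by
            rw [Category.assoc, ← Bicategory.leftUnitor_inv_naturality_assoc]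
        _ = ((𝗅 _).inv ≫ A.η ▹ J.one M.M ≫ M.l) ▹ J.one N.M ≫ q := by
            rw [Bicategory.whisker_exchange, Category.assoc, hq.π_left]
            bicategory
        _ = _ := by rw [M.l_unit]; simp
  r_assoc := by
    refine hq.epiRR D.A D.A K _ _ ?_ ?_ ?_
    · exact (IsCell.assocHom _ _ _).comp ((D.isCell.whiskerLeft _).comp hq.isCell_right)
    · exact (hq.isCell_right.whiskerRight _).comp hq.isCell_right
    · calc _ = (𝖺 _ _ _).hom ≫ (q ▹ _ ≫ J.one K ◃ D.μ) ≫ hq.right := by simp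
        _ = (𝖺 _ _ _).hom ≫ _ ◃ D.μ ≫ (𝖺 _ _ _).hom ≫ J.one M.M ◃ N.r ≫ q := by
          rw [← Bicategory.whisker_exchange, Category.assoc, hq.π_right]
        _ = (𝖺 _ _ _).hom ▹ _ ≫ (𝖺 _ _ _).hom ≫
            J.one M.M ◃ ((𝖺 _ _ _).hom ≫ J.one N.M ◃ D.μ ≫ N.r) ≫ q := by
          bicategory
        _ = ((𝖺 _ _ _).hom ≫ J.one M.M ◃ N.r) ▹ J.one D.A ≫ (𝖺 _ _ _).hom ≫
            J.one M.M ◃ N.r ≫ q := by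
          rw [N.r_assoc]
          bicategory
        _ = _ := by
          rw [← hq.π_right]
          simp only [← Bicategory.comp_whiskerRight_assoc, Category.assoc, ← hq.π_right]
  r_unit := by
    refine hq.coeq.isEpi K _ _ ?_ (IsCell.id _) ?_
    · exact IsCell.unitRight D.isUnitCell (J.plain K) hq.isCell_right
    · calc _ = (𝗋 _).inv ≫ (q ▹ 𝟙 _ ≫ _ ◃ D.η) ≫ hq.right := by
            rw [Category.assoc, ← Bicategory.rightUnitor_inv_naturality_assoc]
        _ = J.one M.M ◃ ((𝗋 _).inv ≫ J.one N.M ◃ D.η ≫ N.r) ≫ q := by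
            rw [← Bicategory.whisker_exchange, Category.assoc, hq.π_right]
            bicategory
        _ = _ := by rw [N.r_unit]; simp
  comm := by
    -- On A ⊗ M ⊗ N ⊗ D the two actions affect different factors, so they commute by interchange.
    refine hq.epiLR A.A D.A K _ _ ?_ ?_ ?_
    · exact (hq.isCell_right.whiskerLeft _).comp hq.isCell_left
    · exact (IsCell.assocInv _ _ _).comp ((hq.isCell_left.whiskerRight _).comp hq.isCell_right)
    · calc _ = J.one A.A ◃ (𝖺 _ _ _).hom ≫ J.one A.A ◃ J.one M.M ◃ N.r ≫
            (𝖺 _ _ _).inv ≫ M.l ▹ J.one N.M ≫ q := by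
            rw [← Bicategory.whiskerLeft_comp_assoc, hq.π_right]
            simp only [Bicategory.whiskerLeft_comp, Category.assoc]
            rw [hq.π_left]
        _ = J.one A.A ◃ (𝖺 _ _ _).hom ≫ (𝖺 _ _ _).inv ≫
            ((J.one A.A ≫ J.one M.M) ◃ N.r ≫ M.l ▹ J.one N.M) ≫ q := by simp
        _ = J.one A.A ◃ (𝖺 _ _ _).hom ≫ (𝖺 _ _ _).inv ≫ M.l ▹ _ ≫ J.one M.M ◃ N.r ≫ q := by
          rw [Bicategory.whisker_exchange, Category.assoc]
        _ = (𝖺 _ _ _).inv ≫ ((𝖺 _ _ _).inv ≫ M.l ▹ J.one N.M) ▹ J.one D.A ≫ (𝖺 _ _ _).hom ≫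
            J.one M.M ◃ N.r ≫ q := by bicategory
        _ = _ := by
          rw [← hq.π_right, ← Bicategory.comp_whiskerRight_assoc, Category.assoc, ← hq.π_left]
          simp

end IsTensor

/-- `q` exhibits the module `K` as the tensor product of two modules. -/
structure IsProd {A : J.Mon a} {C : J.Mon b} {D : J.Mon c} (M : TwoSidedMod A C)
    (N : TwoSidedMod C D)
    (K : TwoSidedMod A D) (q : J.one M.M ≫
        J.one N.M ⟶ J.one K.M) : Prop extends IsTensor M N K.M q where
  left : J.one A.A ◃ q ≫ K.l = (𝖺 _ _ _).inv ≫ M.l ▹ J.one N.M ≫ q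
  right : q ▹ J.one D.A ≫ K.r = (𝖺 _ _ _).hom ≫ J.one M.M ◃ N.r ≫ q

lemma IsTensor.isProd {A : J.Mon a} {C : J.Mon b} {D : J.Mon c} {M : TwoSidedMod A C}
    {N : TwoSidedMod C D}
    {K : J.carrier a c} {q : J.one M.M ≫ J.one N.M ⟶ J.one K} (hq : IsTensor M N K q) :
    IsProd M N hq.mod q :=
  { hq with
    left := hq.π_left
    right := hq.π_right }

namespace IsProd

variable {A : J.Mon a} {C : J.Mon b} {D : J.Mon c} {M : TwoSidedMod A C} {N : TwoSidedMod C D}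
  {K : TwoSidedMod A D} {q : J.one M.M ≫ J.one N.M ⟶ J.one K.M} (hq : IsProd M N K q)

/-- The map of modules induced by a multimap. -/
noncomputable def desc {X : TwoSidedMod A D} (h : J.one M.M ≫ J.one N.M ⟶ J.one X.M)
    (hh : IsCell ((J.wall M.M).tensor (J.wall N.M)) (J.wall X.M) h)
    (e : J.one M.M ◃ N.l ≫ h = ((𝖺 _ _ _).inv ≫ M.r ▹ J.one N.M) ≫ h)
    (hl : J.one A.A ◃ h ≫ X.l = (𝖺 _ _ _).inv ≫ M.l ▹ J.one N.M ≫ h)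
    (hr : h ▹ J.one D.A ≫ X.r = (𝖺 _ _ _).hom ≫ J.one M.M ◃ N.r ≫ h) : K ⟶ X where
  hom := hq.coeq.desc h hh e
  isCell := IsCoeq.isCell_desc ..
  left := by
    -- Linearity of the induced map is tested on A ⊗ M ⊗ N; this needs the universal map to stay epi
    -- after a variable is adjoined.
    refine (hq.coeqL A.A).isEpi X.M _ _ ((IsCell.whiskerLeft _
        (IsCoeq.isCell_desc ..)).comp X.isCell_l)
      (K.isCell_l.comp (IsCoeq.isCell_desc ..)) ?_
    rw [← Bicategory.whiskerLeft_comp_assoc, hq.coeq.π_desc, hl, reassoc_of% hq.left,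
      hq.coeq.π_desc]
  right := by
    refine (hq.coeqR D.A).isEpi X.M _ _ ((IsCell.whiskerRight
        (IsCoeq.isCell_desc ..) _).comp X.isCell_r)
      (K.isCell_r.comp (IsCoeq.isCell_desc ..)) ?_
    rw [← Bicategory.comp_whiskerRight_assoc, hq.coeq.π_desc, hr, reassoc_of% hq.right,
      hq.coeq.π_desc]

lemma π_desc {X : TwoSidedMod A D} (h : J.one M.M ≫ J.one N.M ⟶ J.one X.M)
    (hh : IsCell ((J.wall M.M).tensor (J.wall N.M)) (J.wall X.M) h)
    (e : J.one M.M ◃ N.l ≫ h = ((𝖺 _ _ _).inv ≫ M.r ▹ J.one N.M) ≫ h)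
    (hl : J.one A.A ◃ h ≫ X.l = (𝖺 _ _ _).inv ≫ M.l ▹ J.one N.M ≫ h)
    (hr : h ▹ J.one D.A ≫ X.r = (𝖺 _ _ _).hom ≫ J.one M.M ◃ N.r ≫ h) :
    q ≫ (hq.desc h hh e hl hr).hom = h := hq.coeq.π_desc h hh e

include hq in
lemma hom_ext {X : TwoSidedMod A D} {f g : K ⟶ X} (h : q ≫ f.hom = q ≫ g.hom) : f = g :=
  TwoSidedMod.hom_ext (hq.coeq.isEpi X.M _ _ f.isCell g.isCell h)

include hq in
lemma w : J.one M.M ◃ N.l ≫ q = (𝖺 _ _ _).inv ≫ M.r ▹ J.one N.M ≫ q :=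
  hq.coeq.w.trans (Category.assoc _ _ _)

section Map

variable {M' : TwoSidedMod A C} {N' : TwoSidedMod C D} {K' : TwoSidedMod A D}
  {q' : J.one M'.M ≫ J.one N'.M ⟶ J.one K'.M} (hq' : IsProd M' N' K' q') (f : M ⟶ M') (g : N ⟶ N')

/-- The tensor product of two maps of modules. -/
noncomputable def map : K ⟶ K' :=
  hq.desc (f.hom ▹ _ ≫ _ ◃ g.hom ≫ q')
    ((f.isCell.whiskerRight _).comp ((g.isCell.whiskerLeft _).comp hq'.coeq.isCell))
    (by
      calc _ = (_ ◃ N.l ≫ f.hom ▹ _) ≫ _ ◃ g.hom ≫ q' := by rw [Category.assoc]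
        _ = f.hom ▹ _ ≫ _ ◃ (N.l ≫ g.hom) ≫ q' := by
          rw [Bicategory.whisker_exchange]; simp
        _ = f.hom ▹ _ ≫ (𝖺 _ _ _).inv ≫ (_ ◃ g.hom ≫ M'.r ▹ _) ≫ q' := by
          rw [← g.left, Bicategory.whiskerLeft_comp, Category.assoc, hq'.w]; simp
        _ = (𝖺 _ _ _).inv ≫ (f.hom ▹ _ ≫ M'.r) ▹ _ ≫ _ ◃ g.hom ≫ q' := by
          rw [Bicategory.whisker_exchange]; simp
        _ = _ := by rw [f.right]; simp)
    (by
      calc _ = _ ◃ (f.hom ▹ _) ≫ _ ◃ _ ◃ g.hom ≫ _ ◃ q' ≫ K'.l := by simp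
        _ = _ ◃ (f.hom ▹ _) ≫ (𝖺 _ _ _).inv ≫ (_ ◃ g.hom ≫ M'.l ▹ _) ≫ q' := by
          rw [hq'.left]; simp
        _ = (𝖺 _ _ _).inv ≫ (_ ◃ f.hom ≫ M'.l) ▹ _ ≫ _ ◃ g.hom ≫ q' := by
          rw [Bicategory.whisker_exchange]; simp
        _ = _ := by rw [f.left]; simp)
    (by
      calc _ = (f.hom ▹ _) ▹ _ ≫ (_ ◃ g.hom) ▹ _ ≫ q' ▹ _ ≫ K'.r := by simp
        _ = (f.hom ▹ _) ▹ _ ≫ (𝖺 _ _ _).hom ≫ _ ◃ (g.hom ▹ _ ≫ N'.r) ≫ q' := by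
          rw [hq'.right]; simp
        _ = (𝖺 _ _ _).hom ≫ (f.hom ▹ _ ≫ _ ◃ N.r) ≫ _ ◃ g.hom ≫ q' := by
          rw [g.right]; simp
        _ = _ := by rw [← Bicategory.whisker_exchange, Category.assoc])

lemma π_map : q ≫ (hq.map hq' f g).hom = f.hom ▹ _ ≫ _ ◃ g.hom ≫ q' := hq.π_desc ..

end Map

end IsProd

end Carriers

end Modules

/-! ### Associativity and unit isomorphisms of modules -/

section ModuleAssociator

universe w w₁ v₁ u₁

local infixr:81 " ◃ " => Bicategory.whiskerLeft
local infixl:81 " ▹ " => Bicategory.whiskerRight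
local notation "𝖺" => Bicategory.associator
local notation "𝗅" => Bicategory.leftUnitor
local notation "𝗋" => Bicategory.rightUnitor

open Walled

variable {B : Type u₁} [Bicategory.{w₁, v₁} B] [CentralAction B]

namespace Carriers.IsProd

variable {J : Carriers.{w} B} {a b c d : B}
  {A : J.Mon a} {C : J.Mon b} {D : J.Mon c} {E : J.Mon d}
  {M : TwoSidedMod A C} {N : TwoSidedMod C D} {P : TwoSidedMod D E} {MN : TwoSidedMod A D}
      {NP : TwoSidedMod C E} {K L : TwoSidedMod A E}
  {q₁ : J.one M.M ≫ J.one N.M ⟶ J.one MN.M} {q₂ : J.one N.M ≫ J.one P.M ⟶ J.one NP.M}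
  {q : J.one MN.M ≫ J.one P.M ⟶ J.one K.M} {q' : J.one M.M ≫ J.one NP.M ⟶ J.one L.M}
  (h₁ : IsProd M N MN q₁) (h₂ : IsProd N P NP q₂) (h : IsProd MN P K q) (h' : IsProd M NP L q')

-- The left action of C on NP is induced by that on N, so balancing of M with NP over C contains
-- balancing of M with N.
include h₂ h' in
lemma assocAux_cond : (J.one M.M ◃ N.l) ▹ J.one P.M ≫ (𝖺 _ _ _).hom ≫ J.one M.M ◃ q₂ ≫ q' =
    ((𝖺 _ _ _).inv ≫ M.r ▹ J.one N.M) ▹ J.one P.M ≫ (𝖺 _ _ _).hom ≫ J.one M.M ◃ q₂ ≫ q' := by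
  have e : N.l ▹ J.one P.M ≫ q₂ = (𝖺 _ _ _).hom ≫ J.one C.A ◃ q₂ ≫ NP.l := by
    rw [h₂.left]; simp
  calc _ = (𝖺 _ _ _).hom ≫ J.one M.M ◃ (N.l ▹ J.one P.M ≫ q₂) ≫ q' := by simp
    _ = (𝖺 _ _ _).hom ≫ J.one M.M ◃ (𝖺 _ _ _).hom ≫ J.one M.M ◃ J.one C.A ◃ q₂ ≫
        (𝖺 _ _ _).inv ≫ M.r ▹ _ ≫ q' := by
      rw [e]
      simp only [Bicategory.whiskerLeft_comp, Category.assoc, h'.w]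
    _ = (𝖺 _ _ _).hom ≫ J.one M.M ◃ (𝖺 _ _ _).hom ≫ (𝖺 _ _ _).inv ≫
        ((J.one M.M ≫ J.one C.A) ◃ q₂ ≫ M.r ▹ _) ≫ q' := by simp
    _ = (𝖺 _ _ _).hom ≫ J.one M.M ◃ (𝖺 _ _ _).hom ≫ (𝖺 _ _ _).inv ≫
        M.r ▹ _ ≫ J.one M.M ◃ q₂ ≫ q' := by
      rw [Bicategory.whisker_exchange, Category.assoc]
    _ = _ := by bicategory

/-- The map `MN ⊗ P ⟶ M(NP)`. -/
noncomputable def assocAux : J.one MN.M ≫ J.one P.M ⟶ J.one L.M :=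
  (h₁.coeqR P.M).desc ((𝖺 _ _ _).hom ≫ J.one M.M ◃ q₂ ≫ q')
    ((IsCell.assocHom _ _ _).comp ((h₂.coeq.isCell.whiskerLeft _).comp h'.coeq.isCell))
    (assocAux_cond h₂ h')

lemma isCell_assocAux :
    IsCell ((J.wall MN.M).tensor (J.wall P.M)) (J.wall L.M) (h₁.assocAux h₂ h') :=
  IsCoeq.isCell_desc ..

lemma π_assocAux : q₁ ▹ J.one P.M ≫ h₁.assocAux h₂ h' = (𝖺 _ _ _).hom ≫ J.one M.M ◃ q₂ ≫ q' :=
  (h₁.coeqR P.M).π_desc _ _ _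

/-- The associativity map of modules. -/
noncomputable def assocHom : K ⟶ L :=
  h.desc (h₁.assocAux h₂ h') (h₁.isCell_assocAux h₂ h')
    (by
      rw [← cancel_epi (𝖺 _ _ _).hom]
      -- Balancing over D is tested on M ⊗ N ⊗ D ⊗ P, where it is the balancing of N with P inside M
      -- ⊗ NP; two further variables are present.
      refine h₁.epiRR D.A P.M L.M _ _
        ((IsCell.assocHom _ _ _).comp ((P.isCell_l.whiskerLeft _).comp (h₁.isCell_assocAux h₂ h')))
        (by
          simpa using (MN.isCell_r.whiskerRight (J.wall P.M)).comp (h₁.isCell_assocAux h₂ h')) ?_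
      calc _ = (𝖺 _ _ _).hom ≫ (q₁ ▹ _ ≫ _ ◃ P.l) ≫ h₁.assocAux h₂ h' := by simp
        _ = (𝖺 _ _ _).hom ≫ _ ◃ P.l ≫ (𝖺 _ _ _).hom ≫ J.one M.M ◃ q₂ ≫ q' := by
          rw [← Bicategory.whisker_exchange, Category.assoc, h₁.π_assocAux]
        _ = (𝖺 _ _ _).hom ≫ (𝖺 _ _ _).hom ≫ J.one M.M ◃ (J.one N.M ◃ P.l ≫ q₂) ≫ q' := by
          simp
        _ = ((𝖺 _ _ _).hom ≫ J.one M.M ◃ N.r) ▹ _ ≫ (𝖺 _ _ _).hom ≫ J.one M.M ◃ q₂ ≫ q' := by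
          rw [h₂.w]
          bicategory
        _ = (q₁ ▹ J.one D.A ≫ MN.r) ▹ _ ≫ h₁.assocAux h₂ h' := by
          rw [h₁.right, ← h₁.π_assocAux h₂ h']
          simp
        _ = _ := by simp)
    (by
      refine h₁.epiLR A.A P.M L.M _ _
        (((h₁.isCell_assocAux h₂ h').whiskerLeft _).comp L.isCell_l)
        ((IsCell.assocInv _ _ _).comp ((MN.isCell_l.whiskerRight _).comp
            (h₁.isCell_assocAux h₂ h')))
        ?_
      calc _ = _ ◃ (𝖺 _ _ _).hom ≫ _ ◃ _ ◃ q₂ ≫ _ ◃ q' ≫ L.l := by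
            rw [← Bicategory.whiskerLeft_comp_assoc, h₁.π_assocAux]
            simp
        _ = _ ◃ (𝖺 _ _ _).hom ≫ (𝖺 _ _ _).inv ≫ (_ ◃ q₂ ≫ M.l ▹ _) ≫ q' := by
          rw [h'.left]; simp
        _ = (𝖺 _ _ _).inv ≫ ((𝖺 _ _ _).inv ≫ M.l ▹ J.one N.M) ▹ _ ≫ (𝖺 _ _ _).hom ≫
            _ ◃ q₂ ≫ q' := by
          rw [Bicategory.whisker_exchange]
          bicategory
        _ = (𝖺 _ _ _).inv ≫ (_ ◃ q₁ ≫ MN.l) ▹ _ ≫ h₁.assocAux h₂ h' := by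
          rw [h₁.left, ← h₁.π_assocAux h₂ h']
          simp
        _ = _ := by simp)
    (by
      refine h₁.epiRR P.M E.A L.M _ _
        (((h₁.isCell_assocAux h₂ h').whiskerRight _).comp L.isCell_r)
        ((IsCell.assocHom _ _ _).comp ((P.isCell_r.whiskerLeft _).comp (h₁.isCell_assocAux h₂ h')))
        ?_
      calc _ = (𝖺 _ _ _).hom ▹ _ ≫ (_ ◃ q₂) ▹ _ ≫ q' ▹ _ ≫ L.r := by
            rw [← Bicategory.comp_whiskerRight_assoc, h₁.π_assocAux]
            simp
        _ = (𝖺 _ _ _).hom ▹ _ ≫ (𝖺 _ _ _).hom ≫ _ ◃ (q₂ ▹ _ ≫ NP.r) ≫ q' := by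
          rw [h'.right]; simp
        _ = (𝖺 _ _ _).hom ≫ _ ◃ P.r ≫ (𝖺 _ _ _).hom ≫ _ ◃ q₂ ≫ q' := by
          rw [h₂.right]
          bicategory
        _ = (𝖺 _ _ _).hom ≫ (_ ◃ P.r ≫ q₁ ▹ _) ≫ h₁.assocAux h₂ h' := by
          rw [Category.assoc, h₁.π_assocAux]
        _ = _ := by
          rw [Bicategory.whisker_exchange]
          simp)

lemma π_assocHom : q₁ ▹ J.one P.M ≫ q ≫ (assocHom h₁ h₂ h h').hom =
    (𝖺 _ _ _).hom ≫ J.one M.M ◃ q₂ ≫ q' := by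
  rw [assocHom, h.π_desc, h₁.π_assocAux]

-- The right action of D on MN is induced by that on N, so balancing of MN with P over D contains
-- balancing of N with P.
include h₁ h in
lemma assocInvAux_cond : (J.one M.M ◃ J.one N.M ◃ P.l) ≫ (𝖺 _ _ _).inv ≫ q₁ ▹ J.one P.M ≫ q =
    (J.one M.M ◃ ((𝖺 _ _ _).inv ≫ N.r ▹ J.one P.M)) ≫ (𝖺 _ _ _).inv ≫ q₁ ▹ J.one P.M ≫ q := by
  have e : J.one M.M ◃ N.r ≫ q₁ = (𝖺 _ _ _).inv ≫ q₁ ▹ J.one D.A ≫ MN.r := by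
    rw [h₁.right]; simp
  calc _ = (𝖺 _ _ _).inv ≫ (_ ◃ P.l ≫ q₁ ▹ _) ≫ q := by simp
    _ = (𝖺 _ _ _).inv ≫ q₁ ▹ _ ≫ (𝖺 _ _ _).inv ≫ MN.r ▹ _ ≫ q := by
      rw [Bicategory.whisker_exchange, Category.assoc, h.w]
    _ = J.one M.M ◃ (𝖺 _ _ _).inv ≫ (𝖺 _ _ _).inv ≫
        ((𝖺 _ _ _).inv ≫ q₁ ▹ J.one D.A ≫ MN.r) ▹ _ ≫ q := by bicategory
    _ = _ := by
      rw [← e]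
      bicategory

/-- The map `M ⊗ NP ⟶ (MN)P`. -/
noncomputable def assocInvAux : J.one M.M ≫ J.one NP.M ⟶ J.one K.M :=
  (h₂.coeqL M.M).desc ((𝖺 _ _ _).inv ≫ q₁ ▹ J.one P.M ≫ q)
    ((IsCell.assocInv _ _ _).comp ((h₁.coeq.isCell.whiskerRight _).comp h.coeq.isCell))
    (assocInvAux_cond h₁ h)

lemma isCell_assocInvAux :
    IsCell ((J.wall M.M).tensor (J.wall NP.M)) (J.wall K.M) (h₁.assocInvAux h₂ h) :=
  IsCoeq.isCell_desc ..

lemma π_assocInvAux : J.one M.M ◃ q₂ ≫ h₁.assocInvAux h₂ h = (𝖺 _ _ _).inv ≫ q₁ ▹ J.one P.M ≫ q :=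
  (h₂.coeqL M.M).π_desc _ _ _

/-- Tested on M ⊗ C ⊗ N ⊗ P, where the action on NP becomes the action on N, this is the balancing
of M with N over C. -/
lemma assocInvAux_w : J.one M.M ◃ NP.l ≫ h₁.assocInvAux h₂ h =
    ((𝖺 _ _ _).inv ≫ M.r ▹ J.one NP.M) ≫ h₁.assocInvAux h₂ h := by
  refine h₂.epiLL M.M C.A K.M _ _
    ((NP.isCell_l.whiskerLeft _).comp (h₁.isCell_assocInvAux h₂ h))
    (by
      simpa using (IsCell.assocInv _ _ _).comp
        ((M.isCell_r.whiskerRight (J.wall NP.M)).comp (h₁.isCell_assocInvAux h₂ h))) ?_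
  calc _ = J.one M.M ◃ (J.one C.A ◃ q₂ ≫ NP.l) ≫ h₁.assocInvAux h₂ h := by simp
    _ = J.one M.M ◃ (𝖺 _ _ _).inv ≫ J.one M.M ◃ (N.l ▹ J.one P.M) ≫ (𝖺 _ _ _).inv ≫
        q₁ ▹ J.one P.M ≫ q := by
      rw [h₂.left, ← h₁.π_assocInvAux h₂ h]
      simp
    _ = J.one M.M ◃ (𝖺 _ _ _).inv ≫ (𝖺 _ _ _).inv ≫ (J.one M.M ◃ N.l ≫ q₁) ▹ J.one P.M ≫ q := by
      simp
    _ = (𝖺 _ _ _).inv ≫ M.r ▹ _ ≫ (𝖺 _ _ _).inv ≫ q₁ ▹ J.one P.M ≫ q := by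
      rw [h₁.w]
      bicategory
    _ = (𝖺 _ _ _).inv ≫ (M.r ▹ _ ≫ J.one M.M ◃ q₂) ≫ h₁.assocInvAux h₂ h := by
      rw [Category.assoc, h₁.π_assocInvAux]
    _ = _ := by
      rw [← Bicategory.whisker_exchange]
      simp

/-- The inverse of the associativity map of modules. -/
noncomputable def assocInv : J.one L.M ⟶ J.one K.M :=
  h'.coeq.desc (h₁.assocInvAux h₂ h) (h₁.isCell_assocInvAux h₂ h) (h₁.assocInvAux_w h₂ h)

lemma isCell_assocInv : IsCell (J.wall L.M) (J.wall K.M) (assocInv h₁ h₂ h h') :=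
  IsCoeq.isCell_desc ..

lemma π_assocInv : J.one M.M ◃ q₂ ≫ q' ≫ assocInv h₁ h₂ h h' =
    (𝖺 _ _ _).inv ≫ q₁ ▹ J.one P.M ≫ q := by
  rw [assocInv, h'.coeq.π_desc, h₁.π_assocInvAux]

/-- The associativity isomorphism of modules. -/
noncomputable def assoc : K ≅ L :=
  TwoSidedMod.isoMk (assocHom h₁ h₂ h h') (assocInv h₁ h₂ h h') (isCell_assocInv h₁ h₂ h h')
    (by
      have hc := (assocHom h₁ h₂ h h').isCell.comp (isCell_assocInv h₁ h₂ h h')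
      refine h.coeq.isEpi K.M _ _ hc (IsCell.id _) ((h₁.coeqR P.M).isEpi K.M _ _
        (h.coeq.isCell.comp hc) (h.coeq.isCell.comp (IsCell.id _)) ?_)
      rw [reassoc_of% (π_assocHom h₁ h₂ h h'), π_assocInv]
      simp)
    (by
      have hc := (isCell_assocInv h₁ h₂ h h').comp (assocHom h₁ h₂ h h').isCell
      refine h'.coeq.isEpi L.M _ _ hc (IsCell.id _) ((h₂.coeqL M.M).isEpi L.M _ _
        (h'.coeq.isCell.comp hc) (h'.coeq.isCell.comp (IsCell.id _)) ?_)
      rw [reassoc_of% (π_assocInv h₁ h₂ h h'), π_assocHom]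
      simp)

lemma π_assoc : q₁ ▹ J.one P.M ≫ q ≫ (assoc h₁ h₂ h h').hom.hom =
    (𝖺 _ _ _).hom ≫ J.one M.M ◃ q₂ ≫ q' := π_assocHom h₁ h₂ h h'

-- The universal map of MN with P is epi, and that of M with N stays epi when P is adjoined.
include h₁ h in
lemma hom_ext₂ {X : TwoSidedMod A E} {f g : K ⟶ X}
    (e : q₁ ▹ J.one P.M ≫ q ≫ f.hom = q₁ ▹ J.one P.M ≫ q ≫ g.hom) : f = g :=
  h.hom_ext ((h₁.coeqR P.M).isEpi X.M _ _ (h.coeq.isCell.comp f.isCell)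
    (h.coeq.isCell.comp g.isCell) e)

end Carriers.IsProd

namespace Carriers

variable {J : Carriers.{w} B} {a b c d : B}

/-- A monoid as a module over itself. -/
def Mon.mod (A : J.Mon a) : TwoSidedMod A A where
  M := A.A
  l := A.μ
  r := A.μ
  isCell_l := A.isCell
  isCell_r := A.isCell
  l_assoc := A.assoc
  l_unit := A.one_mul
  r_assoc := by rw [← A.assoc]; simp
  r_unit := A.mul_one
  comm := A.assoc.symm

namespace IsProd

variable {A : J.Mon a} {C : J.Mon b} {M K : TwoSidedMod A C}

section

variable {q : J.one A.A ≫ J.one M.M ⟶ J.one K.M} (hq : IsProd A.mod M K q)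

/-- The left unit map of modules. -/
noncomputable def lunitHom : K ⟶ M :=
  hq.desc M.l M.isCell_l (M.l_assoc.symm.trans (Category.assoc _ _ _).symm) M.l_assoc.symm
    ((Iso.eq_inv_comp _).1 M.comm).symm

lemma π_lunitHom : q ≫ hq.lunitHom.hom = M.l :=
  hq.coeq.π_desc M.l M.isCell_l (M.l_assoc.symm.trans (Category.assoc _ _ _).symm)

/-- The left unit isomorphism of modules. -/
noncomputable def lunit : K ≅ M :=
  TwoSidedMod.isoMk hq.lunitHom ((𝗅 _).inv ≫ A.η ▹ _ ≫ q)
    (IsCell.unitLeft A.isUnitCell (J.plain _) hq.coeq.isCell)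
    (by
      have hc := IsCell.unitLeft A.isUnitCell (J.plain _) hq.coeq.isCell
      refine hq.coeq.isEpi _ _ _ (hq.lunitHom.isCell.comp hc) (IsCell.id _) ?_
      -- Inserting a unit after the action is undone by balancing: the action moves onto the
      -- inserted copy of A as a multiplication, which the unit law absorbs.
      have hw : J.one A.A ◃ M.l ≫ q = (𝖺 _ _ _).inv ≫ A.μ ▹ _ ≫ q := hq.w
      have e : q ≫ hq.lunitHom.hom ≫ (𝗅 (J.one M.M)).inv ≫ A.η ▹ _ ≫ q = q := by
        rw [reassoc_of% hq.π_lunitHom]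
        calc _ = (𝗅 _).inv ≫ (_ ◃ M.l ≫ A.η ▹ _) ≫ q := by
              rw [Category.assoc, ← Bicategory.leftUnitor_inv_naturality_assoc]
          _ = (𝗅 _).inv ≫ A.η ▹ _ ≫ (𝖺 _ _ _).inv ≫ A.μ ▹ _ ≫ q := by
            rw [Bicategory.whisker_exchange, Category.assoc, hw]
          _ = ((𝗅 _).inv ≫ A.η ▹ _ ≫ A.μ) ▹ _ ≫ q := by bicategory
          _ = _ := by
            rw [A.one_mul, Bicategory.id_whiskerRight, Category.id_comp]
      exact e.trans (Category.comp_id q).symm)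
    (by rw [Category.assoc, Category.assoc, hq.π_lunitHom, M.l_unit])

lemma π_lunit : q ≫ hq.lunit.hom.hom = M.l := hq.π_lunitHom

end

section

variable {q : J.one M.M ≫ J.one C.A ⟶ J.one K.M} (hq : IsProd M C.mod K q)

/-- The right unit map of modules. -/
noncomputable def runitHom : K ⟶ M :=
  hq.desc M.r M.isCell_r (((Iso.eq_inv_comp _).2 M.r_assoc).trans (Category.assoc _ _ _).symm)
    M.comm M.r_assoc.symm

lemma π_runitHom : q ≫ hq.runitHom.hom = M.r :=
  hq.coeq.π_desc M.r M.isCell_r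
    (((Iso.eq_inv_comp _).2 M.r_assoc).trans (Category.assoc _ _ _).symm)

/-- The right unit isomorphism of modules. -/
noncomputable def runit : K ≅ M :=
  TwoSidedMod.isoMk hq.runitHom ((𝗋 _).inv ≫ _ ◃ C.η ≫ q)
    (IsCell.unitRight C.isUnitCell (J.plain _) hq.coeq.isCell)
    (by
      have hc := IsCell.unitRight C.isUnitCell (J.plain _) hq.coeq.isCell
      refine hq.coeq.isEpi _ _ _ (hq.runitHom.isCell.comp hc) (IsCell.id _) ?_
      have hw : J.one M.M ◃ C.μ ≫ q = (𝖺 _ _ _).inv ≫ M.r ▹ _ ≫ q := hq.w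
      have e : q ≫ hq.runitHom.hom ≫ (𝗋 (J.one M.M)).inv ≫ _ ◃ C.η ≫ q = q := by
        rw [reassoc_of% hq.π_runitHom]
        calc _ = (𝗋 _).inv ≫ (M.r ▹ _ ≫ _ ◃ C.η) ≫ q := by
              rw [Category.assoc, ← Bicategory.rightUnitor_inv_naturality_assoc]
          _ = (𝗋 _).inv ≫ _ ◃ C.η ≫ (𝖺 _ _ _).hom ≫ _ ◃ C.μ ≫ q := by
            rw [← Bicategory.whisker_exchange, Category.assoc, hw]
            simp
          _ = _ ◃ ((𝗋 _).inv ≫ _ ◃ C.η ≫ C.μ) ≫ q := by bicategory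
          _ = _ := by
            rw [C.mul_one, Bicategory.whiskerLeft_id, Category.id_comp]
      exact e.trans (Category.comp_id q).symm)
    (by rw [Category.assoc, Category.assoc, hq.π_runitHom, M.r_unit])

lemma π_runit : q ≫ hq.runit.hom.hom = M.r := hq.π_runitHom

end

end IsProd

end Carriers

end ModuleAssociator

/-! ### The bicategory of monoids and modules -/

section ModuleBicategory

universe w w₁ v₁ u₁ u₂

local infixr:81 " ◃ " => Bicategory.whiskerLeft
local infixl:81 " ▹ " => Bicategory.whiskerRight
local notation "𝖺" => Bicategory.associator
local notation "𝗅" => Bicategory.leftUnitor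
local notation "𝗋" => Bicategory.rightUnitor

open Walled

variable {B : Type u₁} [Bicategory.{w₁, v₁} B] [CentralAction B]

/-- A family of monoids with a choice of tensor products of the modules between them. -/
structure ModuleFamily (J : Carriers.{w} B) (O : Type u₂) where
  base : O → B
  mon (x : O) : J.Mon (base x)
  tensor {x y z : O} (M : Carriers.TwoSidedMod (mon x) (mon y))
    (N : Carriers.TwoSidedMod (mon y) (mon z)) : J.carrier (base x) (base z)
  univ {x y z : O} (M : Carriers.TwoSidedMod (mon x) (mon y))
    (N : Carriers.TwoSidedMod (mon y) (mon z)) : J.one M.M ≫ J.one N.M ⟶ J.one (tensor M N)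
  isTensor {x y z : O} (M : Carriers.TwoSidedMod (mon x) (mon y))
    (N : Carriers.TwoSidedMod (mon y) (mon z)) : Carriers.IsTensor M N (tensor M N) (univ M N)

namespace ModuleFamily

open Carriers

variable {J : Carriers.{w} B} {O : Type u₂} (F : ModuleFamily J O) {x y z t s : O}

/-- The 1-cells are the modules. -/
abbrev Cell (x y : O) := TwoSidedMod (F.mon x) (F.mon y)

variable {F}

section

variable (M : F.Cell x y) (N : F.Cell y z)

/-- The composite of two modules. -/
noncomputable def prod : F.Cell x z := (F.isTensor M N).mod

/-- The universal map to the composite of two modules. -/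
def π : J.one M.M ≫ J.one N.M ⟶ J.one (prod M N).M := F.univ M N

lemma isProd : IsProd M N (prod M N) (π M N) :=
  (F.isTensor M N).isProd

end

section

variable {M M' : F.Cell x y} {N N' : F.Cell y z}

/-- The composite of two maps of modules. -/
noncomputable def map (f : M ⟶ M') (g : N ⟶ N') : prod M N ⟶ prod M' N' :=
  (isProd M N).map (isProd M' N') f g

lemma π_map (f : M ⟶ M') (g : N ⟶ N') :
    π M N ≫ (map f g).hom = f.hom ▹ J.one N.M ≫ J.one M'.M ◃ g.hom ≫ π M' N' := IsProd.π_map ..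

lemma π_map_left (M : F.Cell x y) (g : N ⟶ N') :
    π M N ≫ (map (𝟙 M) g).hom = J.one M.M ◃ g.hom ≫ π M N' := by
  rw [π_map]; simp

lemma π_map_right (f : M ⟶ M') (N : F.Cell y z) :
    π M N ≫ (map f (𝟙 N)).hom = f.hom ▹ J.one N.M ≫ π M' N := by
  rw [π_map]; simp

lemma hom_ext {X : F.Cell x z} {f g : prod M N ⟶ X} (h : π M N ≫ f.hom = π M N ≫ g.hom) : f = g :=
  (isProd M N).hom_ext h

lemma hom_ext₂ {P : F.Cell z t} {X : F.Cell x t} {f g : prod (prod M N) P ⟶ X}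
    (h : π M N ▹ J.one P.M ≫ π (prod M N) P ≫ f.hom = π M N ▹ J.one P.M ≫ π (prod M N) P ≫ g.hom) :
    f = g :=
  (isProd M N).hom_ext₂ (isProd _ P) h

lemma map_id : map (𝟙 M) (𝟙 N) = 𝟙 (prod M N) := hom_ext (by rw [π_map]; simp)

lemma map_comp {M'' : F.Cell x y} {N'' : F.Cell y z} (f : M ⟶ M') (f' : M' ⟶ M'') (g : N ⟶ N')
    (g' : N' ⟶ N'') : map (f ≫ f') (g ≫ g') = map f g ≫ map f' g' := by
  refine hom_ext ?_
  rw [TwoSidedMod.comp_hom, π_map, reassoc_of% (π_map f g), π_map]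
  simp [Bicategory.whisker_exchange_assoc]

end

section

variable (M : F.Cell x y) (N : F.Cell y z) (P : F.Cell z t) (Q : F.Cell t s)

/-- The associator. -/
noncomputable def assoc : prod (prod M N) P ≅ prod M (prod N P) :=
  IsProd.assoc (isProd M N) (isProd N P) (isProd _ P) (isProd M _)

lemma π_assoc : π M N ▹ J.one P.M ≫ π (prod M N) P ≫ (assoc M N P).hom.hom =
    (𝖺 _ _ _).hom ≫ J.one M.M ◃ π N P ≫ π M (prod N P) :=
  IsProd.π_assoc (isProd M N) (isProd N P) (isProd _ P) (isProd M _)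

variable (F) in
/-- The unit 1-cell. -/
def one (x : O) : F.Cell x x := (F.mon x).mod

/-- The left unitor. -/
noncomputable def lunit : prod (F.one x) M ≅ M := (isProd (F.one x) M).lunit

lemma π_lunit : π (F.one x) M ≫ (lunit M).hom.hom = M.l := (isProd (F.one x) M).π_lunit

/-- The right unitor. -/
noncomputable def runit : prod M (F.one y) ≅ M := (isProd M (F.one y)).runit

lemma π_runit : π M (F.one y) ≫ (runit M).hom.hom = M.r := (isProd M (F.one y)).π_runit

lemma assoc_naturality {M M' : F.Cell x y} {N N' : F.Cell y z} {P P' : F.Cell z t} (f : M ⟶ M')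
    (g : N ⟶ N') (h : P ⟶ P') :
    map (map f g) h ≫ (assoc M' N' P').hom = (assoc M N P).hom ≫ map f (map g h) := by
  refine hom_ext₂ ?_
  rw [TwoSidedMod.comp_hom, TwoSidedMod.comp_hom, reassoc_of% (π_assoc M N P), π_map, reassoc_of%
      (π_map (map f g) h)]
  calc _ = (π M N ≫ (map f g).hom) ▹ _ ≫ _ ◃ h.hom ≫ π _ _ ≫ (assoc M' N' P').hom.hom := by
        simp
    _ = (f.hom ▹ _ ≫ J.one M'.M ◃ g.hom) ▹ _ ≫ (π M' N' ▹ _ ≫ _ ◃ h.hom) ≫ π _ _ ≫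
          (assoc M' N' P').hom.hom := by
        rw [π_map]; simp
    _ = (f.hom ▹ _ ≫ J.one M'.M ◃ g.hom) ▹ _ ≫ _ ◃ h.hom ≫ (𝖺 _ _ _).hom ≫ _ ◃ π N' P' ≫
          π _ _ := by
        rw [← Bicategory.whisker_exchange (π M' N'), Category.assoc, π_assoc]
    _ = (𝖺 _ _ _).hom ≫ f.hom ▹ _ ≫ _ ◃ (g.hom ▹ _ ≫ _ ◃ h.hom ≫ π N' P') ≫ π _ _ := by
        simp
    _ = (𝖺 _ _ _).hom ≫ (f.hom ▹ _ ≫ _ ◃ π N P) ≫ _ ◃ (map g h).hom ≫ π _ _ := by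
        rw [← π_map]; simp
    _ = _ := by
        rw [← Bicategory.whisker_exchange, Category.assoc]

lemma lunit_naturality {M M' : F.Cell x y} (f : M ⟶ M') :
    map (𝟙 (F.one x)) f ≫ (lunit M').hom = (lunit M).hom ≫ f := by
  refine hom_ext ?_
  rw [TwoSidedMod.comp_hom, TwoSidedMod.comp_hom, reassoc_of% (π_lunit M), reassoc_of% (π_map_left
      (F.one x) f),
    π_lunit]
  exact f.left

lemma runit_naturality {M M' : F.Cell x y} (f : M ⟶ M') :
    map f (𝟙 (F.one y)) ≫ (runit M').hom = (runit M).hom ≫ f := by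
  refine hom_ext ?_
  rw [TwoSidedMod.comp_hom, TwoSidedMod.comp_hom, reassoc_of% (π_runit M), reassoc_of%
      (π_map_right f (F.one y)),
    π_runit]
  exact f.right

/-- On M ⊗ A ⊗ N, with A the middle monoid, the two sides become the left action on N and the right
action on M, and these agree by the balancing condition of the tensor product. -/
lemma triangle :
    (assoc M (F.one y) N).hom ≫ map (𝟙 M) (lunit N).hom = map (runit M).hom (𝟙 N) := by
  refine hom_ext₂ ?_
  have h : π M (F.one y) ▹ J.one N.M ≫ (runit M).hom.hom ▹ J.one N.M = M.r ▹ J.one N.M := by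
    rw [← Bicategory.comp_whiskerRight, π_runit]; rfl
  have h2 : J.one M.M ◃ π (F.one y) N ≫ J.one M.M ◃ (lunit N).hom.hom = J.one M.M ◃ N.l := by
    rw [← Bicategory.whiskerLeft_comp, π_lunit]; rfl
  rw [TwoSidedMod.comp_hom, reassoc_of% (π_assoc M (F.one y) N), π_map_left, π_map_right,
    reassoc_of% h, reassoc_of% h2]
  refine (congrArg ((𝖺 (J.one M.M) (J.one (F.mon y).A) (J.one N.M)).hom ≫ ·)
      (isProd M N).w).trans ?_
  exact Iso.hom_inv_id_assoc (𝖺 (J.one M.M) (J.one (F.mon y).A) (J.one N.M)) _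

/-- Restricted to M ⊗ N ⊗ P ⊗ Q, each module associator becomes the associator of the underlying
bicategory, whose pentagon finishes the proof. -/
lemma pentagon :
    map (assoc M N P).hom (𝟙 Q) ≫ (assoc M (prod N P) Q).hom ≫ map (𝟙 M) (assoc N P Q).hom =
      (assoc (prod M N) P Q).hom ≫ (assoc M N (prod P Q)).hom := by
  refine (isProd (prod M N) P).hom_ext₂ (isProd _ Q) ?_
  -- The third cancellation, of the universal map for M and N with P and Q adjoined, holds only
  -- among multimaps, so the composites must first be seen to be cells.
  have hc {X : F.Cell x s} (f : prod (prod (prod M N) P) Q ⟶ X) :=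
    (((isProd (prod M N) P).coeq.isCell.whiskerRight (J.wall Q.M)).comp
      (isProd (prod (prod M N) P) Q).coeq.isCell).comp f.isCell
  simp only [Category.assoc] at hc
  refine (isProd M N).epiRR P.M Q.M _ _ _ (hc _) (hc _) ?_
  have h1 : π (prod M N) P ▹ J.one Q.M ≫ π _ Q ≫ (map (assoc M N P).hom (𝟙 Q)).hom =
      (π (prod M N) P ≫ (assoc M N P).hom.hom) ▹ J.one Q.M ≫ π _ Q := by
    rw [π_map_right]; simp
  have h2 : J.one M.M ◃ π (prod N P) Q ≫ π M _ ≫ (map (𝟙 M) (assoc N P Q).hom).hom =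
      J.one M.M ◃ (π (prod N P) Q ≫ (assoc N P Q).hom.hom) ≫ π M _ := by
    rw [π_map_left]; simp
  simp only [TwoSidedMod.comp_hom]
  rw [reassoc_of% h1, reassoc_of% (π_assoc (prod M N) P Q)]
  calc _ = (π M N ▹ J.one P.M ≫ π (prod M N) P ≫ (assoc M N P).hom.hom) ▹ J.one Q.M ≫
        π _ Q ≫ (assoc M (prod N P) Q).hom.hom ≫ (map (𝟙 M) (assoc N P Q).hom).hom := by simp
    _ = ((𝖺 _ _ _).hom ≫ J.one M.M ◃ π N P) ▹ J.one Q.M ≫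
        π M (prod N P) ▹ J.one Q.M ≫ π _ Q ≫ (assoc M (prod N P) Q).hom.hom ≫
          (map (𝟙 M) (assoc N P Q).hom).hom := by
      rw [π_assoc]; simp
    _ = (𝖺 _ _ _).hom ▹ _ ≫ (𝖺 _ _ _).hom ≫
        J.one M.M ◃ (π N P ▹ J.one Q.M ≫ π _ _ ≫ (assoc N P Q).hom.hom) ≫ π _ _ := by
      rw [reassoc_of% (π_assoc M (prod N P) Q), h2]; simp
    _ = (𝖺 _ _ _).hom ▹ _ ≫ (𝖺 _ _ _).hom ≫
        J.one M.M ◃ ((𝖺 _ _ _).hom ≫ J.one N.M ◃ π P Q ≫ π _ _) ≫ π _ _ := by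
      rw [π_assoc]
    _ = (𝖺 _ _ _).hom ≫ _ ◃ π P Q ≫ (𝖺 _ _ _).hom ≫ _ ◃ π _ _ ≫ π _ _ := by
      bicategory
    _ = (𝖺 _ _ _).hom ≫ (_ ◃ π P Q ≫ π M N ▹ _) ≫ π _ _ ≫ (assoc M N (prod P Q)).hom.hom := by
      rw [Category.assoc, π_assoc]
    _ = _ := by
      rw [Bicategory.whisker_exchange]; simp

end

variable (F) in
/-- The bicategory of monoids and modules. -/
@[reducible]
noncomputable def bicategory : Bicategory.{w₁, max w w₁} O where
  Hom x y := F.Cell x y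
  homCategory x y := inferInstanceAs (Category (TwoSidedMod (F.mon x) (F.mon y)))
  id x := F.one x
  comp M N := prod M N
  whiskerLeft M _ _ g := map (𝟙 M) g
  whiskerRight f N := map f (𝟙 N)
  associator M N P := assoc M N P
  leftUnitor M := lunit M
  rightUnitor M := runit M
  whiskerLeft_id _ _ := map_id
  whiskerLeft_comp M _ _ _ f g := by
    rw [← map_comp, Category.comp_id]
  id_whiskerLeft f := by
    rw [← Category.assoc, Iso.eq_comp_inv]
    exact lunit_naturality f
  comp_whiskerLeft M N _ _ f := by
    rw [← Category.assoc, Iso.eq_comp_inv]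
    have h := assoc_naturality (𝟙 M) (𝟙 N) f
    rw [map_id] at h
    exact h
  id_whiskerRight _ _ := map_id
  comp_whiskerRight f g N := by
    rw [← map_comp, Category.comp_id]
  whiskerRight_id f := by
    rw [← Category.assoc, Iso.eq_comp_inv]
    exact runit_naturality f
  whiskerRight_comp f N P := by
    rw [Iso.eq_inv_comp]
    have h := assoc_naturality f (𝟙 N) (𝟙 P)
    rw [map_id] at h
    exact h.symm
  whisker_assoc M _ _ f P := by
    rw [← Category.assoc, Iso.eq_comp_inv]
    exact assoc_naturality (𝟙 M) f (𝟙 P)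
  whisker_exchange f g := by
    rw [← map_comp, ← map_comp]
    simp
  pentagon M N P Q := pentagon M N P Q
  triangle M N := triangle M N

end ModuleFamily

end ModuleBicategory

/-! ### Stability of universal multimaps under tensoring -/

section UniversalCells

variable {V : Type u} [Category.{v} V] [MonoidalCategory V] [BraidedCategory V]
  [HasCoreflexiveEqualizers V] [∀ Z : V, PreservesCoreflexiveEqualizers (tensorLeft Z)]

local infixr:81 " ◃ " => Bicategory.whiskerLeft
local infixl:81 " ▹ " => Bicategory.whiskerRight
local notation "𝖺" => Bicategory.associator

open Bicomod Walled

namespace Chain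

/-- The total object of the list differs from the plain tensor product only by a bracketing and by
the form of its last entry. This transfers statements about underlying maps of 2-cells to `map₂`. -/
lemma exists_twoIso {c d e : Comon V} (X : EndoComod c d) (Y : EndoComod d e) :
    ∃ i : ((endoObj X).tensor (endoObj Y)).obj ≅ (totObj (two X Y)).obj,
      IsCellIso ((endoObj X).tensor (endoObj Y)) (totObj (two X Y)) i ∧
        ∀ {Z : EndoComod c e} (s : Cell (two X Y) Z), s.map₂ = i.hom ≫ s.map := by
  refine ⟨Bicategory.whiskerLeftIso (endoObj X).obj (Iso.refl (totObj (single Y)).obj) ≪≫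
    (consIso X (single Y)).symm, ((isCellIso_single Y).symm.whiskerLeft (endoObj X)).trans
      (isCellIso_consIso X (single Y)).symm, fun s => ?_⟩
  have h : compMap (𝟙 (bd X)) (𝟙 (bd Y)) = 𝟙 _ := compMap_id _ _
  have h2 : s.map₂ = (compMap (𝟙 (bd X)) (𝟙 (bd Y)) ≫ (consIso X (single Y)).inv) ≫ s.map := by
    rw [h]
    exact congrArg (· ≫ s.map) (Category.id_comp (consIso X (single Y)).inv).symm
  exact h2

lemma exists_threeIso {a c d e : Comon V} (X : EndoComod a c) (Y : EndoComod c d)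
    (W : EndoComod d e) :
    ∃ i : ((endoObj X).tensor ((endoObj Y).tensor (endoObj W))).obj ≅ (totObj (three X Y W)).obj,
      IsCellIso ((endoObj X).tensor ((endoObj Y).tensor (endoObj W))) (totObj (three X Y W)) i ∧
        ∀ {Z : EndoComod a e} (s : Cell (three X Y W) Z), s.map₃ = i.hom ≫ s.map := by
  refine ⟨Bicategory.whiskerLeftIso (endoObj X).obj
      (Bicategory.whiskerLeftIso (endoObj Y).obj (Iso.refl (totObj (single W)).obj) ≪≫
        (consIso Y (single W)).symm) ≪≫ (consIso X (two Y W)).symm,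
    ((((isCellIso_single W).symm.whiskerLeft (endoObj Y)).trans
      (isCellIso_consIso Y (single W)).symm).whiskerLeft (endoObj X)).trans
        (isCellIso_consIso X (two Y W)).symm, fun s => ?_⟩
  have h : compMap (𝟙 (bd Y)) (𝟙 (bd W)) = 𝟙 _ := compMap_id _ _
  have h2 : s.map₃ = (compMap (𝟙 (bd X)) (compMap (𝟙 (bd Y)) (𝟙 (bd W)) ≫
      (consIso Y (single W)).inv) ≫ (consIso X (two Y W)).inv) ≫ s.map := by
    rw [h, Category.assoc]
    exact congrArg (fun k => compMap (𝟙 (bd X)) k ≫ (consIso X (two Y W)).inv ≫ s.map)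
      (Category.id_comp (consIso Y (single W)).inv).symm
  exact h2

lemma Cell.isCell_map₂ {c d e : Comon V} {X : EndoComod c d} {Y : EndoComod d e}
    {Z : EndoComod c e} (s : Cell (two X Y) Z) :
    IsCell ((endoObj X).tensor (endoObj Y)) (endoObj Z) s.map₂ := by
  obtain ⟨i, hi, h⟩ := exists_twoIso X Y
  rw [h]
  exact hi.hom.comp s.isCell

lemma Cell.isCell_map₃ {a c d e : Comon V} {X : EndoComod a c} {Y : EndoComod c d}
    {W : EndoComod d e} {Z : EndoComod a e} (s : Cell (three X Y W) Z) :
    IsCell ((endoObj X).tensor ((endoObj Y).tensor (endoObj W))) (endoObj Z) s.map₃ := by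
  obtain ⟨i, hi, h⟩ := exists_threeIso X Y W
  rw [h]
  exact hi.hom.comp s.isCell

lemma exists_cell₃ {a c d e : Comon V} {X : EndoComod a c} {Y : EndoComod c d}
    {W : EndoComod d e} {Z : EndoComod a e}
    (f : ((endoObj X).tensor ((endoObj Y).tensor (endoObj W))).obj ⟶ (endoObj Z).obj)
    (hf : IsCell ((endoObj X).tensor ((endoObj Y).tensor (endoObj W))) (endoObj Z) f) :
    ∃ s : Cell (three X Y W) Z, s.map₃ = f := by
  obtain ⟨i, hi, h⟩ := exists_threeIso X Y W
  obtain ⟨s, hs⟩ := exists_cell _ (hi.inv.comp hf)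
  refine ⟨s, (h s).trans ?_⟩
  rw [hs]
  exact Iso.hom_inv_id_assoc i f

lemma Cell.map₃_injective {a c d e : Comon V} {X : EndoComod a c} {Y : EndoComod c d}
    {W : EndoComod d e} {Z : EndoComod a e} {s s' : Cell (three X Y W) Z}
    (e : s.map₃ = s'.map₃) : s = s' := by
  obtain ⟨i, hi, h⟩ := exists_threeIso X Y W
  rw [h, h] at e
  exact Cell.map_injective ((cancel_epi i.hom).1 e)

variable (𝒳 : ∀ c d : Comon V, EndoComod c d → Prop)

/-- Maps isomorphic to the map underlying a left Kan extension of comodules in a class. -/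
def KanLike {c d : Comon V} (W : Walled (⟨c⟩ : ComodBicat V) ⟨d⟩) (T : EndoComod c d)
    (g : W.obj ⟶ (endoObj T).obj) : Prop :=
  ∃ (l : Chain c d) (t : Cell l T) (i : W.obj ≅ (totObj l).obj),
    l.All 𝒳 ∧ IsKan t ∧ IsCellIso W (totObj l) i ∧ g = i.hom ≫ t.map

/-- Maps isomorphic to a tensor product of maps underlying left Kan extensions of comodules in a
class. -/
def BlockLike {c d : Comon V} (W W' : Walled (⟨c⟩ : ComodBicat V) ⟨d⟩) (f : W.obj ⟶ W'.obj) :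
    Prop :=
  ∃ (l m : Chain c d) (b : Blocks l m) (i : W.obj ≅ (totObj l).obj)
    (j : W'.obj ≅ (totObj m).obj), l.All 𝒳 ∧ b.AllKan ∧ IsCellIso W (totObj l) i ∧
      IsCellIso W' (totObj m) j ∧ f ≫ j.hom = i.hom ≫ b.map

variable {𝒳} {a c d e : Comon V}

/-- This is T₁(X) = X, in the form used for variables that are left unchanged. -/
lemma kanLike_id {X : EndoComod c d} (hX : 𝒳 c d X) : KanLike 𝒳 (endoObj X) X (𝟙 _) := by
  obtain ⟨s, hs, hk⟩ := exists_idCell X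
  refine ⟨single X, s, Iso.refl _, hX, hk, (isCellIso_single X).symm, ?_⟩
  rw [hs]
  exact (Category.id_comp (𝟙 (bd X))).symm

lemma IsKan.kanLike₂ {X : EndoComod c d} {Y : EndoComod d e} {T : EndoComod c e} (hX : 𝒳 c d X)
    (hY : 𝒳 d e Y) {t : Cell (two X Y) T} (ht : IsKan t) :
    KanLike 𝒳 ((endoObj X).tensor (endoObj Y)) T t.map₂ := by
  obtain ⟨i, hi, h⟩ := exists_twoIso X Y
  exact ⟨_, t, i, ⟨hX, hY⟩, ht, hi, h t⟩

lemma IsKan.kanLike₃ {X : EndoComod a c} {Y : EndoComod c d} {W : EndoComod d e}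
    {T : EndoComod a e} (hX : 𝒳 a c X) (hY : 𝒳 c d Y) (hW : 𝒳 d e W)
    {t : Cell (three X Y W) T} (ht : IsKan t) :
    KanLike 𝒳 ((endoObj X).tensor ((endoObj Y).tensor (endoObj W))) T t.map₃ := by
  obtain ⟨i, hi, h⟩ := exists_threeIso X Y W
  exact ⟨_, t, i, ⟨hX, hY, hW⟩, ht, hi, h t⟩

lemma KanLike.blockLike {W : Walled (⟨c⟩ : ComodBicat V) ⟨d⟩} {T : EndoComod c d}
    {g : W.obj ⟶ (endoObj T).obj} (hg : KanLike 𝒳 W T g) : BlockLike 𝒳 W (endoObj T) g := by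
  obtain ⟨l, t, i, hl, ht, hi, rfl⟩ := hg
  exact ⟨l, _, .single t, i, Iso.refl _, hl, ht, hi, (isCellIso_single T).symm, Category.comp_id _⟩

lemma BlockLike.isUniversal (h𝒳 : IsAdmissible 𝒳) {W W' : Walled (⟨c⟩ : ComodBicat V) ⟨d⟩}
    {f : W.obj ⟶ W'.obj} (hf : BlockLike 𝒳 W W' f) : IsUniversal W W' f := by
  obtain ⟨l, m, b, i, j, hl, hb, hi, hj, h⟩ := hf
  exact (Blocks.isUniversal h𝒳 b hb hl).conj hi hj h

lemma BlockLike.conj {W W' W₁ W₁' : Walled (⟨c⟩ : ComodBicat V) ⟨d⟩} {f : W.obj ⟶ W'.obj}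
    {g : W₁.obj ⟶ W₁'.obj} (hf : BlockLike 𝒳 W W' f) {i : W₁.obj ≅ W.obj} {j : W₁'.obj ≅ W'.obj}
    (hi : IsCellIso W₁ W i) (hj : IsCellIso W₁' W' j) (h : g ≫ j.hom = i.hom ≫ f) :
    BlockLike 𝒳 W₁ W₁' g := by
  obtain ⟨l, m, b, i', j', hl, hb, hi', hj', h'⟩ := hf
  refine ⟨l, m, b, i ≪≫ i', j ≪≫ j', hl, hb, hi.trans hi', hj.trans hj', ?_⟩
  rw [Iso.trans_hom, reassoc_of% h, h', Iso.trans_hom, Category.assoc]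

/-- A Kan extension is a partition with a single block; placing it in front of another partition
gives a partition of the concatenated list, and the bracketings match. -/
lemma KanLike.tensor {W : Walled (⟨c⟩ : ComodBicat V) ⟨d⟩} {T : EndoComod c d}
    {g : W.obj ⟶ (endoObj T).obj} (hg : KanLike 𝒳 W T g) {W' W'' : Walled (⟨d⟩ : ComodBicat V) ⟨e⟩}
    {f : W'.obj ⟶ W''.obj} (hf : BlockLike 𝒳 W' W'' f) :
    BlockLike 𝒳 (W.tensor W') ((endoObj T).tensor W'') (g ▹ W'.obj ≫ (endoObj T).obj ◃ f) := by
  obtain ⟨l, t, i, hl, ht, hi, rfl⟩ := hg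
  obtain ⟨m, n, b, i', j', hm, hb, hi', hj', h⟩ := hf
  obtain ⟨k, hk, hk'⟩ := exists_splitIso l m
  refine ⟨append l m, cons T n, .cons t b,
    Bicategory.whiskerRightIso i W'.obj ≪≫ Bicategory.whiskerLeftIso (totObj l).obj i' ≪≫ k.symm,
    Bicategory.whiskerLeftIso (endoObj T).obj j' ≪≫ (consIso T n).symm, all_append hl hm, ⟨ht, hb⟩,
    (hi.whiskerRight W').trans ((hi'.whiskerLeft _).trans hk'.symm),
    (hj'.whiskerLeft (endoObj T)).trans (isCellIso_consIso T n).symm, ?_⟩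
  have e1 : (Blocks.cons t b).map = k.hom ≫ (t.map ▹ (totObj m).obj ≫ (endoObj T).obj ◃ b.map) ≫
      (consIso T n).inv := by
    rw [hk]
    exact congrArg (fun z => split l m ≫ z ≫ (consIso T n).inv) (compMap_eq t.map b.map)
  have e2 : k.inv ≫ (Blocks.cons t b).map = (t.map ▹ (totObj m).obj ≫ (endoObj T).obj ◃ b.map) ≫
      (consIso T n).inv := by
    rw [e1]
    exact Iso.inv_hom_id_assoc k _
  have e3 : (i.hom ▹ W'.obj ≫ (totObj l).obj ◃ i'.hom) ≫ k.inv ≫ (Blocks.cons t b).map =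
      ((i.hom ≫ t.map) ▹ W'.obj ≫ (endoObj T).obj ◃ f) ≫ (endoObj T).obj ◃ j'.hom ≫
        (consIso T n).inv := by
    rw [e2]
    have e4 : (i.hom ▹ W'.obj ≫ (totObj l).obj ◃ i'.hom) ≫
        (t.map ▹ (totObj m).obj ≫ (endoObj T).obj ◃ b.map) =
        ((i.hom ≫ t.map) ▹ W'.obj ≫ (endoObj T).obj ◃ f) ≫ (endoObj T).obj ◃ j'.hom := by
      have e5 : f ≫ j'.hom = i'.hom ≫ b.map := h
      have e6 := Bicategory.whisker_exchange (show (totObj l).obj ⟶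
          (endoObj T).obj from t.map) i'.hom
      rw [Category.assoc, Category.assoc, ← Bicategory.whiskerLeft_comp, e5,
        reassoc_of% e6, Bicategory.whiskerLeft_comp, Bicategory.comp_whiskerRight, Category.assoc]
    exact (Category.assoc _ _ _).symm.trans ((congrArg (· ≫ (consIso T n).inv) e4).trans
      (Category.assoc _ _ _))
  exact e3.symm.trans (Category.assoc _ _ _ |>.trans (by simp [Category.assoc]))

lemma BlockLike.whiskerLeft {X : EndoComod c d} (hX : 𝒳 c d X)
    {W W' : Walled (⟨d⟩ : ComodBicat V) ⟨e⟩} {f : W.obj ⟶ W'.obj} (hf : BlockLike 𝒳 W W' f) :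
    BlockLike 𝒳 ((endoObj X).tensor W) ((endoObj X).tensor W') ((endoObj X).obj ◃ f) := by
  simpa using (kanLike_id hX).tensor hf

lemma KanLike.whiskerRight {W : Walled (⟨c⟩ : ComodBicat V) ⟨d⟩} {T : EndoComod c d}
    {g : W.obj ⟶ (endoObj T).obj} (hg : KanLike 𝒳 W T g) {Y : EndoComod d e} (hY : 𝒳 d e Y) :
    BlockLike 𝒳 (W.tensor (endoObj Y)) ((endoObj T).tensor (endoObj Y)) (g ▹ (endoObj Y).obj) := by
  simpa using hg.tensor (kanLike_id hY).blockLike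

/-- The two extra variables are bracketed together first, so that the Kan extension remains the
leading block. -/
lemma KanLike.whiskerRight₂ {W : Walled (⟨a⟩ : ComodBicat V) ⟨c⟩} {T : EndoComod a c}
    {g : W.obj ⟶ (endoObj T).obj} (hg : KanLike 𝒳 W T g) {Y : EndoComod c d} (hY : 𝒳 c d Y)
    {Y' : EndoComod d e} (hY' : 𝒳 d e Y') :
    BlockLike 𝒳 ((W.tensor (endoObj Y)).tensor (endoObj Y'))
      (((endoObj T).tensor (endoObj Y)).tensor (endoObj Y'))
      ((g ▹ (endoObj Y).obj) ▹ (endoObj Y').obj) := by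
  have h := hg.tensor ((kanLike_id hY).whiskerRight hY')
  refine h.conj (IsCellIso.assoc _ _ _) (IsCellIso.assoc _ _ _) ?_
  simp

end Chain
end UniversalCells

/-! ### Reflexive coequalizers of comodules and cotensor products -/

section Coequalizers

variable {V : Type u} [Category.{v} V] [MonoidalCategory V]

namespace Bicomod

variable {A B C D : Comon V}

/-- The comodule which has a coaction of the unit on the right. -/
def forgetR (M : Bicomod C D) : Bicomod C (unitComon (V := V)) where
  X := M.X
  lact := M.lact
  ract := (ρ_ M.X).inv
  lact_counit := M.lact_counit
  lact_coassoc := M.lact_coassoc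
  ract_counit := by
    change _ ≫ _ ◁ 𝟙 _ = _
    simp
  ract_coassoc := by
    change _ = _ ≫ _ ◁ (λ_ _).inv ≫ _
    monoidal
  comm := by
    change M.lact ≫ C.X ◁ (ρ_ M.X).inv = (ρ_ M.X).inv ≫ M.lact ▷ 𝟙_ V ≫ _
    simp

/-- The comodule which has a coaction of the unit on the left. -/
def forgetL (M : Bicomod C D) : Bicomod (unitComon (V := V)) D where
  X := M.X
  lact := (λ_ M.X).inv
  ract := M.ract
  ract_counit := M.ract_counit
  ract_coassoc := M.ract_coassoc
  lact_counit := by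
    change _ ≫ 𝟙 _ ▷ _ = _
    simp
  lact_coassoc := by
    change _ = _ ≫ (λ_ _).inv ▷ _ ≫ _
    monoidal
  comm := by
    change (λ_ M.X).inv ≫ 𝟙_ V ◁ M.ract = M.ract ≫ (λ_ M.X).inv ▷ D.X ≫ _
    simp

/-- `forgetR` on maps. -/
def forgetRMap {M N : Bicomod C D} (f : M ⟶ N) : forgetR M ⟶ forgetR N where
  hom := f.hom
  left := f.left
  right := by
    change (ρ_ M.X).inv ≫ f.hom ▷ 𝟙_ V = f.hom ≫ (ρ_ N.X).inv
    simp

/-- `forgetL` on maps. -/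
def forgetLMap {M N : Bicomod C D} (f : M ⟶ N) : forgetL M ⟶ forgetL N where
  hom := f.hom
  right := f.right
  left := by
    change (λ_ M.X).inv ≫ 𝟙_ V ◁ f.hom = f.hom ≫ (λ_ N.X).inv
    simp

/-- An object as a comodule over the unit. -/
abbrev triv (Z : V) : Bicomod (unitComon (V := V)) (unitComon (V := V)) where
  X := Z
  lact := (λ_ Z).inv
  ract := (ρ_ Z).inv
  lact_counit := by
    change _ ≫ 𝟙 _ ▷ _ = _
    simp
  lact_coassoc := by
    change _ = _ ≫ (λ_ _).inv ▷ _ ≫ _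
    monoidal
  ract_counit := by
    change _ ≫ _ ◁ 𝟙 _ = _
    simp
  ract_coassoc := by
    change _ = _ ≫ _ ◁ (λ_ _).inv ≫ _
    monoidal
  comm := by
    change (λ_ Z).inv ≫ 𝟙_ V ◁ (ρ_ Z).inv = (ρ_ Z).inv ≫ (λ_ Z).inv ▷ 𝟙_ V ≫ _
    monoidal

/-- The cofree comodule on an object. -/
abbrev cofree (C D : Comon V) (Z : V) : Bicomod C D :=
  outer (regular C) (outer (triv Z) (regular D))

/-- The map to the cofree comodule given by a map from the underlying object. -/
def toCofree {M : Bicomod C D} {Z : V} (h : M.X ⟶ Z) : M ⟶ cofree C D Z where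
  hom := M.lact ≫ C.X ◁ (M.ract ≫ h ▷ D.X)
  left := by
    change M.lact ≫ C.X ◁ (M.lact ≫ C.X ◁ (M.ract ≫ h ▷ D.X)) =
      (M.lact ≫ C.X ◁ (M.ract ≫ h ▷ D.X)) ≫ Δ[C.X] ▷ (Z ⊗ D.X) ≫ (α_ _ _ _).hom
    rw [MonoidalCategory.whiskerLeft_comp, reassoc_of% M.lact_coassoc, Category.assoc,
      whisker_exchange_assoc]
    simp
  right := by
    change M.ract ≫ (M.lact ≫ C.X ◁ (M.ract ≫ h ▷ D.X)) ▷ D.X =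
      (M.lact ≫ C.X ◁ (M.ract ≫ h ▷ D.X)) ≫ C.X ◁ (Z ◁ Δ[D.X] ≫ (α_ _ _ _).inv) ≫ (α_ _ _ _).inv
    have e1 : M.ract ≫ M.lact ▷ D.X = M.lact ≫ C.X ◁ M.ract ≫ (α_ _ _ _).inv := by
      rw [reassoc_of% M.comm]; simp
    have e2 : M.ract ≫ h ▷ D.X ≫ Z ◁ Δ[D.X] ≫ (α_ _ _ _).inv =
        M.ract ≫ (M.ract ≫ h ▷ D.X) ▷ D.X := by
      rw [comp_whiskerRight, reassoc_of% M.ract_coassoc, ← whisker_exchange_assoc]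
      simp
    rw [comp_whiskerRight, reassoc_of% e1, Category.assoc,
        ← MonoidalCategory.whiskerLeft_comp_assoc,
      Category.assoc, e2]
    simp

/-- Together with `comp_toCofree` this gives what is needed of the adjunction between the forgetful
functor and C ⊗ - ⊗ D. -/
lemma toCofree_counit {M : Bicomod C D} {Z : V} (h : M.X ⟶ Z) :
    (toCofree h).hom ≫ ε[C.X] ▷ (Z ⊗ D.X) ≫ (λ_ _).hom ≫ Z ◁ ε[D.X] ≫ (ρ_ Z).hom = h := by
  change (M.lact ≫ C.X ◁ (M.ract ≫ h ▷ D.X)) ≫ _ = h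
  rw [Category.assoc, whisker_exchange_assoc, reassoc_of% M.lact_counit,
    leftUnitor_naturality_assoc, Iso.inv_hom_id_assoc, Category.assoc, ← whisker_exchange_assoc,
    reassoc_of% M.ract_counit]
  simp

lemma comp_toCofree {M N : Bicomod C D} {Z : V} (f : M ⟶ N) (h : N.X ⟶ Z) :
    f ≫ toCofree h = toCofree (f.hom ≫ h) := by
  ext
  change f.hom ≫ N.lact ≫ C.X ◁ (N.ract ≫ h ▷ D.X) = M.lact ≫ C.X ◁ (M.ract ≫ (f.hom ≫ h) ▷ D.X)
  rw [comp_whiskerRight, reassoc_of% f.right, MonoidalCategory.whiskerLeft_comp C.X f.hom,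
    reassoc_of% f.left]

/-- A reflexive coequalizer of comodules which is a coequalizer of underlying objects. -/
structure IsReflCoeq {M N K : Bicomod C D} (f g : M ⟶ N) (p : N ⟶ K) : Prop where
  exists_section : ∃ s : N ⟶ M, s ≫ f = 𝟙 N ∧ s ≫ g = 𝟙 N
  w : f ≫ p = g ≫ p
  exists_desc : ∀ {Z : V} (h : N.X ⟶ Z), f.hom ≫ h = g.hom ≫ h → ∃ k : K.X ⟶ Z, p.hom ≫ k = h
  epi : Epi p.hom

namespace IsReflCoeq

variable {M N K : Bicomod C D} {f g : M ⟶ N} {p : N ⟶ K}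

/-- Colinearity of the induced map is tested after p itself, so it does not matter whether C ⊗ p or
p ⊗ D is epi. -/
lemma exists_descHom (hp : IsReflCoeq f g p) {Z : Bicomod C D} (h : N ⟶ Z) (w : f ≫ h = g ≫ h) :
    ∃ k : K ⟶ Z, p ≫ k = h := by
  obtain ⟨k, hk⟩ := hp.exists_desc h.hom (congrArg Hom.hom w)
  have := hp.epi
  refine ⟨⟨k, ?_, ?_⟩, Hom.ext hk⟩
  · rw [← cancel_epi p.hom, ← reassoc_of% p.left, ← MonoidalCategory.whiskerLeft_comp, hk, h.left,
      reassoc_of% hk]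
  · rw [← cancel_epi p.hom, ← reassoc_of% p.right, ← comp_whiskerRight, hk, h.right,
      reassoc_of% hk]

lemma hom_ext (hp : IsReflCoeq f g p) {Z : Bicomod C D} {h k : K ⟶ Z} (e : p ≫ h = p ≫ k) :
    h = k := by
  have := hp.epi
  exact Hom.ext ((cancel_epi p.hom).1 (congrArg Hom.hom e))

/-- A coequalizer of comodules is a coequalizer of underlying objects. -/
lemma of_isColimit (w : f ≫ p = g ≫ p) (hp : IsColimit (Cofork.ofπ p w)) (s : N ⟶ M)
    (hf : s ≫ f = 𝟙 N) (hg : s ≫ g = 𝟙 N) : IsReflCoeq f g p where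
  exists_section := ⟨s, hf, hg⟩
  w := w
  exists_desc {Z} h e := by
    -- A map of underlying objects becomes a comodule map into the cofree comodule, factors there,
    -- and is recovered by the counits.
    obtain ⟨k, hk⟩ := Cofork.IsColimit.desc' hp (toCofree h)
      (by rw [comp_toCofree, comp_toCofree, e])
    refine ⟨k.hom ≫ ε[C.X] ▷ (Z ⊗ D.X) ≫ (λ_ _).hom ≫ Z ◁ ε[D.X] ≫ (ρ_ Z).hom, ?_⟩
    have h1 : p.hom ≫ k.hom = (toCofree h).hom := congrArg Hom.hom hk
    rw [reassoc_of% h1]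
    exact toCofree_counit h
  -- The same adjunction shows that two maps of underlying objects which agree after p agree as maps
  -- to the cofree comodule.
  epi := ⟨fun {Z} h k e => by
    have h1 : toCofree h = toCofree k := Cofork.IsColimit.hom_ext hp (by
      change p ≫ _ = p ≫ _
      rw [comp_toCofree, comp_toCofree, e])
    rw [← toCofree_counit h, h1, toCofree_counit]⟩

/-- The property is independent of the second coaction. -/
lemma forgetR (hp : IsReflCoeq f g p) :
    IsReflCoeq (forgetRMap f) (forgetRMap g) (forgetRMap p) where
  exists_section := by
    obtain ⟨s, h1, h2⟩ := hp.exists_section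
    exact ⟨forgetRMap s, congrArg forgetRMap h1, congrArg forgetRMap h2⟩
  w := congrArg forgetRMap hp.w
  exists_desc := hp.exists_desc
  epi := hp.epi

lemma forgetL (hp : IsReflCoeq f g p) :
    IsReflCoeq (forgetLMap f) (forgetLMap g) (forgetLMap p) where
  exists_section := by
    obtain ⟨s, h1, h2⟩ := hp.exists_section
    exact ⟨forgetLMap s, congrArg forgetLMap h1, congrArg forgetLMap h2⟩
  w := congrArg forgetLMap hp.w
  exists_desc := hp.exists_desc
  epi := hp.epi

/-- The descent and uniqueness properties make p a coequalizer of comodules, and the section makes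
the pair reflexive, so the functor preserves it. -/
lemma exists_map (hp : IsReflCoeq f g p) (F : Bicomod C D ⥤ V) [PreservesReflexiveCoequalizers F] :
    (∀ {Z : V} (h : F.obj N ⟶ Z), F.map f ≫ h = F.map g ≫ h → ∃ k : F.obj K ⟶ Z, F.map p ≫ k = h) ∧
      Epi (F.map p) := by
  obtain ⟨s, h1, h2⟩ := hp.exists_section
  have : IsReflexivePair f g := IsReflexivePair.mk' s h1 h2
  have := PreservesReflexiveCoequalizers.preserves (F := F) f g
  have hc : IsColimit (Cofork.ofπ p hp.w) := Cofork.IsColimit.mk _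
    (fun t => (hp.exists_descHom t.π t.condition).choose)
    (fun t => (hp.exists_descHom t.π t.condition).choose_spec)
    (fun t m hm => hp.hom_ext (hm.trans (hp.exists_descHom t.π t.condition).choose_spec.symm))
  have hc' := isColimitCoforkMapOfIsColimit F hp.w hc
  refine ⟨fun h e => ?_, ⟨fun h k e => Cofork.IsColimit.hom_ext hc' e⟩⟩
  obtain ⟨k, hk⟩ := Cofork.IsColimit.desc' hc' h e
  exact ⟨k, hk⟩

end IsReflCoeq

variable [BraidedCategory V] [HasCoreflexiveEqualizers V]
  [∀ Z : V, PreservesCoreflexiveEqualizers (tensorLeft Z)]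

/-- The equalizer X ⊗_C M uses only the left coaction of M, so forgetting the right one changes
neither the object nor the map. -/
lemma compMap_forgetR (X : Bicomod B C) {M N : Bicomod C D} (f : M ⟶ N) :
    (compMap (𝟙 X) (forgetRMap f)).hom = (compMap (𝟙 X) f).hom := by
  have h1 := whiskerL_hom_ι X (forgetRMap f)
  have h2 := whiskerL_hom_ι X f
  exact (cancel_mono (compι X N).hom).1 (h1.trans h2.symm)

lemma compMap_forgetL {M N : Bicomod B C} (f : M ⟶ N) (Y : Bicomod C D) :
    (compMap (forgetLMap f) (𝟙 Y)).hom = (compMap f (𝟙 Y)).hom := by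
  have h1 := whiskerR_hom_ι (forgetLMap f) Y
  have h2 := whiskerR_hom_ι f Y
  exact (cancel_mono (compι N Y).hom).1 (h1.trans h2.symm)

lemma compMap_id_comp (X : Bicomod B C) {M N K : Bicomod C D} (f : M ⟶ N) (g : N ⟶ K) :
    compMap (𝟙 X) (f ≫ g) = compMap (𝟙 X) f ≫ compMap (𝟙 X) g := by
  rw [← compMap_comp, Category.comp_id]

lemma compMap_comp_id {M N K : Bicomod B C} (f : M ⟶ N) (g : N ⟶ K) (Y : Bicomod C D) :
    compMap (f ≫ g) (𝟙 Y) = compMap f (𝟙 Y) ≫ compMap g (𝟙 Y) := by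
  rw [← compMap_comp, Category.comp_id]

namespace IsReflCoeq

/-- Condition (3) speaks of comodules with one nontrivial coaction. Since the coequalizer lives on
underlying objects, the other coaction may be dropped before applying it and restored afterwards. -/
lemma compLeft {M N K : Bicomod C D} {f g : M ⟶ N} {p : N ⟶ K} (hp : IsReflCoeq f g p)
    (X : Bicomod B C) [PreservesReflexiveCoequalizers (cotensorLeft X)] :
    IsReflCoeq (compMap (𝟙 X) f) (compMap (𝟙 X) g) (compMap (𝟙 X) p) where
  exists_section := by
    obtain ⟨s, h1, h2⟩ := hp.exists_section
    exact ⟨compMap (𝟙 X) s, by rw [← compMap_id_comp, h1, compMap_id],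
      by rw [← compMap_id_comp, h2, compMap_id]⟩
  w := by rw [← compMap_id_comp, hp.w, compMap_id_comp]
  exists_desc {Z} h e := by
    obtain ⟨h1, -⟩ := hp.forgetR.exists_map (cotensorLeft X)
    obtain ⟨k, hk⟩ := h1 h (by
      change (compMap (𝟙 X) (forgetRMap f)).hom ≫ h = (compMap (𝟙 X) (forgetRMap g)).hom ≫ h
      rw [compMap_forgetR, compMap_forgetR]
      exact e)
    exact ⟨k, (congrArg (· ≫ k) (compMap_forgetR X p)).symm.trans hk⟩
  epi := by
    obtain ⟨-, h⟩ := hp.forgetR.exists_map (cotensorLeft X)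
    rw [← compMap_forgetR]
    exact h

lemma compRight {M N K : Bicomod B C} {f g : M ⟶ N} {p : N ⟶ K} (hp : IsReflCoeq f g p)
    (Y : Bicomod C D) [PreservesReflexiveCoequalizers (cotensorRight Y)] :
    IsReflCoeq (compMap f (𝟙 Y)) (compMap g (𝟙 Y)) (compMap p (𝟙 Y)) where
  exists_section := by
    obtain ⟨s, h1, h2⟩ := hp.exists_section
    exact ⟨compMap s (𝟙 Y), by rw [← compMap_comp_id, h1, compMap_id],
      by rw [← compMap_comp_id, h2, compMap_id]⟩
  w := by rw [← compMap_comp_id, hp.w, compMap_comp_id]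
  exists_desc {Z} h e := by
    obtain ⟨h1, -⟩ := hp.forgetL.exists_map (cotensorRight Y)
    obtain ⟨k, hk⟩ := h1 h (by
      change (compMap (forgetLMap f) (𝟙 Y)).hom ≫ h = (compMap (forgetLMap g) (𝟙 Y)).hom ≫ h
      rw [compMap_forgetL, compMap_forgetL]
      exact e)
    exact ⟨k, (congrArg (· ≫ k) (compMap_forgetL p Y)).symm.trans hk⟩
  epi := by
    obtain ⟨-, h⟩ := hp.forgetL.exists_map (cotensorRight Y)
    rw [← compMap_forgetL]
    exact h

/-- The comodule map of `bd` inherits the property. -/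
lemma bdHom {P a c : Comon V} {M N K : Bicomod P (tensorComon (opComon a) c)} {f g : M ⟶ N}
    {p : N ⟶ K} (hp : IsReflCoeq f g p) :
    IsReflCoeq (bdHom f) (bdHom g) (bdHom p) where
  exists_section := by
    obtain ⟨s, h1, h2⟩ := hp.exists_section
    exact ⟨Bicomod.bdHom s, congrArg Bicomod.bdHom h1, congrArg Bicomod.bdHom h2⟩
  w := congrArg Bicomod.bdHom hp.w
  exists_desc := hp.exists_desc
  epi := hp.epi

end IsReflCoeq

end Bicomod
end Coequalizers

/-! ### Contracting a balanced map with an augmentation -/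

section UnitCells

variable {V : Type u} [Category.{v} V] [MonoidalCategory V]

/-- Balancing moves the coaction from Z to N, where the augmentation contracts it to t. It will be
applied twice with the same t, to compare two coactions on Z. -/
lemma augment_coaction {N E Z Q : V} (k : N ⟶ N ⊗ Z) (r : N ⟶ N ⊗ Q) (l : Z ⟶ Q ⊗ Z) (u : Q ⟶ E)
    (g : N ⟶ 𝟙_ V) (t : N ⟶ E)
    (hk : k ≫ r ▷ Z = k ≫ N ◁ l ≫ (α_ N Q Z).inv) (ht : (r ≫ N ◁ u) ≫ g ▷ E = t ≫ (λ_ E).inv) :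
    (k ≫ g ▷ Z ≫ (λ_ Z).hom) ≫ l ≫ u ▷ Z = k ≫ t ▷ Z := by
  calc _ = k ≫ (g ▷ Z ≫ 𝟙_ V ◁ l) ≫ (λ_ (Q ⊗ Z)).hom ≫ u ▷ Z := by simp
    _ = (k ≫ N ◁ l ≫ (α_ N Q Z).inv) ≫ (α_ N Q Z).hom ≫ g ▷ (Q ⊗ Z) ≫
        (λ_ (Q ⊗ Z)).hom ≫ u ▷ Z := by
      rw [← whisker_exchange]; simp
    _ = k ≫ (r ≫ (g ▷ Q ≫ 𝟙_ V ◁ u) ≫ (λ_ E).hom) ▷ Z := by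
      rw [← hk]
      monoidal
    _ = _ := by
      rw [← whisker_exchange, ← Category.assoc r, ← Category.assoc r, ht]
      simp

end UnitCells

/-! ### Unit cells, quotients and coequalizers with respect to multimaps -/

section Coequalizers

variable {V : Type u} [Category.{v} V] [MonoidalCategory V] [BraidedCategory V]
  [HasCoreflexiveEqualizers V] [∀ Z : V, PreservesCoreflexiveEqualizers (tensorLeft Z)]

local infixr:81 " ◃ " => Bicategory.whiskerLeft
local infixl:81 " ▹ " => Bicategory.whiskerRight
local notation "𝖺" => Bicategory.associator
local notation "𝗅" => Bicategory.leftUnitor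
local notation "𝗋" => Bicategory.rightUnitor

open Bicomod Walled CentralAction

namespace Chain

/-- Each of the two parts of the right coaction of `n`, contracted by the counit, gives the identity
of C. Hence both coactions of Z take the same value on the image of the unit. -/
lemma UnitCell.isUnitCell {c : Comon V} {Z : EndoComod c c} (s : UnitCell Z) :
    (endoObj Z).IsUnitCell s.map := by
  have hk := comp_condition (n c) Z
  have hk' : (s.hom ≫ (compι (n c) Z).hom) ≫ (n c).ract ▷ Z.X =
      (s.hom ≫ (compι (n c) Z).hom) ≫ (n c).X ◁ Z.lact ≫
        (α_ (n c).X ((opComon c).X ⊗ c.X) Z.X).inv := by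
    rw [Category.assoc, Category.assoc]
    exact congrArg (s.hom ≫ ·) hk
  have hL : ((n c).ract ≫ (n c).X ◁ (projL (opComon c) c).hom) ≫ ε[c.X] ▷ c.X =
      𝟙 c.X ≫ (λ_ c.X).inv := by
    have h := n_ractL c
    change (n c).ractL ≫ _ = _
    rw [h]
    exact (opComon c).comon.counit_comul.trans (Category.id_comp _).symm
  have hR : ((n c).ract ≫ (n c).X ◁ (projR (opComon c) c).hom) ≫ ε[c.X] ▷ c.X =
      𝟙 c.X ≫ (λ_ c.X).inv := by
    have h := n_ractR c
    change (n c).ractR ≫ _ = _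
    rw [h]
    exact (ComonObj.counit_comul c.X).trans (Category.id_comp _).symm
  have e1 := augment_coaction _ _ _ (projL (opComon c) c).hom ε[c.X] (𝟙 c.X) hk' hL
  have e2 := augment_coaction _ _ _ (projR (opComon c) c).hom ε[c.X] (𝟙 c.X) hk' hR
  have e3 : s.map.hom = (s.hom ≫ (compι (n c) Z).hom) ≫ ε[c.X] ▷ Z.X ≫ (λ_ Z.X).hom :=
    (Category.id_comp _).trans (Category.assoc _ _ _).symm
  refine Bicomod.hom_ext ?_
  change s.map.hom ≫ Z.lact ≫ (projL (opComon c) c).hom ▷ Z.X =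
    s.map.hom ≫ Z.lact ≫ (projR (opComon c) c).hom ▷ Z.X
  rw [e3]
  exact e1.trans e2.symm

end Chain

/-- A map which respects the coactions and such that the walls of the target come from the
source. -/
structure Walled.IsQuotient {B : Type*} [Bicategory B] [CentralAction B] {a b : B}
    (W W' : Walled a b) (p : W.obj ⟶ W'.obj) : Prop where
  isCell : IsCell W W' p
  exists_bal : ∀ e φ ψ, W'.bal e φ ψ → ∃ φ' ψ', W.bal e φ' ψ' ∧ Tw p φ' φ ∧ Tw p ψ' ψ

namespace Walled.IsQuotient

variable {B : Type*} [Bicategory B] [CentralAction B] {a b c : B}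

lemma whiskerLeft (L : Walled a b) {W W' : Walled b c} {p : W.obj ⟶ W'.obj}
    (hp : IsQuotient W W' p) : IsQuotient (L.tensor W) (L.tensor W') (L.obj ◃ p) where
  isCell := hp.isCell.whiskerLeft L
  exists_bal e φ ψ h := by
    cases h with
    | left h => exact ⟨_, _, .left h, Tw.whiskerLeft_coL p _, Tw.whiskerLeft_coL p _⟩
    | right h =>
      obtain ⟨φ', ψ', h, h1, h2⟩ := hp.exists_bal _ _ _ h
      exact ⟨_, _, .right h, h1.whiskerLeft _, h2.whiskerLeft _⟩
    | mid => exact ⟨_, _, .mid, Tw.whiskerLeft_coL p _, hp.isCell.lo.whiskerLeft _⟩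

lemma whiskerRight {W W' : Walled a b} {p : W.obj ⟶ W'.obj} (hp : IsQuotient W W' p)
    (R : Walled b c) : IsQuotient (W.tensor R) (W'.tensor R) (p ▹ R.obj) where
  isCell := hp.isCell.whiskerRight R
  exists_bal e φ ψ h := by
    cases h with
    | right h => exact ⟨_, _, .right h, Tw.whiskerRight_coR p _, Tw.whiskerRight_coR p _⟩
    | left h =>
      obtain ⟨φ', ψ', h, h1, h2⟩ := hp.exists_bal _ _ _ h
      exact ⟨_, _, .left h, h1.whiskerRight _, h2.whiskerRight _⟩
    | mid => exact ⟨_, _, .mid, hp.isCell.l.whiskerRight _, Tw.whiskerRight_coR p _⟩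

/-- A map out of a quotient respects the coactions and the walls as soon as its composite with the
quotient map does. -/
lemma isCell_of_comp {W W' Z : Walled a b} {p : W.obj ⟶ W'.obj} [Epi p] (hp : IsQuotient W W' p)
    (hZ : Z.Plain) {k : W'.obj ⟶ Z.obj} (hk : IsCell W Z (p ≫ k)) : IsCell W' Z k := by
  have aux {e : B} {φ : W.obj ⟶ act e W.obj} {φ' : W'.obj ⟶ act e W'.obj} (h : Tw p φ φ') :
      φ ≫ map e (p ≫ k) = p ≫ φ' ≫ map e k := by
    unfold Tw at h
    rw [map_comp, reassoc_of% h]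
  refine ⟨?_, ?_, fun e φ ψ h => Or.inl ?_⟩
  · have h := hk.lo
    unfold Tw at *
    rw [← cancel_epi p, ← aux hp.isCell.lo, h, Category.assoc]
  · have h := hk.l
    unfold Tw at *
    rw [← cancel_epi p, ← aux hp.isCell.l, h, Category.assoc]
  · obtain ⟨φ', ψ', h, h1, h2⟩ := hp.exists_bal _ _ _ h
    rw [← cancel_epi p, ← aux h1, ← aux h2]
    exact hk.bal_eq hZ h

end Walled.IsQuotient

namespace Chain

lemma isQuotient_bdHom {c d : Comon V} {T K : EndoComod c d} (p : T ⟶ K) :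
    IsQuotient (endoObj T) (endoObj K) (bdHom p) :=
  ⟨isCell_bdHom p, fun _ _ _ h => h.elim⟩

variable (𝒳 : ∀ c d : Comon V, EndoComod c d → Prop)

/-- The comodules in a class as 1-cells with coactions. -/
def carriers : Carriers (ComodBicat V) where
  carrier c d := { X : EndoComod c.base d.base // 𝒳 c.base d.base X }
  wall X := endoObj X.1
  plain X := endoObj_plain X.1

variable {𝒳} {c d : Comon V} {W W₃ W₂ K : Walled (⟨c⟩ : ComodBicat V) ⟨d⟩}
  {R S T : (⟨c⟩ : ComodBicat V) ⟶ ⟨d⟩}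

lemma epi_of_isReflCoeq {f g : R ⟶ S} {p : S ⟶ T} (hp : IsReflCoeq f g p) :
    Epi p := ⟨fun _ _ e => hp.hom_ext e⟩

/-- The coequalizer part can be cancelled outright and the universal part can be cancelled among
cells; no parallel pair upstairs is needed for uniqueness. -/
lemma isEpi_comp {u : W.obj ⟶ W₂.obj} (hu : IsUniversal W W₂ u) {f g : R ⟶ W₂.obj}
    {p : W₂.obj ⟶ K.obj} (hp : IsReflCoeq f g p) (hq : IsQuotient W₂ K p) :
    (carriers 𝒳).IsEpi K (u ≫ p) := by
  intro Z k k' hk hk' e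
  rw [Category.assoc, Category.assoc] at e
  have := epi_of_isReflCoeq hp
  exact (cancel_epi p).1 (hu.hom_ext Z.1 _ _ (hq.isCell.comp hk) (hq.isCell.comp hk') e)

/-- A multimap h which coequalizes x and y factors through u. Universality of v shows that the
factorization coequalizes f and g, so it descends along p; it remains a cell because the walls of K
come from those of the source of p. -/
lemma isCoeq_comp {u : W.obj ⟶ W₂.obj} (hu : IsUniversal W W₂ u) {X : Walled
    (⟨c⟩ : ComodBicat V) ⟨d⟩}
    {v : X.obj ⟶ W₃.obj} (hv : IsUniversal X W₃ v) {f g : W₃.obj ⟶ W₂.obj} (hf : IsCell W₃ W₂ f)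
    (hg : IsCell W₃ W₂ g) {x y : X.obj ⟶ W.obj} (ef : v ≫ f = x ≫ u) (eg : v ≫ g = y ≫ u)
    {p : W₂.obj ⟶ K.obj} (hp : IsReflCoeq f g p) (hq : IsQuotient W₂ K p) :
    (carriers 𝒳).IsCoeq W K x y (u ≫ p) where
  isCell := hu.isCell.comp hq.isCell
  w := by
    have h : f ≫ p = g ≫ p := hp.w
    rw [← reassoc_of% ef, ← reassoc_of% eg, h]
  exists_desc Z h hh e := by
    obtain ⟨h', hh', rfl⟩ := hu.exists_lift Z.1 h hh
    have e1 : f ≫ h' = g ≫ h' := hv.hom_ext Z.1 _ _ (hf.comp hh') (hg.comp hh') (by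
      rw [reassoc_of% ef, reassoc_of% eg]
      exact e)
    obtain ⟨k, hk⟩ := hp.exists_descHom h' e1
    have hk' : p ≫ k = h' := hk
    have := epi_of_isReflCoeq hp
    refine ⟨k, hq.isCell_of_comp (endoObj_plain Z.1) (hk'.symm ▸ hh'), ?_⟩
    exact (Category.assoc u p _).trans (congrArg (u ≫ ·) hk')
  isEpi := isEpi_comp hu hp hq

end Chain
end Coequalizers

/-! ### Algebroids as monoids, modules as two-sided modules -/

section Translation

variable {V : Type u} [Category.{v} V] [MonoidalCategory V] [BraidedCategory V]
  [HasCoreflexiveEqualizers V] [∀ Z : V, PreservesCoreflexiveEqualizers (tensorLeft Z)]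

local infixr:81 " ◃ " => Bicategory.whiskerLeft
local infixl:81 " ▹ " => Bicategory.whiskerRight
local notation "𝖺" => Bicategory.associator
local notation "𝗅" => Bicategory.leftUnitor
local notation "𝗋" => Bicategory.rightUnitor

open Bicomod Walled Chain Carriers CentralAction

variable {𝒳 : ∀ c d : Comon V, EndoComod c d → Prop} {c d : Comon V}

namespace Algebroid

variable (A : Algebroid c)

/-- The multiplication as a 2-cell of the bicategory of comodules. -/
noncomputable abbrev mul : (endoObj A.A).obj ≫ (endoObj A.A).obj ⟶ (endoObj A.A).obj := A.μ.map₂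

/-- The unit as a 2-cell of the bicategory of comodules. -/
noncomputable abbrev one : 𝟙 (⟨c⟩ : ComodBicat V) ⟶ (endoObj A.A).obj := A.η.map

lemma one_mul' : (𝗅 _).inv ≫ A.one ▹ (endoObj A.A).obj ≫ A.mul = 𝟙 _ := A.one_mul

lemma mul_one' : (𝗋 _).inv ≫ (endoObj A.A).obj ◃ A.one ≫ A.mul = 𝟙 _ := A.mul_one

/-- An algebroid as a monoid with respect to multimaps. -/
noncomputable def mon (h : 𝒳 c c A.A) :
    (carriers 𝒳).Mon (⟨c⟩ : ComodBicat V) where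
  A := ⟨A.A, h⟩
  μ := A.mul
  η := A.one
  isCell := A.μ.isCell_map₂
  isUnitCell := A.η.isUnitCell
  assoc := A.assoc
  one_mul := A.one_mul
  mul_one := A.mul_one

end Algebroid

namespace AlgModule

variable {A : Algebroid c} {C : Algebroid d}

section

variable (M : AlgModule A C)

/-- The action as a 2-cell of the bicategory of comodules. -/
noncomputable abbrev act : (endoObj A.A).obj ≫ (endoObj M.M).obj ≫ (endoObj C.A).obj ⟶
  (endoObj M.M).obj := M.γ.map₃

/-- The left action as a 2-cell of the bicategory of comodules. -/
noncomputable abbrev left : (endoObj A.A).obj ≫ (endoObj M.M).obj ⟶ (endoObj M.M).obj := M.actL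

/-- The right action as a 2-cell of the bicategory of comodules. -/
noncomputable abbrev right : (endoObj M.M).obj ≫ (endoObj C.A).obj ⟶ (endoObj M.M).obj := M.actR

lemma left_eq : (endoObj A.A).obj ◃ ((𝗋 _).inv ≫ (endoObj M.M).obj ◃ C.one) ≫ M.act = M.left := rfl

lemma right_eq : (𝗅 _).inv ≫ A.one ▹ ((endoObj M.M).obj ≫ (endoObj C.A).obj) ≫ M.act = M.right :=
  rfl

/-- The axiom of a module with the horizontal composite of the two multiplications written by
whiskering. -/
lemma act_assoc : (endoObj A.A).obj ◃ ((endoObj A.A).obj ◃ (𝖺 (endoObj M.M).obj (endoObj C.A).obj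
      (endoObj C.A).obj).inv ≫ (𝖺 _ _ _).inv ≫ M.act ▹ (endoObj C.A).obj) ≫ M.act =
    (𝖺 _ _ _).inv ≫ A.mul ▹ _ ≫ (endoObj A.A).obj ◃ (endoObj M.M).obj ◃ C.mul ≫ M.act := by
  have h : _ = (𝖺 _ _ _).inv ≫ (A.mul ▹ _ ≫ (endoObj A.A).obj ◃ (endoObj M.M).obj ◃ C.mul) ≫
      M.act :=
    M.assoc.trans (congrArg (fun z => assocInv (bd A.A) (bd A.A) _ ≫ z ≫ M.γ.map₃) (compMap_eq _ _))
  rw [Category.assoc] at h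
  exact h

lemma act_unit : (𝗅 _).inv ≫ A.one ▹ (endoObj M.M).obj ≫
    (endoObj A.A).obj ◃ ((𝗋 _).inv ≫ (endoObj M.M).obj ◃ C.one) ≫ M.act = 𝟙 _ := by
  have h : _ = 𝟙 _ := (congrArg (fun z => lunitInv (bd M.M) ≫ z ≫ M.γ.map₃)
    (compMap_eq A.one ((𝗋 _).inv ≫ (endoObj M.M).obj ◃ C.one))).symm.trans M.unit
  rw [Category.assoc] at h
  exact h

/-- The action is a cell, and inserting the unit of C as the last argument keeps it one, because the
unit identifies the two coactions. -/
lemma isCell_left : IsCell ((endoObj A.A).tensor (endoObj M.M)) (endoObj M.M) M.left := by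
  have h := IsCell.unitRight C.η.isUnitCell (endoObj_plain M.M)
    ((IsCell.assocHom (endoObj A.A) (endoObj M.M) (endoObj C.A)).comp M.γ.isCell_map₃)
  have e : M.left = (𝗋 _).inv ≫ _ ◃ C.one ≫ (𝖺 _ _ _).hom ≫ M.act := by
    rw [← left_eq]
    simp
  rw [e]
  exact h

lemma isCell_right : IsCell ((endoObj M.M).tensor (endoObj C.A)) (endoObj M.M) M.right :=
  IsCell.unitLeft A.η.isUnitCell (endoObj_plain M.M) M.γ.isCell_map₃

/-- A module as a two-sided module. -/
noncomputable def twoSided (hA : 𝒳 c c A.A) (hC : 𝒳 d d C.A) (hM : 𝒳 c d M.M) :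
    TwoSidedMod (A.mon hA) (C.mon hC) where
  M := ⟨M.M, hM⟩
  l := M.left
  r := M.right
  isCell_l := M.isCell_left
  isCell_r := M.isCell_right
  l_assoc := twoSided_l_assoc M.act_assoc M.left_eq C.mul_one'
  l_unit := M.act_unit
  r_assoc := twoSided_r_assoc M.act_assoc M.right_eq A.one_mul'
  r_unit := by
    calc (𝗋 _).inv ≫ (endoObj M.M).obj ◃ C.one ≫ M.right = ((𝗋 _).inv ≫ (endoObj M.M).obj ◃ C.one) ≫
            (𝗅 _).inv ≫ A.one ▹ ((endoObj M.M).obj ≫ (endoObj C.A).obj) ≫ M.act := by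
          rw [right_eq, Category.assoc]
      _ = (𝗅 _).inv ≫ 𝟙 _ ◃ ((𝗋 _).inv ≫ (endoObj M.M).obj ◃ C.one) ≫
            A.one ▹ ((endoObj M.M).obj ≫ (endoObj C.A).obj) ≫ M.act := by
          rw [← Bicategory.leftUnitor_inv_naturality_assoc]
      _ = 𝟙 _ := by
          rw [Bicategory.whisker_exchange_assoc]
          exact M.act_unit
  comm := (twoSided_eq_left M.act_assoc M.left_eq M.right_eq A.mul_one' C.mul_one').trans
    (twoSided_eq_right M.act_assoc M.left_eq M.right_eq A.one_mul' C.one_mul').symm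

end

end AlgModule

namespace TwoSided

variable {A : Algebroid c} {C : Algebroid d} {hA : 𝒳 c c A.A} {hC : 𝒳 d d C.A}

section

variable (M : TwoSidedMod (A.mon hA) (C.mon hC))

/-- The two-sided action given by two commuting actions. -/
noncomputable def cell : Cell (three A.A M.M.1 C.A) M.M.1 :=
  (exists_cell₃ _ ((M.isCell_r.whiskerLeft (endoObj A.A)).comp M.isCell_l)).choose

lemma map₃_cell : (cell M).map₃ = (endoObj A.A).obj ◃ M.r ≫ M.l :=
  (exists_cell₃ _ ((M.isCell_r.whiskerLeft (endoObj A.A)).comp M.isCell_l)).choose_spec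

/-- A two-sided module as a module. -/
noncomputable def algModule : AlgModule A C where
  M := M.M.1
  γ := cell M
  assoc := by
    rw [map₃_cell]
    have h := twoSided_assoc_of M.l_assoc M.r_assoc M.comm
    rw [← Category.assoc ((A.mon hA).μ ▹ _)] at h
    exact h.trans (congrArg (fun z => assocInv (bd A.A) (bd A.A) _ ≫ z ≫ _) (compMap_eq _ _).symm)
  unit := by
    rw [map₃_cell]
    exact (congrArg (fun z => lunitInv (bd M.M.1) ≫ z ≫ _) (compMap_eq A.one _)).trans
      (twoSided_unit_of M.l_unit M.r_unit)

lemma act_algModule : (algModule M).act = (endoObj A.A).obj ◃ M.r ≫ M.l := map₃_cell M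

lemma actL_algModule : (algModule M).left = M.l := by
  rw [← AlgModule.left_eq, act_algModule]
  exact twoSided_left_of M.r_unit

lemma actR_algModule : (algModule M).right = M.r := by
  rw [← AlgModule.right_eq, act_algModule]
  exact twoSided_right_of M.l_unit

end

/-- A two-sided module is determined by the corresponding module. -/
lemma algModule_injective :
    Function.Injective (algModule (hA := hA) (hC := hC)) := by
  rintro ⟨⟨X, hX⟩, l, r, h₁, h₂, h₃, h₄, h₅, h₆, h₇⟩ ⟨⟨Y, hY⟩, l', r', h₁', h₂', h₃', h₄', h₅', h₆',
      h₇'⟩ h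
  obtain rfl : X = Y := congrArg AlgModule.M h
  set M : TwoSidedMod (A.mon hA) (C.mon hC) := ⟨⟨X, hX⟩, l, r, h₁, h₂, h₃, h₄, h₅, h₆, h₇⟩
  set N : TwoSidedMod (A.mon hA) (C.mon hC) := ⟨⟨X, hX⟩, l', r', h₁', h₂', h₃', h₄', h₅', h₆', h₇'⟩
  have hγ : cell M = cell N := eq_of_heq (AlgModule.mk.inj h).2
  have e : (endoObj A.A).obj ◃ M.r ≫ M.l = (endoObj A.A).obj ◃ N.r ≫ N.l :=
    (map₃_cell M).symm.trans ((congrArg Cell.map₃ hγ).trans (map₃_cell N))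
  -- The one-sided actions are recovered from the two-sided action by inserting units.
  have hl : M.l = N.l := by
    rw [← twoSided_left_of (A := (carriers 𝒳).one (A.mon hA).A) (l := M.l) M.r_unit,
      ← twoSided_left_of (A := (carriers 𝒳).one (A.mon hA).A) (l := N.l) N.r_unit]
    exact congrArg (fun z => (endoObj A.A).obj ◃ ((𝗋 _).inv ≫ (endoObj X).obj ◃ C.one) ≫ z) e
  have hr : M.r = N.r := by
    rw [← twoSided_right_of (C := (carriers 𝒳).one (C.mon hC).A) (r := M.r) M.l_unit,
      ← twoSided_right_of (C := (carriers 𝒳).one (C.mon hC).A) (r := N.r) N.l_unit]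
    exact congrArg (fun z => (𝗅 _).inv ≫ A.one ▹ ((endoObj X).obj ≫ (endoObj C.A).obj) ≫ z) e
  obtain rfl : l = l' := hl
  obtain rfl : r = r' := hr
  rfl

/-- Every module comes from a two-sided module. -/
lemma algModule_twoSided (M : AlgModule A C) (hM : 𝒳 c d M.M) :
    algModule (M.twoSided hA hC hM) = M := by
  -- Both 2-cells have the same underlying map, since γ is the right action followed by the left
  -- one, and the underlying map determines the 2-cell.
  have e : cell (M.twoSided hA hC hM) = M.γ := Cell.map₃_injective ((map₃_cell _).trans
    (twoSided_eq_left M.act_assoc M.left_eq M.right_eq A.mul_one' C.mul_one'))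
  obtain ⟨X, γ, h₁, h₂⟩ := M
  exact (AlgModule.mk.injEq ..).mpr ⟨rfl, heq_of_eq e⟩

variable {M N : TwoSidedMod (A.mon hA) (C.mon hC)}

lemma exists_hom (f : M ⟶ N) : ∃ g : algModule M ⟶ algModule N, bdHom g.hom = f.hom := by
  obtain ⟨g, hg⟩ := exists_bdHom f.hom f.isCell
  refine ⟨⟨g, ?_⟩, hg⟩
  have h := twoSided_hom_of f.left f.right
  rw [← hg] at h
  change _ ≫ (algModule N).act = (algModule M).act ≫ bdHom g
  rw [act_algModule, act_algModule]
  exact h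

/-- Compatibility with the two-sided action specializes along the units to compatibility with each
one-sided action. -/
lemma exists_preimage (g : algModule M ⟶ algModule N) : ∃ f : M ⟶ N, f.hom = bdHom g.hom := by
  have h : (endoObj A.A).obj ◃ ((bdHom g.hom : (endoObj M.M.1).obj ⟶ (endoObj N.M.1).obj) ▹
      (endoObj C.A).obj) ≫
    (algModule N).act = (algModule M).act ≫ bdHom g.hom := g.comm
  refine ⟨⟨bdHom g.hom, isCell_bdHom _, ?_, ?_⟩, rfl⟩
  · rw [← actL_algModule, ← actL_algModule]
    exact twoSided_hom_left (ζ := C.one) h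
  · rw [← actR_algModule, ← actR_algModule]
    exact twoSided_hom_right (η := A.one) h

end TwoSided
end Translation

/-- This rewrites a unit inserted between M and N and then absorbed by M as the unit law of M,
tensored with N. -/
lemma whisker_unit {B : Type*} [Bicategory B] {a b c : B} {M : a ⟶ b} {N : b ⟶ c} {C : b ⟶ b}
    (η : 𝟙 b ⟶ C) (r : M ≫ C ⟶ M) :
    Bicategory.whiskerLeft M ((Bicategory.leftUnitor N).inv ≫ Bicategory.whiskerRight η N) ≫
        (Bicategory.associator M C N).inv ≫ Bicategory.whiskerRight r N =
      Bicategory.whiskerRight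
        ((Bicategory.rightUnitor M).inv ≫ Bicategory.whiskerLeft M η ≫ r) N := by
  simp

/-! ### The composite M • N as a tensor product with respect to multimaps -/

section Bullets

variable {V : Type u} [Category.{v} V] [MonoidalCategory V] [BraidedCategory V]
  [HasCoreflexiveEqualizers V] [∀ Z : V, PreservesCoreflexiveEqualizers (tensorLeft Z)]

local infixr:81 " ◃ " => Bicategory.whiskerLeft
local infixl:81 " ▹ " => Bicategory.whiskerRight
local notation "𝖺" => Bicategory.associator
local notation "𝗅" => Bicategory.leftUnitor
local notation "𝗋" => Bicategory.rightUnitor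

open Bicomod Walled Chain Carriers CentralAction

variable {𝒳 : ∀ c d : Comon V, EndoComod c d → Prop} (h𝒳 : IsAdmissible 𝒳)
  {c₁ c₂ c₃ : Comon V} {A₁ : Algebroid c₁} {A₂ : Algebroid c₂} {A₃ : Algebroid c₃}

section

include h𝒳

/-- The two parallel maps are the factorizations, through the universal map to T₃(M, A₂, N), of the
left action on N and of the right action on M, each followed by the universal map to T₂(M, N). -/
lemma exists_bulletDiagram (M : AlgModule A₁ A₂) (N : AlgModule A₂ A₃) (hM : 𝒳 c₁ c₂ M.M)
    (hA : 𝒳 c₂ c₂ A₂.A) (hN : 𝒳 c₂ c₃ N.M) : Nonempty (BulletDiagram M N) := by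
  obtain ⟨T₂, t₂, ht₂⟩ := h𝒳.exists_kan (two M.M N.M) ⟨hM, hN⟩
  obtain ⟨T₃, t₃, ht₃⟩ := h𝒳.exists_kan (three M.M A₂.A N.M) ⟨hM, hA, hN⟩
  have hu := (ht₃.kanLike₃ hM hA hN).blockLike.isUniversal h𝒳
  obtain ⟨f', hf', ef⟩ := hu.exists_lift T₂ ((endoObj M.M).obj ◃ N.left ≫ t₂.map₂)
    ((N.isCell_left.whiskerLeft (endoObj M.M)).comp t₂.isCell_map₂)
  obtain ⟨g', hg', eg⟩ := hu.exists_lift T₂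
    ((𝖺 _ _ _).inv ≫ M.right ▹ (endoObj N.M).obj ≫ t₂.map₂)
    ((IsCell.assocInv (endoObj M.M) (endoObj A₂.A) (endoObj N.M)).comp
      ((M.isCell_right.whiskerRight (endoObj N.M)).comp t₂.isCell_map₂))
  obtain ⟨f, rfl⟩ := exists_bdHom f' hf'
  obtain ⟨g, rfl⟩ := exists_bdHom g' hg'
  exact ⟨⟨T₂, t₂, ht₂, T₃, t₃, ht₃, f, g, ef, eg⟩⟩

omit h𝒳 in
lemma BulletDiagram.universal_f {hA₁ : 𝒳 c₁ c₁ A₁.A} {hA₂ : 𝒳 c₂ c₂ A₂.A} {hA₃ : 𝒳 c₃ c₃ A₃.A}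
    {M : TwoSidedMod (A₁.mon hA₁) (A₂.mon hA₂)}
    {N : TwoSidedMod (A₂.mon hA₂) (A₃.mon hA₃)}
    (D : BulletDiagram (TwoSided.algModule M) (TwoSided.algModule N)) :
    CategoryStruct.comp (X := (carriers 𝒳).one M.M ≫ (carriers 𝒳).one (A₂.mon hA₂).A ≫
        (carriers 𝒳).one N.M)
      (Y := (endoObj D.T₃).obj) (Z := (endoObj D.T₂).obj) D.t₃.map₃ (bdHom D.f) =
        (carriers 𝒳).one M.M ◃ N.l ≫ D.t₂.map₂ :=
  D.hf.trans (congrArg (fun z => (endoObj M.M.1).obj ◃ z ≫ D.t₂.map₂) (TwoSided.actL_algModule N))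

omit h𝒳 in
lemma BulletDiagram.universal_g {hA₁ : 𝒳 c₁ c₁ A₁.A} {hA₂ : 𝒳 c₂ c₂ A₂.A} {hA₃ : 𝒳 c₃ c₃ A₃.A}
    {M : TwoSidedMod (A₁.mon hA₁) (A₂.mon hA₂)}
    {N : TwoSidedMod (A₂.mon hA₂) (A₃.mon hA₃)}
    (D : BulletDiagram (TwoSided.algModule M) (TwoSided.algModule N)) :
    CategoryStruct.comp (X := (carriers 𝒳).one M.M ≫ (carriers 𝒳).one (A₂.mon hA₂).A ≫
        (carriers 𝒳).one N.M)
      (Y := (endoObj D.T₃).obj) (Z := (endoObj D.T₂).obj) D.t₃.map₃ (bdHom D.g) =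
        ((𝖺 _ _ _).inv ≫ M.r ▹ (carriers 𝒳).one N.M) ≫ D.t₂.map₂ :=
  D.hg.trans (((congrArg (fun z => (𝖺 _ _ _).inv ≫ z ▹ (endoObj N.M.1).obj ≫ D.t₂.map₂)
    (TwoSided.actR_algModule M))).trans (Category.assoc _ _ _).symm)

/-- The parallel pair `T₃(M, A₂, N) ⇉ T₂(M, N)` is reflexive. -/
lemma BulletDiagram.exists_section {hA₁ : 𝒳 c₁ c₁ A₁.A} {hA₂ : 𝒳 c₂ c₂ A₂.A} {hA₃ : 𝒳 c₃ c₃ A₃.A}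
    {M : TwoSidedMod (A₁.mon hA₁) (A₂.mon hA₂)}
    {N : TwoSidedMod (A₂.mon hA₂) (A₃.mon hA₃)}
    (D : BulletDiagram (TwoSided.algModule M) (TwoSided.algModule N)) :
    ∃ s : D.T₂ ⟶ D.T₃, s ≫ D.f = 𝟙 _ ∧ s ≫ D.g = 𝟙 _ := by
  have hu := (D.isKan₂.kanLike₂ M.M.2 N.M.2).blockLike.isUniversal h𝒳
  -- The section inserts the unit of A₂ between M and N; that this is a multimap is
  -- `IsCell.unitMid`.
  obtain ⟨s', hs', es⟩ := hu.exists_lift D.T₃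
    ((endoObj M.M.1).obj ◃ ((𝗅 _).inv ≫ A₂.one ▹ (endoObj N.M.1).obj) ≫ D.t₃.map₃)
    (IsCell.unitMid A₂.η.isUnitCell (endoObj_plain D.T₃) D.t₃.isCell_map₃)
  obtain ⟨s, rfl⟩ := exists_bdHom s' hs'
  let u : (carriers 𝒳).one M.M ≫ (carriers 𝒳).one N.M ⟶ (endoObj D.T₂).obj := D.t₂.map₂
  let f : (endoObj D.T₃).obj ⟶ (endoObj D.T₂).obj := bdHom D.f
  let g : (endoObj D.T₃).obj ⟶ (endoObj D.T₂).obj := bdHom D.g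
  let k : (endoObj D.T₂).obj ⟶ (endoObj D.T₃).obj := bdHom s
  let v : (carriers 𝒳).one M.M ≫ (carriers 𝒳).one (A₂.mon hA₂).A ≫ (carriers 𝒳).one N.M ⟶
    (endoObj D.T₃).obj := D.t₃.map₃
  have ek : u ≫ k = (carriers 𝒳).one M.M ◃
      ((𝗅 _).inv ≫ (A₂.mon hA₂).η ▹ (carriers 𝒳).one N.M) ≫ v := es
  have ef : v ≫ f = (carriers 𝒳).one M.M ◃ N.l ≫ u := D.universal_f
  have eg : v ≫ g = ((𝖺 _ _ _).inv ≫ M.r ▹ (carriers 𝒳).one N.M) ≫ u := D.universal_g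
  -- Tested on M ⊗ N, this is the unit law of the left action on N, and its companion `e2` is the
  -- unit law of the right action on M.
  have e1 : u ≫ k ≫ f = u ≫ 𝟙 _ := by
    rw [reassoc_of% ek, ef, ← Bicategory.whiskerLeft_comp_assoc, Category.assoc, N.l_unit]
    simp
  have e2 : u ≫ k ≫ g = u ≫ 𝟙 _ := by
    rw [reassoc_of% ek, eg, ← Category.assoc, whisker_unit, M.r_unit]
    simp
  exact ⟨s, bdHom_injective (hu.hom_ext D.T₂ _ _ (isCell_bdHom (s ≫ D.f)) (IsCell.id _) e1),
    bdHom_injective (hu.hom_ext D.T₂ _ _ (isCell_bdHom (s ≫ D.g)) (IsCell.id _) e2)⟩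

lemma IsReflCoeq.whiskerLeft {c d e : Comon V} {R S T : (⟨d⟩ : ComodBicat V) ⟶ ⟨e⟩}
    {f g : R ⟶ S} {p : S ⟶ T} (hp : IsReflCoeq f g p) {X : EndoComod c d}
    (hX : 𝒳 c d X) :
    IsReflCoeq ((endoObj X).obj ◃ f) ((endoObj X).obj ◃ g) ((endoObj X).obj ◃ p) := by
  have := h𝒳.preserves_left X hX
  exact hp.compLeft (bd X)

lemma IsReflCoeq.whiskerRight {c d e : Comon V} {R S T : (⟨c⟩ : ComodBicat V) ⟶ ⟨d⟩}
    {f g : R ⟶ S} {p : S ⟶ T} (hp : IsReflCoeq f g p) {X : EndoComod d e}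
    (hX : 𝒳 d e X) :
    IsReflCoeq (f ▹ (endoObj X).obj) (g ▹ (endoObj X).obj) (p ▹ (endoObj X).obj) := by
  have := h𝒳.preserves_right X hX
  exact hp.compRight (bd X)

end

variable {hA₁ : 𝒳 c₁ c₁ A₁.A} {hA₂ : 𝒳 c₂ c₂ A₂.A} {hA₃ : 𝒳 c₃ c₃ A₃.A}
  (M : TwoSidedMod (A₁.mon hA₁) (A₂.mon hA₂)) (N : TwoSidedMod (A₂.mon hA₂) (A₃.mon hA₃))

/-- `q` is the composite of the universal map to `T₂(M, N)` with a coequalizer. -/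
def IsBulletMap (K : (carriers 𝒳).carrier ⟨c₁⟩ ⟨c₃⟩)
    (q : (carriers 𝒳).one M.M ≫ (carriers 𝒳).one N.M ⟶ (carriers 𝒳).one K) : Prop :=
  ∃ (D : BulletDiagram (TwoSided.algModule M) (TwoSided.algModule N)) (π : D.T₂ ⟶ K.1)
    (w : D.f ≫ π = D.g ≫ π), Nonempty (IsColimit (Cofork.ofπ π w)) ∧ q = D.t₂.map₂ ≫ bdHom π

-- The coequalizer belongs to the class because T₂(M, N) does and the class is closed under
-- epimorphic images.
include h𝒳 in
lemma exists_isBulletMap (h : ∀ D : BulletDiagram (TwoSided.algModule M) (TwoSided.algModule N),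
    HasCoequalizer D.f D.g) : ∃ K q, IsBulletMap M N K q := by
  obtain ⟨D⟩ := exists_bulletDiagram h𝒳 (TwoSided.algModule M)
      (TwoSided.algModule N) M.M.2 hA₂ N.M.2
  have := h D
  exact ⟨⟨_, h𝒳.of_epi (coequalizer.π D.f D.g)
      (D.isKan₂.mem h𝒳 (show (two M.M.1 N.M.1).All 𝒳 from ⟨M.M.2, N.M.2⟩))⟩, _, D,
    coequalizer.π D.f D.g, coequalizer.condition _ _, ⟨coequalizerIsCoequalizer _ _⟩, rfl⟩

variable {M N}

-- The map q is a universal multimap followed by a reflexive coequalizer. The first factor is stable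
-- under adjoining variables by (2), the second by (3), so each clause comes from `isCoeq_comp` or
-- `isEpi_comp`.
include h𝒳 in
lemma IsBulletMap.isTensor {K : (carriers 𝒳).carrier ⟨c₁⟩ ⟨c₃⟩}
    {q : (carriers 𝒳).one M.M ≫ (carriers 𝒳).one N.M ⟶ (carriers 𝒳).one K}
    (hq : IsBulletMap M N K q) : IsTensor M N K q := by
  obtain ⟨D, π, w, ⟨hπ⟩, rfl⟩ := hq
  -- Reflexivity is essential: condition (3) says nothing about other coequalizers.
  obtain ⟨s, hf, hg⟩ := D.exists_section h𝒳
  have hp := (IsReflCoeq.of_isColimit w hπ s hf hg).bdHom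
  have hp₂ := isQuotient_bdHom π
  have hu := D.isKan₂.kanLike₂ M.M.2 N.M.2
  have hv := D.isKan₃.kanLike₃ M.M.2 hA₂ N.M.2
  let u : (carriers 𝒳).one M.M ≫ (carriers 𝒳).one N.M ⟶ (endoObj D.T₂).obj := D.t₂.map₂
  let v : (carriers 𝒳).one M.M ≫ (carriers 𝒳).one (A₂.mon hA₂).A ≫ (carriers 𝒳).one N.M ⟶
    (endoObj D.T₃).obj := D.t₃.map₃
  let f : (endoObj D.T₃).obj ⟶ (endoObj D.T₂).obj := bdHom D.f
  let g : (endoObj D.T₃).obj ⟶ (endoObj D.T₂).obj := bdHom D.g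
  let p : (endoObj D.T₂).obj ⟶ (carriers 𝒳).one K := bdHom π
  have ef : v ≫ f = (carriers 𝒳).one M.M ◃ N.l ≫ u := D.universal_f
  have eg : v ≫ g = ((𝖺 _ _ _).inv ≫ M.r ▹ (carriers 𝒳).one N.M) ≫ u := D.universal_g
  change IsTensor M N K (u ≫ p)
  refine ⟨?_, fun X => ?_, fun Y => ?_, fun X' X => ?_, fun X Y => ?_, fun Y Y' => ?_⟩
  · exact isCoeq_comp (hu.blockLike.isUniversal h𝒳) (hv.blockLike.isUniversal h𝒳) (isCell_bdHom D.f)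
      (isCell_bdHom D.g) ef eg hp hp₂
  · have h := isCoeq_comp (𝒳 := 𝒳) ((hu.blockLike.whiskerLeft X.2).isUniversal h𝒳)
      ((hv.blockLike.whiskerLeft X.2).isUniversal h𝒳)
      ((isCell_bdHom D.f).whiskerLeft (endoObj X.1)) ((isCell_bdHom D.g).whiskerLeft (endoObj X.1))
      (by rw [← Bicategory.whiskerLeft_comp, ← Bicategory.whiskerLeft_comp]; exact congrArg _ ef)
      (by rw [← Bicategory.whiskerLeft_comp, ← Bicategory.whiskerLeft_comp]; exact congrArg _ eg)
      (IsReflCoeq.whiskerLeft h𝒳 hp X.2) (hp₂.whiskerLeft (endoObj X.1))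
    rw [Bicategory.whiskerLeft_comp _ u p]
    exact h
  · have h := isCoeq_comp (𝒳 := 𝒳) ((hu.whiskerRight Y.2).isUniversal h𝒳)
      ((hv.whiskerRight Y.2).isUniversal h𝒳)
      ((isCell_bdHom D.f).whiskerRight (endoObj Y.1)) ((isCell_bdHom D.g).whiskerRight
          (endoObj Y.1))
      (by rw [← Bicategory.comp_whiskerRight, ← Bicategory.comp_whiskerRight]; exact congrArg (· ▹ _) ef)
      (by rw [← Bicategory.comp_whiskerRight, ← Bicategory.comp_whiskerRight]; exact congrArg (· ▹ _) eg)
      (IsReflCoeq.whiskerRight h𝒳 hp Y.2) (hp₂.whiskerRight (endoObj Y.1))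
    rw [Bicategory.comp_whiskerRight u p]
    exact h
  · rw [Bicategory.whiskerLeft_comp _ u p, Bicategory.whiskerLeft_comp]
    have h := isEpi_comp (𝒳 := 𝒳) (((hu.blockLike.whiskerLeft X.2).whiskerLeft X'.2).isUniversal h𝒳)
      (IsReflCoeq.whiskerLeft h𝒳 (IsReflCoeq.whiskerLeft h𝒳 hp X.2) X'.2)
      ((hp₂.whiskerLeft (endoObj X.1)).whiskerLeft (endoObj X'.1))
    exact h
  · rw [Bicategory.comp_whiskerRight u p, Bicategory.whiskerLeft_comp]
    have h := isEpi_comp (𝒳 := 𝒳) (((hu.whiskerRight Y.2).whiskerLeft X.2).isUniversal h𝒳)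
      (IsReflCoeq.whiskerLeft h𝒳 (IsReflCoeq.whiskerRight h𝒳 hp Y.2) X.2)
      ((hp₂.whiskerRight (endoObj Y.1)).whiskerLeft (endoObj X.1))
    exact h
  · rw [Bicategory.comp_whiskerRight u p, Bicategory.comp_whiskerRight]
    have h := isEpi_comp (𝒳 := 𝒳) ((hu.whiskerRight₂ Y.2 Y'.2).isUniversal h𝒳)
      (IsReflCoeq.whiskerRight h𝒳 (IsReflCoeq.whiskerRight h𝒳 hp Y.2) Y'.2)
      ((hp₂.whiskerRight (endoObj Y.1)).whiskerRight (endoObj Y'.1))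
    exact h

end Bullets

/-! ### The bicategory of algebroids and modules in the class -/

section BulletBicategory

/-- The two one-sided compatibilities of q combine, after an interchange, into the single formula by
which the two-sided action on M • N is specified. -/
lemma Carriers.IsProd.action {B : Type*} [Bicategory B] [CentralAction B] {J : Carriers B}
    {a b c : B} {A : J.Mon a} {C : J.Mon b} {D : J.Mon c} {M : Carriers.TwoSidedMod A C}
    {N : Carriers.TwoSidedMod C D} {K : Carriers.TwoSidedMod A D}
    {q : J.one M.M ≫ J.one N.M ⟶ J.one K.M} (hq : Carriers.IsProd M N K q) :
    Bicategory.whiskerLeft (J.one A.A) ((Bicategory.associator _ _ _).inv ≫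
        Bicategory.whiskerRight q (J.one D.A)) ≫ Bicategory.whiskerLeft (J.one A.A) K.r ≫ K.l =
      (Bicategory.associator _ _ _).inv ≫ (Bicategory.whiskerRight M.l _ ≫
        Bicategory.whiskerLeft (J.one M.M) N.r) ≫ q := by
  rw [← Bicategory.whiskerLeft_comp_assoc, Category.assoc, hq.right, Iso.inv_hom_id_assoc,
    Bicategory.whiskerLeft_comp, Category.assoc, hq.left, ← Bicategory.whisker_exchange]
  simp

variable {V : Type u} [Category.{v} V] [MonoidalCategory V] [BraidedCategory V]
  [HasCoreflexiveEqualizers V] [∀ Z : V, PreservesCoreflexiveEqualizers (tensorLeft Z)]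

local infixr:81 " ◃ " => Bicategory.whiskerLeft
local infixl:81 " ▹ " => Bicategory.whiskerRight
local notation "𝖺" => Bicategory.associator
local notation "𝗅" => Bicategory.leftUnitor
local notation "𝗋" => Bicategory.rightUnitor

open Bicomod Walled Chain Carriers CentralAction

variable {𝒳 : ∀ c d : Comon V, EndoComod c d → Prop}

/-- The algebroids in a class, with chosen compositions of modules. -/
noncomputable def moduleFamily (h𝒳 : IsAdmissible 𝒳)
    (hcoeq : ∀ (a b c : AlgebroidIn 𝒳) (M : AlgModule a.alg b.alg) (N : AlgModule b.alg c.alg),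
      𝒳 _ _ M.M → 𝒳 _ _ N.M → ∀ D : BulletDiagram M N, HasCoequalizer D.f D.g) :
    ModuleFamily (carriers 𝒳) (AlgebroidIn 𝒳) where
  base a := ⟨a.base⟩
  mon a := a.alg.mon a.mem
  tensor M N := (exists_isBulletMap h𝒳 M N (hcoeq _ _ _ _ _ M.M.2 N.M.2)).choose
  univ M N := (exists_isBulletMap h𝒳 M N (hcoeq _ _ _ _ _ M.M.2 N.M.2)).choose_spec.choose
  isTensor M N :=
    (exists_isBulletMap h𝒳 M N (hcoeq _ _ _ _ _ M.M.2 N.M.2)).choose_spec.choose_spec.isTensor h𝒳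

section

variable (h𝒳 : IsAdmissible 𝒳)
  (hcoeq : ∀ (a b c : AlgebroidIn 𝒳) (M : AlgModule a.alg b.alg) (N : AlgModule b.alg c.alg),
    𝒳 _ _ M.M → 𝒳 _ _ N.M → ∀ D : BulletDiagram M N, HasCoequalizer D.f D.g)
  {a b c d : AlgebroidIn 𝒳}

/-- The 1-cells from `a` to `b`. -/
abbrev ModuleCell (a b : AlgebroidIn 𝒳) := TwoSidedMod (J := carriers 𝒳) (a.alg.mon a.mem)
    (b.alg.mon b.mem)

/-- The identification of the 1-cells with the modules in the class. -/
noncomputable def toAlgModule (a b : AlgebroidIn 𝒳) : ModuleCell a b ⥤ AlgModule a.alg b.alg where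
  obj M := TwoSided.algModule M
  map f := (TwoSided.exists_hom f).choose
  map_id M := AlgModule.Hom.ext (bdHom_injective (TwoSided.exists_hom (𝟙 M)).choose_spec)
  map_comp f g := AlgModule.Hom.ext (bdHom_injective
    ((TwoSided.exists_hom (f ≫ g)).choose_spec.trans (congrArg₂ (· ≫ ·)
      (TwoSided.exists_hom f).choose_spec (TwoSided.exists_hom g).choose_spec).symm))

lemma bdHom_map {M N : ModuleCell a b} (f : M ⟶ N) :
    bdHom ((toAlgModule a b).map f).hom = f.hom :=
  (TwoSided.exists_hom f).choose_spec

lemma toAlgModule_full : (toAlgModule a b).Full where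
  map_surjective g := by
    obtain ⟨f, hf⟩ := TwoSided.exists_preimage g
    exact ⟨f, AlgModule.Hom.ext (bdHom_injective ((bdHom_map f).trans hf))⟩

lemma toAlgModule_faithful : (toAlgModule a b).Faithful where
  map_injective {_ _ f g} h := TwoSidedMod.hom_ext
    ((bdHom_map f).symm.trans ((congrArg (fun k => bdHom (AlgModule.Hom.hom k)) h).trans
        (bdHom_map g)))

lemma range_toAlgModule :
    Set.range (toAlgModule a b).obj = {M | 𝒳 a.base b.base M.M} := by
  ext M
  constructor
  · rintro ⟨M, rfl⟩
    exact M.M.2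
  · intro h
    exact ⟨_, TwoSided.algModule_twoSided M h⟩

/-- The universal map to a composite. -/
noncomputable abbrev bulletMap (M : ModuleCell a b) (N : ModuleCell b c) :
    comp (bd (TwoSided.algModule M).M) (bd (TwoSided.algModule N).M) ⟶
      bd (TwoSided.algModule (ModuleFamily.prod (F := moduleFamily h𝒳 hcoeq) M N)).M :=
  ModuleFamily.π (F := moduleFamily h𝒳 hcoeq) M N

lemma isBullet_prod (M : ModuleCell a b) (N : ModuleCell b c) :
    IsBullet (TwoSided.algModule M) (TwoSided.algModule N)
      (TwoSided.algModule (ModuleFamily.prod (F := moduleFamily h𝒳 hcoeq) M N))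
      (ModuleFamily.π (F := moduleFamily h𝒳 hcoeq) M N) where
  isCoequalizer :=
    (exists_isBulletMap h𝒳 M N (hcoeq _ _ _ _ _ M.M.2 N.M.2)).choose_spec.choose_spec
  action := by
    refine (congrArg (fun z => (endoObj a.alg.A).obj ◃ ((𝖺 _ _ _).inv ≫
      ModuleFamily.π (F := moduleFamily h𝒳 hcoeq) M N ▹ (endoObj c.alg.A).obj) ≫ z)
        (TwoSided.act_algModule (ModuleFamily.prod (F := moduleFamily h𝒳 hcoeq) M N))).trans ?_
    refine (ModuleFamily.isProd (F := moduleFamily h𝒳 hcoeq) M N).action.trans ?_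
    refine (congrArg (fun z => (𝖺 _ _ _).inv ≫ z ≫ ModuleFamily.π (F := moduleFamily h𝒳 hcoeq) M N)
      ((compMap_eq (TwoSided.algModule M).left (TwoSided.algModule N).right).trans ?_)).symm
    rw [TwoSided.actL_algModule, TwoSided.actR_algModule]
    rfl

lemma bulletMap_whiskerLeft (M : ModuleCell a b) {N N' : ModuleCell b c} (f : N ⟶ N') :
    bulletMap h𝒳 hcoeq M N ≫ bdHom ((toAlgModule a c).map
        (ModuleFamily.map (F := moduleFamily h𝒳 hcoeq) (𝟙 M) f)).hom =
      compMap (𝟙 _) (bdHom ((toAlgModule b c).map f).hom) ≫ bulletMap h𝒳 hcoeq M N' :=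
  (congrArg (bulletMap h𝒳 hcoeq M N ≫ ·) (bdHom_map _)).trans
    ((ModuleFamily.π_map_left (F := moduleFamily h𝒳 hcoeq) M f).trans
      (congrArg (fun k => compMap (𝟙 _) k ≫ bulletMap h𝒳 hcoeq M N') (bdHom_map f)).symm)

lemma bulletMap_whiskerRight {M M' : ModuleCell a b} (f : M ⟶ M') (N : ModuleCell b c) :
    bulletMap h𝒳 hcoeq M N ≫ bdHom ((toAlgModule a c).map
        (ModuleFamily.map (F := moduleFamily h𝒳 hcoeq) f (𝟙 N))).hom =
      compMap (bdHom ((toAlgModule a b).map f).hom) (𝟙 _) ≫ bulletMap h𝒳 hcoeq M' N :=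
  (congrArg (bulletMap h𝒳 hcoeq M N ≫ ·) (bdHom_map _)).trans
    ((ModuleFamily.π_map_right (F := moduleFamily h𝒳 hcoeq) f N).trans
      (congrArg (fun k => compMap k (𝟙 _) ≫ bulletMap h𝒳 hcoeq M' N) (bdHom_map f)).symm)

lemma bulletMap_assoc (M : ModuleCell a b) (N : ModuleCell b c) (K : ModuleCell c d) :
    assocInv _ _ _ ≫ compMap (bulletMap h𝒳 hcoeq M N) (𝟙 _) ≫
        bulletMap h𝒳 hcoeq (ModuleFamily.prod (F := moduleFamily h𝒳 hcoeq) M N) K ≫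
        bdHom ((toAlgModule a d).map
          (ModuleFamily.assoc (F := moduleFamily h𝒳 hcoeq) M N K).hom).hom =
      compMap (𝟙 _) (bulletMap h𝒳 hcoeq N K) ≫
        bulletMap h𝒳 hcoeq M (ModuleFamily.prod (F := moduleFamily h𝒳 hcoeq) N K) :=
  (congrArg (fun k => assocInv _ _ _ ≫ compMap (bulletMap h𝒳 hcoeq M N) (𝟙 _) ≫
    bulletMap h𝒳 hcoeq _ K ≫ k) (bdHom_map _)).trans
    ((congrArg (assocInv _ _ _ ≫ ·) (ModuleFamily.π_assoc (F := moduleFamily h𝒳 hcoeq) M N K)).trans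
      (Iso.inv_hom_id_assoc (𝖺 (endoObj M.M.1).obj (endoObj N.M.1).obj (endoObj K.M.1).obj) _))

lemma bulletMap_lunit (M : ModuleCell a b) :
    compMap (bdHom (𝟙 a.alg.A)) (𝟙 _) ≫ bulletMap h𝒳 hcoeq ((moduleFamily h𝒳 hcoeq).one a) M ≫
        bdHom ((toAlgModule a b).map (ModuleFamily.lunit (F := moduleFamily h𝒳 hcoeq) M).hom).hom =
      (TwoSided.algModule M).actL :=
  (congrArg₂ (· ≫ ·) (compMap_id (bd a.alg.A) (bd M.M.1)) (congrArg (bulletMap h𝒳 hcoeq _ M ≫ ·)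
      (bdHom_map _))).trans ((Category.id_comp _).trans
        ((ModuleFamily.π_lunit (F := moduleFamily h𝒳 hcoeq) M).trans
          (TwoSided.actL_algModule M).symm))

lemma bulletMap_runit (M : ModuleCell a b) :
    compMap (𝟙 _) (bdHom (𝟙 b.alg.A)) ≫ bulletMap h𝒳 hcoeq M ((moduleFamily h𝒳 hcoeq).one b) ≫
        bdHom ((toAlgModule a b).map (ModuleFamily.runit (F := moduleFamily h𝒳 hcoeq) M).hom).hom =
      (TwoSided.algModule M).actR :=
  (congrArg₂ (· ≫ ·) (compMap_id (bd M.M.1) (bd b.alg.A)) (congrArg (bulletMap h𝒳 hcoeq M _ ≫ ·)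
      (bdHom_map _))).trans ((Category.id_comp _).trans
        ((ModuleFamily.π_runit (F := moduleFamily h𝒳 hcoeq) M).trans
          (TwoSided.actR_algModule M).symm))

lemma isUnitModule_one (a : AlgebroidIn 𝒳) :
    IsUnitModule a.alg (TwoSided.algModule ((moduleFamily h𝒳 hcoeq).one a)) rfl := by
  have h : compMap (𝟙 (bd a.alg.A)) (compMap (𝟙 (bd a.alg.A)) (𝟙 (bd a.alg.A))) = 𝟙 _ := by
    rw [compMap_id, compMap_id]
  exact (congrArg₂ (· ≫ ·) h
    (TwoSided.act_algModule ((moduleFamily h𝒳 hcoeq).one a))).trans ((Category.id_comp _).trans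
      (congrArg (fun k => (endoObj a.alg.A).obj ◃ a.alg.mul ≫ k) (Category.comp_id a.alg.mul).symm))

/-- The characterizing equations of the module bicategory are already equations of underlying maps.
They pass to algebroid modules because `toAlgModule` leaves underlying maps unchanged and the
one-sided actions correspond. -/
theorem isBulletBicategory :
    letI := (moduleFamily h𝒳 hcoeq).bicategory
    IsBulletBicategory 𝒳 toAlgModule (bulletMap h𝒳 hcoeq) :=
  letI := (moduleFamily h𝒳 hcoeq).bicategory
  { full := fun _ _ => toAlgModule_full
    faithful := fun _ _ => toAlgModule_faithful
    injective := fun _ _ => TwoSided.algModule_injective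
    range := fun _ _ => range_toAlgModule
    isBullet := isBullet_prod h𝒳 hcoeq
    whiskerLeft := bulletMap_whiskerLeft h𝒳 hcoeq
    whiskerRight := bulletMap_whiskerRight h𝒳 hcoeq
    associator := bulletMap_assoc h𝒳 hcoeq
    unit := fun a => ⟨rfl, isUnitModule_one h𝒳 hcoeq a, bulletMap_lunit h𝒳 hcoeq,
      bulletMap_runit h𝒳 hcoeq⟩ }

end
end BulletBicategory
end QuantumModules
open QuantumModules

theorem theorem10 {V : Type u} [Category.{v} V] [MonoidalCategory V] [BraidedCategory V]
    [HasCoreflexiveEqualizers V] [∀ Z : V, PreservesCoreflexiveEqualizers (tensorLeft Z)]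
    (𝒳 : ∀ c d : Comon V, EndoComod c d → Prop) (h𝒳 : IsAdmissible 𝒳)
    (hcoeq : ∀ (a b c : AlgebroidIn 𝒳) (M : AlgModule a.alg b.alg) (N : AlgModule b.alg c.alg),
      𝒳 _ _ M.M → 𝒳 _ _ N.M → ∀ D : BulletDiagram M N, HasCoequalizer D.f D.g) :
    ∃ (_ : Bicategory.{v, max u v} (AlgebroidIn 𝒳))
      (U : ∀ a b : AlgebroidIn 𝒳, (a ⟶ b) ⥤ AlgModule a.alg b.alg)
      (q : ∀ {a b c : AlgebroidIn 𝒳} (M : a ⟶ b) (N : b ⟶ c),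
        Bicomod.comp (Bicomod.bd ((U a b).obj M).M) (Bicomod.bd ((U b c).obj N).M) ⟶
          Bicomod.bd ((U a c).obj (M ≫ N)).M),
      IsBulletBicategory 𝒳 U q :=
  ⟨_, _, _, isBulletBicategory h𝒳 hcoeq⟩
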